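/- For a weight $w\ge 0$ on $\mathbb R$, $N\ge 1$ and $\beta=1,2,4$ let $\mathrm{OE}_N(w)$, $\mathrm{UE}_N(w)$, $\mathrm{SE}_N(w)$ be the probability distribution of $N$ unlabelled real points with density proportional to $\prod_{i} w(x_i)\prod_{i<j}|x_j-x_i|^\beta$; an identity between ensembles includes the claim that these densities can be normalised. Let $M\cup M'$ be the random superposition of independent copies of $M$ and $M'$, and let $\mathrm{even}(M)$ (resp. $\mathrm{odd}(M)$) be the ensemble formed by the 2nd, 4th, … (resp. 1st, 3rd, …) largest points of $M$. Fix an integer $n\ge 2$ and consider, for weights $f,g$, the four pairs of statements (the second ones presupposing that $g$ vanishes wherever $f$ does, with $g/f:=0$ there) 1. $\mathrm{even}(\mathrm{OE}_{2n}(f)\cup \mathrm{OE}_{2n+1}(f))=\mathrm{UE}_{2n}(g)$ and $\mathrm{even}(\mathrm{OE}_{2n+1}(f))=\mathrm{SE}_n((g/f)^2)$; 2. $\mathrm{even}(\mathrm{OE}_{2n}(f)\cup \mathrm{OE}_{2n}(f))=\mathrm{UE}_{2n}(g)$ and $\mathrm{even}(\mathrm{OE}_{2n}(f))=\mathrm{SE}_n((g/f)^2)$;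 3. $\mathrm{odd}(\mathrm{OE}_{2n}(f)\cup \mathrm{OE}_{2n}(f))=\mathrm{UE}_{2n}(g)$ and $\mathrm{odd}(\mathrm{OE}_{2n}(f))=\mathrm{SE}_n((g/f)^2)$; 4. $\mathrm{odd}(\mathrm{OE}_{2n-1}(f)\cup \mathrm{OE}_{2n}(f))=\mathrm{UE}_{2n}(g)$ and $\mathrm{odd}(\mathrm{OE}_{2n-1}(f))=\mathrm{SE}_n((g/f)^2)$. The classical weights are, up to a positive constant factor and the scale $x\mapsto cx$ ($c>0$): $e^{-x^2}$ on $\mathbb R$; $x^a e^{-x}$ on $x>0$ ($a>-1$); $x^a(1-x)^b$ on $0<x<1$ ($a,b>-1$); $(1+x^2)^{-\alpha}$ on $\mathbb R$ ($\alpha>1$). All weights are zero outside the stated intervals. **Theorem.** Up to a common scale $x\mapsto cx$, $c>0$, and positive constant factors of $f$ and of $g$: - both statements of pair 1 hold for $(f,g)$ equal to $(e^{-x^2/2},e^{-x^2})$ on $\mathbb R$; $(x^{(a-1)/2}e^{-x/2},\,x^ae^{-x})$ on $x>0$, $a>-1$; $(x^{(a-1)/2}(1-x)^{(b-1)/2},\,x^a(1-x)^b)$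 on $0<x<1$, $a,b>-1$; and $((1+x^2)^{-(\alpha+1)/2},(1+x^2)^{-\alpha})$ on $\mathbb R$, $\alpha>2n$; - both statements of pair 2 hold for $(e^{-x/2},e^{-x})$ on $x>0$ and for $((1-x)^{(a-1)/2},(1-x)^a)$ on $0<x<1$, $a>-1$; - both statements of pair 3 hold for $(x^{(a-1)/2},x^a)$ on $0<x<1$, $a>-1$; - both statements of pair 4 hold for $(1,1)$ on $0<x<1$. Conversely, if $f$ and $g$ are classical weights and at least one of the two statements of one of these pairs holds, then, up to a common scale and positive constant factors, $(f,g)$ is in the list given for that pair. -/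

import Mathlib

open MeasureTheory

noncomputable section

namespace EigenvalueEnsemble

/-! ### Configurations and their order statistics -/

/-- The `k`-th largest entry of the configuration `x`, counted from `0`
(so that `k = 0` gives the largest entry). -/
def kthLargest {N : ℕ} (x : Fin N → ℝ) (k : Fin N) : ℝ := x (Tuple.sort x k.rev)

/-- The decreasing rearrangement is a measurable function of the configuration, so that the image
measures below are the genuine ones. -/
theorem measurable_kthLargest {N : ℕ} :
    Measurable (fun (x : Fin N → ℝ) (k : Fin N) => kthLargest x k) := by
  have key : ∀ σ : Equiv.Perm (Fin N), MeasurableSet {x : Fin N → ℝ | Tuple.sort x = σ} := by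
    intro σ
    have h : {x : Fin N → ℝ | Tuple.sort x = σ} =
        (⋂ i, ⋂ j, {x : Fin N → ℝ | i ≤ j → x (σ i) ≤ x (σ j)}) ∩
        ⋂ i, ⋂ j, {x : Fin N → ℝ | i < j → x (σ i) = x (σ j) → σ i < σ j} := by
      ext x
      simp only [Set.mem_ofPred_eq, Set.mem_inter_iff, Set.mem_iInter]
      rw [eq_comm, Tuple.eq_sort_iff]
      rfl
    rw [h]
    refine MeasurableSet.inter ?_ ?_
    · refine MeasurableSet.iInter fun i => MeasurableSet.iInter fun j => ?_
      by_cases hij : i ≤ j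
      · simpa [hij] using
          measurableSet_le (measurable_pi_apply (σ i)) (measurable_pi_apply (σ j))
      · simp [hij]
    · refine MeasurableSet.iInter fun i => MeasurableSet.iInter fun j => ?_
      by_cases hij : i < j
      · by_cases hs : σ i < σ j
        · simp [hs]
        · simp only [hij, hs, forall_const, imp_false]
          exact (measurableSet_eq_fun (measurable_pi_apply (σ i))
            (measurable_pi_apply (σ j))).compl
      · simp [hij]
  refine measurable_pi_lambda _ fun k => ?_
  intro s hs
  have h : (fun x : Fin N → ℝ => kthLargest x k) ⁻¹' s =
      ⋃ σ : Equiv.Perm (Fin N), {x : Fin N → ℝ | Tuple.sort x = σ} ∩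
        (fun x : Fin N → ℝ => x (σ k.rev)) ⁻¹' s := by
    ext x
    simp [kthLargest]
  rw [h]
  exact MeasurableSet.iUnion fun σ => (key σ).inter (measurable_pi_apply _ hs)

/-- The 2nd largest, 4th largest, … entries of a configuration of `N` points. -/
def evenPart {N m : ℕ} (h : N / 2 = m) (x : Fin N → ℝ) : Fin m → ℝ :=
  fun i => kthLargest x ⟨2 * (i : ℕ) + 1, by have := i.isLt; omega⟩

/-- The largest, 3rd largest, … entries of a configuration of `N` points. -/
def oddPart {N m : ℕ} (h : (N + 1) / 2 = m) (x : Fin N → ℝ) : Fin m → ℝ :=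
  fun i => kthLargest x ⟨2 * (i : ℕ), by have := i.isLt; omega⟩

/-! ### Ensembles -/

/-- The unnormalised eigenvalue measure with density `∏ w (x i) * |Δ(x)| ^ β` on `ℝ ^ N`. -/
def unnormalized (β : ℕ) (N : ℕ) (w : ℝ → ℝ) : Measure (Fin N → ℝ) :=
  volume.withDensity fun x =>
    ENNReal.ofReal ((∏ i, w (x i)) * |∏ i, ∏ j ∈ Finset.Ioi i, (x j - x i)| ^ β)

/-- The normalised eigenvalue measure; it is a probability measure exactly when the total mass of
the unnormalised measure is neither `0` nor `∞`. -/
def ensemble (β : ℕ) (N : ℕ) (w : ℝ → ℝ) : Measure (Fin N → ℝ) :=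
  (unnormalized β N w Set.univ)⁻¹ • unnormalized β N w

/-- The orthogonal ensemble. -/
def OE (N : ℕ) (w : ℝ → ℝ) : Measure (Fin N → ℝ) := ensemble 1 N w

/-- The unitary ensemble. -/
def UE (N : ℕ) (w : ℝ → ℝ) : Measure (Fin N → ℝ) := ensemble 2 N w

/-- The symplectic ensemble. -/
def SE (N : ℕ) (w : ℝ → ℝ) : Measure (Fin N → ℝ) := ensemble 4 N w

/-- The random superposition of two independent ensembles. -/
def superpose {M N : ℕ} (μ : Measure (Fin M → ℝ)) (ν : Measure (Fin N → ℝ)) :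
    Measure (Fin (M + N) → ℝ) :=
  (μ.prod ν).map fun p => Fin.append p.1 p.2

/-- `even(μ) = ν` as ensembles of unlabelled points: both are genuine probability distributions,
and the 2nd, 4th, … largest points of `μ` have the law of the points of `ν` in decreasing order. -/
def EvenEq {N m : ℕ} (h : N / 2 = m) (μ : Measure (Fin N → ℝ)) (ν : Measure (Fin m → ℝ)) : Prop :=
  IsProbabilityMeasure μ ∧ IsProbabilityMeasure ν ∧
    μ.map (evenPart h) = ν.map fun x k => kthLargest x k

/-- `odd(μ) = ν` as ensembles of unlabelled points: both are genuine probability distributions,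
and the 1st, 3rd, … largest points of `μ` have the law of the points of `ν` in decreasing order. -/
def OddEq {N m : ℕ} (h : (N + 1) / 2 = m) (μ : Measure (Fin N → ℝ)) (ν : Measure (Fin m → ℝ)) :
    Prop :=
  IsProbabilityMeasure μ ∧ IsProbabilityMeasure ν ∧
    μ.map (oddPart h) = ν.map fun x k => kthLargest x k

/-- The weight `(g / f) ^ 2`, meant for `g` vanishing wherever `f` does, and then `0` there. -/
def ratioSq (f g : ℝ → ℝ) : ℝ → ℝ := fun x => (g x / f x) ^ 2

/-- The quotient `g / f` is meaningful: `g` vanishes off the interval on which `f` lives. -/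
def RatioDefined (f g : ℝ → ℝ) : Prop := ∀ x, f x = 0 → g x = 0

/-! ### The four pairs of decimation statements -/

/-- `even(OE_{2n}(f) ∪ OE_{2n+1}(f)) = UE_{2n}(g)`. -/
def EvenUnionSucc (n : ℕ) (f g : ℝ → ℝ) : Prop :=
  EvenEq (by omega) (superpose (OE (2 * n) f) (OE (2 * n + 1) f)) (UE (2 * n) g)

/-- `even(OE_{2n+1}(f)) = SE_n((g/f)^2)`. -/
def EvenSingleSucc (n : ℕ) (f g : ℝ → ℝ) : Prop :=
  RatioDefined f g ∧ EvenEq (by omega) (OE (2 * n + 1) f) (SE n (ratioSq f g))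

/-- `even(OE_{2n}(f) ∪ OE_{2n}(f)) = UE_{2n}(g)`. -/
def EvenUnionSame (n : ℕ) (f g : ℝ → ℝ) : Prop :=
  EvenEq (by omega) (superpose (OE (2 * n) f) (OE (2 * n) f)) (UE (2 * n) g)

/-- `even(OE_{2n}(f)) = SE_n((g/f)^2)`. -/
def EvenSingle (n : ℕ) (f g : ℝ → ℝ) : Prop :=
  RatioDefined f g ∧ EvenEq (by omega) (OE (2 * n) f) (SE n (ratioSq f g))

/-- `odd(OE_{2n}(f) ∪ OE_{2n}(f)) = UE_{2n}(g)`. -/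
def OddUnionSame (n : ℕ) (f g : ℝ → ℝ) : Prop :=
  OddEq (by omega) (superpose (OE (2 * n) f) (OE (2 * n) f)) (UE (2 * n) g)

/-- `odd(OE_{2n}(f)) = SE_n((g/f)^2)`. -/
def OddSingle (n : ℕ) (f g : ℝ → ℝ) : Prop :=
  RatioDefined f g ∧ OddEq (by omega) (OE (2 * n) f) (SE n (ratioSq f g))

/-- `odd(OE_{2n-1}(f) ∪ OE_{2n}(f)) = UE_{2n}(g)`, for `n ≥ 1`. -/
def OddUnionPred (n : ℕ) (hn : 1 ≤ n) (f g : ℝ → ℝ) : Prop :=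
  OddEq (by omega) (superpose (OE (2 * n - 1) f) (OE (2 * n) f)) (UE (2 * n) g)

/-- `odd(OE_{2n-1}(f)) = SE_n((g/f)^2)`, for `n ≥ 1`. -/
def OddSinglePred (n : ℕ) (hn : 1 ≤ n) (f g : ℝ → ℝ) : Prop :=
  RatioDefined f g ∧ OddEq (by omega) (OE (2 * n - 1) f) (SE n (ratioSq f g))

/-! ### Classical weights -/

/-- `w` is `w₀` up to a positive constant factor and the scale of `x`. -/
def IsRescaling (w w₀ : ℝ → ℝ) : Prop :=
  ∃ c > (0 : ℝ), ∃ C > (0 : ℝ), ∀ x, w x = C * w₀ (c * x)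

/-- The classical weights (Gaussian, Laguerre, Jacobi, Cauchy), up to a positive constant factor
and the scale of `x`. -/
def IsClassicalWeight (w : ℝ → ℝ) : Prop :=
  IsRescaling w (fun x => Real.exp (-x ^ 2)) ∨
  (∃ a > (-1 : ℝ), IsRescaling w
    ((Set.Ioi 0).indicator fun x => x ^ a * Real.exp (-x))) ∨
  (∃ a > (-1 : ℝ), ∃ b > (-1 : ℝ), IsRescaling w
    ((Set.Ioo 0 1).indicator fun x => x ^ a * (1 - x) ^ b)) ∨
  (∃ α > (1 : ℝ), IsRescaling w fun x => (1 + x ^ 2) ^ (-α))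

/-- `(f, g)` is the pair `(f₀, g₀)` up to a common scale of `x` and positive constant factors. -/
def IsPairRescaling (f g f₀ g₀ : ℝ → ℝ) : Prop :=
  ∃ c > (0 : ℝ), ∃ C > (0 : ℝ), ∃ D > (0 : ℝ), (∀ x, f x = C * f₀ (c * x)) ∧ ∀ x, g x = D * g₀ (c * x)

/-- The Gaussian, Laguerre, Jacobi and Cauchy pairs. For the Cauchy pair, `2 * n < α` is the
condition that the orthogonal ensemble on `2 * n + 1` points be normalisable. -/
def EvenSuccPair (n : ℕ) (f g : ℝ → ℝ) : Prop :=
  IsPairRescaling f g (fun x => Real.exp (-x ^ 2 / 2)) (fun x => Real.exp (-x ^ 2)) ∨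
  (∃ a > (-1 : ℝ), IsPairRescaling f g
    ((Set.Ioi 0).indicator fun x => x ^ ((a - 1) / 2) * Real.exp (-x / 2))
    ((Set.Ioi 0).indicator fun x => x ^ a * Real.exp (-x))) ∨
  (∃ a > (-1 : ℝ), ∃ b > (-1 : ℝ), IsPairRescaling f g
    ((Set.Ioo 0 1).indicator fun x => x ^ ((a - 1) / 2) * (1 - x) ^ ((b - 1) / 2))
    ((Set.Ioo 0 1).indicator fun x => x ^ a * (1 - x) ^ b)) ∨
  (∃ α > (2 * n : ℝ), IsPairRescaling f g
    (fun x => (1 + x ^ 2) ^ (-(α + 1) / 2)) (fun x => (1 + x ^ 2) ^ (-α)))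

/-- `(exp (-x/2), exp (-x))` on `x > 0`, and `((1-x)^((a-1)/2), (1-x)^a)` on `0 < x < 1`. -/
def EvenSamePair (f g : ℝ → ℝ) : Prop :=
  IsPairRescaling f g
    ((Set.Ioi 0).indicator fun x => Real.exp (-x / 2))
    ((Set.Ioi 0).indicator fun x => Real.exp (-x)) ∨
  (∃ a > (-1 : ℝ), IsPairRescaling f g
    ((Set.Ioo 0 1).indicator fun x => (1 - x) ^ ((a - 1) / 2))
    ((Set.Ioo 0 1).indicator fun x => (1 - x) ^ a))

/-- `(x^((a-1)/2), x^a)` on `0 < x < 1`. -/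
def OddSamePair (f g : ℝ → ℝ) : Prop :=
  ∃ a > (-1 : ℝ), IsPairRescaling f g
    ((Set.Ioo 0 1).indicator fun x => x ^ ((a - 1) / 2))
    ((Set.Ioo 0 1).indicator fun x => x ^ a)

/-- `(1, 1)` on `0 < x < 1`. -/
def OddPredPair (f g : ℝ → ℝ) : Prop :=
  IsPairRescaling f g
    ((Set.Ioo 0 1).indicator fun _ => 1) ((Set.Ioo 0 1).indicator fun _ => 1)

end EigenvalueEnsemble

end

/-!
Each of the four pairs asks for the law of every other point of an orthogonal ensemble, or of two
superposed ones. Write `y` for the kept points and `f` for the weight.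

*Densities.* The law of `y` is found by integrating the remaining points over the gaps between the
kept ones (`map_kept_eq_withDensity_gap`). For two superposed ensembles one has to sum, over all
ways of splitting a decreasing configuration into two groups, the product of the absolute
Vandermonde determinants of the groups. All terms of the Laplace expansion of a suitable determinant
have the same sign, so this sum is a single determinant (`sum_abs_vdm_mul_abs_vdm`), and column
operations factor it into the Vandermonde determinants of the points of even and of odd rank
(`abs_det_splitMatrix`). Integrating the points in the gaps then turns the rows of a determinant
into moments of `f` over the gaps, and row operations turn these into moments over half-lines.

*The listed pairs.* Each listed `f` solves a Pearson equation `(q f)' = r f` with polynomials `q` and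
`r` of degrees at most `2` and `1`, and `g` is a multiple of `q f²`. So `(q f t ^ j)' = f L_j`, with
`L_j = j t ^ (j - 1) q + t ^ j r`, integrates to a boundary term over a half-line. If both extreme
points are integrated out, `L_j` has degree `j + 1`, and `1, L_0, L_1, …` is a basis of the
polynomials; if only one of them is, `L_j` has degree `j`; if neither is, `f` is constant on its
support. In each case the determinant in this basis has rows `q f y ^ j` (`absDet_gap_both`,
`absDet_gap_lower`, `absDet_gap_upper`, `absDet_gap_none`). For two superposed ensembles it is a
Vandermonde determinant, and the remaining Vandermonde factor of `y` gives the exponent `2`. For a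
single ensemble the kept points contribute rows of their own, and both sets of rows combine to a
confluent Vandermonde determinant, which is the fourth power of the Vandermonde product
(`absDet_lift_confluent`). The distinction between the pairs is where `q f` has to be continuous: at
both ends of the support, at one of them, or at neither.

*The converse.* For a fixed `f` either statement of a pair determines `g` up to a constant
(`weight_eq_of_map_kthLargest_eq`), so it suffices to show that `f` is the first weight of a listed
pair. For the first pair every classical `f` is one, provided that the ensembles can be normalised
(`exists_evenSuccPair`). In the other pairs some end of the support has no integrated point beyond
the last kept one. Equality of the laws says that the integral over the gaps, a continuous function
of `y`, is a product `C ∏ W (y i)` times a power of the Vandermonde product (`GapIdentity`), and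
sending kept points to an end restricts `f`.

- At a finite end, such as the upper one, `W` stays bounded and bounded away from `0`; two kept
  points approaching the end at mutual distance `ε` force the exponent of `f` there to vanish
  (`GapIdentity.exponent_eq_zero`).
- At an infinite end where `f` decays rapidly, two kept points far out give a contradiction
  (`GapIdentity.false_of_rapid_decay`).
- If the support is the whole line, both weights are even. With one extreme point integrated out,
  symmetry contradicts the different behaviour at the two ends (`GapIdentity.false_of_even`); with
  none, two kept points going to infinity in opposite directions contradict the decay of `W`
  obtained from a single one (`GapIdentity.false_of_even_two_sided`).
-/

noncomputable section

namespace EigenvalueEnsemble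

open Finset Matrix

/-! ### Vandermonde products -/

/-- The Vandermonde product `∏_{i<j} (x j - x i)`. -/
def vdm {N : ℕ} (x : Fin N → ℝ) : ℝ := ∏ i, ∏ j ∈ Finset.Ioi i, (x j - x i)

theorem vdm_eq_det {N : ℕ} (x : Fin N → ℝ) : vdm x = (vandermonde x).det :=
  (det_vandermonde x).symm

/-- The product of the distances over all ordered pairs of distinct indices. In contrast with
`vdm` it needs no order on the index type; for `Fin N` it is the square of `vdm`. -/
def pairProd {ι : Type*} [Fintype ι] [DecidableEq ι] (x : ι → ℝ) : ℝ :=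
  ∏ i, ∏ j, if i = j then 1 else |x i - x j|

theorem pairProd_comp_equiv {ι κ : Type*} [Fintype ι] [DecidableEq ι] [Fintype κ] [DecidableEq κ]
    (e : ι ≃ κ) (x : κ → ℝ) : pairProd (x ∘ e) = pairProd x := by
  unfold pairProd
  refine Fintype.prod_equiv e _ _ fun i => Fintype.prod_equiv e _ _ fun j => ?_
  simp

theorem pairProd_sum {ι κ : Type*} [Fintype ι] [DecidableEq ι] [Fintype κ] [DecidableEq κ]
    (a : ι → ℝ) (b : κ → ℝ) :
    pairProd (Sum.elim a b) = pairProd a * pairProd b * (∏ i, ∏ j, |a i - b j|) ^ 2 := by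
  unfold pairProd
  simp only [Fintype.prod_sum_type, Sum.elim_inl, Sum.elim_inr, Sum.inl.injEq, Sum.inr.injEq,
    reduceCtorEq, if_false, prod_mul_distrib]
  have : ∏ x, ∏ y, |b x - a y| = ∏ i, ∏ j, |a i - b j| := by
    rw [prod_comm]
    simp only [abs_sub_comm]
  rw [this]
  ring

theorem abs_vdm {N : ℕ} (x : Fin N → ℝ) :
    |vdm x| = ∏ i, ∏ j, if i < j then |x i - x j| else 1 := by
  simp only [vdm, abs_prod]
  refine prod_congr rfl fun i _ => ?_
  rw [← prod_filter]
  refine prod_congr ?_ fun j _ => abs_sub_comm _ _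
  ext j; simp

theorem sq_abs_vdm {N : ℕ} (x : Fin N → ℝ) : |vdm x| ^ 2 = pairProd x := by
  have h2 : |vdm x| = ∏ i, ∏ j, if j < i then |x i - x j| else 1 := by
    rw [abs_vdm, prod_comm]
    simp only [abs_sub_comm]
  rw [sq]
  nth_rewrite 1 [abs_vdm]
  rw [h2, pairProd, ← prod_mul_distrib]
  refine prod_congr rfl fun i _ => ?_
  rw [← prod_mul_distrib]
  refine prod_congr rfl fun j _ => ?_
  rcases lt_trichotomy i j with h | h | h
  · simp [h, h.ne, h.le]
  · simp [h]
  · simp [h, h.ne', h.le]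

theorem abs_vdm_eq_of_pairProd {N : ℕ} {x : Fin N → ℝ} {c : ℝ} (hc : 0 ≤ c)
    (h : pairProd x = c ^ 2) : |vdm x| = c := by
  rw [← sq_abs_vdm] at h
  exact (pow_left_inj₀ (abs_nonneg _) hc two_ne_zero).1 h

theorem abs_vdm_comp_perm {N : ℕ} (x : Fin N → ℝ) (σ : Equiv.Perm (Fin N)) :
    |vdm (x ∘ σ)| = |vdm x| :=
  abs_vdm_eq_of_pairProd (abs_nonneg _) (by rw [pairProd_comp_equiv, sq_abs_vdm])

/-- The Vandermonde product of a configuration split into two groups. -/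
theorem abs_vdm_split {M N K : ℕ} (e : Fin M ⊕ Fin N ≃ Fin K) (z : Fin K → ℝ) :
    |vdm z| = |vdm fun i => z (e (.inl i))| * |vdm fun j => z (e (.inr j))| *
      ∏ i, ∏ j, |z (e (.inl i)) - z (e (.inr j))| := by
  refine abs_vdm_eq_of_pairProd (by positivity) ?_
  rw [← pairProd_comp_equiv e]
  have : z ∘ e = Sum.elim (fun i => z (e (.inl i))) (fun j => z (e (.inr j))) := by
    ext r; cases r <;> rfl
  rw [this, pairProd_sum, ← sq_abs_vdm, ← sq_abs_vdm]
  ring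

theorem measurable_vdm {N : ℕ} : Measurable (vdm : (Fin N → ℝ) → ℝ) := by
  unfold vdm; fun_prop

theorem continuous_vdm {N : ℕ} : Continuous (vdm : (Fin N → ℝ) → ℝ) := by
  unfold vdm; fun_prop

theorem vdm_ne_zero {N : ℕ} {x : Fin N → ℝ} (hx : Function.Injective x) : vdm x ≠ 0 := by
  rw [vdm_eq_det]; exact det_vandermonde_ne_zero_iff.2 hx

/-- On decreasing configurations the Vandermonde product has a constant sign. -/
theorem abs_vdm_of_strictAnti {N : ℕ} {x : Fin N → ℝ} (hx : StrictAnti x) :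
    |vdm x| = (∏ i : Fin N, ∏ _j ∈ Finset.Ioi i, (-1 : ℝ)) * vdm x := by
  simp only [vdm, abs_prod, ← prod_mul_distrib]
  refine prod_congr rfl fun i _ => prod_congr rfl fun j hj => ?_
  have := hx (Finset.mem_Ioi.1 hj)
  rw [abs_of_neg (by linarith)]; ring

theorem vdm_comp_perm {N : ℕ} (x : Fin N → ℝ) (σ : Equiv.Perm (Fin N)) :
    vdm (x ∘ σ) = Equiv.Perm.sign σ * vdm x := by
  rw [vdm_eq_det, vdm_eq_det, ← det_permute]
  rfl

/-! ### The confluent Vandermonde determinant -/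

/-- The confluent Vandermonde determinant, each node having multiplicity two. It is the limit, for
`ε → 0`, of the Vandermonde determinant of the nodes `y i` and `y i + ε`, divided by `ε ^ n`. -/
theorem abs_det_confluent_vandermonde {n : ℕ} (y : Fin n → ℝ) (e : Fin n ⊕ Fin n ≃ Fin (n + n)) :
    |(of fun (r c : Fin n ⊕ Fin n) => r.elim (fun i => y i ^ (e c : ℕ))
      fun i => (e c : ℕ) * y i ^ ((e c : ℕ) - 1)).det| = |vdm y| ^ 4 := by
  set D : ℝ → Matrix (Fin n ⊕ Fin n) (Fin n ⊕ Fin n) ℝ := fun ε => of fun r c =>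
    r.elim (fun i => y i ^ (e c : ℕ))
      fun i => ε⁻¹ * ((y i + ε) ^ (e c : ℕ) - y i ^ (e c : ℕ)) with hD
  have h1 : ∀ ε : ℝ, ε ≠ 0 → |(D ε).det| =
      |vdm y| ^ 2 * ∏ i, ∏ j, if i = j then 1 else |y i - (y j + ε)| := by
    intro ε hε
    -- Row operations recover the Vandermonde matrix of the nodes `y i` and `y i + ε`.
    have hfac : (of fun (r c : Fin n ⊕ Fin n) =>
        (Sum.elim y (fun i => y i + ε) r) ^ (e c : ℕ)) =
        fromBlocks (1 : Matrix (Fin n) (Fin n) ℝ) 0 1 (ε • (1 : Matrix (Fin n) (Fin n) ℝ)) *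
          D ε := by
      ext r c
      rcases r with i | i
      · simp [hD, mul_apply, Fintype.sum_sum_type, fromBlocks_apply₁₁, fromBlocks_apply₁₂,
          one_apply]
      · simp [hD, mul_apply, Fintype.sum_sum_type, one_apply]
        field_simp
        ring
    have hdet := congrArg Matrix.det hfac
    rw [det_mul, det_fromBlocks_zero₁₂, det_one, one_mul, det_smul, det_one, mul_one,
      Fintype.card_fin] at hdet
    have hv : |(of fun (r c : Fin n ⊕ Fin n) =>
        (Sum.elim y (fun i => y i + ε) r) ^ (e c : ℕ)).det| =
        |vdm (Sum.elim y (fun i => y i + ε) ∘ e.symm)| := by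
      rw [vdm_eq_det, ← abs_det_submatrix_equiv_equiv e e]
      congr 2
      ext r c
      simp [vandermonde_apply]
    rw [abs_vdm_split e] at hv
    simp only [Function.comp, Equiv.symm_apply_apply, Sum.elim_inl, Sum.elim_inr] at hv
    have hshift : vdm (fun j => y j + ε) = vdm y := by simp [vdm]
    have hdiag : ∏ i, ∏ j, |y i - (y j + ε)| =
        |ε| ^ n * ∏ i, ∏ j, if i = j then 1 else |y i - (y j + ε)| := by
      have : ∀ i : Fin n, ∏ j, |y i - (y j + ε)| =
          |ε| * ∏ j, if i = j then 1 else |y i - (y j + ε)| := by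
        intro i
        rw [← mul_prod_erase univ _ (mem_univ i),
          ← mul_prod_erase univ (fun j => if i = j then 1 else |y i - (y j + ε)|) (mem_univ i)]
        simp only [sub_add_cancel_left, abs_neg, if_true, one_mul]
        congr 1
        refine prod_congr rfl fun j hj => ?_
        rw [if_neg (ne_of_mem_erase hj).symm]
      simp only [this, prod_mul_distrib]
      simp
    rw [hdet, hshift, hdiag, abs_mul, abs_pow] at hv
    have hε' : |ε| ^ n ≠ 0 := by positivity
    have := mul_left_cancel₀ hε' (hv.trans (by ring : _ = |ε| ^ n * (|vdm y| ^ 2 *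
      ∏ i, ∏ j, if i = j then 1 else |y i - (y j + ε)|)))
    exact this
  -- Both sides converge as `ε` tends to `0`; on the left the difference quotients become
  -- derivatives.
  have h2 : Filter.Tendsto (fun ε => |(D ε).det|) (nhdsWithin 0 {0}ᶜ)
      (nhds |(of fun (r c : Fin n ⊕ Fin n) => r.elim (fun i => y i ^ (e c : ℕ))
        fun i => (e c : ℕ) * y i ^ ((e c : ℕ) - 1)).det|) := by
    refine (continuous_abs.tendsto _).comp (((Continuous.matrix_det continuous_id).tendsto _).comp
      ?_)
    refine tendsto_pi_nhds.2 fun r => tendsto_pi_nhds.2 fun c => ?_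
    rcases r with i | i
    · exact tendsto_const_nhds
    · have := (hasDerivAt_pow (e c : ℕ) (y i)).tendsto_slope_zero
      simpa [hD] using this
  have h3 : Filter.Tendsto (fun ε : ℝ => |vdm y| ^ 2 *
      ∏ i, ∏ j, if i = j then 1 else |y i - (y j + ε)|) (nhdsWithin 0 {0}ᶜ)
      (nhds (|vdm y| ^ 2 * ∏ i, ∏ j, if i = j then 1 else |y i - (y j + 0)|)) := by
    refine Filter.Tendsto.mono_left (Continuous.tendsto ?_ 0) nhdsWithin_le_nhds
    refine continuous_const.mul (continuous_finsetProd _ fun i _ =>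
      continuous_finsetProd _ fun j _ => ?_)
    split_ifs <;> fun_prop
  have h4 := tendsto_nhds_unique (h2.congr' (by
    filter_upwards [self_mem_nhdsWithin] with ε hε using h1 ε hε)) h3
  rw [h4]
  have : (∏ i, ∏ j, if i = j then 1 else |y i - (y j + 0)|) = |vdm y| ^ 2 := by
    rw [sq_abs_vdm, pairProd]; simp
  rw [this]; ring

/-! ### Two superposed Vandermonde products -/

theorem vdm_eq_ite {N : ℕ} (x : Fin N → ℝ) :
    vdm x = ∏ i, ∏ j, if i < j then x j - x i else 1 := by
  refine prod_congr rfl fun i _ => ?_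
  rw [← prod_filter]
  refine prod_congr ?_ fun j _ => rfl
  ext j; simp

theorem vdm_add {M N : ℕ} (x : Fin (M + N) → ℝ) :
    vdm x = vdm (fun i => x (Fin.castAdd N i)) * vdm (fun j => x (Fin.natAdd M j)) *
      ∏ j, ∏ i, (x (Fin.natAdd M j) - x (Fin.castAdd N i)) := by
  have h1 : ∀ (i : Fin M) (j : Fin N), Fin.castAdd N i < Fin.natAdd M j := fun i j => by
    rw [Fin.lt_def]; simp; omega
  have h2 : ∀ (i : Fin M) (j : Fin N), ¬ Fin.natAdd M j < Fin.castAdd N i := fun i j =>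
    not_lt.2 (h1 i j).le
  have h3 : ∀ i i' : Fin M, Fin.castAdd N i < Fin.castAdd N i' ↔ i < i' := fun i i' => Iff.rfl
  rw [vdm_eq_ite, vdm_eq_ite, vdm_eq_ite,
    prod_comm (f := fun (j : Fin N) (i : Fin M) => x (Fin.natAdd M j) - x (Fin.castAdd N i))]
  simp only [Fin.prod_univ_add, h1, h2, if_true, if_false, prod_const_one,
    prod_mul_distrib, h3, Fin.natAdd_lt_natAdd_iff]
  ring

theorem prod_ne_sub {N : ℕ} (x : Fin N → ℝ) :
    (∏ i, ∏ j, if j = i then 1 else x i - x j) =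
      (∏ i : Fin N, ∏ j : Fin N, if i < j then (-1 : ℝ) else 1) * vdm x ^ 2 := by
  have h : vdm x = ∏ i, ∏ j, if j < i then x i - x j else 1 := by
    rw [vdm_eq_ite, prod_comm]
  rw [sq]
  nth_rewrite 2 [h]
  rw [vdm_eq_ite]
  simp only [← prod_mul_distrib]
  refine prod_congr rfl fun i _ => prod_congr rfl fun j _ => ?_
  rcases lt_trichotomy i j with h | h | h
  · simp [h, h.ne', h.not_gt]
  · simp [h]
  · simp [h, h.ne, h.not_gt]

/-- In a decreasing configuration the point of index `r` has exactly `r` points above it. -/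
theorem neg_one_pow_mul_prod_sub_pos {K : ℕ} {z : Fin K → ℝ} (hz : StrictAnti z) (r : Fin K) :
    0 < (-1 : ℝ) ^ (r : ℕ) * ∏ k, if k = r then 1 else z r - z k := by
  have : (-1 : ℝ) ^ (r : ℕ) = ∏ k : Fin K, if k < r then (-1 : ℝ) else 1 := by
    rw [← prod_filter, prod_const]
    congr 1
    rw [show univ.filter (fun k => k < r) = Finset.Iio r by ext; simp, Fin.card_Iio]
  rw [this, ← prod_mul_distrib]
  refine prod_pos fun k _ => ?_
  rcases lt_trichotomy k r with h | h | h
  · have := hz h; simp [h, h.ne]; linarith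
  · simp [h]
  · have := hz h; simp [h.ne', h.not_gt]; linarith

/-- The matrix whose Laplace expansion along its two groups of columns is the sum, over the ways of
splitting the points `z` into two groups, of the products of the Vandermonde determinants. -/
def splitMatrix {M N : ℕ} (z : Fin (M + N) → ℝ) : Matrix (Fin (M + N)) (Fin (M + N)) ℝ :=
  of fun k c => (finSumFinEquiv.symm c).elim (fun j : Fin M => z k ^ (j : ℕ))
    fun j : Fin N => (-1) ^ (k : ℕ) * z k ^ (j : ℕ)

/-- The Laplace expansion of `splitMatrix`. Summing over permutations instead of over splittings
counts each splitting `M! N!` times, once for each way of ordering the two groups. -/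
theorem sum_sign_mul_vdm_mul_vdm {M N : ℕ} (z : Fin (M + N) → ℝ) :
    ∑ σ : Equiv.Perm (Fin (M + N)), (Equiv.Perm.sign σ : ℝ) *
      (∏ j : Fin N, (-1 : ℝ) ^ (σ (Fin.natAdd M j) : ℕ)) *
      (vdm (fun i => z (σ (Fin.castAdd N i))) * vdm fun j => z (σ (Fin.natAdd M j))) =
    M.factorial * N.factorial * (splitMatrix z).det := by
  have hdet : ∀ τ : Equiv.Perm (Fin M) × Equiv.Perm (Fin N),
      ∑ σ : Equiv.Perm (Fin (M + N)), (Equiv.Perm.sign σ : ℝ) *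
        (∏ j : Fin N, (-1 : ℝ) ^ (σ (Fin.natAdd M j) : ℕ)) *
        (((Equiv.Perm.sign τ.1 : ℝ) * ∏ i, z (σ (Fin.castAdd N (τ.1 i))) ^ (i : ℕ)) *
        ((Equiv.Perm.sign τ.2 : ℝ) * ∏ j, z (σ (Fin.natAdd M (τ.2 j))) ^ (j : ℕ))) =
      (splitMatrix z).det := by
    rintro ⟨τ₁, τ₂⟩
    rw [det_apply']
    refine Fintype.sum_equiv
      (Equiv.mulRight (finSumFinEquiv.permCongr (Equiv.sumCongr τ₁ τ₂))) _ _ fun σ => ?_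
    have hs : ((Equiv.Perm.sign (σ * finSumFinEquiv.permCongr (Equiv.sumCongr τ₁ τ₂)) : ℤ) : ℝ) =
        (Equiv.Perm.sign σ : ℝ) * (Equiv.Perm.sign τ₁ : ℝ) * (Equiv.Perm.sign τ₂ : ℝ) := by
      rw [Equiv.Perm.sign_mul, Equiv.Perm.sign_permCongr, ← Equiv.Perm.sumCongr,
        Equiv.Perm.sign_sumCongr]
      push_cast; ring
    have hl : ∀ i, (σ * finSumFinEquiv.permCongr (Equiv.sumCongr τ₁ τ₂)) (Fin.castAdd N i) =
        σ (Fin.castAdd N (τ₁ i)) := fun i => by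
      simp [Equiv.permCongr_apply]
    have hr : ∀ j, (σ * finSumFinEquiv.permCongr (Equiv.sumCongr τ₁ τ₂)) (Fin.natAdd M j) =
        σ (Fin.natAdd M (τ₂ j)) := fun j => by
      simp [Equiv.permCongr_apply]
    have hp : ∏ j, (-1 : ℝ) ^ (σ (Fin.natAdd M j) : ℕ) =
        ∏ j, (-1 : ℝ) ^ (σ (Fin.natAdd M (τ₂ j)) : ℕ) :=
      (Equiv.prod_comp τ₂ fun j => (-1 : ℝ) ^ (σ (Fin.natAdd M j) : ℕ)).symm
    simp only [Equiv.coe_mulRight, hs, Fin.prod_univ_add, hl, hr, splitMatrix, of_apply,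
      finSumFinEquiv_symm_apply_castAdd, finSumFinEquiv_symm_apply_natAdd, Sum.elim_inl,
      Sum.elim_inr, prod_mul_distrib, hp]
    ring
  have hv : ∀ {L : ℕ} (x : Fin L → ℝ), vdm x =
      ∑ τ : Equiv.Perm (Fin L), (Equiv.Perm.sign τ : ℝ) * ∏ i, x (τ i) ^ (i : ℕ) := fun x => by
    rw [vdm_eq_det, det_apply']; rfl
  have hsum := sum_congr (rfl : (univ : Finset (Equiv.Perm (Fin M) × Equiv.Perm (Fin N))) = univ)
    fun τ _ => hdet τ
  rw [sum_comm, sum_const, card_univ, Fintype.card_prod, Fintype.card_perm, Fintype.card_perm,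
    Fintype.card_fin, Fintype.card_fin, nsmul_eq_mul] at hsum
  push_cast at hsum
  rw [← hsum]
  refine sum_congr rfl fun σ _ => ?_
  rw [hv, hv, sum_mul_sum, ← mul_sum, ← Fintype.sum_prod_type']

/-- For decreasing `z` the terms of the Laplace expansion of `splitMatrix z` all have the same
sign, so that the expansion computes the sum of their absolute values. -/
theorem sum_abs_vdm_mul_abs_vdm {M N : ℕ} {z : Fin (M + N) → ℝ} (hz : StrictAnti z) :
    ∑ σ : Equiv.Perm (Fin (M + N)), |vdm fun i => z (σ (Fin.castAdd N i))| *
      |vdm fun j => z (σ (Fin.natAdd M j))| =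
    M.factorial * N.factorial * |(splitMatrix z).det| := by
  set S : ℝ := ∏ i : Fin N, ∏ j : Fin N, if i < j then (-1 : ℝ) else 1 with hS
  -- `sign σ` and the parities of the indices in the second group account for the signs of all
  -- differences, so that every term has the sign of `vdm z * S`.
  have hpos : ∀ σ : Equiv.Perm (Fin (M + N)), 0 < (vdm z * S) * ((Equiv.Perm.sign σ : ℝ) *
      (∏ j : Fin N, (-1 : ℝ) ^ (σ (Fin.natAdd M j) : ℕ)) *
      (vdm (fun i => z (σ (Fin.castAdd N i))) * vdm fun j => z (σ (Fin.natAdd M j)))) := by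
    intro σ
    have hinj : Function.Injective (z ∘ σ) := hz.injective.comp σ.injective
    set A := vdm fun i => z (σ (Fin.castAdd N i)) with hA
    set B := vdm fun j => z (σ (Fin.natAdd M j)) with hB
    set C := ∏ j, ∏ i, (z (σ (Fin.natAdd M j)) - z (σ (Fin.castAdd N i))) with hC
    have h1 : (Equiv.Perm.sign σ : ℝ) * vdm z = A * B * C := by
      rw [← vdm_comp_perm, vdm_add]; rfl
    have h2 : 0 < (∏ j : Fin N, (-1 : ℝ) ^ (σ (Fin.natAdd M j) : ℕ)) * (C * (S * B ^ 2)) := by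
      have := prod_pos (s := univ) fun (j : Fin N) _ =>
        neg_one_pow_mul_prod_sub_pos hz (σ (Fin.natAdd M j))
      rw [prod_mul_distrib] at this
      have e2 : ∀ j : Fin N, (∏ k, if k = σ (Fin.natAdd M j) then (1 : ℝ) else
          z (σ (Fin.natAdd M j)) - z k) = (∏ i, (z (σ (Fin.natAdd M j)) -
            z (σ (Fin.castAdd N i)))) * ∏ j', if j' = j then 1 else
          z (σ (Fin.natAdd M j)) - z (σ (Fin.natAdd M j')) := by
        intro j
        rw [← Equiv.prod_comp σ, Fin.prod_univ_add]
        congr 1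
        · refine prod_congr rfl fun i _ => if_neg fun h => ?_
          have := congrArg Fin.val (σ.injective h)
          simp at this; omega
        · refine prod_congr rfl fun i _ => ?_
          simp only [EmbeddingLike.apply_eq_iff_eq, Fin.natAdd_inj]
      rw [prod_congr rfl fun j _ => e2 j, prod_mul_distrib,
        prod_ne_sub fun j => z (σ (Fin.natAdd M j))] at this
      exact this
    have hA0 : A ≠ 0 := vdm_ne_zero (hinj.comp (Fin.castAdd_injective M N))
    have : 0 < A ^ 2 := by positivity
    calc 0 < A ^ 2 * ((∏ j : Fin N, (-1 : ℝ) ^ (σ (Fin.natAdd M j) : ℕ)) * (C * (S * B ^ 2))) :=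
          mul_pos this h2
      _ = (A * B * C) * S * (∏ j : Fin N, (-1 : ℝ) ^ (σ (Fin.natAdd M j) : ℕ)) * (A * B) := by ring
      _ = _ := by rw [← h1]; ring
  have habs : ∀ σ : Equiv.Perm (Fin (M + N)),
      |vdm z * S| * (|vdm fun i => z (σ (Fin.castAdd N i))| *
        |vdm fun j => z (σ (Fin.natAdd M j))|) = (vdm z * S) * ((Equiv.Perm.sign σ : ℝ) *
      (∏ j : Fin N, (-1 : ℝ) ^ (σ (Fin.natAdd M j) : ℕ)) *
      (vdm (fun i => z (σ (Fin.castAdd N i))) * vdm fun j => z (σ (Fin.natAdd M j)))) := by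
    intro σ
    rw [← abs_of_pos (hpos σ)]
    simp only [abs_mul, abs_prod, abs_pow, abs_neg, abs_one, one_pow, prod_const_one, mul_one]
    have : |((Equiv.Perm.sign σ : ℤ) : ℝ)| = 1 := by
      rcases Int.units_eq_one_or (Equiv.Perm.sign σ) with h | h <;> simp [h]
    rw [this]; ring
  have hne : |vdm z * S| ≠ 0 := by
    refine abs_ne_zero.2 (mul_ne_zero (vdm_ne_zero hz.injective) ?_)
    refine prod_ne_zero_iff.2 fun i _ => prod_ne_zero_iff.2 fun j _ => ?_
    split_ifs <;> norm_num
  refine mul_left_cancel₀ hne ?_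
  have hnn : 0 ≤ (vdm z * S) * (M.factorial * N.factorial * (splitMatrix z).det) := by
    rw [← sum_sign_mul_vdm_mul_vdm, mul_sum]
    exact sum_nonneg fun σ _ => (hpos σ).le
  rw [mul_sum, sum_congr rfl fun σ _ => habs σ, ← mul_sum, sum_sign_mul_vdm_mul_vdm,
    ← abs_of_nonneg hnn, abs_mul, abs_mul (M.factorial * N.factorial : ℝ),
    abs_of_nonneg (a := (M.factorial : ℝ) * N.factorial) (by positivity)]

/-- When the sign `(-1) ^ k` separates the points `z k` into groups of sizes `M ≤ N`, column
operations make `splitMatrix z` block triangular. -/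
theorem abs_det_splitMatrix {M N : ℕ} (hMN : M ≤ N) (z : Fin (M + N) → ℝ)
    (e : Fin M ⊕ Fin N ≃ Fin (M + N)) (δ : ℝ) (hδ : δ * δ = 1)
    (hl : ∀ i, (-1 : ℝ) ^ (e (.inl i) : ℕ) = δ) (hr : ∀ j, (-1 : ℝ) ^ (e (.inr j) : ℕ) = -δ) :
    |(splitMatrix z).det| =
      2 ^ M * (|vdm fun i => z (e (.inl i))| * |vdm fun j => z (e (.inr j))|) := by
  set a : Fin M → ℝ := fun i => z (e (.inl i)) with ha
  set b : Fin N → ℝ := fun j => z (e (.inr j)) with hb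
  -- Adding `δ` times a column of the second group to the corresponding column of the first group
  -- doubles the latter at the points of sign `δ` and annihilates it at the others.
  set J : Matrix (Fin N) (Fin M) ℝ := of fun j i => if j = Fin.castLE hMN i then δ else 0 with hJ
  have h1 : (splitMatrix z).submatrix e finSumFinEquiv * fromBlocks 1 0 J 1 =
      fromBlocks ((2 : ℝ) • vandermonde a) (of fun i (j : Fin N) => δ * a i ^ (j : ℕ)) 0
        ((-δ) • vandermonde b) := by
    ext r c
    rcases r with i | i <;> rcases c with j | j <;>
    simp [mul_apply, Fintype.sum_sum_type, splitMatrix, hl, hr, one_apply, hJ, vandermonde_apply,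
      ha, hb]
    · linear_combination (z (e (Sum.inl i)) ^ (j : ℕ)) * hδ
    · linear_combination -(z (e (Sum.inr i)) ^ (j : ℕ)) * hδ
  have h2 := congrArg (fun A => |Matrix.det A|) h1
  have habs : |δ| = 1 := by
    have : |δ| * |δ| = 1 := by rw [← abs_mul, hδ, abs_one]
    nlinarith [abs_nonneg δ]
  simp only [det_mul, det_fromBlocks_zero₁₂, det_fromBlocks_zero₂₁, det_one, mul_one,
    abs_det_submatrix_equiv_equiv, det_smul, abs_mul, abs_pow, abs_neg, habs, one_pow, one_mul,
    Fintype.card_fin, ← vdm_eq_det] at h2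
  rw [h2, abs_of_pos (by norm_num : (0 : ℝ) < 2)]
  ring

/-! ### Laws of order statistics -/

theorem kthLargest_eq_of_antitone {N : ℕ} {x : Fin N → ℝ} {σ : Equiv.Perm (Fin N)}
    (h : Antitone (x ∘ σ)) (k : Fin N) : kthLargest x k = x (σ k) := by
  have h2 : Monotone (x ∘ (Fin.revPerm.trans σ)) := fun a b hab => h (Fin.rev_le_rev.2 hab)
  have := congrFun (Tuple.unique_monotone (Tuple.monotone_sort x) h2) k.rev
  simpa [kthLargest] using this

theorem kthLargest_antitone {N : ℕ} (x : Fin N → ℝ) : Antitone (kthLargest x) := fun _ _ hab =>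
  Tuple.monotone_sort x (Fin.rev_le_rev.2 hab)

theorem exists_unique_strictAnti {N : ℕ} {x : Fin N → ℝ} (hx : Function.Injective x) :
    ∃! σ : Equiv.Perm (Fin N), StrictAnti (x ∘ σ) := by
  refine ⟨Fin.revPerm.trans (Tuple.sort x), ?_, fun τ hτ => ?_⟩
  · exact ((kthLargest_antitone x).strictAnti_of_injective
      (hx.comp ((Tuple.sort x).injective.comp Fin.rev_injective)))
  · ext k
    have := kthLargest_eq_of_antitone hτ.antitone k
    exact congrArg Fin.val (hx this).symm

theorem ae_injective (N : ℕ) : ∀ᵐ x : Fin N → ℝ, Function.Injective x := by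
  have : ∀ i j : Fin N, i ≠ j → ∀ᵐ x : Fin N → ℝ, x i ≠ x j := by
    intro i j hij
    let L : (Fin N → ℝ) →ₗ[ℝ] ℝ := (LinearMap.proj i : (Fin N → ℝ) →ₗ[ℝ] ℝ) - LinearMap.proj j
    -- The hyperplane on which two coordinates agree is a null set.
    have h0 := Measure.addHaar_submodule (volume : Measure (Fin N → ℝ)) (LinearMap.ker L) (by
      intro h
      have : L (Pi.single i 1) = 0 := by
        have : Pi.single i 1 ∈ LinearMap.ker L := h ▸ Submodule.mem_top
        simpa using this
      simp [L, hij] at this)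
    refine measure_mono_null (fun x hx => ?_) h0
    simpa [L, sub_eq_zero] using hx
  have h2 : ∀ᵐ x : Fin N → ℝ, ∀ i j : Fin N, i ≠ j → x i ≠ x j := by
    rw [ae_all_iff]; intro i
    rw [ae_all_iff]; intro j
    by_cases hij : i = j
    · simp [hij]
    · filter_upwards [this i j hij] with x hx _ using hx
  filter_upwards [h2] with x hx i j hij
  by_contra h
  exact hx i j h hij

theorem measurableSet_strictAnti (N : ℕ) : MeasurableSet {y : Fin N → ℝ | StrictAnti y} := by
  have : {y : Fin N → ℝ | StrictAnti y} = ⋂ i, ⋂ j, {y | i < j → y j < y i} := by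
    ext y; simp [StrictAnti]
  rw [this]
  refine MeasurableSet.iInter fun i => MeasurableSet.iInter fun j => ?_
  by_cases hij : i < j
  · simpa [hij] using measurableSet_lt (measurable_pi_apply j) (measurable_pi_apply i)
  · simp [hij]

theorem measurable_comp_perm {N : ℕ} (σ : Equiv.Perm (Fin N)) :
    Measurable fun x : Fin N → ℝ => x ∘ σ :=
  measurable_pi_lambda _ fun i => measurable_pi_apply (σ i)

theorem lintegral_comp_perm {N : ℕ} (σ : Equiv.Perm (Fin N)) (F : (Fin N → ℝ) → ENNReal) :
    ∫⁻ x, F (x ∘ σ) = ∫⁻ x, F x := by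
  have h := (volume_measurePreserving_piCongrLeft (fun _ : Fin N => ℝ) σ.symm)
  have h2 := h.lintegral_comp_emb (MeasurableEquiv.measurableEmbedding _) F
  rw [← h2]
  congr 1
  ext x
  congr 1
  ext k
  have := MeasurableEquiv.piCongrLeft_apply_apply (β := fun _ : Fin N => ℝ) σ.symm x (σ k)
  simpa using this.symm

/-- The law of the decreasing rearrangement: on decreasing configurations its density is the sum
of the original density over all orderings. -/
theorem map_kthLargest_withDensity {N : ℕ} {ρ : (Fin N → ℝ) → ENNReal} (hρ : Measurable ρ) :
    ((volume.withDensity ρ).map fun x k => kthLargest x k) =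
      volume.withDensity ({y | StrictAnti y}.indicator
        fun y => ∑ σ : Equiv.Perm (Fin N), ρ (y ∘ σ)) := by
  ext s hs
  rw [Measure.map_apply measurable_kthLargest hs,
    withDensity_apply _ (measurable_kthLargest hs), withDensity_apply _ hs,
    ← lintegral_indicator (measurable_kthLargest hs), ← lintegral_indicator hs]
  -- Almost every `x` has exactly one decreasing rearrangement, and only its term survives.
  have key : ∀ᵐ x : Fin N → ℝ, ((fun x k => kthLargest x k) ⁻¹' s).indicator ρ x =
      ∑ σ : Equiv.Perm (Fin N), (({y | StrictAnti y} ∩ s).indicator (fun y => ρ (y ∘ σ.symm)))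
        (x ∘ σ) := by
    filter_upwards [ae_injective N] with x hx
    obtain ⟨σ, hσ, hu⟩ := exists_unique_strictAnti hx
    have hk : (fun k => kthLargest x k) = x ∘ σ := by
      ext k; exact kthLargest_eq_of_antitone hσ.antitone k
    have hmem : x ∈ (fun x k => kthLargest x k) ⁻¹' s ↔ x ∘ σ ∈ s := by
      rw [Set.mem_preimage, hk]
    rw [sum_eq_single σ]
    · have hxx : (x ∘ σ) ∘ σ.symm = x := by ext k; simp
      by_cases hm : x ∘ σ ∈ s
      · rw [Set.indicator_of_mem (hmem.2 hm), Set.indicator_of_mem (Set.mem_inter hσ hm), hxx]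
      · rw [Set.indicator_of_notMem (mt hmem.1 hm), Set.indicator_of_notMem fun h => hm h.2]
    · intro τ _ hτ
      exact Set.indicator_of_notMem (fun h => hτ (hu τ h.1)) _
    · intro h; exact absurd (mem_univ _) h
  have hmeas : ∀ σ : Equiv.Perm (Fin N), Measurable (({y : Fin N → ℝ | StrictAnti y} ∩ s).indicator
      (fun y => ρ (y ∘ σ.symm))) := fun σ =>
    (hρ.comp (measurable_comp_perm σ.symm)).indicator ((measurableSet_strictAnti N).inter hs)
  have hmeas' : ∀ σ ∈ (univ : Finset (Equiv.Perm (Fin N))), Measurable fun x : Fin N → ℝ =>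
      ({y : Fin N → ℝ | StrictAnti y} ∩ s).indicator (fun y => ρ (y ∘ σ.symm)) (x ∘ σ) :=
    fun σ _ => (hmeas σ).comp (measurable_comp_perm σ)
  rw [lintegral_congr_ae key, lintegral_finsetSum _ hmeas']
  have hc : ∀ σ : Equiv.Perm (Fin N), ∫⁻ x : Fin N → ℝ, ({y | StrictAnti y} ∩ s).indicator
      (fun y => ρ (y ∘ σ.symm)) (x ∘ σ) = ∫⁻ x, ({y | StrictAnti y} ∩ s).indicator
      (fun y => ρ (y ∘ σ.symm)) x := fun σ => lintegral_comp_perm σ _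
  rw [sum_congr rfl fun σ _ => hc σ, ← lintegral_finsetSum _ fun σ _ => hmeas σ]
  congr 1
  ext y
  by_cases hy : y ∈ s <;> by_cases hy' : StrictAnti y <;>
    simp only [Set.indicator, Set.mem_inter_iff, Set.mem_ofPred_eq, hy, hy', and_true, and_false,
      if_true, if_false, sum_const_zero]
  exact Fintype.sum_equiv (Equiv.inv _) _ _ fun σ => rfl

/-- The configuration with the points `y` and `x` at the positions prescribed by `e`. -/
def merge {m p K : ℕ} (e : Fin m ⊕ Fin p ≃ Fin K) (y : Fin m → ℝ) (x : Fin p → ℝ) : Fin K → ℝ :=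
  Sum.elim y x ∘ e.symm

@[simp] theorem merge_inl {m p K : ℕ} (e : Fin m ⊕ Fin p ≃ Fin K) (y : Fin m → ℝ)
    (x : Fin p → ℝ) (i : Fin m) : merge e y x (e (.inl i)) = y i := by simp [merge]

@[simp] theorem merge_inr {m p K : ℕ} (e : Fin m ⊕ Fin p ≃ Fin K) (y : Fin m → ℝ)
    (x : Fin p → ℝ) (i : Fin p) : merge e y x (e (.inr i)) = x i := by simp [merge]

theorem measurable_merge {m p K : ℕ} (e : Fin m ⊕ Fin p ≃ Fin K) :
    Measurable fun q : (Fin m → ℝ) × (Fin p → ℝ) => merge e q.1 q.2 := by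
  refine measurable_pi_lambda _ fun k => ?_
  obtain ⟨r, rfl⟩ := e.surjective k
  cases r <;> simp <;> fun_prop

theorem measurePreserving_merge {m p K : ℕ} (e : Fin m ⊕ Fin p ≃ Fin K) :
    MeasurePreserving (fun q : (Fin m → ℝ) × (Fin p → ℝ) => merge e q.1 q.2)
      (volume.prod volume) volume := by
  have h1 := (volume_measurePreserving_sumPiEquivProdPi (fun _ : Fin m ⊕ Fin p => ℝ)).symm
  have h2 := volume_measurePreserving_piCongrLeft (fun _ : Fin K => ℝ) e
  have h3 := h2.comp h1
  convert! h3 using 1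
  ext q k
  obtain ⟨r, rfl⟩ := e.surjective k
  have := MeasurableEquiv.piCongrLeft_apply_apply (β := fun _ : Fin K => ℝ) e
    ((MeasurableEquiv.sumPiEquivProdPi fun _ : Fin m ⊕ Fin p => ℝ).symm q) r
  simp only [Function.comp]
  rw [this]
  cases r <;> simp [MeasurableEquiv.coe_sumPiEquivProdPi_symm, Equiv.sumPiEquivProdPi]

theorem lintegral_merge {m p K : ℕ} (e : Fin m ⊕ Fin p ≃ Fin K) {F : (Fin K → ℝ) → ENNReal}
    (hF : Measurable F) : ∫⁻ z, F z = ∫⁻ y, ∫⁻ x, F (merge e y x) := by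
  rw [← (measurePreserving_merge e).lintegral_comp hF,
    lintegral_prod (fun q : (Fin m → ℝ) × (Fin p → ℝ) => F (merge e q.1 q.2))
      (hF.comp (measurable_merge e)).aemeasurable]

/-- The law of the points at the positions `e (.inl i)` is obtained by integrating out those at
the positions `e (.inr i)`. -/
theorem map_kept_withDensity {m p K : ℕ} (e : Fin m ⊕ Fin p ≃ Fin K) {ρ : (Fin K → ℝ) → ENNReal}
    (hρ : Measurable ρ) :
    ((volume.withDensity ρ).map fun x (i : Fin m) => kthLargest x (e (.inl i))) =
      volume.withDensity fun y => ∫⁻ x : Fin p → ℝ, {y | StrictAnti y}.indicator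
        (fun z => ∑ σ : Equiv.Perm (Fin K), ρ (z ∘ σ)) (merge e y x) := by
  have hπ : Measurable fun (z : Fin K → ℝ) (i : Fin m) => z (e (.inl i)) := by fun_prop
  have h1 : ((volume.withDensity ρ).map fun x (i : Fin m) => kthLargest x (e (.inl i))) =
      ((volume.withDensity ρ).map fun x k => kthLargest x k).map
        fun (z : Fin K → ℝ) (i : Fin m) => z (e (.inl i)) := by
    rw [Measure.map_map hπ measurable_kthLargest]; rfl
  rw [h1, map_kthLargest_withDensity hρ]
  have hF : Measurable ({y : Fin K → ℝ | StrictAnti y}.indicator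
      fun z => ∑ σ : Equiv.Perm (Fin K), ρ (z ∘ σ)) :=
    (Finset.measurable_sum _ fun σ _ => hρ.comp (measurable_comp_perm σ)).indicator
      (measurableSet_strictAnti K)
  ext s hs
  rw [Measure.map_apply hπ hs, withDensity_apply _ (hπ hs), withDensity_apply _ hs,
    ← lintegral_indicator (hπ hs), ← lintegral_indicator hs,
    lintegral_merge e (hF.indicator (hπ hs))]
  congr 1
  ext y
  by_cases hy : y ∈ s
  · rw [Set.indicator_of_mem hy]
    congr 1
    ext x
    exact Set.indicator_of_mem (by simpa using hy) _
  · rw [Set.indicator_of_notMem hy, ← lintegral_zero (μ := (volume : Measure (Fin p → ℝ)))]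
    congr 1
    ext x
    exact Set.indicator_of_notMem (by simpa using hy) _

/-! ### Interlacing -/

/-- The interval in which the `i`-th integrated point lies when the kept points are `y` and, in
decreasing order, the kept points occupy the positions `2 * j + h` and the integrated points the
positions `2 * i + 1 - h`. -/
def gap {m : ℕ} (h : ℕ) (y : Fin m → ℝ) (i : ℕ) : Set ℝ :=
  {t | ∀ j : Fin m, ((j : ℕ) + h ≤ i → t < y j) ∧ (i < (j : ℕ) + h → y j < t)}

theorem measurableSet_gap {m : ℕ} (h : ℕ) (y : Fin m → ℝ) (i : ℕ) : MeasurableSet (gap h y i) := by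
  have : gap h y i = ⋂ j : Fin m, {t | ((j : ℕ) + h ≤ i → t < y j) ∧ (i < (j : ℕ) + h → y j < t)} := by
    ext t; simp [gap]
  rw [this]
  refine MeasurableSet.iInter fun j => ?_
  rcases le_or_gt ((j : ℕ) + h) i with hj | hj
  · convert! (measurableSet_Iio : MeasurableSet (Set.Iio (y j))) using 1
    ext t; simp [hj, hj.not_gt]
  · convert! (measurableSet_Ioi : MeasurableSet (Set.Ioi (y j))) using 1
    ext t; simp [hj, hj.not_ge]

/-- `e` numbers the kept points `2 * i + h` and the integrated points `2 * i + 1 - h`. -/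
def IsAlternating {m p K : ℕ} (h : ℕ) (e : Fin m ⊕ Fin p ≃ Fin K) : Prop :=
  (∀ i, (e (.inl i) : ℕ) = 2 * i + h) ∧ ∀ i, (e (.inr i) : ℕ) = 2 * i + 1 - h

theorem exists_isAlternating {m p K h : ℕ} (hh : h ≤ 1) (hK : K = m + p) (h1 : m + h ≤ p + 1)
    (h2 : p ≤ m + h) : ∃ e : Fin m ⊕ Fin p ≃ Fin K, IsAlternating h e := by
  let f : Fin m ⊕ Fin p → Fin K := Sum.elim (fun i => ⟨2 * i + h, by have := i.isLt; omega⟩)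
    fun i => ⟨2 * i + 1 - h, by have := i.isLt; omega⟩
  have hf : Function.Bijective f := by
    rw [Fintype.bijective_iff_injective_and_card]
    refine ⟨?_, by simp [hK]⟩
    rintro (i | i) (j | j) hij <;> simp [f, Fin.ext_iff] at hij ⊢ <;> omega
  exact ⟨Equiv.ofBijective f hf, fun i => rfl, fun i => rfl⟩

theorem strictAnti_merge_iff {m p K h : ℕ} {e : Fin m ⊕ Fin p ≃ Fin K} (he : IsAlternating h e)
    (hh : h ≤ 1) (h1 : p ≤ m + h) (y : Fin m → ℝ) (x : Fin p → ℝ) :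
    StrictAnti (merge e y x) ↔ StrictAnti y ∧ ∀ i : Fin p, x i ∈ gap h y i := by
  obtain ⟨hl, hr⟩ := he
  constructor
  · intro hz
    refine ⟨fun i j hij => ?_, fun i j => ⟨fun hij => ?_, fun hij => ?_⟩⟩
    · have : e (.inl i) < e (.inl j) := by
        rw [Fin.lt_def, hl, hl]; have : (i : ℕ) < j := hij; omega
      simpa using hz this
    · have : e (.inl j) < e (.inr i) := by rw [Fin.lt_def, hl, hr]; omega
      simpa using hz this
    · have : e (.inr i) < e (.inl j) := by rw [Fin.lt_def, hl, hr]; omega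
      simpa using hz this
  · rintro ⟨hy, hx⟩ a b hab
    obtain ⟨a, rfl⟩ := e.surjective a
    obtain ⟨b, rfl⟩ := e.surjective b
    rw [Fin.lt_def] at hab
    rcases a with i | i <;> rcases b with j | j <;> simp only [merge_inl, merge_inr] <;>
      simp only [hl, hr] at hab
    · exact hy (by rw [Fin.lt_def]; omega)
    · exact (hx j i).1 (by omega)
    · exact (hx i j).2 (by omega)
    · have hj := j.isLt
      have hk : (i : ℕ) + 1 - h < m := by omega
      exact ((hx j ⟨i + 1 - h, hk⟩).1 (by simp; omega)).trans
        ((hx i ⟨i + 1 - h, hk⟩).2 (by simp; omega))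

/-- The law of the kept points of an alternating pattern, as an integral over the gaps. -/
theorem map_kept_eq_withDensity_gap {m p K h : ℕ} {e : Fin m ⊕ Fin p ≃ Fin K}
    (he : IsAlternating h e) (hh : h ≤ 1) (h1 : p ≤ m + h) {ρ : (Fin K → ℝ) → ENNReal}
    (hρ : Measurable ρ) :
    ((volume.withDensity ρ).map fun x (i : Fin m) => kthLargest x (e (.inl i))) =
      volume.withDensity ({y | StrictAnti y}.indicator fun y =>
        ∫⁻ x in Set.univ.pi fun i : Fin p => gap h y i,
          ∑ σ : Equiv.Perm (Fin K), ρ (merge e y x ∘ σ)) := by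
  rw [map_kept_withDensity e hρ]
  congr 1
  ext y
  by_cases hy : StrictAnti y
  · rw [Set.indicator_of_mem (show y ∈ {y | StrictAnti y} from hy),
      ← lintegral_indicator (MeasurableSet.univ_pi fun i : Fin p => measurableSet_gap h y i)]
    congr 1
    ext x
    by_cases hx : ∀ i : Fin p, x i ∈ gap h y i
    · rw [Set.indicator_of_mem (show merge e y x ∈ {y | StrictAnti y} from
        (strictAnti_merge_iff he hh h1 y x).2 ⟨hy, hx⟩), Set.indicator_of_mem (by simpa using hx)]
    · rw [Set.indicator_of_notMem (show merge e y x ∉ {y | StrictAnti y} from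
        fun h => hx ((strictAnti_merge_iff he hh h1 y x).1 h).2),
        Set.indicator_of_notMem (by simpa using hx)]
  · rw [Set.indicator_of_notMem (show y ∉ {y | StrictAnti y} from hy), ← lintegral_zero (μ := (volume : Measure (Fin p → ℝ)))]
    congr 1
    ext x
    exact Set.indicator_of_notMem (fun h => hy ((strictAnti_merge_iff he hh h1 y x).1 h).1) _

/-! ### Absolute values of determinants with rows indexed by an arbitrary finite type -/

section AbsDet

variable {R R' : Type*} [Fintype R] [DecidableEq R] [Fintype R'] [DecidableEq R']

/-- The absolute value of the determinant of the square matrix whose row `r` consists of the first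
`Fintype.card R` terms of the sequence `v r`. It does not depend on how the rows are numbered. -/
def absDet (v : R → ℕ → ℝ) : ℝ := |(of fun r c : R => v r (Fintype.equivFin R c)).det|

theorem absDet_eq {K : ℕ} (e : R ≃ Fin K) (v : R → ℕ → ℝ) :
    absDet v = |(of fun r c : R => v r (e c)).det| := by
  have hK : Fintype.card R = K := by simpa using Fintype.card_congr e
  subst hK
  rw [absDet, ← abs_det_submatrix_equiv_equiv (Equiv.refl R) ((Fintype.equivFin R).trans e.symm)
    (of fun r c : R => v r (e c))]
  congr 3
  ext r c
  simp

theorem absDet_nonneg (v : R → ℕ → ℝ) : 0 ≤ absDet v := abs_nonneg _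

theorem absDet_reindex (σ : R' ≃ R) (v : R → ℕ → ℝ) : absDet (v ∘ σ) = absDet v := by
  rw [absDet_eq (Fintype.equivFin R), absDet_eq (σ.trans (Fintype.equivFin R)),
    ← abs_det_submatrix_equiv_equiv σ σ]
  rfl

theorem absDet_congr {v w : R → ℕ → ℝ} (h : ∀ r, ∀ j < Fintype.card R, v r j = w r j) :
    absDet v = absDet w := by
  unfold absDet
  congr 3
  ext r c
  exact h r _ (Fin.isLt _)

/-- A triangular change of basis of the columns. -/
theorem absDet_mul_triangular (v : R → ℕ → ℝ) (C : ℕ → ℕ → ℝ) (hC : ∀ k j, j < k → C k j = 0) :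
    absDet (fun r j => ∑ k ∈ range (Fintype.card R), v r k * C k j) =
      (∏ j ∈ range (Fintype.card R), |C j j|) * absDet v := by
  set e := Fintype.equivFin R
  have h1 : (of fun r c : R => ∑ k ∈ range (Fintype.card R), v r k * C k (e c)) =
      (of fun r (c : Fin (Fintype.card R)) => v r c).submatrix id e *
        (of fun k j : Fin (Fintype.card R) => C k j).submatrix e e := by
    ext r c
    simp only [of_apply, mul_apply, submatrix_apply, id]
    rw [Equiv.sum_comp e (fun k => v r k * C k (e c)), Finset.sum_range]
  have h2 : (of fun k j : Fin (Fintype.card R) => C k j).det =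
      ∏ j : Fin (Fintype.card R), C j j := by
    rw [det_of_isUpperTriangular]
    · rfl
    · intro i j hij
      exact hC _ _ hij
  rw [absDet, h1, det_mul, abs_mul, abs_det_submatrix_equiv_equiv, h2, abs_prod, mul_comm,
    Finset.prod_range]
  rfl

theorem absDet_mul_column (v : R → ℕ → ℝ) (c : ℕ → ℝ) :
    absDet (fun r j => c j * v r j) = (∏ j ∈ range (Fintype.card R), |c j|) * absDet v := by
  have := absDet_mul_triangular v (fun k j => if k = j then c j else 0)
    (fun k j h => if_neg h.ne')
  simp only [if_true] at this
  rw [← this]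
  refine absDet_congr fun r j hj => ?_
  simp [hj, mul_comm]

theorem absDet_mul_row (v : R → ℕ → ℝ) (c : R → ℝ) :
    absDet (fun r j => c r * v r j) = (∏ r, |c r|) * absDet v := by
  rw [absDet, ← abs_prod, absDet, ← abs_mul, ← det_mul_column]
  rfl

/-- Expansion along a first row with one nonzero entry, in the first column. -/
theorem absDet_of_row (v : Option R → ℕ → ℝ) (h : ∀ j, 1 ≤ j → v none j = 0) :
    absDet v = |v none 0| * absDet fun r j => v (some r) (j + 1) := by
  let e₀ := Fintype.equivFin R
  let e : Unit ⊕ R ≃ Fin (1 + Fintype.card R) :=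
    (Equiv.sumCongr (Equiv.ofUnique _ _) e₀).trans finSumFinEquiv
  let σ : Unit ⊕ R ≃ Option R := (Equiv.sumComm _ _).trans (Equiv.optionEquivSumPUnit R).symm
  rw [← absDet_reindex σ, absDet_eq e, absDet_eq e₀]
  have : (of fun r c => (v ∘ σ) r (e c)) = fromBlocks (of fun _ _ : Unit => v none 0) 0
      (of fun r (_ : Unit) => v (some r) 0) (of fun r c : R => v (some r) (e₀ c + 1)) := by
    ext r c
    rcases r with r | r <;> rcases c with c | c <;> simp [e, σ, h, add_comm]
  rw [this, det_fromBlocks_zero₁₂, abs_mul]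
  simp

/-- Expansion along a first column with one nonzero entry, in the first row. -/
theorem absDet_of_column (v : Option R → ℕ → ℝ) (h : ∀ r, v (some r) 0 = 0) :
    absDet v = |v none 0| * absDet fun r j => v (some r) (j + 1) := by
  let e₀ := Fintype.equivFin R
  let e : Unit ⊕ R ≃ Fin (1 + Fintype.card R) :=
    (Equiv.sumCongr (Equiv.ofUnique _ _) e₀).trans finSumFinEquiv
  let σ : Unit ⊕ R ≃ Option R := (Equiv.sumComm _ _).trans (Equiv.optionEquivSumPUnit R).symm
  rw [← absDet_reindex σ, absDet_eq e, absDet_eq e₀]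
  have : (of fun r c => (v ∘ σ) r (e c)) = fromBlocks (of fun _ _ : Unit => v none 0)
      (of fun (_ : Unit) (c : R) => v none (e₀ c + 1)) 0
      (of fun r c : R => v (some r) (e₀ c + 1)) := by
    ext r c
    rcases r with r | r <;> rcases c with c | c <;> simp [e, σ, h, add_comm]
  rw [this, det_fromBlocks_zero₂₁, abs_mul]
  simp

theorem absDet_row_operation {p : ℕ} (q : R → ℕ → ℝ) (V W : Fin p → ℕ → ℝ)
    (S : Matrix (Fin p) (Fin p) ℝ) (hS : S.det = 1) (h : ∀ i j, W i j = ∑ k, S i k * V k j) :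
    absDet (Sum.elim q W) = absDet (Sum.elim q V) := by
  rw [absDet, absDet]
  have : (of fun r c => Sum.elim q W r (Fintype.equivFin (R ⊕ Fin p) c)) =
      fromBlocks 1 0 0 S * (of fun r c => Sum.elim q V r (Fintype.equivFin (R ⊕ Fin p) c)) := by
    ext r c
    rcases r with r | r <;> simp [mul_apply, Fintype.sum_sum_type, one_apply, h]
  rw [this, det_mul, det_fromBlocks_zero₂₁, det_one, hS, one_mul, one_mul]

theorem absDet_sub_succ {p : ℕ} (q : R → ℕ → ℝ) (V : ℕ → ℕ → ℝ) (hV : V p = 0) :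
    absDet (Sum.elim q fun (i : Fin p) j => V i j - V (i + 1) j) =
      absDet (Sum.elim q fun (i : Fin p) j => V i j) := by
  refine absDet_row_operation q _ _
    (of fun i k : Fin p => (if i = k then 1 else 0) - if (i : ℕ) + 1 = k then 1 else 0) ?_ ?_
  · rw [det_of_isUpperTriangular]
    · simp
    · intro i k hik
      have h1 : k < i := hik
      have h2 : ¬ (i : ℕ) + 1 = k := by rw [Fin.lt_def] at h1; omega
      simp [h1.ne', h2]
  · intro i j
    simp only [of_apply, sub_mul, sum_sub_distrib, ite_mul, one_mul, zero_mul, sum_ite_eq,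
      mem_univ, if_true]
    congr 1
    by_cases hi : (i : ℕ) + 1 < p
    · rw [sum_eq_single (⟨i + 1, hi⟩ : Fin p)]
      · simp
      · intro k _ hk
        rw [if_neg]
        intro h; exact hk (Fin.ext h.symm)
      · simp
    · have : (i : ℕ) + 1 = p := by omega
      rw [this, hV, sum_eq_zero]
      · rfl
      · intro k _; rw [if_neg]; omega

theorem absDet_succ_sub {p : ℕ} (q : R → ℕ → ℝ) (W : ℕ → ℕ → ℝ) (hW : W 0 = 0) :
    absDet (Sum.elim q fun (i : Fin p) j => W (i + 1) j - W i j) =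
      absDet (Sum.elim q fun (i : Fin p) j => W (i + 1) j) := by
  refine absDet_row_operation q _ _
    (of fun i k : Fin p => (if i = k then 1 else 0) - if (i : ℕ) = k + 1 then 1 else 0) ?_ ?_
  · rw [det_of_isLowerTriangular]
    · simp
    · intro i k hik
      have h1 : i < k := hik
      have h2 : ¬ (i : ℕ) = k + 1 := by rw [Fin.lt_def] at h1; omega
      simp [h1.ne, h2]
  · intro i j
    simp only [of_apply, sub_mul, sum_sub_distrib, ite_mul, one_mul, zero_mul, sum_ite_eq,
      mem_univ, if_true]
    congr 1
    rcases Nat.eq_zero_or_pos (i : ℕ) with hi | hi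
    · rw [hi, hW, sum_eq_zero]
      · rfl
      · intro k _; rw [if_neg]; omega
    · rw [sum_eq_single (⟨i - 1, by omega⟩ : Fin p)]
      · rw [if_pos (by simp; omega)]
        congr 1; simp; omega
      · intro k _ hk
        rw [if_neg]
        intro h; exact hk (Fin.ext (by simp; omega))
      · simp

/-- Differences of consecutive rows, as a determinant with one more row and a column of ones. -/
theorem absDet_sub_succ_bordered {p : ℕ} (q : R → ℕ → ℝ) (V : ℕ → ℕ → ℝ) (hq : ∀ r, q r 0 = 0)
    (hV : ∀ i, V i 0 = 1) :
    absDet (Sum.elim q fun (i : Fin (p + 1)) j => V i j) =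
      absDet (Sum.elim (fun r j => q r (j + 1))
        fun (i : Fin p) j => V i (j + 1) - V (i + 1) (j + 1)) := by
  have h1 := absDet_sub_succ (p := p + 1) q (fun i => if i = p + 1 then 0 else V i) (if_pos rfl)
  have h2 : (fun (i : Fin (p + 1)) j => (if (i : ℕ) = p + 1 then (0 : ℕ → ℝ) else V i) j) =
      fun (i : Fin (p + 1)) j => V i j := by
    ext i j; rw [if_neg (by omega)]
  rw [h2] at h1
  rw [← h1]
  let σ : Option (R ⊕ Fin p) ≃ R ⊕ Fin (p + 1) :=
    (Equiv.optionEquivSumPUnit.{0} _).trans ((Equiv.sumAssoc _ _ _).trans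
      (Equiv.sumCongr (Equiv.refl R) ((Equiv.sumCongr (Equiv.refl _)
        (Equiv.ofUnique _ _)).trans finSumFinEquiv)))
  have hσ0 : σ none = .inr (Fin.last p) := by
    simp [σ]; rfl
  have hσ1 : ∀ r, σ (some (.inl r)) = .inl r := fun r => by simp [σ]
  have hσ2 : ∀ i, σ (some (.inr i)) = .inr i.castSucc := fun i => by simp [σ]; rfl
  rw [← absDet_reindex σ, absDet_of_column]
  · simp only [Function.comp, hσ0, Sum.elim_inr, Fin.val_last, if_true]
    rw [if_neg (by omega), hV]
    simp only [Pi.zero_apply, sub_zero, abs_one, one_mul]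
    congr 1
    ext r j
    rcases r with r | i
    · simp [hσ1]
    · have := i.isLt
      simp [hσ2, this.ne]
      rw [if_neg (by omega)]
  · rintro (r | i)
    · simp [hσ1, hq]
    · have := i.isLt
      simp [hσ2, this.ne, hV]
      rw [if_neg (by omega)]; simp [hV]

end AbsDet

theorem abs_vdm_eq_absDet {N : ℕ} (x : Fin N → ℝ) : |vdm x| = absDet fun i j => x i ^ j := by
  rw [absDet_eq (Equiv.refl _), vdm_eq_det]; rfl

theorem abs_vdm_merge {m p K : ℕ} (e : Fin m ⊕ Fin p ≃ Fin K) (y : Fin m → ℝ) (x : Fin p → ℝ) :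
    |vdm (merge e y x)| = absDet (Sum.elim (fun i j => y i ^ j) fun i j => x i ^ j) := by
  rw [abs_vdm_eq_absDet, ← absDet_reindex e]
  congr 1
  ext r j
  rcases r with r | r <;> simp

/-! ### Densities of the decimated ensembles -/

theorem measurable_unnormalized_density {N : ℕ} {w : ℝ → ℝ} (hw : Measurable w) (β : ℕ) :
    Measurable fun x : Fin N → ℝ =>
      ENNReal.ofReal ((∏ i, w (x i)) * |vdm x| ^ β) := by
  have := measurable_vdm (N := N)
  fun_prop

theorem unnormalized_eq (β N : ℕ) (w : ℝ → ℝ) :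
    unnormalized β N w = volume.withDensity fun x : Fin N → ℝ =>
      ENNReal.ofReal ((∏ i, w (x i)) * |vdm x| ^ β) := rfl

theorem prod_comp_perm {N : ℕ} (w : ℝ → ℝ) (x : Fin N → ℝ) (σ : Equiv.Perm (Fin N)) :
    ∏ i, w ((x ∘ σ) i) = ∏ i, w (x i) := Equiv.prod_comp σ fun i => w (x i)

/-- The law of the ordered points of an ensemble. -/
theorem map_kthLargest_unnormalized {N : ℕ} {w : ℝ → ℝ} (hw : Measurable w) (β : ℕ) :
    (unnormalized β N w).map (fun x k => kthLargest x k) =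
      volume.withDensity ({y | StrictAnti y}.indicator fun y : Fin N → ℝ =>
        N.factorial * ENNReal.ofReal ((∏ i, w (y i)) * |vdm y| ^ β)) := by
  rw [unnormalized_eq, map_kthLargest_withDensity (measurable_unnormalized_density hw β)]
  congr 2
  ext y
  simp only [prod_comp_perm, abs_vdm_comp_perm, sum_const, card_univ, Fintype.card_perm,
    Fintype.card_fin, nsmul_eq_mul]

/-- The law of the superposition of two orthogonal ensembles. -/
theorem superpose_unnormalized {M N : ℕ} {f : ℝ → ℝ} (hf : Measurable f) (hf0 : ∀ x, 0 ≤ f x) :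
    superpose (unnormalized 1 M f) (unnormalized 1 N f) =
      volume.withDensity fun z : Fin (M + N) → ℝ => ENNReal.ofReal ((∏ i, f (z i)) *
        (|vdm fun i => z (Fin.castAdd N i)| * |vdm fun j => z (Fin.natAdd M j)|)) := by
  have happ : ∀ q : (Fin M → ℝ) × (Fin N → ℝ), Fin.append q.1 q.2 = merge finSumFinEquiv q.1 q.2 := by
    intro q
    ext k
    refine Fin.addCases (fun i => ?_) (fun i => ?_) k <;> simp [merge]
  have hmp := measurePreserving_merge (finSumFinEquiv (m := M) (n := N))
  have hmeas : Measurable fun z : Fin (M + N) → ℝ => ENNReal.ofReal ((∏ i, f (z i)) *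
        (|vdm fun i => z (Fin.castAdd N i)| * |vdm fun j => z (Fin.natAdd M j)|)) := by
    have h1 : Measurable fun z : Fin (M + N) → ℝ => vdm fun i => z (Fin.castAdd N i) :=
      measurable_vdm.comp (by fun_prop)
    have h2 : Measurable fun z : Fin (M + N) → ℝ => vdm fun i => z (Fin.natAdd M i) :=
      measurable_vdm.comp (by fun_prop)
    fun_prop
  rw [superpose, unnormalized_eq, unnormalized_eq, prod_withDensity
    (measurable_unnormalized_density hf 1) (measurable_unnormalized_density hf 1)]
  simp only [happ]
  ext s hs
  rw [Measure.map_apply hmp.measurable hs, withDensity_apply _ (hmp.measurable hs),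
    withDensity_apply _ hs, ← hmp.setLIntegral_comp_preimage hs hmeas]
  congr 1
  ext q
  have h1 : ∀ i, merge finSumFinEquiv q.1 q.2 (Fin.castAdd N i) = q.1 i := fun i =>
    merge_inl finSumFinEquiv q.1 q.2 i
  have h2 : ∀ i, merge finSumFinEquiv q.1 q.2 (Fin.natAdd M i) = q.2 i := fun i =>
    merge_inr finSumFinEquiv q.1 q.2 i
  rw [← ENNReal.ofReal_mul (mul_nonneg (prod_nonneg fun i _ => hf0 _) (by positivity))]
  simp only [Fin.prod_univ_add, h1, h2, pow_one]
  congr 1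
  ring

theorem sum_ofReal_orthogonal {K : ℕ} (f : ℝ → ℝ) (z : Fin K → ℝ) :
    ∑ σ : Equiv.Perm (Fin K), ENNReal.ofReal ((∏ i, f ((z ∘ σ) i)) * |vdm (z ∘ σ)| ^ 1) =
      K.factorial * ENNReal.ofReal ((∏ i, f (z i)) * |vdm z|) := by
  simp only [prod_comp_perm, abs_vdm_comp_perm, sum_const, card_univ, Fintype.card_perm,
    Fintype.card_fin, nsmul_eq_mul, pow_one]

/-- The sum over all orderings of the density of two superposed orthogonal ensembles: the points of
even and of odd rank decouple. -/
theorem sum_ofReal_superposed {M N m p h : ℕ} (hMN : M ≤ N) {e : Fin m ⊕ Fin p ≃ Fin (M + N)}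
    (he : IsAlternating h e) (hh : h ≤ 1) (hmp : (m = M ∧ p = N) ∨ (m = N ∧ p = M))
    {f : ℝ → ℝ} (hf0 : ∀ x, 0 ≤ f x) {z : Fin (M + N) → ℝ} (hz : StrictAnti z) :
    ∑ σ : Equiv.Perm (Fin (M + N)), ENNReal.ofReal ((∏ i, f ((z ∘ σ) i)) *
        (|vdm fun i => (z ∘ σ) (Fin.castAdd N i)| * |vdm fun j => (z ∘ σ) (Fin.natAdd M j)|)) =
      (M.factorial * N.factorial * 2 ^ M : ℕ) * ENNReal.ofReal ((∏ i, f (z i)) *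
        (|vdm fun i => z (e (.inl i))| * |vdm fun i => z (e (.inr i))|)) := by
  have hp : 0 ≤ ∏ i, f (z i) := prod_nonneg fun i _ => hf0 _
  rw [← ENNReal.ofReal_sum_of_nonneg fun σ _ =>
    mul_nonneg (by rw [prod_comp_perm]; exact hp) (by positivity)]
  simp only [prod_comp_perm]
  rw [← mul_sum]
  simp only [Function.comp]
  rw [sum_abs_vdm_mul_abs_vdm hz]
  have hdet : |(splitMatrix z).det| =
      2 ^ M * (|vdm fun i => z (e (.inl i))| * |vdm fun i => z (e (.inr i))|) := by
    have hl : ∀ i, (-1 : ℝ) ^ (e (.inl i) : ℕ) = (-1) ^ h := fun i => by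
      rw [he.1, pow_add, pow_mul]; norm_num
    have hr : ∀ i, (-1 : ℝ) ^ (e (.inr i) : ℕ) = -(-1) ^ h := fun i => by
      rw [he.2]
      interval_cases h
      · simp [pow_succ, pow_mul]
      · simp [pow_mul]
    have hδ : (-1 : ℝ) ^ h * (-1) ^ h = 1 := by rw [← mul_pow]; norm_num
    rcases hmp with ⟨rfl, rfl⟩ | ⟨rfl, rfl⟩
    · exact abs_det_splitMatrix hMN z e _ hδ hl hr
    · rw [abs_det_splitMatrix hMN z ((Equiv.sumComm _ _).trans e) (-(-1) ^ h) (by linarith)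
        (by simpa using hr) (by simpa using hl)]
      simp only [Equiv.trans_apply, Equiv.sumComm_apply, Sum.swap_inl, Sum.swap_inr]
      ring
  rw [hdet, ← ENNReal.ofReal_natCast, ← ENNReal.ofReal_mul (by positivity)]
  congr 1
  push_cast
  ring

theorem prod_merge {m p K : ℕ} (e : Fin m ⊕ Fin p ≃ Fin K) (f : ℝ → ℝ) (y : Fin m → ℝ)
    (x : Fin p → ℝ) : ∏ i, f (merge e y x i) = (∏ i, f (y i)) * ∏ i, f (x i) := by
  rw [← Equiv.prod_comp e, Fintype.prod_sum_type]
  simp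

/-- The law of the kept points of one orthogonal ensemble. -/
theorem map_kept_single {m p K h : ℕ} {e : Fin m ⊕ Fin p ≃ Fin K}
    (he : IsAlternating h e) (hh : h ≤ 1) (h1 : p ≤ m + h) {f : ℝ → ℝ} (hf : Measurable f)
    (hf0 : ∀ x, 0 ≤ f x) :
    ((unnormalized 1 K f).map fun x (i : Fin m) => kthLargest x (e (.inl i))) =
      volume.withDensity ({y | StrictAnti y}.indicator fun y =>
        K.factorial * (ENNReal.ofReal (∏ i, f (y i)) *
          ∫⁻ x in Set.univ.pi fun i : Fin p => gap h y i,
            ENNReal.ofReal ((∏ i, f (x i)) * |vdm (merge e y x)|))) := by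
  rw [unnormalized_eq, map_kept_eq_withDensity_gap he hh h1 (measurable_unnormalized_density hf 1)]
  congr 2
  ext y
  have hm : Measurable fun x : Fin p → ℝ => ENNReal.ofReal ((∏ i, f (x i)) * |vdm (merge e y x)|) := by
    have : Measurable fun x : Fin p → ℝ => vdm (merge e y x) :=
      measurable_vdm.comp ((measurable_merge e).comp (by fun_prop : Measurable fun x => (y, x)))
    fun_prop
  rw [← lintegral_const_mul _ hm, ← lintegral_const_mul _ (hm.const_mul _)]
  refine lintegral_congr fun x => ?_
  have hp : 0 ≤ ∏ i, f (y i) := prod_nonneg fun i _ => hf0 _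
  rw [sum_ofReal_orthogonal, prod_merge, mul_assoc, ENNReal.ofReal_mul hp]

/-- The law of the kept points of two superposed orthogonal ensembles. -/
theorem map_kept_superposed {M N m p h : ℕ} (hMN : M ≤ N) {e : Fin m ⊕ Fin p ≃ Fin (M + N)}
    (he : IsAlternating h e) (hh : h ≤ 1) (h1 : p ≤ m + h)
    (hmp : (m = M ∧ p = N) ∨ (m = N ∧ p = M)) {f : ℝ → ℝ} (hf : Measurable f)
    (hf0 : ∀ x, 0 ≤ f x) :
    ((superpose (unnormalized 1 M f) (unnormalized 1 N f)).map
        fun x (i : Fin m) => kthLargest x (e (.inl i))) =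
      volume.withDensity ({y | StrictAnti y}.indicator fun y =>
        (M.factorial * N.factorial * 2 ^ M : ℕ) * (ENNReal.ofReal ((∏ i, f (y i)) * |vdm y|) *
          ∫⁻ x in Set.univ.pi fun i : Fin p => gap h y i,
            ENNReal.ofReal ((∏ i, f (x i)) * |vdm x|))) := by
  have hmeas : Measurable fun z : Fin (M + N) → ℝ => ENNReal.ofReal ((∏ i, f (z i)) *
        (|vdm fun i => z (Fin.castAdd N i)| * |vdm fun j => z (Fin.natAdd M j)|)) := by
    have h1 : Measurable fun z : Fin (M + N) → ℝ => vdm fun i => z (Fin.castAdd N i) :=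
      measurable_vdm.comp (by fun_prop)
    have h2 : Measurable fun z : Fin (M + N) → ℝ => vdm fun i => z (Fin.natAdd M i) :=
      measurable_vdm.comp (by fun_prop)
    fun_prop
  rw [superpose_unnormalized hf hf0, map_kept_eq_withDensity_gap he hh h1 hmeas]
  congr 1
  refine Set.indicator_congr fun y hy => ?_
  have hm : Measurable fun x : Fin p → ℝ => ENNReal.ofReal ((∏ i, f (x i)) * |vdm x|) := by
    have := measurable_vdm (N := p)
    fun_prop
  rw [← lintegral_const_mul _ hm, ← lintegral_const_mul _ (hm.const_mul _)]
  refine setLIntegral_congr_fun (MeasurableSet.univ_pi fun i : Fin p => measurableSet_gap h y i)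
    fun x hx => ?_
  have hz : StrictAnti (merge e y x) :=
    (strictAnti_merge_iff he hh h1 y x).2 ⟨hy, by simpa using hx⟩
  have hp : 0 ≤ ∏ i, f (y i) := prod_nonneg fun i _ => hf0 _
  rw [sum_ofReal_superposed hMN he hh hmp hf0 hz, prod_merge,
    ← ENNReal.ofReal_mul (mul_nonneg hp (abs_nonneg _))]
  simp only [merge_inl, merge_inr]
  congr 2
  ring

/-! ### Integrating out the points in the gaps -/

section GapIntegral

variable {m p : ℕ}

theorem integral_det_rows {κ : Type*} [Fintype κ] [DecidableEq κ] (s : Fin p → Set ℝ)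
    (c : κ ⊕ Fin p → ℕ) (r : κ → ℕ → ℝ) (φ : ℕ → ℝ → ℝ)
    (hφ : ∀ i a, IntegrableOn (φ (c a)) (s i)) :
    Integrable (fun x : Fin p → ℝ => (of fun (k a : κ ⊕ Fin p) =>
        Sum.elim (fun q => r q (c a)) (fun i => φ (c a) (x i)) k).det)
        (volume.restrict (Set.univ.pi s)) ∧
    ∫ x in Set.univ.pi s, (of fun (k a : κ ⊕ Fin p) =>
        Sum.elim (fun q => r q (c a)) (fun i => φ (c a) (x i)) k).det =
      (of fun (k a : κ ⊕ Fin p) =>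
        Sum.elim (fun q => r q (c a)) (fun i => ∫ t in s i, φ (c a) t) k).det := by
  have hvol : (volume : Measure (Fin p → ℝ)).restrict (Set.univ.pi s) =
      Measure.pi fun i => volume.restrict (s i) := by
    rw [volume_pi, Measure.restrict_pi_pi]
  rw [hvol]
  simp only [← det_transpose (of _), det_apply', transpose_apply, of_apply, Fintype.prod_sum_type,
    Sum.elim_inl, Sum.elim_inr]
  have hint : ∀ σ : Equiv.Perm (κ ⊕ Fin p), Integrable
      (fun x : Fin p → ℝ => ∏ i, φ (c (σ (.inr i))) (x i))
      (Measure.pi fun i => volume.restrict (s i)) := fun σ =>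
    Integrable.fintype_prod fun i => hφ i _
  constructor
  · exact integrable_finsetSum _ fun σ _ => ((hint σ).const_mul _).const_mul _
  · rw [integral_finsetSum _ fun σ _ => ((hint σ).const_mul _).const_mul _]
    refine sum_congr rfl fun σ _ => ?_
    rw [integral_const_mul, integral_const_mul,
      integral_fintype_prod_eq_prod (fun i t => φ (c (σ (.inr i))) t)]

/-- Integrating the weighted determinant over the gaps integrates its rows. The hypothesis `hs`
says that the determinant does not change sign on the domain of integration. -/
theorem lintegral_absDet_rows {κ : Type*} [Fintype κ] [DecidableEq κ] (s : Fin p → Set ℝ)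
    (hsm : ∀ i, MeasurableSet (s i)) (r : κ → ℕ → ℝ) {f : ℝ → ℝ} (hf0 : ∀ x, 0 ≤ f x)
    (hφ : ∀ j < Fintype.card κ + p, Integrable fun t => f t * t ^ j)
    (e : κ ⊕ Fin p ≃ Fin (Fintype.card κ + p)) (S : ℝ) (hS : |S| = 1)
    (hs : ∀ x ∈ Set.univ.pi s, absDet (Sum.elim r fun i j => x i ^ j) =
      S * (of fun (k a : κ ⊕ Fin p) => Sum.elim r (fun i j => x i ^ j) k (e a)).det) :
    ∫⁻ x in Set.univ.pi s, ENNReal.ofReal ((∏ i, f (x i)) * absDet (Sum.elim r fun i j => x i ^ j)) =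
      ENNReal.ofReal (absDet (Sum.elim r fun i j => ∫ t in s i, f t * t ^ j)) := by
  obtain ⟨hI, hE⟩ := integral_det_rows s (fun a => (e a : ℕ)) r (fun j t => f t * t ^ j)
    fun i a => (hφ _ (e a).isLt).integrableOn
  have hrow : ∀ x : Fin p → ℝ, (∏ i, f (x i)) *
      (of fun (k a : κ ⊕ Fin p) => Sum.elim r (fun i j => x i ^ j) k (e a)).det =
      (of fun (k a : κ ⊕ Fin p) =>
        Sum.elim (fun q => r q (e a)) (fun i => f (x i) * x i ^ (e a : ℕ)) k).det := by
    intro x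
    have := det_mul_column (Sum.elim (fun _ : κ => 1) fun i => f (x i))
      (of fun (k a : κ ⊕ Fin p) => Sum.elim r (fun i j => x i ^ j) k (e a))
    rw [Fintype.prod_sum_type] at this
    simp only [Sum.elim_inl, Sum.elim_inr, prod_const_one, one_mul] at this
    rw [← this]
    congr 1
    ext k a
    rcases k with k | k <;> simp
  have hms : MeasurableSet (Set.univ.pi s) := MeasurableSet.univ_pi hsm
  have h1 : ∀ x ∈ Set.univ.pi s, (∏ i, f (x i)) * absDet (Sum.elim r fun i j => x i ^ j) =
      S * (of fun (k a : κ ⊕ Fin p) =>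
        Sum.elim (fun q => r q (e a)) (fun i => f (x i) * x i ^ (e a : ℕ)) k).det := by
    intro x hx
    rw [hs x hx, ← hrow]; ring
  have h2 : ∀ x ∈ Set.univ.pi s, 0 ≤ S * (of fun (k a : κ ⊕ Fin p) =>
        Sum.elim (fun q => r q (e a)) (fun i => f (x i) * x i ^ (e a : ℕ)) k).det := by
    intro x hx
    rw [← h1 x hx]
    exact mul_nonneg (prod_nonneg fun i _ => hf0 _) (absDet_nonneg _)
  rw [setLIntegral_congr_fun hms fun x hx => by rw [h1 x hx],
    ← ofReal_integral_eq_lintegral_ofReal (hI.const_mul S)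
      ((ae_restrict_iff' hms).2 (Filter.Eventually.of_forall h2)), integral_const_mul, hE]
  congr 1
  have h3 := setIntegral_nonneg (μ := volume) hms h2
  rw [integral_const_mul, hE] at h3
  rw [← abs_of_nonneg h3, abs_mul, hS, one_mul, absDet_eq e]
  congr 3
  ext k a
  rcases k with k | k <;> simp

/-- The integral over the gaps of the Vandermonde product of all points. -/
theorem lintegral_gap_single {K h : ℕ} {e : Fin m ⊕ Fin p ≃ Fin K} (he : IsAlternating h e)
    (hh : h ≤ 1) (h1 : p ≤ m + h) {f : ℝ → ℝ} (hf0 : ∀ x, 0 ≤ f x)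
    (hφ : ∀ j < m + p, Integrable fun t => f t * t ^ j) {y : Fin m → ℝ} (hy : StrictAnti y) :
    ∫⁻ x in Set.univ.pi fun i : Fin p => gap h y i,
        ENNReal.ofReal ((∏ i, f (x i)) * |vdm (merge e y x)|) =
      ENNReal.ofReal (absDet (Sum.elim (fun i j => y i ^ j)
        fun (i : Fin p) j => ∫ t in gap h y i, f t * t ^ j)) := by
  have hK : K = m + p := by simpa using (Fintype.card_congr e).symm
  subst hK
  simp only [abs_vdm_merge]
  let e' : Fin m ⊕ Fin p ≃ Fin (Fintype.card (Fin m) + p) :=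
    e.trans (finCongr (by simp))
  -- On the gaps the whole configuration is decreasing, so the determinant has the sign of the
  -- product of `-1` over all pairs.
  refine lintegral_absDet_rows (fun i : Fin p => gap h y i) (fun i => measurableSet_gap h y i) _
    hf0 (by simpa using hφ) e' (∏ i : Fin (m + p), ∏ _j ∈ Finset.Ioi i, (-1 : ℝ)) ?_ ?_
  · simp [abs_prod]
  · intro x hx
    rw [← abs_vdm_merge e, abs_vdm_of_strictAnti ((strictAnti_merge_iff he hh h1 y x).2
      ⟨hy, by simpa using hx⟩), vdm_eq_det]
    congr 1
    rw [← det_submatrix_equiv_self e]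
    congr 1
    ext k a
    rcases k with k | k <;> simp [vandermonde_apply, e']

/-- The integral over the gaps of the Vandermonde product of the integrated points. -/
theorem lintegral_gap_superposed {h : ℕ} (hh : h ≤ 1) (h1 : p ≤ m + h) (h2 : m + h ≤ p + 1)
    {f : ℝ → ℝ} (hf0 : ∀ x, 0 ≤ f x) (hφ : ∀ j < p, Integrable fun t => f t * t ^ j)
    {y : Fin m → ℝ} (hy : StrictAnti y) :
    ∫⁻ x in Set.univ.pi fun i : Fin p => gap h y i, ENNReal.ofReal ((∏ i, f (x i)) * |vdm x|) =
      ENNReal.ofReal (absDet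
        fun (i : Fin p) j => ∫ t in gap h y i, f t * t ^ j) := by
  obtain ⟨e, he⟩ := exists_isAlternating hh rfl h2 h1
  let σ : Fin 0 ⊕ Fin p ≃ Fin p := Equiv.emptySum _ _
  have hσ : ∀ i, σ (.inr i) = i := fun i => by simp [σ]
  have hre : ∀ v : Fin p → ℕ → ℝ, absDet v = absDet (Sum.elim (fun (_ : Fin 0) (_ : ℕ) => (0 : ℝ)) v) := by
    intro v
    rw [← absDet_reindex σ]
    congr 1
    ext k j
    rcases k with k | k
    · exact k.elim0
    · simp [hσ]
  simp only [abs_vdm_eq_absDet, hre]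
  -- Points in consecutive gaps are decreasing, which fixes the sign of their determinant.
  refine lintegral_absDet_rows (fun i : Fin p => gap h y i) (fun i => measurableSet_gap h y i) _
    hf0 (by simpa using hφ) (σ.trans (finCongr (by simp)))
    (∏ i : Fin p, ∏ _j ∈ Finset.Ioi i, (-1 : ℝ)) ?_ ?_
  · simp [abs_prod]
  · intro x hx
    have hxa : StrictAnti x := by
      have hz := (strictAnti_merge_iff he hh h1 y x).2 ⟨hy, by simpa using hx⟩
      intro i j hij
      have : e (.inr i) < e (.inr j) := by
        rw [Fin.lt_def, he.2, he.2]; have : (i : ℕ) < j := hij; omega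
      simpa using hz this
    rw [← hre, ← abs_vdm_eq_absDet, abs_vdm_of_strictAnti hxa, vdm_eq_det]
    congr 1
    rw [← det_submatrix_equiv_self σ]
    congr 1
    ext k a
    rcases k with k | k
    · exact k.elim0
    · simp [vandermonde_apply, hσ]

end GapIntegral

/-! ### Evaluation of the gap determinants for Pearson weights -/

section Evaluation

variable {m p h : ℕ}

/-- The half line below the `i`-th end point; it is empty from `i = m + h` on, and for `h = 1` it is
the whole line for `i = 0`. -/
def belowGap (h : ℕ) (y : Fin m → ℝ) (i : ℕ) : Set ℝ :=
  {t | i < m + h ∧ ∀ j : Fin m, (j : ℕ) + h ≤ i → t < y j}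

theorem measurableSet_belowGap (h : ℕ) (y : Fin m → ℝ) (i : ℕ) :
    MeasurableSet (belowGap h y i) := by
  have : belowGap h y i = {_t | i < m + h} ∩ ⋂ j : Fin m, {t | (j : ℕ) + h ≤ i → t < y j} := by
    ext t; simp [belowGap]
  rw [this]
  refine MeasurableSet.inter (by simp) (MeasurableSet.iInter fun j => ?_)
  by_cases hj : (j : ℕ) + h ≤ i
  · simp only [hj, forall_const]; exact measurableSet_Iio
  · simp [hj]

theorem belowGap_zero (y : Fin m → ℝ) : belowGap 1 y 0 = Set.univ := by
  ext t; simp [belowGap]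

theorem belowGap_of_le (y : Fin m → ℝ) {i : ℕ} (hi : m + h ≤ i) : belowGap h y i = ∅ := by
  ext t; simp [belowGap, hi]

theorem belowGap_add {y : Fin m → ℝ} (hy : StrictAnti y) (i : Fin m) :
    belowGap h y (i + h) = Set.Iio (y i) := by
  ext t
  simp only [belowGap, Set.mem_ofPred_eq, Set.mem_Iio]
  constructor
  · intro ht; exact ht.2 i le_rfl
  · intro ht
    refine ⟨by have := i.isLt; omega, fun j hj => lt_of_lt_of_le ht (hy.antitone ?_)⟩
    rw [Fin.le_def]; omega

theorem belowGap_succ_subset (y : Fin m → ℝ) (i : ℕ) : belowGap h y (i + 1) ⊆ belowGap h y i :=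
  fun _ ht => ⟨by have := ht.1; omega, fun j hj => ht.2 j (by omega)⟩

theorem setIntegral_gap (hh : h ≤ 1) {y : Fin m → ℝ} (hy : StrictAnti y) {i : ℕ} (hi : i < m + h)
    {φ : ℝ → ℝ} (hφ : Integrable φ) :
    ∫ t in gap h y i, φ t = (∫ t in belowGap h y i, φ t) - ∫ t in belowGap h y (i + 1), φ t := by
  rw [← setIntegral_sdiff (measurableSet_belowGap h y (i + 1)) hφ.integrableOn
    (belowGap_succ_subset y i)]
  refine setIntegral_congr_set ?_
  -- The two sides differ at kept points only.
  have hnull : ∀ᵐ t : ℝ, t ∉ Set.range y :=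
    (Set.countable_range y).ae_notMem volume
  filter_upwards [hnull] with t ht
  refine propext ⟨fun hg => ⟨⟨hi, fun j hj => (hg j).1 hj⟩, fun hb => ?_⟩, fun hb => ?_⟩
  · have hk : i + 1 - h < m := by have := hb.1; omega
    exact lt_asymm ((hg ⟨i + 1 - h, hk⟩).2 (by simp; omega))
      (hb.2 ⟨i + 1 - h, hk⟩ (by simp; omega))
  · intro j
    refine ⟨hb.1.2 j, fun hj => ?_⟩
    by_contra hlt
    refine hb.2 ⟨by have := j.isLt; omega, fun j' hj' => ?_⟩
    have h1 : j' ≤ j := by rw [Fin.le_def]; omega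
    have h2 : t ≠ y j := fun h' => ht ⟨j, h'.symm⟩
    exact (lt_of_le_of_ne (not_lt.1 hlt) h2).trans_le (hy.antitone h1)

/-- Coefficients `q = q₀ + q₁ t + q₂ t²` and `r = r₀ + r₁ t` of a Pearson equation
`(q f)' = r f`. -/
structure PearsonCoeff where
  /-- The constant coefficient of `q`. -/
  q₀ : ℝ
  /-- The linear coefficient of `q`. -/
  q₁ : ℝ
  /-- The quadratic coefficient of `q`. -/
  q₂ : ℝ
  /-- The constant coefficient of `r`. -/
  r₀ : ℝ
  /-- The linear coefficient of `r`. -/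
  r₁ : ℝ

namespace PearsonCoeff

variable (P : PearsonCoeff)

/-- The polynomial `q`. -/
def q (t : ℝ) : ℝ := P.q₀ + P.q₁ * t + P.q₂ * t ^ 2

/-- The polynomial `r`. -/
def r (t : ℝ) : ℝ := P.r₀ + P.r₁ * t

/-- The coefficient of `t ^ k` in the polynomial `L_j = j t ^ (j - 1) q + t ^ j r`, for which
`(q f t ^ j)' = f L_j`. -/
def coeff (k j : ℕ) : ℝ :=
  (if k + 1 = j then j * P.q₀ else 0) + (if k = j then j * P.q₁ + P.r₀ else 0) +
    if k = j + 1 then j * P.q₂ + P.r₁ else 0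

/-- The linear functional taking the values `g k` at the monomials `t ^ k`, evaluated at `L_j`. -/
def lift (g : ℕ → ℝ) (j : ℕ) : ℝ :=
  j * P.q₀ * g (j - 1) + (j * P.q₁ + P.r₀) * g j + (j * P.q₂ + P.r₁) * g (j + 1)

theorem sum_mul_coeff (g : ℕ → ℝ) {j K : ℕ} (hj : j < K) (hK : j + 1 < K ∨ j * P.q₂ + P.r₁ = 0) :
    ∑ k ∈ range K, g k * P.coeff k j = P.lift g j := by
  simp only [coeff, mul_add, sum_add_distrib, mul_ite, mul_zero, lift]
  congr 1
  · congr 1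
    · rcases j with _ | j
      · simp
      · simp only [add_left_inj, add_tsub_cancel_right]
        rw [sum_ite_eq' (range K), if_pos (by simp; omega)]
        ring
    · rw [sum_ite_eq' (range K), if_pos (by simpa using hj)]
      ring
  · rw [sum_ite_eq' (range K)]
    rcases hK with hK | hK
    · rw [if_pos (by simpa using hK)]; ring
    · rw [← mul_add, hK]; simp

theorem lift_pow (a : ℝ) (j : ℕ) :
    P.lift (fun k => a ^ k) j = P.q a * (j * a ^ (j - 1)) + P.r a * a ^ j := by
  rcases j with _ | j
  · simp [lift, q, r]
  · simp only [lift, q, r, add_tsub_cancel_right]; push_cast; ring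

end PearsonCoeff

variable (P : PearsonCoeff) {κ : Type*} [Fintype κ] [DecidableEq κ]

/-- Both extreme points integrated: here `L_j` has degree `j + 1`, and `1` completes the `L_j` to a
basis of the polynomials. -/
theorem absDet_gap_both {f : ℝ → ℝ} (a : κ → ℝ) {y : Fin m → ℝ} (hy : StrictAnti y)
    (hint : ∀ j ≤ Fintype.card κ + m, Integrable fun t => f t * t ^ j)
    (htot : ∀ j < Fintype.card κ + m, P.lift (fun k => ∫ t, f t * t ^ k) j = 0)
    (hbel : ∀ j < Fintype.card κ + m, ∀ i,
      P.lift (fun k => ∫ t in Set.Iio (y i), f t * t ^ k) j = P.q (y i) * f (y i) * y i ^ j) :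
    (∏ j ∈ range (Fintype.card κ + m), |j * P.q₂ + P.r₁|) *
      absDet (Sum.elim (fun c j => a c ^ j)
        fun (i : Fin (m + 1)) j => ∫ t in gap 1 y i, f t * t ^ j) =
    |∫ t, f t| * absDet (Sum.elim (fun c => P.lift fun k => a c ^ k)
        fun (i : Fin m) j => P.q (y i) * f (y i) * y i ^ j) := by
  have hcard : Fintype.card (κ ⊕ Fin (m + 1)) = Fintype.card κ + m + 1 := by simp; ring
  -- The gaps are differences of consecutive half-lines below the kept points.
  have h1 : absDet (Sum.elim (fun c j => a c ^ j)
        fun (i : Fin (m + 1)) j => ∫ t in gap 1 y i, f t * t ^ j) =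
      absDet (Sum.elim (fun c j => a c ^ j)
        fun (i : Fin (m + 1)) j => ∫ t in belowGap 1 y i, f t * t ^ j) := by
    rw [← absDet_sub_succ (p := m + 1) _ (fun i j => ∫ t in belowGap 1 y i, f t * t ^ j)]
    · refine absDet_congr fun k j hj => ?_
      rw [hcard] at hj
      rcases k with k | i
      · rfl
      · exact setIntegral_gap le_rfl hy i.isLt (hint j (by omega))
    · ext j; rw [belowGap_of_le y le_rfl]; simp
  -- The columns are expressed in the basis `1, L_0, L_1, …` of the polynomials.
  set C : ℕ → ℕ → ℝ := fun k j => if j = 0 then (if k = 0 then 1 else 0) else P.coeff k (j - 1)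
    with hC
  have hC' : ∀ k j, j < k → C k j = 0 := by
    intro k j hjk
    rcases j with _ | j
    · simp [hC]; omega
    · simp only [hC, PearsonCoeff.coeff]
      simp only [add_tsub_cancel_right, Nat.succ_ne_zero, if_false]
      rw [if_neg (by omega), if_neg (by omega), if_neg (by omega)]; simp
  have hsum : ∀ (g : ℕ → ℝ) j, j < Fintype.card κ + m + 1 →
      ∑ k ∈ range (Fintype.card κ + m + 1), g k * C k j =
        if j = 0 then g 0 else P.lift g (j - 1) := by
    intro g j hj
    rcases j with _ | j
    · simp [hC]
    · simp only [hC, add_tsub_cancel_right, Nat.succ_ne_zero, if_false]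
      exact P.sum_mul_coeff g (by omega) (Or.inl (by omega))
  have h2 := absDet_mul_triangular (Sum.elim (fun c j => a c ^ j)
        fun (i : Fin (m + 1)) j => ∫ t in belowGap 1 y i, f t * t ^ j) C hC'
  rw [hcard] at h2
  have hdiag : ∏ j ∈ range (Fintype.card κ + m + 1), |C j j| =
      ∏ j ∈ range (Fintype.card κ + m), |j * P.q₂ + P.r₁| := by
    have h0 : ∀ j : ℕ, j + 1 + 1 ≠ j := fun j => by omega
    rw [prod_range_succ']
    simp [hC, PearsonCoeff.coeff, h0]
  rw [h1, ← hdiag, ← h2]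
  let σ : Option (κ ⊕ Fin m) ≃ κ ⊕ Fin (m + 1) :=
    (Equiv.optionEquivSumPUnit.{0} _).trans ((Equiv.sumAssoc _ _ _).trans
      (Equiv.sumCongr (Equiv.refl κ) ((Equiv.optionEquivSumPUnit.{0} _).symm.trans
        (finSuccEquiv m).symm)))
  have hσ0 : σ none = .inr 0 := by simp [σ]
  have hσ1 : ∀ k, σ (some (.inl k)) = .inl k := fun k => by simp [σ]
  have hσ2 : ∀ i, σ (some (.inr i)) = .inr i.succ := fun i => by simp [σ]
  rw [← absDet_reindex σ]
  -- In this basis the row of integrals over the whole line vanishes except in the first column, and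
  -- the integrals of `f L_j` over half-lines are boundary terms.
  have h3 : absDet ((fun k j => ∑ k_1 ∈ range (Fintype.card κ + m + 1),
      Sum.elim (fun c j => a c ^ j) (fun (i : Fin (m + 1)) j => ∫ t in belowGap 1 y i, f t * t ^ j)
        k k_1 * C k_1 j) ∘ σ) =
      absDet (fun (k : Option (κ ⊕ Fin m)) j => if j = 0 then (k.elim (∫ t, f t) (Sum.elim
          (fun _ => 1) fun i => ∫ t in Set.Iio (y i), f t)) else
        k.elim 0 (Sum.elim (fun c => P.lift (fun k => a c ^ k) (j - 1))
          fun i => P.q (y i) * f (y i) * y i ^ (j - 1))) := by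
    refine absDet_congr fun k j hj => ?_
    have hj' : j < Fintype.card κ + m + 1 := by simpa [add_assoc] using hj
    rcases k with _ | k | i
    · simp only [Function.comp, hσ0, Sum.elim_inr, hsum _ j hj', Fin.val_zero, belowGap_zero,
        Measure.restrict_univ, Option.elim]
      rcases j with _ | j
      · simp
      · simp only [Nat.succ_ne_zero, if_false, add_tsub_cancel_right]
        exact htot j (by omega)
    · simp [Function.comp, hσ1, hsum _ j hj']
    · simp only [Function.comp, hσ2, Sum.elim_inr, hsum _ j hj', Option.elim, Fin.val_succ,
        belowGap_add hy]
      rcases j with _ | j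
      · simp
      · simp only [Nat.succ_ne_zero, if_false, add_tsub_cancel_right]
        exact hbel j (by omega) i
  rw [h3, absDet_of_row]
  · simp only [if_true, Option.elim, Nat.succ_ne_zero, if_false, add_tsub_cancel_right]
    congr 2
    ext k j
    rcases k with k | k <;> rfl
  · intro j hj
    rw [if_neg (by omega)]; rfl

/-- One extreme point integrated: here `L_j` has degree `j`. -/
theorem absDet_mul_triangular_lift (hq : P.q₂ = 0) (hr : P.r₁ = 0) {R : Type*} [Fintype R]
    [DecidableEq R] (v : R → ℕ → ℝ) :
    absDet (fun r => P.lift (v r)) =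
      (∏ j ∈ range (Fintype.card R), |j * P.q₁ + P.r₀|) * absDet v := by
  have hC' : ∀ k j, j < k → P.coeff k j = 0 := by
    intro k j hjk
    simp only [PearsonCoeff.coeff, hq, hr]
    rw [if_neg (by omega), if_neg (by omega)]; simp
  have h2 := absDet_mul_triangular v P.coeff hC'
  have hdiag : ∀ j, P.coeff j j = j * P.q₁ + P.r₀ := fun j => by simp [PearsonCoeff.coeff]
  simp only [hdiag] at h2
  rw [← h2]
  exact absDet_congr fun k j hj => (P.sum_mul_coeff _ hj (Or.inr (by simp [hq, hr]))).symm

/-- Only the lower extreme point integrated: the gaps are differences of half-lines extending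
downwards, over which `f L_j = (q f t ^ j)'` integrates to its value at the upper end. -/
theorem absDet_gap_lower (hq : P.q₂ = 0) (hr : P.r₁ = 0) {f : ℝ → ℝ} (a : κ → ℝ) {y : Fin m → ℝ}
    (hy : StrictAnti y) (hint : ∀ j < Fintype.card κ + m, Integrable fun t => f t * t ^ j)
    (hbel : ∀ j < Fintype.card κ + m, ∀ i,
      P.lift (fun k => ∫ t in Set.Iio (y i), f t * t ^ k) j = P.q (y i) * f (y i) * y i ^ j) :
    (∏ j ∈ range (Fintype.card κ + m), |j * P.q₁ + P.r₀|) *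
      absDet (Sum.elim (fun c j => a c ^ j)
        fun (i : Fin m) j => ∫ t in gap 0 y i, f t * t ^ j) =
    absDet (Sum.elim (fun c => P.lift fun k => a c ^ k)
        fun (i : Fin m) j => P.q (y i) * f (y i) * y i ^ j) := by
  have hcard : Fintype.card (κ ⊕ Fin m) = Fintype.card κ + m := by simp
  have h1 : absDet (Sum.elim (fun c j => a c ^ j)
        fun (i : Fin m) j => ∫ t in gap 0 y i, f t * t ^ j) =
      absDet (Sum.elim (fun c j => a c ^ j)
        fun (i : Fin m) j => ∫ t in Set.Iio (y i), f t * t ^ j) := by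
    have := absDet_sub_succ (p := m) (fun c j => a c ^ j)
      (fun i j => ∫ t in belowGap 0 y i, f t * t ^ j)
      (by ext j; rw [belowGap_of_le (h := 0) y (i := m) le_rfl]; simp)
    have hb : ∀ i : Fin m, belowGap 0 y i = Set.Iio (y i) := fun i => belowGap_add (h := 0) hy i
    simp only [hb] at this
    rw [← this]
    refine absDet_congr fun k j hj => ?_
    rw [hcard] at hj
    rcases k with k | i
    · rfl
    · have := setIntegral_gap (Nat.zero_le 1) hy i.isLt (hint j hj)
      rw [hb] at this; exact this
  rw [h1, ← hcard, ← absDet_mul_triangular_lift P hq hr]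
  refine absDet_congr fun k j hj => ?_
  rcases k with k | i
  · rfl
  · exact hbel j (by simpa using hj) i

/-- Only the upper extreme point integrated: the same computation with half-lines extending
upwards. -/
theorem absDet_gap_upper (hq : P.q₂ = 0) (hr : P.r₁ = 0) {f : ℝ → ℝ} (a : κ → ℝ) {y : Fin m → ℝ}
    (hy : StrictAnti y) (hint : ∀ j < Fintype.card κ + m, Integrable fun t => f t * t ^ j)
    (habv : ∀ j < Fintype.card κ + m, ∀ i,
      P.lift (fun k => ∫ t in Set.Ici (y i), f t * t ^ k) j = -(P.q (y i) * f (y i) * y i ^ j)) :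
    (∏ j ∈ range (Fintype.card κ + m), |j * P.q₁ + P.r₀|) *
      absDet (Sum.elim (fun c j => a c ^ j)
        fun (i : Fin m) j => ∫ t in gap 1 y i, f t * t ^ j) =
    absDet (Sum.elim (fun c => P.lift fun k => a c ^ k)
        fun (i : Fin m) j => P.q (y i) * f (y i) * y i ^ j) := by
  have hcard : Fintype.card (κ ⊕ Fin m) = Fintype.card κ + m := by simp
  have hb : ∀ i : Fin m, (belowGap 1 y (i + 1))ᶜ = Set.Ici (y i) := fun i => by
    rw [belowGap_add hy]; simp
  have h1 : absDet (Sum.elim (fun c j => a c ^ j)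
        fun (i : Fin m) j => ∫ t in gap 1 y i, f t * t ^ j) =
      absDet (Sum.elim (fun c j => a c ^ j)
        fun (i : Fin m) j => ∫ t in Set.Ici (y i), f t * t ^ j) := by
    have := absDet_succ_sub (p := m) (fun c j => a c ^ j)
      (fun i j => ∫ t in (belowGap 1 y i)ᶜ, f t * t ^ j)
      (by ext j; simp [belowGap_zero y])
    simp only [hb] at this
    rw [← this]
    refine absDet_congr fun k j hj => ?_
    rw [hcard] at hj
    rcases k with k | i
    · rfl
    · have hi := hint j hj
      have e1 := setIntegral_gap le_rfl hy (i := i) (by have := i.isLt; omega) hi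
      have e2 := integral_add_compl (measurableSet_belowGap 1 y i) hi
      have e3 := integral_add_compl (measurableSet_belowGap 1 y (i + 1)) hi
      rw [hb] at e3
      simp only [Sum.elim_inr]
      linarith
  rw [h1, ← hcard, ← absDet_mul_triangular_lift P hq hr]
  have hneg : absDet (Sum.elim (fun c => P.lift fun k => a c ^ k)
        fun (i : Fin m) j => P.q (y i) * f (y i) * y i ^ j) =
      absDet (Sum.elim (fun c => P.lift fun k => a c ^ k)
        fun (i : Fin m) j => -(P.q (y i) * f (y i) * y i ^ j)) := by
    have := absDet_mul_row (Sum.elim (fun c => P.lift fun k => a c ^ k)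
        fun (i : Fin m) j => (P.q (y i) * f (y i) * y i ^ j)) (Sum.elim (fun _ => 1) fun _ => -1)
    rw [Fintype.prod_sum_type] at this
    simp only [Sum.elim_inl, Sum.elim_inr, abs_one, prod_const_one, abs_neg, one_mul] at this
    rw [← this]
    congr 1
    ext k j
    rcases k with k | k <;> simp
  rw [hneg]
  refine absDet_congr fun k j hj => ?_
  rcases k with k | i
  · rfl
  · exact habv j (by simpa using hj) i

/-- No extreme point integrated and `f` constant between the extreme points: the determinant is
again a Vandermonde determinant, bordered by a row and a column. -/
theorem absDet_gap_none {f : ℝ → ℝ} {c : ℝ} (hc : 0 < c) (κ : Type*) [Fintype κ] [DecidableEq κ]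
    (a : κ → ℝ) {y : Fin (p + 1) → ℝ} (hy : StrictAnti y)
    (hf : ∀ t, y (Fin.last p) < t → t < y 0 → f t = c) :
    (∏ j ∈ range (Fintype.card κ + p), ((j : ℝ) + 1)) *
      absDet (Sum.elim (fun k j => a k ^ j)
        fun (i : Fin p) j => ∫ t in gap 0 y i, f t * t ^ j) =
    c ^ p * absDet (Sum.elim (fun k j => j * a k ^ (j - 1)) fun (i : Fin (p + 1)) j => y i ^ j) := by
  have hgap : ∀ i : Fin p, gap 0 y i = Set.Ioo (y i.succ) (y i.castSucc) := by
    intro i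
    ext t
    simp only [gap, add_zero, Set.mem_ofPred_eq, Set.mem_Ioo]
    constructor
    · intro ht
      exact ⟨(ht i.succ).2 (by simp), (ht i.castSucc).1 (by simp)⟩
    · rintro ⟨h1, h2⟩ j
      exact ⟨fun hj => h2.trans_le (hy.antitone (by rw [Fin.le_def]; simpa using hj)),
        fun hj => lt_of_le_of_lt (hy.antitone (by rw [Fin.le_def]; simpa using hj)) h1⟩
  have hval : ∀ (i : Fin p) (j : ℕ), ((j : ℝ) + 1) * ∫ t in gap 0 y i, f t * t ^ j =
      c * (y i.castSucc ^ (j + 1) - y i.succ ^ (j + 1)) := by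
    intro i j
    have hlt : y i.succ < y i.castSucc := hy (by simp [Fin.lt_def])
    have : ∫ t in gap 0 y i, f t * t ^ j = ∫ t in gap 0 y i, c * t ^ j := by
      refine setIntegral_congr_fun (measurableSet_gap 0 y i) fun t ht => ?_
      rw [hgap] at ht
      rw [hf t ((hy.antitone (Fin.le_last _)).trans_lt ht.1)
        (ht.2.trans_le (hy.antitone (Fin.zero_le _)))]
    rw [this, hgap, integral_const_mul, ← integral_Ioc_eq_integral_Ioo,
      ← intervalIntegral.integral_of_le hlt.le, integral_pow]
    field_simp
  have h1 := absDet_mul_column (Sum.elim (fun k j => a k ^ j)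
        fun (i : Fin p) j => ∫ t in gap 0 y i, f t * t ^ j) (fun j => (j : ℝ) + 1)
  have hcard : Fintype.card (κ ⊕ Fin p) = Fintype.card κ + p := by simp
  have habs : ∀ j : ℕ, |(j : ℝ) + 1| = (j : ℝ) + 1 := fun j => abs_of_pos (by positivity)
  simp only [hcard, habs] at h1
  rw [← h1]
  -- Integrating `c t ^ j` over a gap gives a multiple of a difference of values of `t ^ (j + 1)`, and
  -- such differences come from a determinant with one more row and a column of ones.
  have h2 := absDet_sub_succ_bordered (p := p) (fun (k : κ) j => (j : ℝ) * a k ^ (j - 1))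
    (fun i j => if hi : i < p + 1 then y ⟨i, hi⟩ ^ j else 1) (by simp)
    (fun i => by split_ifs <;> simp)
  simp only [Fin.is_lt, dite_true, Fin.eta] at h2
  rw [h2]
  have h3 := absDet_mul_row (Sum.elim (fun (k : κ) j => ((j + 1 : ℕ) : ℝ) * a k ^ (j + 1 - 1))
    fun (i : Fin p) j => y i.castSucc ^ (j + 1) - y i.succ ^ (j + 1))
    (Sum.elim (fun _ => 1) fun _ => c)
  rw [Fintype.prod_sum_type] at h3
  simp only [Sum.elim_inl, Sum.elim_inr, abs_one, prod_const_one, one_mul, prod_const, card_univ,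
    Fintype.card_fin, abs_of_pos hc] at h3
  have h4 : (fun (i : Fin p) j => (if hi : (i : ℕ) < p + 1 then y ⟨i, hi⟩ ^ (j + 1) else 1) -
      if hi : (i : ℕ) + 1 < p + 1 then y ⟨i + 1, hi⟩ ^ (j + 1) else 1) =
      fun (i : Fin p) j => y i.castSucc ^ (j + 1) - y i.succ ^ (j + 1) := by
    ext i j
    have := i.isLt
    rw [dif_pos (by omega), dif_pos (by omega)]
    rfl
  rw [h4, ← h3]
  refine absDet_congr fun k j _ => ?_
  rcases k with k | i
  · simp
  · simp [hval]

/-- The rows `q f t ^ j` and the rows `L_j = q (t ^ j)' + r t ^ j` of the same points combine to a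
confluent Vandermonde determinant, the source of the exponent `4`. -/
theorem absDet_lift_confluent (P : PearsonCoeff) (f : ℝ → ℝ) (y : Fin m → ℝ) :
    absDet (Sum.elim (fun (i : Fin m) => P.lift fun k => y i ^ k)
        fun (i : Fin m) j => P.q (y i) * f (y i) * y i ^ j) =
      (∏ i, |P.q (y i)|) * (∏ i, |P.q (y i) * f (y i)|) * |vdm y| ^ 4 := by
  rw [← abs_det_confluent_vandermonde y finSumFinEquiv, absDet_eq finSumFinEquiv]
  have : (of fun k c => Sum.elim (fun (i : Fin m) => P.lift fun k => y i ^ k)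
        (fun (i : Fin m) j => P.q (y i) * f (y i) * y i ^ j) k (finSumFinEquiv c)) =
      fromBlocks (diagonal fun i => P.r (y i)) (diagonal fun i => P.q (y i))
        (diagonal fun i => P.q (y i) * f (y i)) 0 *
      (of fun (k c : Fin m ⊕ Fin m) => k.elim (fun i => y i ^ (finSumFinEquiv c : ℕ))
      fun i => (finSumFinEquiv c : ℕ) * y i ^ ((finSumFinEquiv c : ℕ) - 1)) := by
    ext k c
    rcases k with k | k
    · simp [mul_apply, Fintype.sum_sum_type, diagonal_apply, P.lift_pow]; ring
    · simp [mul_apply, Fintype.sum_sum_type, diagonal_apply]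
  rw [this, det_mul, abs_mul, ← abs_det_submatrix_equiv_equiv (Equiv.refl _) (Equiv.sumComm _ _)
    (fromBlocks _ _ _ _)]
  congr 1
  have h2 : (fromBlocks (diagonal fun i => P.r (y i)) (diagonal fun i => P.q (y i))
        (diagonal fun i => P.q (y i) * f (y i)) 0).submatrix (Equiv.refl _) (Equiv.sumComm _ _) =
      fromBlocks (diagonal fun i => P.q (y i)) (diagonal fun i => P.r (y i)) 0
        (diagonal fun i => P.q (y i) * f (y i)) := by
    ext k c
    rcases k with k | k <;> rcases c with c | c <;> rfl
  rw [h2, det_fromBlocks_zero₂₁, det_diagonal, det_diagonal, abs_mul, abs_prod, abs_prod]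

theorem absDet_node (w : ℝ → ℝ) (y : Fin m → ℝ) (s : Fin 0 → ℕ → ℝ) :
    absDet (Sum.elim s fun (i : Fin m) j => w (y i) * y i ^ j) = (∏ i, |w (y i)|) * |vdm y| := by
  rw [abs_vdm_eq_absDet, ← absDet_mul_row, ← absDet_reindex (Equiv.emptySum (Fin 0) (Fin m))]
  congr 1
  ext k j
  rcases k with k | k
  · exact k.elim0
  · simp

theorem absDet_emptySum (v : Fin p → ℕ → ℝ) (s : Fin 0 → ℕ → ℝ) :
    absDet (Sum.elim s v) = absDet v := by
  rw [← absDet_reindex (Equiv.emptySum (Fin 0) (Fin p))]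
  congr 1
  ext k j
  rcases k with k | k
  · exact k.elim0
  · simp

end Evaluation

/-! ### Normalisation -/

theorem measurable_keptMap {K m : ℕ} (s : Fin m → Fin K) :
    Measurable fun (x : Fin K → ℝ) (i : Fin m) => kthLargest x (s i) :=
  measurable_pi_lambda _ fun i => (measurable_pi_apply (s i)).comp measurable_kthLargest

/-- An identity between images of unnormalised measures passes to the normalised ones, and the
finiteness of the total mass of the second follows from that of the first. -/
theorem normalize_map_eq {α β γ : Type*} [MeasurableSpace α] [MeasurableSpace β]
    [MeasurableSpace γ] {μ : Measure α} {ν : Measure β} {T : α → γ} {S : β → γ} (hT : Measurable T)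
    (hS : Measurable S) {c C : ENNReal}
    (hP : IsProbabilityMeasure (c • μ)) (h : μ.map T = C • ν.map S) :
    IsProbabilityMeasure ((ν Set.univ)⁻¹ • ν) ∧ (c • μ).map T = ((ν Set.univ)⁻¹ • ν).map S := by
  have h1 : (c • μ).map T = (c * C) • ν.map S := by
    rw [Measure.map_smul, h, smul_smul]
  have h2 : c * C * ν Set.univ = 1 := by
    have := congrArg (fun m : Measure γ => m Set.univ) h1
    simp only [Measure.smul_apply, smul_eq_mul] at this
    rw [Measure.map_apply hT MeasurableSet.univ, Measure.map_apply hS MeasurableSet.univ,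
      Set.preimage_univ, Set.preimage_univ, hP.measure_univ] at this
    exact this.symm
  have h3 : (ν Set.univ)⁻¹ = c * C := by
    have := ENNReal.eq_inv_of_mul_eq_one_left h2
    exact this.symm
  refine ⟨⟨?_⟩, ?_⟩
  · rw [Measure.smul_apply, smul_eq_mul, h3, h2]
  · rw [h1, Measure.map_smul, h3]

theorem integrable_prod_mul_vdm {N : ℕ} {f : ℝ → ℝ}
    (hint : ∀ j < N, Integrable fun t => f t * t ^ j) :
    Integrable fun x : Fin N → ℝ => (∏ i, f (x i)) * vdm x := by
  obtain ⟨h, -⟩ := integral_det_rows (κ := Fin 0) (p := N) (fun _ => Set.univ)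
    (fun a => (Equiv.emptySum (Fin 0) (Fin N) a : ℕ)) (fun _ _ => 0) (fun j t => f t * t ^ j)
    fun i a => (hint _ (Fin.isLt _)).integrableOn
  rw [Set.pi_univ, Measure.restrict_univ] at h
  refine h.congr (Filter.Eventually.of_forall fun x => ?_)
  simp only
  rw [vdm_eq_det, ← det_mul_column, ← det_submatrix_equiv_self (Equiv.emptySum (Fin 0) (Fin N))]
  congr 1
  ext k a
  rcases k with k | k
  · exact k.elim0
  · simp [vandermonde_apply]

theorem unnormalized_one_ne_top {N : ℕ} {f : ℝ → ℝ} (hf0 : ∀ x, 0 ≤ f x)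
    (hint : ∀ j < N, Integrable fun t => f t * t ^ j) : unnormalized 1 N f Set.univ ≠ ⊤ := by
  rw [unnormalized_eq, withDensity_apply _ MeasurableSet.univ, Measure.restrict_univ]
  have h := (integrable_prod_mul_vdm hint).abs.lintegral_lt_top
  refine ne_of_lt (lt_of_le_of_lt (le_of_eq (lintegral_congr fun x => ?_)) h)
  rw [pow_one, abs_mul, abs_of_nonneg (prod_nonneg fun i _ => hf0 _)]

theorem unnormalized_pi_ne_zero {β N : ℕ} {w : ℝ → ℝ} (hw : Measurable w) {U : Fin N → Set ℝ}
    (hU : ∀ i, IsOpen (U i)) (hne : ∀ i, (U i).Nonempty) (hpos : ∀ i, ∀ x ∈ U i, 0 < w x) :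
    unnormalized β N w (Set.univ.pi U) ≠ 0 := by
  have hms : MeasurableSet (Set.univ.pi U) := MeasurableSet.univ_pi fun i => (hU i).measurableSet
  rw [unnormalized_eq, withDensity_apply _ hms]
  intro h
  rw [lintegral_eq_zero_iff (measurable_unnormalized_density hw β)] at h
  rw [Filter.EventuallyEq, ae_restrict_iff' hms] at h
  have h0 : volume (Set.univ.pi U) = 0 := by
    refine measure_eq_zero_iff_ae_notMem.2 ?_
    filter_upwards [h, ae_injective N] with x hx hinj hmem
    have := hx hmem
    simp only [Pi.zero_apply, ENNReal.ofReal_eq_zero] at this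
    have h1 : 0 < ∏ i, w (x i) := prod_pos fun i _ => hpos i _ (hmem i (Set.mem_univ i))
    have h2 : 0 < |vdm x| := abs_pos.2 (vdm_ne_zero hinj)
    have := mul_pos h1 (pow_pos h2 β)
    linarith
  exact (isOpen_set_pi Set.finite_univ fun i _ => hU i).measure_ne_zero volume
    (Set.univ_pi_nonempty_iff.2 hne) h0

theorem unnormalized_univ_ne_zero {β N : ℕ} {w : ℝ → ℝ} (hw : Measurable w) {U : Set ℝ}
    (hU : IsOpen U) (hne : U.Nonempty) (hpos : ∀ x ∈ U, 0 < w x) :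
    unnormalized β N w Set.univ ≠ 0 := fun h =>
  unnormalized_pi_ne_zero (β := β) (N := N) hw (U := fun _ => U) (fun _ => hU) (fun _ => hne)
    (fun _ => hpos) (measure_mono_null (Set.subset_univ _) h)

theorem isProbabilityMeasure_ensemble {β N : ℕ} {w : ℝ → ℝ} (h0 : unnormalized β N w Set.univ ≠ 0)
    (h1 : unnormalized β N w Set.univ ≠ ⊤) : IsProbabilityMeasure (ensemble β N w) :=
  ⟨by rw [ensemble, Measure.smul_apply, smul_eq_mul, ENNReal.inv_mul_cancel h0 h1]⟩

theorem mass_of_isProbabilityMeasure_ensemble {β N : ℕ} {w : ℝ → ℝ}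
    (h : IsProbabilityMeasure (ensemble β N w)) :
    unnormalized β N w Set.univ ≠ 0 ∧ unnormalized β N w Set.univ ≠ ⊤ := by
  have := h.measure_univ
  rw [ensemble, Measure.smul_apply, smul_eq_mul] at this
  constructor <;> intro h' <;> simp [h'] at this

theorem sFinite_unnormalized {β N : ℕ} {w : ℝ → ℝ} : SFinite (unnormalized β N w) := by
  rw [unnormalized_eq]; infer_instance

instance sFinite_ensemble {β N : ℕ} {w : ℝ → ℝ} : SFinite (ensemble β N w) := by
  have := @sFinite_unnormalized β N w
  rw [ensemble]; infer_instance

theorem measurable_append {M N : ℕ} :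
    Measurable fun p : (Fin M → ℝ) × (Fin N → ℝ) => Fin.append p.1 p.2 := by
  refine measurable_pi_lambda _ fun k => ?_
  refine Fin.addCases (fun i => ?_) (fun i => ?_) k
  · simp only [Fin.append_left]; fun_prop
  · simp only [Fin.append_right]; fun_prop

theorem superpose_ensemble {M N : ℕ} {β : ℕ} {f : ℝ → ℝ} :
    superpose (ensemble β M f) (ensemble β N f) =
      ((unnormalized β M f Set.univ)⁻¹ * (unnormalized β N f Set.univ)⁻¹) •
        superpose (unnormalized β M f) (unnormalized β N f) := by
  have h1 := @sFinite_unnormalized β M f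
  have h2 := @sFinite_unnormalized β N f
  rw [superpose, ensemble, ensemble, Measure.prod_smul_left, Measure.prod_smul_right, smul_smul,
    Measure.map_smul, superpose]

theorem isProbabilityMeasure_superpose {M N : ℕ} {μ : Measure (Fin M → ℝ)}
    {ν : Measure (Fin N → ℝ)} [IsProbabilityMeasure μ] [IsProbabilityMeasure ν] :
    IsProbabilityMeasure (superpose μ ν) :=
  Measure.isProbabilityMeasure_map measurable_append.aemeasurable

/-! ### From determinants to decimated ensembles -/

/-- If the kept points have, up to a constant, the density of an ensemble on decreasing
configurations, then they form that ensemble; its normalisability is part of the conclusion. -/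
theorem ensemble_of_densities {K m β : ℕ} {s : Fin m → Fin K} {μ : Measure (Fin K → ℝ)}
    {c : ENNReal} (hP : IsProbabilityMeasure (c • μ))
    {w : ℝ → ℝ} (hw : Measurable w) {C : ℝ}
    (h : μ.map (fun x i => kthLargest x (s i)) =
      volume.withDensity ({y | StrictAnti y}.indicator fun y : Fin m → ℝ =>
        ENNReal.ofReal C * ENNReal.ofReal ((∏ i, w (y i)) * |vdm y| ^ β))) :
    IsProbabilityMeasure (ensemble β m w) ∧
      (c • μ).map (fun x i => kthLargest x (s i)) =
        (ensemble β m w).map fun x k => kthLargest x k := by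
  have hCm : ENNReal.ofReal C = ENNReal.ofReal (C / m.factorial) * (m.factorial : ENNReal) := by
    rw [← ENNReal.ofReal_natCast, ← ENNReal.ofReal_mul' (by positivity)]
    congr 1
    field_simp
  refine normalize_map_eq (C := ENNReal.ofReal (C / m.factorial)) (measurable_keptMap s)
    measurable_kthLargest hP ?_
  rw [h, map_kthLargest_unnormalized hw, ← withDensity_smul]
  · congr 1
    ext y
    by_cases hy : StrictAnti y
    · rw [Set.indicator_of_mem (by exact hy), Pi.smul_apply, Set.indicator_of_mem (by exact hy),
        smul_eq_mul, hCm, mul_assoc]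
    · rw [Set.indicator_of_notMem (by exact hy), Pi.smul_apply,
        Set.indicator_of_notMem (by exact hy), smul_zero]
  · exact ((measurable_unnormalized_density hw β).const_mul _).indicator (measurableSet_strictAnti m)

/-- One orthogonal ensemble: the determinantal identity `hdet` between densities implies that the
kept points form a symplectic ensemble. -/
theorem single_of_absDet {m p K h : ℕ} {e : Fin m ⊕ Fin p ≃ Fin K} (he : IsAlternating h e)
    (hh : h ≤ 1) (h1 : p ≤ m + h) {f w : ℝ → ℝ} (hf : Measurable f) (hf0 : ∀ x, 0 ≤ f x)
    (hw : Measurable w) (hint : ∀ j < m + p, Integrable fun t => f t * t ^ j)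
    {U : Set ℝ} (hU : IsOpen U) (hne : U.Nonempty) (hpos : ∀ x ∈ U, 0 < f x) {C : ℝ} (hC : 0 < C)
    (hdet : ∀ y : Fin m → ℝ, StrictAnti y → (∏ i, f (y i)) * absDet (Sum.elim (fun i j => y i ^ j)
      fun (i : Fin p) j => ∫ t in gap h y i, f t * t ^ j) = C * ((∏ i, w (y i)) * |vdm y| ^ 4)) :
    IsProbabilityMeasure (OE K f) ∧ IsProbabilityMeasure (SE m w) ∧
      (OE K f).map (fun x (i : Fin m) => kthLargest x (e (.inl i))) =
        (SE m w).map fun x k => kthLargest x k := by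
  have hK : K = m + p := by simpa using (Fintype.card_congr e).symm
  have hne0 : unnormalized 1 K f Set.univ ≠ 0 := unnormalized_univ_ne_zero hf hU hne hpos
  have hnt : unnormalized 1 K f Set.univ ≠ ⊤ := unnormalized_one_ne_top hf0 (hK ▸ hint)
  have hP : IsProbabilityMeasure (OE K f) := isProbabilityMeasure_ensemble hne0 hnt
  have hp : ∀ y : Fin m → ℝ, 0 ≤ ∏ i, f (y i) := fun y => prod_nonneg fun i _ => hf0 _
  refine ⟨hP, ensemble_of_densities hP hw (C := K.factorial * C) ?_⟩
  rw [map_kept_single he hh h1 hf hf0]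
  congr 1
  refine Set.indicator_congr fun y hy => ?_
  rw [lintegral_gap_single he hh h1 hf0 hint hy, ← ENNReal.ofReal_mul (hp y), hdet y hy,
    ENNReal.ofReal_mul hC.le, ENNReal.ofReal_mul (p := (K.factorial : ℝ)) (Nat.cast_nonneg _),
    ENNReal.ofReal_natCast, mul_assoc]

/-- Two superposed orthogonal ensembles: the determinantal identity `hdet` between densities
implies that the kept points form a unitary ensemble. -/
theorem superposed_of_absDet {M N m p h : ℕ} (hMN : M ≤ N) {e : Fin m ⊕ Fin p ≃ Fin (M + N)}
    (he : IsAlternating h e) (hh : h ≤ 1) (h1 : p ≤ m + h) (h2 : m + h ≤ p + 1)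
    (hmp : (m = M ∧ p = N) ∨ (m = N ∧ p = M)) {f w : ℝ → ℝ} (hf : Measurable f)
    (hf0 : ∀ x, 0 ≤ f x) (hw : Measurable w)
    (hint : ∀ j < N, Integrable fun t => f t * t ^ j)
    {U : Set ℝ} (hU : IsOpen U) (hne : U.Nonempty) (hpos : ∀ x ∈ U, 0 < f x) {C : ℝ} (hC : 0 < C)
    (hdet : ∀ y : Fin m → ℝ, StrictAnti y → (∏ i, f (y i)) *
      absDet (fun (i : Fin p) j => ∫ t in gap h y i, f t * t ^ j) =
        C * ((∏ i, w (y i)) * |vdm y|)) :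
    IsProbabilityMeasure (superpose (OE M f) (OE N f)) ∧ IsProbabilityMeasure (UE m w) ∧
      (superpose (OE M f) (OE N f)).map (fun x (i : Fin m) => kthLargest x (e (.inl i))) =
        (UE m w).map fun x k => kthLargest x k := by
  have hneM : unnormalized 1 M f Set.univ ≠ 0 := unnormalized_univ_ne_zero hf hU hne hpos
  have hntM : unnormalized 1 M f Set.univ ≠ ⊤ :=
    unnormalized_one_ne_top hf0 fun j hj => hint j (by omega)
  have hneN : unnormalized 1 N f Set.univ ≠ 0 := unnormalized_univ_ne_zero hf hU hne hpos
  have hntN : unnormalized 1 N f Set.univ ≠ ⊤ := unnormalized_one_ne_top hf0 hint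
  have hPM : IsProbabilityMeasure (OE M f) := isProbabilityMeasure_ensemble hneM hntM
  have hPN : IsProbabilityMeasure (OE N f) := isProbabilityMeasure_ensemble hneN hntN
  have hP : IsProbabilityMeasure (superpose (OE M f) (OE N f)) := isProbabilityMeasure_superpose
  refine ⟨hP, ?_⟩
  have hp : ∀ y : Fin m → ℝ, 0 ≤ ∏ i, f (y i) := fun y => prod_nonneg fun i _ => hf0 _
  rw [OE, OE, superpose_ensemble] at hP ⊢
  refine ensemble_of_densities hP hw
    (C := (M.factorial * N.factorial * 2 ^ M : ℕ) * C) ?_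
  rw [map_kept_superposed hMN he hh h1 hmp hf hf0]
  congr 1
  refine Set.indicator_congr fun y hy => ?_
  rw [lintegral_gap_superposed hh h1 h2 hf0 (fun j hj => hint j (by omega)) hy,
    ← ENNReal.ofReal_mul (mul_nonneg (hp y) (abs_nonneg _))]
  have : (∏ i, f (y i)) * |vdm y| * absDet (fun (i : Fin p) j => ∫ t in gap h y i, f t * t ^ j) =
      C * ((∏ i, w (y i)) * |vdm y| ^ 2) := by
    linear_combination |vdm y| * hdet y hy
  rw [this, ENNReal.ofReal_mul hC.le, ENNReal.ofReal_mul (Nat.cast_nonneg _),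
    ENNReal.ofReal_natCast]
  ring

theorem evenEq_of_kept {K m p : ℕ} {e : Fin m ⊕ Fin p ≃ Fin K} (he : IsAlternating 1 e)
    (hK : K / 2 = m) {μ : Measure (Fin K → ℝ)} {ν : Measure (Fin m → ℝ)}
    (h : IsProbabilityMeasure μ ∧ IsProbabilityMeasure ν ∧
      μ.map (fun x (i : Fin m) => kthLargest x (e (.inl i))) = ν.map fun x k => kthLargest x k) :
    EvenEq hK μ ν := by
  refine ⟨h.1, h.2.1, ?_⟩
  rw [← h.2.2]
  congr 1
  ext x i
  rw [evenPart]
  congr 1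
  exact Fin.ext (he.1 i).symm

theorem oddEq_of_kept {K m p : ℕ} {e : Fin m ⊕ Fin p ≃ Fin K} (he : IsAlternating 0 e)
    (hK : (K + 1) / 2 = m) {μ : Measure (Fin K → ℝ)} {ν : Measure (Fin m → ℝ)}
    (h : IsProbabilityMeasure μ ∧ IsProbabilityMeasure ν ∧
      μ.map (fun x (i : Fin m) => kthLargest x (e (.inl i))) = ν.map fun x k => kthLargest x k) :
    OddEq hK μ ν := by
  refine ⟨h.1, h.2.1, ?_⟩
  rw [← h.2.2]
  congr 1
  ext x i
  rw [oddPart]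
  congr 1
  exact Fin.ext (he.1 i).symm

/-! ### Decimation for Pearson weights -/

/-- The pair `(f, D q f²)`, where `q > 0` on the support of `f`. -/
structure PearsonPair (P : PearsonCoeff) (f g : ℝ → ℝ) : Prop where
  measurable : Measurable f
  nonneg : ∀ t, 0 ≤ f t
  exists_open : ∃ U : Set ℝ, IsOpen U ∧ U.Nonempty ∧ ∀ t ∈ U, 0 < f t
  q_pos : ∀ t, f t ≠ 0 → 0 < P.q t
  eq_mul : ∃ D > 0, ∀ t, g t = D * (P.q t * f t ^ 2)

namespace PearsonPair

variable {P : PearsonCoeff} {f g : ℝ → ℝ} (hP : PearsonPair P f g)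

include hP

theorem measurable_right : Measurable g := by
  obtain ⟨D, -, hg⟩ := hP.eq_mul
  have hf := hP.measurable
  rw [funext hg]
  unfold PearsonCoeff.q
  fun_prop

theorem ratioDefined : RatioDefined f g := by
  intro t ht
  obtain ⟨D, -, hg⟩ := hP.eq_mul
  rw [hg, ht]; simp

theorem measurable_ratioSq : Measurable (ratioSq f g) := by
  have hf := hP.measurable
  have hg := hP.measurable_right
  unfold ratioSq
  fun_prop

theorem integral_pos (hint : Integrable f) : 0 < ∫ t, f t := by
  obtain ⟨U, hU, hne, hpos⟩ := hP.exists_open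
  rw [integral_pos_iff_support_of_nonneg hP.nonneg hint]
  exact (hU.measure_pos volume hne).trans_le
    (measure_mono fun t ht => (hpos t ht).ne')

/-- The factors of the evaluated determinant combine to the weight `(g / f) ^ 2`, which is a multiple
of `(q f) ^ 2`. -/
theorem exists_mul_prod_single {m : ℕ} : ∃ C > 0, ∀ y : Fin m → ℝ,
    (∏ i, f (y i)) * ((∏ i, |P.q (y i)|) * (∏ i, |P.q (y i) * f (y i)|)) =
      C * ∏ i, ratioSq f g (y i) := by
  obtain ⟨D, hD, hg⟩ := hP.eq_mul
  refine ⟨(D ^ 2)⁻¹ ^ m, by positivity, fun y => ?_⟩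
  have : (D ^ 2)⁻¹ ^ m = ∏ _i : Fin m, (D ^ 2)⁻¹ := by simp
  rw [this, ← prod_mul_distrib, ← prod_mul_distrib, ← prod_mul_distrib]
  refine prod_congr rfl fun i _ => ?_
  by_cases h : f (y i) = 0
  · simp [ratioSq, h]
  · rw [ratioSq, hg, abs_mul, abs_of_pos (hP.q_pos _ h), abs_of_nonneg (hP.nonneg _)]
    field_simp

/-- The factors of the evaluated determinant combine to the weight `g`, a multiple of `q f ^ 2`. -/
theorem exists_mul_prod_superposed {m : ℕ} : ∃ C > 0, ∀ y : Fin m → ℝ,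
    (∏ i, f (y i)) * (∏ i, |P.q (y i) * f (y i)|) = C * ∏ i, g (y i) := by
  obtain ⟨D, hD, hg⟩ := hP.eq_mul
  refine ⟨D⁻¹ ^ m, by positivity, fun y => ?_⟩
  have : D⁻¹ ^ m = ∏ _i : Fin m, D⁻¹ := by simp
  rw [this, ← prod_mul_distrib, ← prod_mul_distrib]
  refine prod_congr rfl fun i _ => ?_
  by_cases h : f (y i) = 0
  · simp [hg, h]
  · rw [hg, abs_mul, abs_of_pos (hP.q_pos _ h), abs_of_nonneg (hP.nonneg _)]
    field_simp

/-- The single-ensemble density identity follows from the evaluation `hev` of the gap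
determinant. -/
theorem density_single {m p h : ℕ} {A B : ℝ} (hA : 0 < A) (hB : 0 < B)
    (hev : ∀ y : Fin m → ℝ, StrictAnti y → (∀ i, f (y i) ≠ 0) →
      A * absDet (Sum.elim (fun i j => y i ^ j)
        fun (i : Fin p) j => ∫ t in gap h y i, f t * t ^ j) =
      B * absDet (Sum.elim (fun c => P.lift fun k => y c ^ k)
        fun (i : Fin m) j => P.q (y i) * f (y i) * y i ^ j)) :
    ∃ C > 0, ∀ y : Fin m → ℝ, StrictAnti y →
      (∏ i, f (y i)) * absDet (Sum.elim (fun i j => y i ^ j)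
        fun (i : Fin p) j => ∫ t in gap h y i, f t * t ^ j) =
      C * ((∏ i, ratioSq f g (y i)) * |vdm y| ^ 4) := by
  obtain ⟨C, hC, hprod⟩ := hP.exists_mul_prod_single (m := m)
  refine ⟨B / A * C, by positivity, fun y hy => ?_⟩
  by_cases h0 : ∀ i, f (y i) ≠ 0
  · have h1 := hev y hy h0
    rw [absDet_lift_confluent] at h1
    have h2 := hprod y
    field_simp
    linear_combination (∏ i, f (y i)) * h1 + B * |vdm y| ^ 4 * h2
  · push Not at h0
    obtain ⟨i, hi⟩ := h0
    rw [prod_eq_zero (mem_univ i) hi, prod_eq_zero (mem_univ i) (by simp [ratioSq, hi])]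
    simp

/-- The density identity for two superposed ensembles follows from the evaluation `hev` of the gap
determinant without further rows. -/
theorem density_superposed {m p h : ℕ} {A B : ℝ} (hA : 0 < A) (hB : 0 < B)
    (hev : ∀ y : Fin m → ℝ, StrictAnti y → (∀ i, f (y i) ≠ 0) →
      A * absDet (Sum.elim (fun (i : Fin 0) j => (i : ℝ) ^ j)
        fun (i : Fin p) j => ∫ t in gap h y i, f t * t ^ j) =
      B * absDet (Sum.elim (fun (c : Fin 0) => P.lift fun k => (c : ℝ) ^ k)
        fun (i : Fin m) j => P.q (y i) * f (y i) * y i ^ j)) :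
    ∃ C > 0, ∀ y : Fin m → ℝ, StrictAnti y →
      (∏ i, f (y i)) * absDet (fun (i : Fin p) j => ∫ t in gap h y i, f t * t ^ j) =
      C * ((∏ i, g (y i)) * |vdm y|) := by
  obtain ⟨C, hC, hprod⟩ := hP.exists_mul_prod_superposed (m := m)
  refine ⟨B / A * C, by positivity, fun y hy => ?_⟩
  by_cases h0 : ∀ i, f (y i) ≠ 0
  · have h1 := hev y hy h0
    rw [absDet_node (fun t => P.q t * f t), absDet_emptySum] at h1
    have h2 := hprod y
    field_simp
    linear_combination (∏ i, f (y i)) * h1 + B * |vdm y| * h2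
  · obtain ⟨D, hD, hg⟩ := hP.eq_mul
    push Not at h0
    obtain ⟨i, hi⟩ := h0
    rw [prod_eq_zero (mem_univ i) hi, prod_eq_zero (mem_univ i) (by simp [hg, hi])]
    simp

/-- Both extreme points integrated out. -/
theorem even_succ {n : ℕ} (hint : ∀ j ≤ 2 * n, Integrable fun t => f t * t ^ j)
    (hlead : ∀ j < 2 * n, j * P.q₂ + P.r₁ ≠ 0)
    (htot : ∀ j < 2 * n, P.lift (fun k => ∫ t, f t * t ^ k) j = 0)
    (hbel : ∀ j < 2 * n, ∀ y, f y ≠ 0 →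
      P.lift (fun k => ∫ t in Set.Iio y, f t * t ^ k) j = P.q y * f y * y ^ j) :
    EvenUnionSucc n f g ∧ EvenSingleSucc n f g := by
  obtain ⟨U, hU, hne, hpos⟩ := hP.exists_open
  have hB : 0 < |∫ t, f t| := abs_pos.2 (hP.integral_pos (by simpa using hint 0 (by omega))).ne'
  have hA : ∀ M ≤ 2 * n, 0 < ∏ j ∈ range M, |j * P.q₂ + P.r₁| := fun M hM =>
    prod_pos fun j hj => abs_pos.2 (hlead j (by have := mem_range.1 hj; omega))
  constructor
  · obtain ⟨e, he⟩ := exists_isAlternating (m := 2 * n) (p := 2 * n + 1)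
      (K := 2 * n + (2 * n + 1)) le_rfl rfl (by omega) (by omega)
    obtain ⟨C, hC, hdet⟩ := hP.density_superposed (m := 2 * n) (p := 2 * n + 1) (h := 1)
      (hA (Fintype.card (Fin 0) + 2 * n) (by simp)) hB fun y hy h0 =>
        absDet_gap_both P (fun i : Fin 0 => (i : ℝ)) hy (by simpa using hint) (by simpa using htot)
          fun j hj i => hbel j (by simpa using hj) _ (h0 i)
    exact evenEq_of_kept he _ (superposed_of_absDet (by omega) he le_rfl (by omega) (by omega)
      (Or.inl ⟨rfl, rfl⟩) hP.measurable hP.nonneg hP.measurable_right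
      (fun j hj => hint j (by omega)) hU hne hpos hC hdet)
  · obtain ⟨e, he⟩ := exists_isAlternating (m := n) (p := n + 1) (K := 2 * n + 1) le_rfl
      (by omega) (by omega) (by omega)
    obtain ⟨C, hC, hdet⟩ := hP.density_single (m := n) (p := n + 1) (h := 1)
      (hA (Fintype.card (Fin n) + n) (by simp; omega)) hB fun y hy h0 =>
        absDet_gap_both P y hy (fun j hj => hint j (by simp at hj; omega))
          (fun j hj => htot j (by simp at hj; omega))
          fun j hj i => hbel j (by simp at hj; omega) _ (h0 i)
    exact ⟨hP.ratioDefined, evenEq_of_kept he _ (single_of_absDet he le_rfl (by omega)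
      hP.measurable hP.nonneg hP.measurable_ratioSq (fun j hj => hint j (by omega)) hU hne hpos hC
      hdet)⟩

/-- Only the largest point integrated out. -/
theorem even_same {n : ℕ} (hq : P.q₂ = 0) (hr : P.r₁ = 0)
    (hint : ∀ j < 2 * n, Integrable fun t => f t * t ^ j)
    (hlead : ∀ j < 2 * n, j * P.q₁ + P.r₀ ≠ 0)
    (habv : ∀ j < 2 * n, ∀ y, f y ≠ 0 →
      P.lift (fun k => ∫ t in Set.Ici y, f t * t ^ k) j = -(P.q y * f y * y ^ j)) :
    EvenUnionSame n f g ∧ EvenSingle n f g := by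
  obtain ⟨U, hU, hne, hpos⟩ := hP.exists_open
  have hA : ∀ M ≤ 2 * n, 0 < ∏ j ∈ range M, |j * P.q₁ + P.r₀| := fun M hM =>
    prod_pos fun j hj => abs_pos.2 (hlead j (by have := mem_range.1 hj; omega))
  constructor
  · obtain ⟨e, he⟩ := exists_isAlternating (m := 2 * n) (p := 2 * n)
      (K := 2 * n + 2 * n) le_rfl rfl (by omega) (by omega)
    obtain ⟨C, hC, hdet⟩ := hP.density_superposed (m := 2 * n) (p := 2 * n) (h := 1)
      (hA (Fintype.card (Fin 0) + 2 * n) (by simp)) one_pos fun y hy h0 => by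
        rw [one_mul]
        exact absDet_gap_upper P hq hr (fun i : Fin 0 => (i : ℝ)) hy (by simpa using hint)
          fun j hj i => habv j (by simpa using hj) _ (h0 i)
    exact evenEq_of_kept he _ (superposed_of_absDet (by omega) he le_rfl (by omega) (by omega)
      (Or.inl ⟨rfl, rfl⟩) hP.measurable hP.nonneg hP.measurable_right
      (fun j hj => hint j (by omega)) hU hne hpos hC hdet)
  · obtain ⟨e, he⟩ := exists_isAlternating (m := n) (p := n) (K := 2 * n) le_rfl
      (by omega) (by omega) (by omega)
    obtain ⟨C, hC, hdet⟩ := hP.density_single (m := n) (p := n) (h := 1)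
      (hA (Fintype.card (Fin n) + n) (by simp; omega)) one_pos fun y hy h0 => by
        rw [one_mul]
        exact absDet_gap_upper P hq hr y hy (fun j hj => hint j (by simp at hj; omega))
          fun j hj i => habv j (by simp at hj; omega) _ (h0 i)
    exact ⟨hP.ratioDefined, evenEq_of_kept he _ (single_of_absDet he le_rfl (by omega)
      hP.measurable hP.nonneg hP.measurable_ratioSq (fun j hj => hint j (by omega)) hU hne hpos hC
      hdet)⟩

/-- Only the smallest point integrated out. -/
theorem odd_same {n : ℕ} (hq : P.q₂ = 0) (hr : P.r₁ = 0)
    (hint : ∀ j < 2 * n, Integrable fun t => f t * t ^ j)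
    (hlead : ∀ j < 2 * n, j * P.q₁ + P.r₀ ≠ 0)
    (hbel : ∀ j < 2 * n, ∀ y, f y ≠ 0 →
      P.lift (fun k => ∫ t in Set.Iio y, f t * t ^ k) j = P.q y * f y * y ^ j) :
    OddUnionSame n f g ∧ OddSingle n f g := by
  obtain ⟨U, hU, hne, hpos⟩ := hP.exists_open
  have hA : ∀ M ≤ 2 * n, 0 < ∏ j ∈ range M, |j * P.q₁ + P.r₀| := fun M hM =>
    prod_pos fun j hj => abs_pos.2 (hlead j (by have := mem_range.1 hj; omega))
  constructor
  · obtain ⟨e, he⟩ := exists_isAlternating (m := 2 * n) (p := 2 * n)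
      (K := 2 * n + 2 * n) zero_le_one rfl (by omega) (by omega)
    obtain ⟨C, hC, hdet⟩ := hP.density_superposed (m := 2 * n) (p := 2 * n) (h := 0)
      (hA (Fintype.card (Fin 0) + 2 * n) (by simp)) one_pos fun y hy h0 => by
        rw [one_mul]
        exact absDet_gap_lower P hq hr (fun i : Fin 0 => (i : ℝ)) hy (by simpa using hint)
          fun j hj i => hbel j (by simpa using hj) _ (h0 i)
    exact oddEq_of_kept he _ (superposed_of_absDet (by omega) he zero_le_one (by omega) (by omega)
      (Or.inl ⟨rfl, rfl⟩) hP.measurable hP.nonneg hP.measurable_right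
      (fun j hj => hint j (by omega)) hU hne hpos hC hdet)
  · obtain ⟨e, he⟩ := exists_isAlternating (m := n) (p := n) (K := 2 * n) zero_le_one
      (by omega) (by omega) (by omega)
    obtain ⟨C, hC, hdet⟩ := hP.density_single (m := n) (p := n) (h := 0)
      (hA (Fintype.card (Fin n) + n) (by simp; omega)) one_pos fun y hy h0 => by
        rw [one_mul]
        exact absDet_gap_lower P hq hr y hy (fun j hj => hint j (by simp at hj; omega))
          fun j hj i => hbel j (by simp at hj; omega) _ (h0 i)
    exact ⟨hP.ratioDefined, oddEq_of_kept he _ (single_of_absDet he zero_le_one (by omega)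
      hP.measurable hP.nonneg hP.measurable_ratioSq (fun j hj => hint j (by omega)) hU hne hpos hC
      hdet)⟩

/-- No extreme point integrated out, for a weight `f` that is constant on its support. -/
theorem odd_pred {n : ℕ} (hn : 1 ≤ n) (hPc : P = ⟨1, 0, 0, 0, 0⟩) {c : ℝ} (hc : 0 < c)
    (hf : ∀ s t u, f s ≠ 0 → f u ≠ 0 → s < t → t < u → f t = c) (hfc : ∀ t, f t ≠ 0 → f t = c)
    (hint : ∀ j < 2 * n, Integrable fun t => f t * t ^ j) :
    OddUnionPred n hn f g ∧ OddSinglePred n hn f g := by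
  obtain ⟨U, hU, hne, hpos⟩ := hP.exists_open
  have hA : ∀ M, (0 : ℝ) < ∏ j ∈ range M, ((j : ℝ) + 1) := fun M =>
    prod_pos fun j _ => by positivity
  have hlift : ∀ a : ℝ, (P.lift fun k => a ^ k) = fun j : ℕ => j * a ^ (j - 1) := by
    intro a; ext j; simp [PearsonCoeff.lift, hPc]
  have hq : ∀ t, P.q t = 1 := fun t => by simp [PearsonCoeff.q, hPc]
  -- With `q = 1` and `r = 0` the polynomial `L_j` is the derivative of `t ^ j`, as in the
  -- evaluation of the determinant for a constant weight.
  have hrow : ∀ {κ : Type} [Fintype κ] [DecidableEq κ] {m : ℕ} (a : κ → ℝ) (y : Fin m → ℝ),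
      (∀ i, f (y i) ≠ 0) → absDet (Sum.elim (fun k => P.lift fun l => a k ^ l)
        fun (i : Fin m) j => P.q (y i) * f (y i) * y i ^ j) =
      c ^ m * absDet (Sum.elim (fun k (j : ℕ) => j * a k ^ (j - 1))
        fun (i : Fin m) j => y i ^ j) := by
    intro κ _ _ m a y h0
    have h3 := absDet_mul_row (Sum.elim (fun k (j : ℕ) => j * a k ^ (j - 1))
        fun (i : Fin m) j => y i ^ j) (Sum.elim (fun _ => 1) fun _ => c)
    rw [Fintype.prod_sum_type] at h3
    simp only [Sum.elim_inl, Sum.elim_inr, abs_one, prod_const_one, one_mul, prod_const, card_univ,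
      Fintype.card_fin, abs_of_pos hc] at h3
    rw [← h3]
    refine absDet_congr fun k j _ => ?_
    rcases k with k | i
    · simp [hlift]
    · simp [hq, hfc _ (h0 i)]
  have hev : ∀ {κ : Type} [Fintype κ] [DecidableEq κ] {m p : ℕ} (_ : m = p + 1) (a : κ → ℝ)
      (y : Fin m → ℝ), StrictAnti y → (∀ i, f (y i) ≠ 0) →
      (c * ∏ j ∈ range (Fintype.card κ + p), ((j : ℝ) + 1)) * absDet (Sum.elim (fun i j => a i ^ j)
        fun (i : Fin p) j => ∫ t in gap 0 y i, f t * t ^ j) =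
      1 * absDet (Sum.elim (fun c => P.lift fun k => a c ^ k)
        fun (i : Fin m) j => P.q (y i) * f (y i) * y i ^ j) := by
    intro κ _ _ m p hm a y hy h0
    subst hm
    rw [mul_assoc, absDet_gap_none hc κ a hy fun t h1 h2 => hf _ t _ (h0 _) (h0 _) h1 h2, hrow a y h0]
    ring
  constructor
  · obtain ⟨e, he⟩ := exists_isAlternating (m := 2 * n) (p := 2 * n - 1)
      (K := 2 * n - 1 + 2 * n) zero_le_one (by omega) (by omega) (by omega)
    obtain ⟨C, hC, hdet⟩ := hP.density_superposed (m := 2 * n) (p := 2 * n - 1) (h := 0)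
      (mul_pos hc (hA _)) one_pos fun y hy h0 => hev (by omega) (fun i : Fin 0 => (i : ℝ)) y hy h0
    exact oddEq_of_kept he _ (superposed_of_absDet (by omega) he zero_le_one (by omega) (by omega)
      (Or.inr ⟨rfl, rfl⟩) hP.measurable hP.nonneg hP.measurable_right
      (fun j hj => hint j (by omega)) hU hne hpos hC hdet)
  · obtain ⟨e, he⟩ := exists_isAlternating (m := n) (p := n - 1) (K := 2 * n - 1) zero_le_one
      (by omega) (by omega) (by omega)
    obtain ⟨C, hC, hdet⟩ := hP.density_single (m := n) (p := n - 1) (h := 0)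
      (mul_pos hc (hA _)) one_pos fun y hy h0 => hev (by omega) y y hy h0
    exact ⟨hP.ratioDefined, oddEq_of_kept he _ (single_of_absDet he zero_le_one (by omega)
      hP.measurable hP.nonneg hP.measurable_ratioSq (fun j hj => hint j (by omega)) hU hne hpos hC
      hdet)⟩

end PearsonPair

/-! ### The moment identities -/

/-- The fundamental theorem of calculus on a lower half-line, with a countable exceptional set. -/
theorem setIntegral_Iio_of_hasDerivAt {u v : ℝ → ℝ} {s : Set ℝ} (hs : s.Countable) {y : ℝ}
    (hc : ContinuousOn u (Set.Iic y)) (hd : ∀ t ∉ s, HasDerivAt u (v t) t) (hi : Integrable v)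
    (hl : Filter.Tendsto u Filter.atBot (nhds 0)) : ∫ t in Set.Iio y, v t = u y := by
  rw [← integral_Iic_eq_integral_Iio]
  have h1 := intervalIntegral_tendsto_integral_Iic y hi.integrableOn Filter.tendsto_id
  have h2 : Filter.Tendsto (fun a => u y - u a) Filter.atBot (nhds (u y - 0)) := hl.const_sub _
  rw [sub_zero] at h2
  refine tendsto_nhds_unique (h1.congr' ?_) h2
  filter_upwards [Filter.eventually_le_atBot y] with a ha
  exact integral_eq_of_hasDerivAt_off_countable_of_le u v ha hs
    (hc.mono fun t ht => ht.2) (fun t ht => hd t ht.2) hi.intervalIntegrable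

/-- The fundamental theorem of calculus on an upper half-line, with a countable exceptional set. -/
theorem setIntegral_Ici_of_hasDerivAt {u v : ℝ → ℝ} {s : Set ℝ} (hs : s.Countable) {y : ℝ}
    (hc : ContinuousOn u (Set.Ici y)) (hd : ∀ t ∉ s, HasDerivAt u (v t) t) (hi : Integrable v)
    (hl : Filter.Tendsto u Filter.atTop (nhds 0)) : ∫ t in Set.Ici y, v t = -u y := by
  rw [integral_Ici_eq_integral_Ioi]
  have h1 := intervalIntegral_tendsto_integral_Ioi y hi.integrableOn Filter.tendsto_id
  have h2 : Filter.Tendsto (fun a => u a - u y) Filter.atTop (nhds (0 - u y)) := hl.sub_const _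
  rw [zero_sub] at h2
  refine tendsto_nhds_unique (h1.congr' ?_) h2
  filter_upwards [Filter.eventually_ge_atTop y] with a ha
  exact integral_eq_of_hasDerivAt_off_countable_of_le u v ha hs
    (hc.mono fun t ht => ht.1) (fun t ht => hd t ht.2) hi.intervalIntegrable

/-- The solution `f` of the Pearson equation `(q f)' = r f`, off a countable set, with enough
moments and with `q f t ^ j` vanishing at infinity. -/
structure IsPearsonWeight (P : PearsonCoeff) (N : ℕ) (f : ℝ → ℝ) : Prop where
  measurable : Measurable f
  nonneg : ∀ t, 0 ≤ f t
  exists_open : ∃ U : Set ℝ, IsOpen U ∧ U.Nonempty ∧ ∀ t ∈ U, 0 < f t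
  q_pos : ∀ t, f t ≠ 0 → 0 < P.q t
  hasDerivAt : ∃ s : Set ℝ, s.Countable ∧
    ∀ t ∉ s, HasDerivAt (fun t => P.q t * f t) (P.r t * f t) t
  integrable : ∀ j ≤ N, Integrable fun t => f t * t ^ j
  tendsto_atBot : ∀ j < N, Filter.Tendsto (fun t => P.q t * f t * t ^ j) Filter.atBot (nhds 0)
  tendsto_atTop : ∀ j < N, Filter.Tendsto (fun t => P.q t * f t * t ^ j) Filter.atTop (nhds 0)

/-- The coefficients of the Pearson equation of `t ↦ f (c t)`. -/
def PearsonCoeff.scale (P : PearsonCoeff) (c : ℝ) : PearsonCoeff :=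
  ⟨P.q₀, c * P.q₁, c ^ 2 * P.q₂, c * P.r₀, c ^ 2 * P.r₁⟩

theorem PearsonCoeff.scale_q (P : PearsonCoeff) (c t : ℝ) : (P.scale c).q t = P.q (c * t) := by
  simp only [PearsonCoeff.q, PearsonCoeff.scale]; ring

theorem PearsonCoeff.scale_r (P : PearsonCoeff) (c t : ℝ) :
    (P.scale c).r t = c * P.r (c * t) := by
  simp only [PearsonCoeff.r, PearsonCoeff.scale]; ring

/-- Linearity: the lift of the moments over `S` is the integral of `f L_j` over `S`. -/
theorem PearsonCoeff.setIntegral_lift (P : PearsonCoeff) {f : ℝ → ℝ} {j : ℕ} (S : Set ℝ)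
    (hint : ∀ k ≤ j + 1, Integrable fun t => f t * t ^ k) :
    P.lift (fun k => ∫ t in S, f t * t ^ k) j = ∫ t in S, f t * P.lift (fun k => t ^ k) j := by
  have h0 := (hint (j - 1) (by omega)).integrableOn (s := S)
  have h1 := (hint j (by omega)).integrableOn (s := S)
  have h2 := (hint (j + 1) (by omega)).integrableOn (s := S)
  simp only [PearsonCoeff.lift]
  rw [← integral_const_mul, ← integral_const_mul, ← integral_const_mul, ← integral_add,
    ← integral_add]
  · congr 1; ext t; ring
  · exact (h0.const_mul _).add (h1.const_mul _)
  · exact h2.const_mul _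
  · exact h0.const_mul _
  · exact h1.const_mul _

namespace IsPearsonWeight

variable {P : PearsonCoeff} {N : ℕ} {f : ℝ → ℝ} (hf : IsPearsonWeight P N f)

include hf

theorem integrable_mul_lift {j : ℕ} (hj : j < N) :
    Integrable fun t => f t * P.lift (fun k => t ^ k) j := by
  have h0 := hf.integrable (j - 1) (by omega)
  have h1 := hf.integrable j (by omega)
  have h2 := hf.integrable (j + 1) (by omega)
  refine (((h0.const_mul (j * P.q₀)).add (h1.const_mul (j * P.q₁ + P.r₀))).add
    (h2.const_mul (j * P.q₂ + P.r₁))).congr (Filter.Eventually.of_forall fun t => ?_)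
  simp only [PearsonCoeff.lift, Pi.add_apply]
  ring

/-- The Pearson equation for `q f t ^ j`: its derivative is `f L_j`. -/
theorem hasDerivAt_mul_pow : ∃ s : Set ℝ, s.Countable ∧ ∀ j : ℕ, ∀ t ∉ s,
    HasDerivAt (fun t => P.q t * f t * t ^ j) (f t * P.lift (fun k => t ^ k) j) t := by
  obtain ⟨s, hs, h⟩ := hf.hasDerivAt
  refine ⟨s, hs, fun j t ht => ?_⟩
  convert! (h t ht).mul (hasDerivAt_pow j t) using 1
  rw [PearsonCoeff.lift_pow]
  ring

/-- The integral of `f L_j = (q f t ^ j)'` over a half-line is the boundary term at `y`. -/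
theorem lift_Iio {y : ℝ} (hc : ContinuousOn (fun t => P.q t * f t) (Set.Iic y)) {j : ℕ}
    (hj : j < N) :
    P.lift (fun k => ∫ t in Set.Iio y, f t * t ^ k) j = P.q y * f y * y ^ j := by
  obtain ⟨s, hs, h⟩ := hf.hasDerivAt_mul_pow
  rw [P.setIntegral_lift _ fun k hk => hf.integrable k (by omega)]
  exact setIntegral_Iio_of_hasDerivAt hs (hc.mul (continuous_pow j).continuousOn) (h j)
    (hf.integrable_mul_lift hj) (hf.tendsto_atBot j hj)

theorem lift_Ici {y : ℝ} (hc : ContinuousOn (fun t => P.q t * f t) (Set.Ici y)) {j : ℕ}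
    (hj : j < N) :
    P.lift (fun k => ∫ t in Set.Ici y, f t * t ^ k) j = -(P.q y * f y * y ^ j) := by
  obtain ⟨s, hs, h⟩ := hf.hasDerivAt_mul_pow
  rw [P.setIntegral_lift _ fun k hk => hf.integrable k (by omega)]
  exact setIntegral_Ici_of_hasDerivAt hs (hc.mul (continuous_pow j).continuousOn) (h j)
    (hf.integrable_mul_lift hj) (hf.tendsto_atTop j hj)

/-- The boundary terms of the two half-lines cancel if `q f` is continuous throughout. -/
theorem lift_univ (hc : Continuous fun t => P.q t * f t) {j : ℕ} (hj : j < N) :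
    P.lift (fun k => ∫ t, f t * t ^ k) j = 0 := by
  have h1 := hf.lift_Iio (y := 0) hc.continuousOn hj
  have h2 := hf.lift_Ici (y := 0) hc.continuousOn hj
  have h3 : ∀ k ≤ N, ∫ t, f t * t ^ k =
      (∫ t in Set.Iio 0, f t * t ^ k) + ∫ t in Set.Ici 0, f t * t ^ k := fun k hk => by
    rw [← Set.compl_Iio, integral_add_compl measurableSet_Iio (hf.integrable k hk)]
  simp only [PearsonCoeff.lift] at h1 h2 ⊢
  rw [h3 (j - 1) (by omega), h3 j (by omega), h3 (j + 1) (by omega)]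
  linear_combination h1 + h2

theorem scale {c C : ℝ} (hc : 0 < c) (hC : 0 < C) :
    IsPearsonWeight (P.scale c) N fun t => C * f (c * t) where
  measurable := by have := hf.measurable; fun_prop
  nonneg t := mul_nonneg hC.le (hf.nonneg _)
  exists_open := by
    obtain ⟨U, hU, ⟨t, ht⟩, hpos⟩ := hf.exists_open
    refine ⟨(fun t => c * t) ⁻¹' U, hU.preimage (by fun_prop), ⟨t / c, ?_⟩, fun t ht =>
      mul_pos hC (hpos _ ht)⟩
    rw [Set.mem_preimage, mul_div_cancel₀ _ hc.ne']
    exact ht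
  q_pos t ht := by
    rw [P.scale_q]
    exact hf.q_pos _ fun h => ht (by simp [h])
  hasDerivAt := by
    obtain ⟨s, hs, h⟩ := hf.hasDerivAt
    refine ⟨(fun t => c * t) ⁻¹' s, hs.preimage (mul_right_injective₀ hc.ne'), fun t ht => ?_⟩
    have h1 := ((h (c * t) ht).comp t ((hasDerivAt_id t).const_mul c)).const_mul C
    convert! h1 using 1
    · ext t; simp only [P.scale_q, Function.comp]; ring
    · rw [P.scale_r]; ring
  integrable j hj := by
    have h1 := ((hf.integrable j hj).comp_mul_left' hc.ne').const_mul (C * (c ^ j)⁻¹)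
    refine h1.congr (Filter.Eventually.of_forall fun t => ?_)
    simp only [mul_pow]
    field_simp
  tendsto_atBot j hj := by
    have h1 := ((hf.tendsto_atBot j hj).comp
      (Filter.tendsto_id.const_mul_atBot hc)).const_mul (C * (c ^ j)⁻¹)
    rw [mul_zero] at h1
    refine h1.congr fun t => ?_
    simp only [Function.comp, id, P.scale_q, mul_pow]
    field_simp
  tendsto_atTop j hj := by
    have h1 := ((hf.tendsto_atTop j hj).comp
      (Filter.tendsto_id.const_mul_atTop hc)).const_mul (C * (c ^ j)⁻¹)
    rw [mul_zero] at h1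
    refine h1.congr fun t => ?_
    simp only [Function.comp, id, P.scale_q, mul_pow]
    field_simp

end IsPearsonWeight

/-- A rescaling of the pair `(f₀, q f₀²)` is a Pearson pair for the rescaled coefficients. -/
theorem pearsonPair_of_isPairRescaling {P : PearsonCoeff} {N : ℕ} {f g f₀ g₀ : ℝ → ℝ}
    (hf₀ : IsPearsonWeight P N f₀) (hg₀ : ∀ t, g₀ t = P.q t * f₀ t ^ 2)
    (h : IsPairRescaling f g f₀ g₀) : ∃ c > 0, ∃ C > 0, (f = fun t => C * f₀ (c * t)) ∧
      PearsonPair (P.scale c) f g ∧ IsPearsonWeight (P.scale c) N f := by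
  obtain ⟨c, hc, C, hC, D, hD, hf, hg⟩ := h
  have hw := hf₀.scale hc hC
  rw [← funext hf] at hw
  refine ⟨c, hc, C, hC, funext hf, ⟨hw.measurable, hw.nonneg, hw.exists_open, hw.q_pos,
    D / C ^ 2, by positivity, fun t => ?_⟩, hw⟩
  rw [hg, hf, hg₀, P.scale_q]
  field_simp

section Transfer

variable {P : PearsonCoeff} {n : ℕ} {f g f₀ g₀ : ℝ → ℝ} (hf₀ : IsPearsonWeight P (2 * n) f₀)
  (hg₀ : ∀ t, g₀ t = P.q t * f₀ t ^ 2) (h : IsPairRescaling f g f₀ g₀)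

include hf₀ hg₀ h

/-- If `q f` is continuous, no boundary term arises at either end of the support. -/
theorem even_succ_of_isPearsonWeight (hc₀ : Continuous fun t => P.q t * f₀ t)
    (hlead : ∀ j < 2 * n, j * P.q₂ + P.r₁ ≠ 0) : EvenUnionSucc n f g ∧ EvenSingleSucc n f g := by
  obtain ⟨c, hc, C, hC, hf, hP, hw⟩ := pearsonPair_of_isPairRescaling hf₀ hg₀ h
  have hcont : Continuous fun t => (P.scale c).q t * f t := by
    have := (hc₀.comp (continuous_const_mul c)).const_mul C
    convert! this using 1
    ext t; simp only [P.scale_q, hf, Function.comp]; ring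
  refine hP.even_succ hw.integrable (fun j hj h0 => hlead j hj ?_)
    (fun j hj => hw.lift_univ hcont hj) fun j hj y _ => hw.lift_Iio hcont.continuousOn hj
  simp only [PearsonCoeff.scale] at h0
  have : c ^ 2 * (j * P.q₂ + P.r₁) = 0 := by linear_combination h0
  exact (mul_eq_zero.1 this).resolve_left (by positivity)

/-- Continuity of `q f` is needed at the upper end of the support only: `q f` may jump at the lower
end. -/
theorem even_same_of_isPearsonWeight
    (hc₀ : ∀ y, f₀ y ≠ 0 → ContinuousOn (fun t => P.q t * f₀ t) (Set.Ici y))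
    (hq : P.q₂ = 0) (hr : P.r₁ = 0) (hlead : ∀ j < 2 * n, j * P.q₁ + P.r₀ ≠ 0) :
    EvenUnionSame n f g ∧ EvenSingle n f g := by
  obtain ⟨c, hc, C, hC, hf, hP, hw⟩ := pearsonPair_of_isPairRescaling hf₀ hg₀ h
  refine hP.even_same (by simp [PearsonCoeff.scale, hq]) (by simp [PearsonCoeff.scale, hr])
    (fun j hj => hw.integrable j hj.le) (fun j hj h0 => hlead j hj ?_)
    fun j hj y hy => hw.lift_Ici ?_ hj
  · simp only [PearsonCoeff.scale] at h0
    have : c * (j * P.q₁ + P.r₀) = 0 := by linear_combination h0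
    exact (mul_eq_zero.1 this).resolve_left hc.ne'
  · have := ((hc₀ (c * y) fun h0 => hy (by simp [hf, h0])).comp
      (continuous_const_mul c).continuousOn (s := Set.Ici y)
      fun t ht => mul_le_mul_of_nonneg_left ht hc.le).const_mul C
    refine this.congr fun t _ => ?_
    simp only [P.scale_q, hf, Function.comp]; ring

/-- Continuity of `q f` is needed at the lower end of the support only: `q f` may jump at the upper
end. -/
theorem odd_same_of_isPearsonWeight
    (hc₀ : ∀ y, f₀ y ≠ 0 → ContinuousOn (fun t => P.q t * f₀ t) (Set.Iic y))
    (hq : P.q₂ = 0) (hr : P.r₁ = 0) (hlead : ∀ j < 2 * n, j * P.q₁ + P.r₀ ≠ 0) :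
    OddUnionSame n f g ∧ OddSingle n f g := by
  obtain ⟨c, hc, C, hC, hf, hP, hw⟩ := pearsonPair_of_isPairRescaling hf₀ hg₀ h
  refine hP.odd_same (by simp [PearsonCoeff.scale, hq]) (by simp [PearsonCoeff.scale, hr])
    (fun j hj => hw.integrable j hj.le) (fun j hj h0 => hlead j hj ?_)
    fun j hj y hy => hw.lift_Iio ?_ hj
  · simp only [PearsonCoeff.scale] at h0
    have : c * (j * P.q₁ + P.r₀) = 0 := by linear_combination h0
    exact (mul_eq_zero.1 this).resolve_left hc.ne'
  · have := ((hc₀ (c * y) fun h0 => hy (by simp [hf, h0])).comp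
      (continuous_const_mul c).continuousOn (s := Set.Iic y)
      fun t ht => mul_le_mul_of_nonneg_left ht hc.le).const_mul C
    refine this.congr fun t _ => ?_
    simp only [P.scale_q, hf, Function.comp]; ring

end Transfer

/-! ### The classical Pearson weights -/

theorem isPearsonWeight_gaussian (N : ℕ) :
    IsPearsonWeight ⟨1, 0, 0, 0, -1⟩ N fun x => Real.exp (-x ^ 2 / 2) where
  measurable := by fun_prop
  nonneg t := (Real.exp_pos _).le
  exists_open := ⟨Set.univ, isOpen_univ, Set.univ_nonempty, fun t _ => Real.exp_pos _⟩
  q_pos t _ := by simp [PearsonCoeff.q]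
  hasDerivAt := by
    refine ⟨∅, Set.countable_empty, fun t _ => ?_⟩
    have h := (((hasDerivAt_pow 2 t).neg.div_const 2).exp)
    convert! h using 1
    · ext t; simp [PearsonCoeff.q]
    · simp [PearsonCoeff.r]; ring
  integrable j _ := by
    have h := integrable_rpow_mul_exp_neg_mul_sq (b := 1 / 2) (by norm_num) (s := j)
      (by have : (0 : ℝ) ≤ j := j.cast_nonneg
          linarith)
    refine h.congr (Filter.Eventually.of_forall fun t => ?_)
    simp only [Real.rpow_natCast]
    rw [mul_comm]; congr 2; ring
  tendsto_atBot j _ := by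
    have h := tendsto_rpow_abs_mul_exp_neg_mul_sq_cocompact (a := 1 / 2) (by norm_num) j
    rw [cocompact_eq_atBot_atTop, Filter.tendsto_sup] at h
    refine squeeze_zero_norm (fun t => le_of_eq ?_) h.1
    rw [norm_mul, norm_pow, Real.norm_eq_abs, Real.norm_eq_abs, Real.rpow_natCast, mul_comm]
    simp only [PearsonCoeff.q, zero_mul, add_zero, one_mul, Real.abs_exp]
    congr 2; ring
  tendsto_atTop j _ := by
    have h := tendsto_rpow_abs_mul_exp_neg_mul_sq_cocompact (a := 1 / 2) (by norm_num) j
    rw [cocompact_eq_atBot_atTop, Filter.tendsto_sup] at h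
    refine squeeze_zero_norm (fun t => le_of_eq ?_) h.2
    rw [norm_mul, norm_pow, Real.norm_eq_abs, Real.norm_eq_abs, Real.rpow_natCast, mul_comm]
    simp only [PearsonCoeff.q, zero_mul, add_zero, one_mul, Real.abs_exp]
    congr 2; ring

theorem one_add_sq_pos (t : ℝ) : 0 < 1 + t ^ 2 := by positivity

theorem abs_pow_le_one_add_sq_rpow (t : ℝ) (j : ℕ) : |t| ^ j ≤ (1 + t ^ 2) ^ ((j : ℝ) / 2) := by
  have h : |t| ≤ (1 + t ^ 2) ^ (1 / 2 : ℝ) := by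
    rw [← Real.sqrt_eq_rpow]
    exact Real.abs_le_sqrt (by linarith)
  calc |t| ^ j ≤ ((1 + t ^ 2) ^ (1 / 2 : ℝ)) ^ j := by gcongr
    _ = _ := by
      rw [← Real.rpow_natCast, ← Real.rpow_mul (one_add_sq_pos t).le]
      congr 1; ring

theorem tendsto_one_add_sq_rpow {l : Filter ℝ} (hl : Filter.Tendsto (fun t => |t|) l Filter.atTop)
    {s : ℝ} (hs : s < 0) : Filter.Tendsto (fun t : ℝ => (1 + t ^ 2) ^ s) l (nhds 0) := by
  have h1 : Filter.Tendsto (fun t : ℝ => 1 + t ^ 2) l Filter.atTop := by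
    refine Filter.tendsto_atTop_add_const_left _ _ ?_
    have := (Filter.tendsto_pow_atTop (two_ne_zero) (α := ℝ)).comp hl
    simpa [Function.comp_def] using this
  have h2 := (tendsto_rpow_neg_atTop (y := -s) (by linarith)).comp h1
  simpa [Function.comp_def] using h2

theorem isPearsonWeight_cauchy {N : ℕ} {α : ℝ} (hα : N < α) :
    IsPearsonWeight ⟨1, 0, 1, 0, 1 - α⟩ N fun x => (1 + x ^ 2) ^ (-(α + 1) / 2) := by
  have hq : ∀ t : ℝ, (1 + t ^ 2) * (1 + t ^ 2) ^ (-(α + 1) / 2) = (1 + t ^ 2) ^ ((1 - α) / 2) :=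
    fun t => by
      rw [show (1 - α) / 2 = 1 + -(α + 1) / 2 by ring, Real.rpow_add (one_add_sq_pos t),
        Real.rpow_one]
  have hlim : ∀ j < N, ∀ l : Filter ℝ, Filter.Tendsto (fun t => |t|) l Filter.atTop →
      Filter.Tendsto (fun t => (PearsonCoeff.mk 1 0 1 0 (1 - α)).q t *
        (1 + t ^ 2) ^ (-(α + 1) / 2) * t ^ j) l (nhds 0) := by
    intro j hj l hl
    have hj' : (j : ℝ) + 1 ≤ N := by exact_mod_cast hj
    refine squeeze_zero_norm (fun t => ?_)
      (tendsto_one_add_sq_rpow hl (s := (1 - α) / 2 + j / 2) (by linarith))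
    simp only [PearsonCoeff.q, zero_mul, add_zero, one_mul]
    rw [hq, Real.rpow_add (one_add_sq_pos t), norm_mul, norm_pow, Real.norm_eq_abs,
      Real.norm_eq_abs, abs_of_nonneg (Real.rpow_nonneg (one_add_sq_pos t).le _)]
    gcongr
    exact abs_pow_le_one_add_sq_rpow t j
  exact {
    measurable := by fun_prop
    nonneg := fun t => by positivity
    exists_open := ⟨Set.univ, isOpen_univ, Set.univ_nonempty, fun t _ => by positivity⟩
    q_pos := fun t _ => by simpa [PearsonCoeff.q] using one_add_sq_pos t
    hasDerivAt := by
      refine ⟨∅, Set.countable_empty, fun t _ => ?_⟩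
      have h := ((hasDerivAt_pow 2 t).const_add 1).rpow_const (p := (1 - α) / 2)
        (Or.inl (one_add_sq_pos t).ne')
      convert! h using 1
      · ext t; simp only [PearsonCoeff.q, zero_mul, add_zero, one_mul]; exact hq t
      · have : (1 - α) / 2 - 1 = -(α + 1) / 2 := by ring
        simp only [PearsonCoeff.r, this]; push_cast; ring
    integrable := fun j hj => by
      have hj' : (j : ℝ) ≤ N := by exact_mod_cast hj
      have h := integrable_rpow_neg_one_add_norm_sq (E := ℝ) (μ := volume) (r := α + 1 - j)
        (by simp; linarith)
      refine h.mono' (by fun_prop) (Filter.Eventually.of_forall fun t => ?_)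
      rw [norm_mul, norm_pow, Real.norm_eq_abs, Real.norm_eq_abs, abs_of_nonneg (Real.rpow_nonneg (one_add_sq_pos t).le _),
        sq_abs, show -(α + 1 - j) / 2 = -(α + 1) / 2 + (j : ℝ) / 2 by ring,
        Real.rpow_add (one_add_sq_pos t)]
      gcongr
      exact abs_pow_le_one_add_sq_rpow t j
    tendsto_atBot := fun j hj => hlim j hj _ Filter.tendsto_abs_atBot_atTop
    tendsto_atTop := fun j hj => hlim j hj _ Filter.tendsto_abs_atTop_atTop }

theorem tendsto_of_eq_zero_above {u : ℝ → ℝ} {b : ℝ} (h : ∀ t, b < t → u t = 0) :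
    Filter.Tendsto u Filter.atTop (nhds 0) :=
  tendsto_const_nhds.congr' ((Filter.eventually_gt_atTop b).mono fun t ht => (h t ht).symm)

theorem tendsto_of_eq_zero_below {u : ℝ → ℝ} {b : ℝ} (h : ∀ t, t < b → u t = 0) :
    Filter.Tendsto u Filter.atBot (nhds 0) :=
  tendsto_const_nhds.congr' ((Filter.eventually_lt_atBot b).mono fun t ht => (h t ht).symm)

/-- The derivative of a function given by `v` on an open set and by `0` off it, away from the boundary
of this set. -/
theorem hasDerivAt_of_eq_zero_off {u v : ℝ → ℝ} {d : ℝ} {I : Set ℝ} (hI : IsOpen I) {t : ℝ}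
    (hin : t ∈ I → HasDerivAt v d t) (huv : ∀ t ∈ I, u t = v t)
    (hout : t ∉ I → t ∈ interior Iᶜ) (hu : ∀ t ∉ I, u t = 0) (hd : t ∉ I → d = 0) :
    HasDerivAt u d t := by
  by_cases ht : t ∈ I
  · exact (hin ht).congr_of_eventuallyEq
      (Filter.eventuallyEq_of_mem (hI.mem_nhds ht) huv)
  · rw [hd ht]
    exact (hasDerivAt_const t 0).congr_of_eventuallyEq
      (Filter.eventuallyEq_of_mem (mem_interior_iff_mem_nhds.1 (hout ht)) hu)

theorem isPearsonWeight_laguerre (N : ℕ) {a : ℝ} (ha : -1 < a) :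
    IsPearsonWeight ⟨0, 1, 0, (a + 1) / 2, -1 / 2⟩ N
      ((Set.Ioi 0).indicator fun x => x ^ ((a - 1) / 2) * Real.exp (-x / 2)) := by
  have hz : ∀ t ∉ Set.Ioi (0 : ℝ), ((Set.Ioi 0).indicator
      fun x : ℝ => x ^ ((a - 1) / 2) * Real.exp (-x / 2)) t = 0 :=
    fun t ht => Set.indicator_of_notMem ht _
  have hq : ∀ t ∈ Set.Ioi (0 : ℝ), t * (t ^ ((a - 1) / 2) * Real.exp (-t / 2)) =
      t ^ ((a + 1) / 2) * Real.exp (-t / 2) := fun t ht => by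
    rw [← mul_assoc, ← Real.rpow_one_add' (le_of_lt ht) (by intro h; linarith)]
    congr 2; ring
  exact {
    measurable := Measurable.indicator (by fun_prop) measurableSet_Ioi
    nonneg := fun t => Set.indicator_nonneg (fun t ht =>
      mul_nonneg (Real.rpow_nonneg (le_of_lt ht) _) (Real.exp_pos _).le) t
    exists_open := ⟨Set.Ioi 0, isOpen_Ioi, ⟨1, Set.mem_Ioi.2 one_pos⟩, fun t ht => by
      rw [Set.indicator_of_mem ht]
      exact mul_pos (Real.rpow_pos_of_pos ht _) (Real.exp_pos _)⟩
    q_pos := fun t ht => by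
      have := Set.mem_of_indicator_ne_zero ht
      simpa [PearsonCoeff.q] using this
    hasDerivAt := by
      refine ⟨{0}, Set.countable_singleton 0, fun t ht => ?_⟩
      refine hasDerivAt_of_eq_zero_off (I := Set.Ioi 0)
        (v := fun t => t ^ ((a + 1) / 2) * Real.exp (-t / 2)) isOpen_Ioi (fun h => ?_)
        (fun s hs => ?_) (fun h => ?_) (fun s hs => by simp only [hz s hs, mul_zero])
        fun h => by rw [hz t h, mul_zero]
      · have h' : t ≠ 0 := ne_of_gt h
        have h1 := (Real.hasDerivAt_rpow_const (p := (a + 1) / 2) (Or.inl h')).mul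
          (((hasDerivAt_id t).neg.div_const 2).exp)
        convert! h1 using 1
        rw [Set.indicator_of_mem h]
        have h2 := hq t h
        have : (a + 1) / 2 - 1 = (a - 1) / 2 := by ring
        simp only [PearsonCoeff.r, this, Pi.neg_apply, id] at h2 ⊢
        linear_combination (-1 / 2) * h2
      · simp only [Set.indicator_of_mem hs, PearsonCoeff.q, zero_add, one_mul, zero_mul, add_zero]
        exact hq s hs
      · rw [Set.compl_Ioi, interior_Iic]
        exact lt_of_le_of_ne (not_lt.1 h) ht
    integrable := fun j _ => by
      have h := integrableOn_rpow_mul_exp_neg_mul_rpow (p := 1) (s := (a - 1) / 2 + j)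
        (b := 1 / 2) (by have : (0 : ℝ) ≤ j := j.cast_nonneg
                         linarith) one_pos (by norm_num)
      rw [← integrable_indicator_iff measurableSet_Ioi] at h
      refine h.congr (Filter.Eventually.of_forall fun t => ?_)
      by_cases ht : t ∈ Set.Ioi (0 : ℝ)
      · simp only [Set.indicator_of_mem ht, Real.rpow_one]
        rw [Real.rpow_add ht, Real.rpow_natCast, show -(1 / 2) * t = -t / 2 by ring]
        ring
      · simp only [Set.indicator_of_notMem ht, zero_mul]
    tendsto_atBot := fun j _ => tendsto_of_eq_zero_below (b := 0) fun t ht => by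
      rw [hz t (by simpa using ht.le)]; ring
    tendsto_atTop := fun j _ => by
      have h := tendsto_rpow_mul_exp_neg_mul_atTop_nhds_zero ((a + 1) / 2 + j) (1 / 2) (by norm_num)
      refine h.congr' ((Filter.eventually_gt_atTop 0).mono fun t ht => ?_)
      simp only [Set.indicator_of_mem (Set.mem_Ioi.2 ht)]
      rw [Real.rpow_add ht, Real.rpow_natCast,
        show -(1 / 2) * t = -t / 2 by ring]
      simp only [PearsonCoeff.q, zero_add, one_mul, zero_mul, add_zero]
      rw [hq t ht]; ring }

theorem continuous_laguerre {a : ℝ} (ha : -1 < a) : Continuous fun t =>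
    (PearsonCoeff.mk 0 1 0 ((a + 1) / 2) (-1 / 2)).q t *
      (Set.Ioi 0).indicator (fun x => x ^ ((a - 1) / 2) * Real.exp (-x / 2)) t := by
  have h : Continuous fun t : ℝ => max t 0 ^ ((a + 1) / 2) * Real.exp (-t / 2) := by
    refine Continuous.mul (Continuous.rpow_const (by fun_prop) fun t => Or.inr (by linarith))
      (by fun_prop)
  convert! h using 1
  ext t
  simp only [PearsonCoeff.q, zero_add, one_mul, zero_mul, add_zero]
  by_cases ht : 0 < t
  · rw [Set.indicator_of_mem (by exact ht), max_eq_left ht.le, ← mul_assoc,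
      ← Real.rpow_one_add' ht.le (by intro h; linarith)]
    congr 2; ring
  · rw [Set.indicator_of_notMem (by exact ht), max_eq_right (not_lt.1 ht),
      Real.zero_rpow (by intro h; linarith)]
    ring

theorem isPearsonWeight_exp (N : ℕ) : IsPearsonWeight ⟨1, 0, 0, -1 / 2, 0⟩ N
    ((Set.Ioi 0).indicator fun x => Real.exp (-x / 2)) := by
  have hz : ∀ t ∉ Set.Ioi (0 : ℝ), ((Set.Ioi 0).indicator
      fun x : ℝ => Real.exp (-x / 2)) t = 0 :=
    fun t ht => Set.indicator_of_notMem ht _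
  -- The exponential is the Laguerre weight with `a = 1`.
  have hL := isPearsonWeight_laguerre N (a := 1) (by norm_num)
  have he : ((Set.Ioi 0).indicator fun x : ℝ => x ^ (((1 : ℝ) - 1) / 2) * Real.exp (-x / 2)) =
      (Set.Ioi 0).indicator fun x => Real.exp (-x / 2) := by simp
  rw [he] at hL
  exact {
    measurable := hL.measurable
    nonneg := hL.nonneg
    exists_open := hL.exists_open
    q_pos := fun t ht => by simp [PearsonCoeff.q]
    hasDerivAt := by
      refine ⟨{0}, Set.countable_singleton 0, fun t ht => ?_⟩
      refine hasDerivAt_of_eq_zero_off (I := Set.Ioi 0)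
        (v := fun t => Real.exp (-t / 2)) isOpen_Ioi (fun h => ?_)
        (fun s hs => ?_) (fun h => ?_) (fun s hs => by simp only [hz s hs, mul_zero])
        fun h => by rw [hz t h, mul_zero]
      · have h1 := ((hasDerivAt_id t).neg.div_const 2).exp
        convert! h1 using 1
        rw [Set.indicator_of_mem h]
        simp only [PearsonCoeff.r, Pi.neg_apply, id]
        ring
      · simp [Set.indicator_of_mem hs, PearsonCoeff.q]
      · rw [Set.compl_Ioi, interior_Iic]
        exact lt_of_le_of_ne (not_lt.1 h) ht
    integrable := hL.integrable
    tendsto_atBot := fun j _ => tendsto_of_eq_zero_below (b := 0) fun t ht => by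
      rw [hz t (by simpa using ht.le)]; ring
    tendsto_atTop := fun j _ => by
      have h := tendsto_rpow_mul_exp_neg_mul_atTop_nhds_zero j (1 / 2) (by norm_num)
      refine h.congr' ((Filter.eventually_gt_atTop 0).mono fun t ht => ?_)
      simp only [Set.indicator_of_mem (Set.mem_Ioi.2 ht)]
      rw [Real.rpow_natCast,
        show -(1 / 2) * t = -t / 2 by ring]
      simp only [PearsonCoeff.q, zero_mul, add_zero]
      ring }

theorem integrableOn_rpow_mul_one_sub_rpow {p s : ℝ} (hp : -1 < p) (hs : -1 < s) :
    IntegrableOn (fun x : ℝ => x ^ p * (1 - x) ^ s) (Set.Ioo 0 1) := by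
  have h := Complex.betaIntegral_convergent (u := (p + 1 : ℝ)) (v := (s + 1 : ℝ))
    (by simp; linarith) (by simp; linarith)
  rw [intervalIntegrable_iff_integrableOn_Ioo_of_le zero_le_one] at h
  refine IntegrableOn.congr_fun (Integrable.norm h) (fun x hx => ?_) measurableSet_Ioo
  have h1 : 0 < 1 - x := by linarith [hx.2]
  rw [norm_mul, show (1 - (x : ℂ)) = ((1 - x : ℝ) : ℂ) by push_cast; ring,
    Complex.norm_cpow_eq_rpow_re_of_pos hx.1, Complex.norm_cpow_eq_rpow_re_of_pos h1]
  simp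

/-- Weights on the unit interval. The hypotheses `hq` and `hr` say that `q` raises the exponents `p`
and `s` to `p'` and `s'`, and that `r` is determined by the Pearson equation. -/
theorem isPearsonWeight_unit {P : PearsonCoeff} (N : ℕ) {p s p' s' : ℝ} (hp : -1 < p)
    (hs : -1 < s) (hpos : ∀ t ∈ Set.Ioo (0 : ℝ) 1, 0 < P.q t)
    (hq : ∀ t ∈ Set.Ioo (0 : ℝ) 1, P.q t * (t ^ p * (1 - t) ^ s) = t ^ p' * (1 - t) ^ s')
    (hr : ∀ t ∈ Set.Ioo (0 : ℝ) 1, P.r t * (t ^ p * (1 - t) ^ s) =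
      p' * t ^ (p' - 1) * (1 - t) ^ s' - t ^ p' * (s' * (1 - t) ^ (s' - 1))) :
    IsPearsonWeight P N ((Set.Ioo 0 1).indicator fun x => x ^ p * (1 - x) ^ s) := by
  have hz : ∀ t ∉ Set.Ioo (0 : ℝ) 1, ((Set.Ioo 0 1).indicator
      fun x : ℝ => x ^ p * (1 - x) ^ s) t = 0 :=
    fun t ht => Set.indicator_of_notMem ht _
  have h1 : ∀ t ∈ Set.Ioo (0 : ℝ) 1, 0 < 1 - t := fun t ht => by linarith [ht.2]
  have hz0 : ∀ t < 0, ((Set.Ioo 0 1).indicator fun x : ℝ => x ^ p * (1 - x) ^ s) t = 0 :=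
    fun t ht => hz t fun h => by linarith [h.1]
  have hz1 : ∀ t > 1, ((Set.Ioo 0 1).indicator fun x : ℝ => x ^ p * (1 - x) ^ s) t = 0 :=
    fun t ht => hz t fun h => by linarith [h.2]
  exact {
    measurable := Measurable.indicator (by fun_prop) measurableSet_Ioo
    nonneg := fun t => Set.indicator_nonneg (fun t ht =>
      mul_nonneg (Real.rpow_nonneg ht.1.le _) (Real.rpow_nonneg (h1 t ht).le _)) t
    exists_open := ⟨Set.Ioo 0 1, isOpen_Ioo, Set.nonempty_Ioo.2 one_pos, fun t ht => by
      rw [Set.indicator_of_mem ht]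
      exact mul_pos (Real.rpow_pos_of_pos ht.1 _) (Real.rpow_pos_of_pos (h1 t ht) _)⟩
    q_pos := fun t ht => hpos t (Set.mem_of_indicator_ne_zero ht)
    hasDerivAt := by
      refine ⟨{0, 1}, (Set.countable_singleton 1).insert 0, fun t ht => ?_⟩
      refine hasDerivAt_of_eq_zero_off (I := Set.Ioo 0 1)
        (v := fun t => t ^ p' * (1 - t) ^ s') isOpen_Ioo (fun h => ?_)
        (fun s hs => ?_) (fun h => ?_) (fun s hs => by simp only [hz s hs, mul_zero])
        fun h => by rw [hz t h, mul_zero]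
      · have h2 := (Real.hasDerivAt_rpow_const (p := p') (Or.inl h.1.ne')).mul
          (((hasDerivAt_id t).const_sub 1).rpow_const (p := s') (Or.inl (h1 t h).ne'))
        convert! h2 using 1
        rw [Set.indicator_of_mem h, hr t h]
        simp only [id]
        ring
      · rw [Set.indicator_of_mem hs]
        exact hq s hs
      · simp only [Set.mem_insert_iff, Set.mem_singleton_iff, not_or] at ht
        rw [mem_interior_iff_mem_nhds]
        rcases lt_or_gt_of_ne ht.1 with h0 | h0
        · exact Filter.mem_of_superset (Iio_mem_nhds h0) fun x hx hx' =>
            lt_asymm (Set.mem_Iio.1 hx) hx'.1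
        · have h3 : 1 < t := lt_of_le_of_ne (not_lt.1 fun h4 => h ⟨h0, h4⟩) (Ne.symm ht.2)
          exact Filter.mem_of_superset (Ioi_mem_nhds h3) fun x hx hx' =>
            lt_asymm (Set.mem_Ioi.1 hx) hx'.2
    integrable := fun j _ => by
      have h := integrableOn_rpow_mul_one_sub_rpow (p := p + j) (s := s)
        (by have : (0 : ℝ) ≤ j := j.cast_nonneg
            linarith) hs
      rw [← integrable_indicator_iff measurableSet_Ioo] at h
      refine h.congr (Filter.Eventually.of_forall fun t => ?_)
      by_cases ht : t ∈ Set.Ioo (0 : ℝ) 1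
      · simp only [Set.indicator_of_mem ht]
        rw [Real.rpow_add ht.1, Real.rpow_natCast]
        ring
      · simp only [Set.indicator_of_notMem ht, zero_mul]
    tendsto_atBot := fun j _ => tendsto_of_eq_zero_below (b := 0) fun t ht => by
      rw [hz0 t ht]; ring
    tendsto_atTop := fun j _ => tendsto_of_eq_zero_above (b := 1) fun t ht => by
      rw [hz1 t ht]; ring }

/-- On the support, `q = t (1 - t)` vanishes at both ends. -/
theorem isPearsonWeight_jacobi (N : ℕ) {p s : ℝ} (hp : -1 < p) (hs : -1 < s) :
    IsPearsonWeight ⟨0, 1, -1, p + 1, -(p + s + 2)⟩ N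
      ((Set.Ioo 0 1).indicator fun x => x ^ p * (1 - x) ^ s) := by
  refine isPearsonWeight_unit (p' := p + 1) (s' := s + 1) N hp hs (fun t ht => ?_) (fun t ht => ?_)
    fun t ht => ?_
  · have := mul_pos ht.1 (sub_pos.2 ht.2)
    simp only [PearsonCoeff.q]; linarith
  · rw [Real.rpow_add_one ht.1.ne', Real.rpow_add_one (sub_pos.2 ht.2).ne']
    simp only [PearsonCoeff.q]; ring
  · rw [add_sub_cancel_right, add_sub_cancel_right, Real.rpow_add_one ht.1.ne',
      Real.rpow_add_one (sub_pos.2 ht.2).ne']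
    simp only [PearsonCoeff.r]; ring

/-- Here `q = t` vanishes at the lower end of the support only. -/
theorem isPearsonWeight_lower (N : ℕ) {p : ℝ} (hp : -1 < p) :
    IsPearsonWeight ⟨0, 1, 0, p + 1, 0⟩ N ((Set.Ioo 0 1).indicator fun x => x ^ p) := by
  have h := isPearsonWeight_unit (P := ⟨0, 1, 0, p + 1, 0⟩) (p' := p + 1) (s' := 0) N hp
    (s := 0) (by norm_num) (fun t ht => by simpa [PearsonCoeff.q] using ht.1) (fun t ht => by
      rw [Real.rpow_add_one ht.1.ne']
      simp only [PearsonCoeff.q]; ring) fun t ht => by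
      rw [add_sub_cancel_right]
      simp [PearsonCoeff.r]
  simpa using h

/-- Here `q = 1 - t` vanishes at the upper end of the support only. -/
theorem isPearsonWeight_upper (N : ℕ) {s : ℝ} (hs : -1 < s) :
    IsPearsonWeight ⟨1, -1, 0, -(s + 1), 0⟩ N ((Set.Ioo 0 1).indicator fun x => (1 - x) ^ s) := by
  have h := isPearsonWeight_unit (P := ⟨1, -1, 0, -(s + 1), 0⟩) (p' := 0) (s' := s + 1) N
    (p := 0) (by norm_num) hs (fun t ht => by
      have := ht.2
      simp only [PearsonCoeff.q]; linarith) (fun t ht => by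
      rw [Real.rpow_add_one (sub_pos.2 ht.2).ne']
      simp only [PearsonCoeff.q]; ring) fun t ht => by
      rw [add_sub_cancel_right]
      simp [PearsonCoeff.r]; ring
  simpa using h

theorem isPearsonWeight_one (N : ℕ) :
    IsPearsonWeight ⟨1, 0, 0, 0, 0⟩ N ((Set.Ioo 0 1).indicator fun _ => 1) := by
  have h := isPearsonWeight_unit (P := ⟨1, 0, 0, 0, 0⟩) (p' := 0) (s' := 0) N
    (p := 0) (by norm_num) (s := 0) (by norm_num) (fun t ht => by simp [PearsonCoeff.q])
    (fun t ht => by simp [PearsonCoeff.q]) fun t ht => by simp [PearsonCoeff.r]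
  simpa using h

theorem continuous_jacobi {p s : ℝ} (hp : -1 < p) (hs : -1 < s) : Continuous fun t =>
    (PearsonCoeff.mk 0 1 (-1) (p + 1) (-(p + s + 2))).q t *
      (Set.Ioo 0 1).indicator (fun x => x ^ p * (1 - x) ^ s) t := by
  have h : Continuous fun t : ℝ => max t 0 ^ (p + 1) * max (1 - t) 0 ^ (s + 1) := by
    exact Continuous.mul (Continuous.rpow_const (by fun_prop) fun t => Or.inr (by linarith))
      (Continuous.rpow_const (by fun_prop) fun t => Or.inr (by linarith))
  convert! h using 1
  ext t
  simp only [PearsonCoeff.q]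
  by_cases ht : t ∈ Set.Ioo (0 : ℝ) 1
  · rw [Set.indicator_of_mem ht, max_eq_left ht.1.le, max_eq_left (sub_pos.2 ht.2).le,
      Real.rpow_add_one ht.1.ne', Real.rpow_add_one (sub_pos.2 ht.2).ne']
    ring
  · rw [Set.indicator_of_notMem ht, mul_zero]
    rcases not_and_or.1 ht with h | h
    · rw [max_eq_right (not_lt.1 h), Real.zero_rpow (by linarith), zero_mul]
    · rw [max_eq_right (a := 1 - t) (by linarith), Real.zero_rpow (x := s + 1) (by linarith),
        mul_zero]

theorem continuousOn_lower {p : ℝ} (hp : -1 < p) {y : ℝ} (hy : y < 1) : ContinuousOn (fun t =>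
    (PearsonCoeff.mk 0 1 0 (p + 1) 0).q t * (Set.Ioo 0 1).indicator (fun x => x ^ p) t)
      (Set.Iic y) := by
  have h : Continuous fun t : ℝ => max t 0 ^ (p + 1) :=
    Continuous.rpow_const (by fun_prop) fun t => Or.inr (by linarith)
  refine h.continuousOn.congr fun t (hty : t ≤ y) => ?_
  simp only [PearsonCoeff.q]
  by_cases ht : 0 < t
  · rw [Set.indicator_of_mem (by exact ⟨ht, by linarith⟩), max_eq_left ht.le,
      Real.rpow_add_one ht.ne']
    ring
  · rw [Set.indicator_of_notMem fun h => ht h.1, max_eq_right (not_lt.1 ht),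
      Real.zero_rpow (by linarith), mul_zero]

theorem continuousOn_upper {s : ℝ} (hs : -1 < s) {y : ℝ} (hy : 0 < y) : ContinuousOn (fun t =>
    (PearsonCoeff.mk 1 (-1) 0 (-(s + 1)) 0).q t *
      (Set.Ioo 0 1).indicator (fun x => (1 - x) ^ s) t) (Set.Ici y) := by
  have h : Continuous fun t : ℝ => max (1 - t) 0 ^ (s + 1) :=
    Continuous.rpow_const (by fun_prop) fun t => Or.inr (by linarith)
  refine h.continuousOn.congr fun t (hty : y ≤ t) => ?_
  simp only [PearsonCoeff.q]
  by_cases ht : t < 1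
  · rw [Set.indicator_of_mem (by exact ⟨by linarith, ht⟩), max_eq_left (sub_pos.2 ht).le,
      Real.rpow_add_one (sub_pos.2 ht).ne']
    ring
  · rw [Set.indicator_of_notMem fun h => ht h.2, max_eq_right (a := 1 - t) (by linarith),
      Real.zero_rpow (by linarith), mul_zero]

theorem continuousOn_exp {y : ℝ} (hy : 0 < y) : ContinuousOn (fun t =>
    (PearsonCoeff.mk 1 0 0 (-1 / 2) 0).q t *
      (Set.Ioi 0).indicator (fun x => Real.exp (-x / 2)) t) (Set.Ici y) := by
  have h : Continuous fun t : ℝ => Real.exp (-t / 2) := by fun_prop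
  refine h.continuousOn.congr fun t (hty : y ≤ t) => ?_
  rw [Set.indicator_of_mem (Set.mem_Ioi.2 (hy.trans_le hty))]
  simp [PearsonCoeff.q]

/-! ### The listed pairs -/

theorem rpow_sub_one_div_two_sq {t : ℝ} (ht : 0 < t) (a : ℝ) :
    t ^ a = t * (t ^ ((a - 1) / 2)) ^ 2 := by
  rw [← Real.rpow_mul_natCast ht.le]
  nth_rewrite 2 [← Real.rpow_one t]
  rw [← Real.rpow_add ht]
  congr 1; push_cast; ring

theorem even_succ_of_evenSuccPair {n : ℕ} {f g : ℝ → ℝ} (h : EvenSuccPair n f g) :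
    EvenUnionSucc n f g ∧ EvenSingleSucc n f g := by
  rcases h with h | ⟨a, ha, h⟩ | ⟨a, ha, b, hb, h⟩ | ⟨α, hα, h⟩
  · refine even_succ_of_isPearsonWeight (isPearsonWeight_gaussian _) (fun t => ?_) h ?_
      fun j _ => by simp
    · simp only [PearsonCoeff.q]
      rw [← Real.exp_nat_mul]
      simp only [zero_mul, add_zero, one_mul]
      congr 1; push_cast; ring
    · simp only [PearsonCoeff.q]; fun_prop
  · refine even_succ_of_isPearsonWeight (isPearsonWeight_laguerre _ ha) (fun t => ?_) h
      (continuous_laguerre ha) fun j _ => by norm_num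
    by_cases ht : 0 < t
    · rw [Set.indicator_of_mem (by exact ht), Set.indicator_of_mem (by exact ht), mul_pow,
        ← Real.exp_nat_mul, ← Real.rpow_mul_natCast ht.le,
        show a = 1 + (a - 1) / 2 * (2 : ℕ) by push_cast; ring, Real.rpow_add ht, Real.rpow_one]
      simp only [PearsonCoeff.q]
      rw [show ((2 : ℕ) : ℝ) * (-t / 2) = -t by push_cast; ring]
      push_cast
      ring_nf
    · rw [Set.indicator_of_notMem (by exact ht), Set.indicator_of_notMem (by exact ht)]; ring
  · have hp : -1 < (a - 1) / 2 := by linarith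
    have hs : -1 < (b - 1) / 2 := by linarith
    refine even_succ_of_isPearsonWeight (isPearsonWeight_jacobi _ hp hs) (fun t => ?_) h
      (continuous_jacobi hp hs) fun j _ h0 => ?_
    · by_cases ht : t ∈ Set.Ioo (0 : ℝ) 1
      · have h1 := sub_pos.2 ht.2
        rw [Set.indicator_of_mem ht, Set.indicator_of_mem ht, mul_pow,
          rpow_sub_one_div_two_sq ht.1, rpow_sub_one_div_two_sq h1]
        simp only [PearsonCoeff.q]
        ring
      · rw [Set.indicator_of_notMem ht, Set.indicator_of_notMem ht]; ring
    · simp only at h0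
      have : (0 : ℝ) ≤ j := j.cast_nonneg
      linarith
  · refine even_succ_of_isPearsonWeight (isPearsonWeight_cauchy (by exact_mod_cast hα))
      (fun t => ?_) h ?_ fun j hj h0 => ?_
    · have h1 := one_add_sq_pos t
      rw [← Real.rpow_mul_natCast h1.le]
      simp only [PearsonCoeff.q, zero_mul, add_zero, one_mul]
      rw [show -α = 1 + -(α + 1) / 2 * (2 : ℕ) by push_cast; ring, Real.rpow_add h1, Real.rpow_one]
    · simp only [PearsonCoeff.q]
      refine Continuous.mul (by fun_prop) (Continuous.rpow_const (by fun_prop)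
        fun t => Or.inl (one_add_sq_pos t).ne')
    · simp only at h0
      have : (j : ℝ) + 1 ≤ 2 * n := by exact_mod_cast hj
      linarith

theorem even_same_of_evenSamePair {n : ℕ} {f g : ℝ → ℝ} (h : EvenSamePair f g) :
    EvenUnionSame n f g ∧ EvenSingle n f g := by
  rcases h with h | ⟨a, ha, h⟩
  · refine even_same_of_isPearsonWeight (isPearsonWeight_exp _) (fun t => ?_) h (fun y hy =>
      continuousOn_exp (Set.mem_of_indicator_ne_zero hy)) rfl rfl fun j _ => by norm_num
    by_cases ht : 0 < t
    · rw [Set.indicator_of_mem (by exact ht), Set.indicator_of_mem (by exact ht),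
        ← Real.exp_nat_mul]
      simp only [PearsonCoeff.q, zero_mul, add_zero, one_mul]
      congr 1; push_cast; ring
    · rw [Set.indicator_of_notMem (by exact ht), Set.indicator_of_notMem (by exact ht)]; ring
  · refine even_same_of_isPearsonWeight (isPearsonWeight_upper _ (s := (a - 1) / 2)
      (by linarith)) (fun t => ?_) h (fun y hy => continuousOn_upper (by linarith)
      (Set.mem_of_indicator_ne_zero hy).1) rfl rfl fun j _ h0 => ?_
    · by_cases ht : t ∈ Set.Ioo (0 : ℝ) 1
      · rw [Set.indicator_of_mem ht, Set.indicator_of_mem ht,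
          rpow_sub_one_div_two_sq (sub_pos.2 ht.2)]
        simp only [PearsonCoeff.q]; ring
      · rw [Set.indicator_of_notMem ht, Set.indicator_of_notMem ht]; ring
    · simp only at h0
      have : (0 : ℝ) ≤ j := j.cast_nonneg
      linarith

theorem odd_same_of_oddSamePair {n : ℕ} {f g : ℝ → ℝ} (h : OddSamePair f g) :
    OddUnionSame n f g ∧ OddSingle n f g := by
  obtain ⟨a, ha, h⟩ := h
  refine odd_same_of_isPearsonWeight (isPearsonWeight_lower _ (p := (a - 1) / 2)
    (by linarith)) (fun t => ?_) h (fun y hy => continuousOn_lower (by linarith)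
    (Set.mem_of_indicator_ne_zero hy).2) rfl rfl fun j _ h0 => ?_
  · by_cases ht : t ∈ Set.Ioo (0 : ℝ) 1
    · rw [Set.indicator_of_mem ht, Set.indicator_of_mem ht, rpow_sub_one_div_two_sq ht.1]
      simp only [PearsonCoeff.q]; ring
    · rw [Set.indicator_of_notMem ht, Set.indicator_of_notMem ht]; ring
  · simp only at h0
    have : (0 : ℝ) ≤ j := j.cast_nonneg
    linarith

theorem odd_pred_of_oddPredPair {n : ℕ} (hn : 1 ≤ n) {f g : ℝ → ℝ} (h : OddPredPair f g) :
    OddUnionPred n hn f g ∧ OddSinglePred n hn f g := by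
  have hf₀ := isPearsonWeight_one (2 * n)
  obtain ⟨c, hc, C, hC, hf, hP, hw⟩ := pearsonPair_of_isPairRescaling hf₀
    (fun t => by by_cases ht : t ∈ Set.Ioo (0 : ℝ) 1 <;> simp [ht, PearsonCoeff.q]) h
  have hmem : ∀ t, f t ≠ 0 → c * t ∈ Set.Ioo (0 : ℝ) 1 := fun t ht => by
    by_contra h0
    exact ht (by rw [hf]; simp only [Set.indicator_of_notMem h0, mul_zero])
  have hval : ∀ t, c * t ∈ Set.Ioo (0 : ℝ) 1 → f t = C := fun t ht => by
    rw [hf]; simp only [Set.indicator_of_mem ht, mul_one]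
  refine hP.odd_pred hn (by simp [PearsonCoeff.scale]) hC (fun s t u hs hu hst htu => hval t
    ⟨(hmem s hs).1.trans (mul_lt_mul_of_pos_left hst hc),
      (mul_lt_mul_of_pos_left htu hc).trans (hmem u hu).2⟩) (fun t ht => hval t (hmem t ht))
    fun j hj => hw.integrable j hj.le

/-! ### The integral over the gaps as a function of the kept points -/

theorem abs_vdm_le {N : ℕ} (x : Fin N → ℝ) : |vdm x| ≤ ∏ i, (1 + |x i|) ^ (N - 1) := by
  have hpow : ∀ (i : Fin N) (a : ℝ), ∏ j : Fin N, (if i = j then 1 else a) = a ^ (N - 1) := by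
    intro i a
    rw [prod_ite, prod_const_one, one_mul, prod_const]
    congr 1
    rw [filter_ne, card_erase_of_mem (mem_univ i), card_univ, Fintype.card_fin]
  have h0 : 0 ≤ ∏ i, (1 + |x i|) ^ (N - 1) := prod_nonneg fun i _ => by positivity
  refine (pow_le_pow_iff_left₀ (abs_nonneg _) h0 two_ne_zero).1 ?_
  have h1 : (∏ i, (1 + |x i|) ^ (N - 1)) ^ 2 =
      ∏ i, ∏ j, if i = j then 1 else (1 + |x i|) * (1 + |x j|) := by
    have e1 : ∀ i j : Fin N, (if i = j then 1 else (1 + |x i|) * (1 + |x j|)) =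
        (if i = j then 1 else 1 + |x i|) * (if j = i then 1 else 1 + |x j|) := fun i j => by
      simp only [eq_comm (a := j)]; split_ifs <;> simp
    simp only [e1, prod_mul_distrib]
    rw [prod_comm (f := fun i j : Fin N => if j = i then (1 : ℝ) else 1 + |x j|)]
    simp only [hpow]
    ring
  rw [sq_abs_vdm, h1, pairProd]
  refine prod_le_prod (fun i _ => prod_nonneg fun j _ => by split_ifs <;> positivity) fun i _ =>
    prod_le_prod (fun j _ => by split_ifs <;> positivity) fun j _ => ?_
  split_ifs
  · exact le_rfl
  · refine (abs_sub _ _).trans ?_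
    nlinarith [abs_nonneg (x i), abs_nonneg (x j)]

theorem pow_le_abs_vdm {N : ℕ} {x : Fin N → ℝ} {η : ℝ} (h0 : 0 ≤ η) (h1 : η ≤ 1)
    (h : ∀ i j, i < j → η ≤ |x i - x j|) : η ^ (N * N) ≤ |vdm x| := by
  rw [abs_vdm]
  have : η ^ (N * N) = ∏ _i : Fin N, ∏ _j : Fin N, η := by simp [pow_mul]
  rw [this]
  refine prod_le_prod (fun i _ => prod_nonneg fun j _ => h0) fun i _ =>
    prod_le_prod (fun j _ => h0) fun j _ => ?_
  split_ifs with hij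
  · exact h i j hij
  · exact h1

theorem abs_vdm_cons {N : ℕ} (s : ℝ) (y : Fin N → ℝ) :
    |vdm (Fin.cons s y : Fin (N + 1) → ℝ)| = (∏ i, |s - y i|) * |vdm y| := by
  rw [abs_vdm, Fin.prod_univ_succ]
  congr 1
  · rw [Fin.prod_univ_succ]
    simp
  · rw [abs_vdm]
    refine prod_congr rfl fun i _ => ?_
    rw [Fin.prod_univ_succ]
    simp

theorem abs_vdm_snoc {N : ℕ} (y : Fin N → ℝ) (s : ℝ) :
    |vdm (Fin.snoc (α := fun _ => ℝ) y s : Fin (N + 1) → ℝ)| = (∏ i, |s - y i|) * |vdm y| := by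
  rw [← abs_vdm_cons, Fin.snoc_eq_cons_rotate]
  exact abs_vdm_comp_perm _ _

variable {κ m p h : ℕ} {f : ℝ → ℝ}

/-- The density of the points `x` in the gaps of `y`. For `κ = 0` this is the one belonging to two
superposed orthogonal ensembles, for `κ = 1` the one belonging to a single one. -/
def gapKernel (κ : ℕ) (f : ℝ → ℝ) (y : Fin m → ℝ) (x : Fin p → ℝ) : ℝ :=
  (∏ j, f (x j)) * |vdm x| * ∏ j, ∏ i, |y i - x j| ^ κ

/-- The integral of `gapKernel` over the gaps of `y`. -/
def gapIntegral (κ h p : ℕ) (f : ℝ → ℝ) (y : Fin m → ℝ) : ℝ :=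
  ∫ x in Set.univ.pi fun i : Fin p => gap h y i, gapKernel κ f y x

theorem gapKernel_nonneg (hf0 : ∀ t, 0 ≤ f t) (y : Fin m → ℝ) (x : Fin p → ℝ) :
    0 ≤ gapKernel κ f y x :=
  mul_nonneg (mul_nonneg (prod_nonneg fun j _ => hf0 _) (abs_nonneg _))
    (prod_nonneg fun j _ => prod_nonneg fun i _ => by positivity)

theorem measurable_gapKernel (hf : Measurable f) (y : Fin m → ℝ) :
    Measurable fun x : Fin p → ℝ => gapKernel κ f y x := by
  have := measurable_vdm (N := p)
  unfold gapKernel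
  fun_prop

theorem measurableSet_pi_gap (y : Fin m → ℝ) :
    MeasurableSet (Set.univ.pi fun i : Fin p => gap h y i) :=
  MeasurableSet.univ_pi fun i : Fin p => measurableSet_gap h y i

theorem prod_abs_sub_le (κ : ℕ) (y : Fin m → ℝ) (t : ℝ) :
    ∏ i, |y i - t| ^ κ ≤ (∏ i, (1 + |y i|) ^ κ) * (1 + |t|) ^ (κ * m) := by
  have : (1 + |t|) ^ (κ * m) = ∏ _i : Fin m, (1 + |t|) ^ κ := by simp [pow_mul]
  rw [this, ← prod_mul_distrib]
  refine prod_le_prod (fun i _ => by positivity) fun i _ => ?_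
  rw [← mul_pow]
  refine pow_le_pow_left₀ (abs_nonneg _) ((abs_sub _ _).trans ?_) κ
  nlinarith [abs_nonneg (y i), abs_nonneg t]

/-- The factors of a product bound for `gapKernel`. -/
def gapFactor (κ p : ℕ) (f : ℝ → ℝ) (y : Fin m → ℝ) (t : ℝ) : ℝ :=
  f t * (1 + |t|) ^ (p - 1) * ∏ i, |y i - t| ^ κ

theorem gapFactor_nonneg (hf0 : ∀ t, 0 ≤ f t) (y : Fin m → ℝ) (t : ℝ) :
    0 ≤ gapFactor κ p f y t :=
  mul_nonneg (mul_nonneg (hf0 t) (by positivity)) (prod_nonneg fun i _ => by positivity)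

theorem gapFactor_le (hf0 : ∀ t, 0 ≤ f t) (y : Fin m → ℝ) (t : ℝ) :
    gapFactor κ p f y t ≤ (∏ i, (1 + |y i|) ^ κ) * (f t * (1 + |t|) ^ (p - 1 + κ * m)) := by
  rw [gapFactor, pow_add]
  have h1 := prod_abs_sub_le κ y t
  have h2 : 0 ≤ f t * (1 + |t|) ^ (p - 1) := mul_nonneg (hf0 t) (by positivity)
  calc _ ≤ f t * (1 + |t|) ^ (p - 1) * ((∏ i, (1 + |y i|) ^ κ) * (1 + |t|) ^ (κ * m)) := by gcongr
    _ = _ := by ring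

theorem gapKernel_le (hf0 : ∀ t, 0 ≤ f t) (y : Fin m → ℝ) (x : Fin p → ℝ) :
    gapKernel κ f y x ≤ ∏ j, gapFactor κ p f y (x j) := by
  simp only [gapKernel, gapFactor, prod_mul_distrib]
  have h1 := abs_vdm_le x
  have h2 : 0 ≤ ∏ j, f (x j) := prod_nonneg fun j _ => hf0 _
  gcongr

theorem integrable_gapFactor (hf : Measurable f) (hf0 : ∀ t, 0 ≤ f t)
    (hint : Integrable fun t => f t * (1 + |t|) ^ (p - 1 + κ * m)) (y : Fin m → ℝ) :
    Integrable (gapFactor κ p f y) := by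
  refine (hint.const_mul (∏ i, (1 + |y i|) ^ κ)).mono' (by unfold gapFactor; fun_prop)
    (Filter.Eventually.of_forall fun t => ?_)
  rw [Real.norm_eq_abs, abs_of_nonneg (gapFactor_nonneg hf0 y t)]
  exact gapFactor_le hf0 y t

theorem integrable_gapKernel (hf : Measurable f) (hf0 : ∀ t, 0 ≤ f t)
    (hint : Integrable fun t => f t * (1 + |t|) ^ (p - 1 + κ * m)) (y : Fin m → ℝ) :
    Integrable fun x : Fin p → ℝ => gapKernel κ f y x := by
  refine (Integrable.fintype_prod (f := fun _ : Fin p => gapFactor κ p f y)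
    (μ := fun _ => volume) fun _ => integrable_gapFactor hf hf0 hint y).mono'
    (measurable_gapKernel hf y).aestronglyMeasurable (Filter.Eventually.of_forall fun x => ?_)
  rw [Real.norm_eq_abs, abs_of_nonneg (gapKernel_nonneg hf0 y x)]
  exact gapKernel_le hf0 y x

theorem setIntegral_pi_prod (s : Fin p → Set ℝ) (u : Fin p → ℝ → ℝ) :
    ∫ x in Set.univ.pi s, ∏ j, u j (x j) = ∏ j, ∫ t in s j, u j t := by
  rw [volume_pi, Measure.restrict_pi_pi, integral_fintype_prod_eq_prod]

theorem gapIntegral_le (hf : Measurable f) (hf0 : ∀ t, 0 ≤ f t)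
    (hint : Integrable fun t => f t * (1 + |t|) ^ (p - 1 + κ * m)) (y : Fin m → ℝ) :
    gapIntegral κ h p f y ≤ ∏ j : Fin p, ∫ t in gap h y j, gapFactor κ p f y t := by
  rw [← setIntegral_pi_prod]
  refine setIntegral_mono (integrable_gapKernel hf hf0 hint y).integrableOn
    (Integrable.fintype_prod (f := fun _ : Fin p => gapFactor κ p f y)
      (μ := fun _ => volume) fun _ => integrable_gapFactor hf hf0 hint y).integrableOn
    fun x => gapKernel_le hf0 y x

theorem setIntegral_gapFactor_le (hf : Measurable f) (hf0 : ∀ t, 0 ≤ f t)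
    (hint : Integrable fun t => f t * (1 + |t|) ^ (p - 1 + κ * m)) (y : Fin m → ℝ) (s : Set ℝ) :
    ∫ t in s, gapFactor κ p f y t ≤
      (∏ i, (1 + |y i|) ^ κ) * ∫ t in s, f t * (1 + |t|) ^ (p - 1 + κ * m) := by
  rw [← integral_const_mul]
  exact setIntegral_mono (integrable_gapFactor hf hf0 hint y).integrableOn
    (hint.const_mul _).integrableOn fun t => gapFactor_le hf0 y t

/-- An upper bound in which only the first gap is kept. -/
theorem gapIntegral_le_first {p : ℕ} (hf : Measurable f) (hf0 : ∀ t, 0 ≤ f t)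
    (hint : Integrable fun t => f t * (1 + |t|) ^ (p + κ * m)) (y : Fin m → ℝ) :
    gapIntegral κ h (p + 1) f y ≤ (∫ t in gap h y 0, gapFactor κ (p + 1) f y t) *
      ((∏ i, (1 + |y i|) ^ κ) * ∫ t, f t * (1 + |t|) ^ (p + κ * m)) ^ p := by
  have hint' : Integrable fun t => f t * (1 + |t|) ^ (p + 1 - 1 + κ * m) := hint
  refine (gapIntegral_le hf hf0 hint' y).trans ?_
  rw [Fin.prod_univ_succ]
  have h0 : ∀ s : Set ℝ, 0 ≤ ∫ t in s, gapFactor κ (p + 1) f y t := fun s =>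
    integral_nonneg fun t => gapFactor_nonneg hf0 y t
  refine mul_le_mul_of_nonneg_left ?_ (h0 _)
  calc _ ≤ ∏ _j : Fin p, ((∏ i, (1 + |y i|) ^ κ) * ∫ t, f t * (1 + |t|) ^ (p + κ * m)) := by
        refine prod_le_prod (fun j _ => h0 _) fun j _ =>
          (setIntegral_gapFactor_le hf hf0 hint' y _).trans ?_
        refine mul_le_mul_of_nonneg_left (setIntegral_le_integral hint
          (Filter.Eventually.of_forall fun t => mul_nonneg (hf0 t) (by positivity)))
          (prod_nonneg fun i _ => by positivity)
    _ = _ := by simp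

/-- A lower bound from separated subsets `U j` of the gaps. -/
theorem le_gapIntegral (hf : Measurable f) (hf0 : ∀ t, 0 ≤ f t)
    (hint : Integrable fun t => f t * (1 + |t|) ^ (p - 1 + κ * m)) {y : Fin m → ℝ}
    {U : Fin p → Set ℝ} (hU : ∀ j, MeasurableSet (U j)) (hsub : ∀ j : Fin p, U j ⊆ gap h y j)
    (hfU : ∀ j, IntegrableOn f (U j)) {η : ℝ} (h0 : 0 ≤ η) (h1 : η ≤ 1)
    (hsep : ∀ j k, j < k → ∀ t ∈ U j, ∀ u ∈ U k, η ≤ |t - u|) {d : Fin p → Fin m → ℝ}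
    (hd0 : ∀ j i, 0 ≤ d j i) (hd : ∀ j i, ∀ t ∈ U j, d j i ≤ |y i - t|) :
    (∏ j, ∫ t in U j, f t) * (η ^ (p * p) * ∏ j, ∏ i, d j i ^ κ) ≤ gapIntegral κ h p f y := by
  have hnn : ∀ᵐ x : Fin p → ℝ ∂volume.restrict (Set.univ.pi fun i : Fin p => gap h y i),
      0 ≤ gapKernel κ f y x := Filter.Eventually.of_forall fun x => gapKernel_nonneg hf0 y x
  refine le_trans ?_ (setIntegral_mono_set (integrable_gapKernel hf hf0 hint y).integrableOn hnn
    (Filter.Eventually.of_forall (Set.pi_mono fun j _ => hsub j)))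
  rw [← setIntegral_pi_prod U fun _ => f, ← integral_mul_const]
  have hI : IntegrableOn (fun x : Fin p → ℝ => ∏ j, f (x j)) (Set.univ.pi U) := by
    rw [IntegrableOn, volume_pi, Measure.restrict_pi_pi]
    exact Integrable.fintype_prod (f := fun _ : Fin p => f) hfU
  refine setIntegral_mono_on (hI.mul_const _) (integrable_gapKernel hf hf0 hint y).integrableOn
    (MeasurableSet.univ_pi hU) fun x hx => ?_
  rw [gapKernel, mul_assoc]
  refine mul_le_mul_of_nonneg_left ?_ (prod_nonneg fun j _ => hf0 _)
  refine mul_le_mul (pow_le_abs_vdm h0 h1 fun j k hjk => hsep j k hjk _ (hx j trivial) _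
    (hx k trivial)) ?_ (prod_nonneg fun j _ => prod_nonneg fun i _ => pow_nonneg (hd0 j i) _)
    (abs_nonneg _)
  exact prod_le_prod (fun j _ => prod_nonneg fun i _ => pow_nonneg (hd0 j i) _) fun j _ =>
    prod_le_prod (fun i _ => pow_nonneg (hd0 j i) _) fun i _ =>
      pow_le_pow_left₀ (hd0 j i) (hd j i _ (hx j trivial)) κ

/-- Although the domain of integration moves with `y`, it changes only near points of coordinates
`y i`, which form a null set. -/
theorem continuous_gapIntegral (hf : Measurable f) (hf0 : ∀ t, 0 ≤ f t)
    (hint : Integrable fun t => f t * (1 + |t|) ^ (p - 1 + κ * m)) :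
    Continuous fun y : Fin m → ℝ => gapIntegral κ h p f y := by
  rw [continuous_iff_continuousAt]
  intro y₀
  simp only [gapIntegral, ← integral_indicator (measurableSet_pi_gap _)]
  -- Near `y₀` the kernel is dominated by a fixed product of integrable functions.
  set B : ℝ := ∏ i, (2 + |y₀ i|) ^ κ with hB
  refine continuousAt_of_dominated
    (bound := fun x : Fin p → ℝ => ∏ j, (B * (f (x j) * (1 + |x j|) ^ (p - 1 + κ * m))))
    (Filter.Eventually.of_forall fun y =>
      ((measurable_gapKernel hf y).indicator (measurableSet_pi_gap y)).aestronglyMeasurable)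
    ?_ (Integrable.fintype_prod (μ := fun _ => volume) fun _ => hint.const_mul B) ?_
  · have hnear : ∀ᶠ y in nhds y₀, ∀ i, |y i| < 1 + |y₀ i| := by
      rw [Filter.eventually_all]
      intro i
      have hc : ContinuousAt (fun y : Fin m → ℝ => |y i|) y₀ :=
        (continuous_apply i).abs.continuousAt
      exact hc.eventually (gt_mem_nhds (by linarith))
    filter_upwards [hnear] with y hy
    refine Filter.Eventually.of_forall fun x => ?_
    refine (norm_indicator_le_norm_self _ _).trans ?_
    rw [Real.norm_eq_abs, abs_of_nonneg (gapKernel_nonneg hf0 y x)]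
    refine (gapKernel_le hf0 y x).trans (prod_le_prod (fun j _ => gapFactor_nonneg hf0 y _)
      fun j _ => (gapFactor_le hf0 y _).trans ?_)
    refine mul_le_mul_of_nonneg_right ?_ (mul_nonneg (hf0 _) (by positivity))
    refine prod_le_prod (fun i _ => by positivity) fun i _ =>
      pow_le_pow_left₀ (by positivity) ?_ κ
    linarith [hy i]
  · have hae : ∀ᵐ x : Fin p → ℝ, ∀ j i, x j ≠ y₀ i := by
      rw [ae_all_iff]; intro j
      rw [ae_all_iff]; intro i
      exact Measure.ae_eval_ne (fun _ : Fin p => (volume : Measure ℝ)) j (y₀ i)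
    filter_upwards [hae] with x hx
    have hmem : ∀ᶠ y in nhds y₀, ((x ∈ Set.univ.pi fun i : Fin p => gap h y i) ↔
        x ∈ Set.univ.pi fun i : Fin p => gap h y₀ i) := by
      have h2 : ∀ᶠ y in nhds y₀, ∀ (j : Fin p) (i : Fin m),
          (x j < y i ↔ x j < y₀ i) ∧ (y i < x j ↔ y₀ i < x j) := by
        rw [Filter.eventually_all]; intro j
        rw [Filter.eventually_all]; intro i
        have hc : ContinuousAt (fun y : Fin m → ℝ => y i) y₀ := (continuous_apply i).continuousAt
        rcases lt_or_gt_of_ne (hx j i) with hlt | hlt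
        · filter_upwards [hc.eventually (lt_mem_nhds hlt)] with y hy
          exact ⟨⟨fun _ => hlt, fun _ => hy⟩, ⟨fun h' => absurd h' hy.not_gt,
            fun h' => absurd h' hlt.not_gt⟩⟩
        · filter_upwards [hc.eventually (gt_mem_nhds hlt)] with y hy
          exact ⟨⟨fun h' => absurd h' hy.not_gt, fun h' => absurd h' hlt.not_gt⟩,
            ⟨fun _ => hlt, fun _ => hy⟩⟩
      filter_upwards [h2] with y hy
      simp only [Set.mem_univ_pi, gap, Set.mem_ofPred_eq, (hy _ _).1, (hy _ _).2]
    have hk : ContinuousAt (fun y : Fin m → ℝ => gapKernel κ f y x) y₀ := by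
      refine Continuous.continuousAt ?_
      unfold gapKernel; fun_prop
    by_cases hx0 : x ∈ Set.univ.pi fun i : Fin p => gap h y₀ i
    · refine hk.congr ?_
      filter_upwards [hmem] with y hy
      rw [Set.indicator_of_mem (hy.2 hx0)]
    · refine (continuousAt_const (y := (0 : ℝ))).congr ?_
      filter_upwards [hmem] with y hy
      rw [Set.indicator_of_notMem fun h' => hx0 (hy.1 h')]

theorem gapIntegral_nonneg (hf0 : ∀ t, 0 ≤ f t) (y : Fin m → ℝ) : 0 ≤ gapIntegral κ h p f y :=
  integral_nonneg fun x => gapKernel_nonneg hf0 y x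

theorem gapIntegral_pos (hf : Measurable f) (hf0 : ∀ t, 0 ≤ f t)
    (hint : Integrable fun t => f t * (1 + |t|) ^ (p - 1 + κ * m)) {y : Fin m → ℝ}
    {U : Fin p → Set ℝ} (hU : ∀ j, IsOpen (U j)) (hne : ∀ j, (U j).Nonempty)
    (hsub : ∀ j : Fin p, U j ⊆ gap h y j) (hpos : ∀ j, ∀ t ∈ U j, 0 < f t) :
    0 < gapIntegral κ h p f y := by
  have hnn : ∀ᵐ x : Fin p → ℝ ∂volume.restrict (Set.univ.pi fun i : Fin p => gap h y i),
      0 ≤ gapKernel κ f y x := Filter.Eventually.of_forall fun x => gapKernel_nonneg hf0 y x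
  rw [gapIntegral, setIntegral_pos_iff_support_of_nonneg_ae hnn
    (integrable_gapKernel hf hf0 hint y).integrableOn]
  have hopen : IsOpen (Set.univ.pi U) := isOpen_set_pi Set.finite_univ fun j _ => hU j
  refine (hopen.measure_pos volume (Set.univ_pi_nonempty_iff.2 hne)).trans_le ?_
  refine measure_mono_ae ?_
  have hae : ∀ᵐ x : Fin p → ℝ, ∀ j i, x j ≠ y i := by
    rw [ae_all_iff]; intro j
    rw [ae_all_iff]; intro i
    exact Measure.ae_eval_ne (fun _ : Fin p => (volume : Measure ℝ)) j (y i)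
  filter_upwards [hae, ae_injective p] with x hx hinj hxU
  refine ⟨?_, fun j hj => hsub j (hxU j hj)⟩
  refine mul_ne_zero (mul_ne_zero (prod_ne_zero_iff.2 fun j _ => (hpos j _ (hxU j trivial)).ne')
    (abs_ne_zero.2 (vdm_ne_zero hinj))) (prod_ne_zero_iff.2 fun j _ => prod_ne_zero_iff.2
      fun i _ => pow_ne_zero _ (abs_ne_zero.2 (sub_ne_zero.2 (hx j i).symm)))

/-- Reflection exchanges the roles of the two ends of the line. -/
theorem gapIntegral_neg (hh : h ≤ p + 1 - m) (hp : m ≤ p + 1)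
    (y : Fin m → ℝ) :
    gapIntegral κ (p + 1 - m - h) p (fun t => f (-t)) (fun i => -y i.rev) =
      gapIntegral κ h p f y := by
  have hmp : MeasurePreserving (fun (x : Fin p → ℝ) (j : Fin p) => -x j.rev) volume volume := by
    have h1 := volume_measurePreserving_piCongrLeft (fun _ : Fin p => ℝ) Fin.revPerm
    have h2 : MeasurePreserving (fun (x : Fin p → ℝ) (j : Fin p) => -x j) volume volume :=
      Measure.measurePreserving_neg volume
    convert! h2.comp h1 using 1
    ext x j
    have := MeasurableEquiv.piCongrLeft_apply_apply (β := fun _ : Fin p => ℝ) Fin.revPerm x j.rev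
    simp only [Fin.revPerm_apply, Fin.rev_rev] at this
    simp [this]
  have hinv : Function.Involutive fun (x : Fin p → ℝ) (j : Fin p) => -x j.rev := fun x => by
    ext j; simp
  have hemb : MeasurableEmbedding fun (x : Fin p → ℝ) (j : Fin p) => -x j.rev :=
    (MeasurableEquiv.ofInvolutive _ hinv hmp.measurable).measurableEmbedding
  rw [gapIntegral, gapIntegral, ← hmp.setIntegral_preimage_emb hemb]
  congr 1
  · congr 1
    ext x
    simp only [Set.mem_preimage, Set.mem_univ_pi, gap, Set.mem_ofPred_eq]
    constructor
    · intro H j i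
      have := H j.rev i.rev
      simp only [Fin.rev_rev, neg_lt_neg_iff, Fin.val_rev] at this
      have hi := i.isLt
      have hj := j.isLt
      exact ⟨fun hij => this.2 (by omega), fun hij => this.1 (by omega)⟩
    · intro H j i
      have := H j.rev i.rev
      simp only [neg_lt_neg_iff, Fin.val_rev] at this ⊢
      have hi := i.isLt
      have hj := j.isLt
      exact ⟨fun hij => this.2 (by omega), fun hij => this.1 (by omega)⟩
  · ext x
    simp only [gapKernel, neg_neg]
    congr 1
    · congr 1
      · exact Equiv.prod_comp Fin.revPerm fun j => f (x j)
      · have h1 : |vdm fun j : Fin p => -x j.rev| = |vdm x| := by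
          rw [← abs_vdm_comp_perm x Fin.revPerm, abs_vdm, abs_vdm]
          refine prod_congr rfl fun i _ => prod_congr rfl fun j _ => ?_
          simp only [Function.comp, Fin.revPerm_apply]
          rw [neg_sub_neg, abs_sub_comm]
        exact h1
    · rw [← Equiv.prod_comp Fin.revPerm]
      refine prod_congr rfl fun j _ => ?_
      rw [← Equiv.prod_comp Fin.revPerm]
      refine prod_congr rfl fun i _ => ?_
      simp only [Fin.revPerm_apply, Fin.rev_rev]
      rw [neg_sub_neg, abs_sub_comm]

/-! ### Weights on an open interval -/

/-- A weight that is continuous and positive on the open interval `I` and vanishes off it. -/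
structure IsWeightOn (I : Set ℝ) (w : ℝ → ℝ) : Prop where
  isOpen : IsOpen I
  ordConnected : I.OrdConnected
  nonempty : I.Nonempty
  measurable : Measurable w
  continuousOn : ContinuousOn w I
  pos : ∀ t ∈ I, 0 < w t
  eq_zero : ∀ t ∉ I, w t = 0

theorem IsWeightOn.nonneg {I : Set ℝ} {w : ℝ → ℝ} (hw : IsWeightOn I w) (t : ℝ) : 0 ≤ w t := by
  by_cases h : t ∈ I
  · exact (hw.pos t h).le
  · exact (hw.eq_zero t h).ge

theorem IsWeightOn.mem_iff {I : Set ℝ} {w : ℝ → ℝ} (hw : IsWeightOn I w) (t : ℝ) :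
    t ∈ I ↔ 0 < w t :=
  ⟨hw.pos t, fun h => by by_contra h'; exact h.ne' (hw.eq_zero t h')⟩

theorem IsWeightOn.prod_pos_iff {I : Set ℝ} {w : ℝ → ℝ} (hw : IsWeightOn I w) {m : ℕ}
    (y : Fin m → ℝ) : 0 < ∏ i, w (y i) ↔ ∀ i, y i ∈ I := by
  constructor
  · intro h i
    rw [hw.mem_iff]
    exact lt_of_le_of_ne (hw.nonneg _) fun h0 => h.ne' (prod_eq_zero (mem_univ i) h0.symm)
  · exact fun h => prod_pos fun i _ => hw.pos _ (h i)

theorem exists_gt_mem {I : Set ℝ} (hI : IsOpen I) {t : ℝ} (ht : t ∈ I) : ∃ s ∈ I, t < s := by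
  obtain ⟨ε, hε, hb⟩ := Metric.isOpen_iff.1 hI t ht
  exact ⟨t + ε / 2, hb (by rw [Metric.mem_ball, Real.dist_eq]; rw [add_sub_cancel_left,abs_of_pos (by linarith)]; linarith),
    by linarith⟩

theorem exists_lt_mem {I : Set ℝ} (hI : IsOpen I) {t : ℝ} (ht : t ∈ I) : ∃ s ∈ I, s < t := by
  obtain ⟨ε, hε, hb⟩ := Metric.isOpen_iff.1 hI t ht
  exact ⟨t - ε / 2, hb (by rw [Metric.mem_ball, Real.dist_eq]; rw [sub_sub_cancel_left, abs_neg,abs_of_pos (by linarith)]; linarith),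
    by linarith⟩

theorem exists_isOpen_subset_diff {I J : Set ℝ} (hI : IsOpen I) (hJ : J.OrdConnected)
    (h : ¬ I ⊆ J) : ∃ U : Set ℝ, IsOpen U ∧ U.Nonempty ∧ U ⊆ I ∧ ∀ t ∈ U, t ∉ J := by
  obtain ⟨t, ht, htJ⟩ := Set.not_subset.1 h
  by_cases hl : ∃ j ∈ J, j < t
  · obtain ⟨j, hj, hjt⟩ := hl
    obtain ⟨s, hs, hts⟩ := exists_gt_mem hI ht
    exact ⟨I ∩ Set.Ioi t, hI.inter isOpen_Ioi, ⟨s, hs, hts⟩, Set.inter_subset_left,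
      fun u hu huJ => htJ (hJ.out hj huJ ⟨hjt.le, le_of_lt hu.2⟩)⟩
  · push Not at hl
    obtain ⟨s, hs, hts⟩ := exists_lt_mem hI ht
    exact ⟨I ∩ Set.Iio t, hI.inter isOpen_Iio, ⟨s, hs, hts⟩, Set.inter_subset_left,
      fun u hu huJ => (hl u huJ).not_gt hu.2⟩

theorem exists_strictAnti_mem {U : Set ℝ} (hU : IsOpen U) (hne : U.Nonempty) (m : ℕ) :
    ∃ y : Fin m → ℝ, StrictAnti y ∧ ∀ i, y i ∈ U := by
  obtain ⟨t, ht⟩ := hne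
  obtain ⟨ε, hε, hb⟩ := Metric.isOpen_iff.1 hU t ht
  refine ⟨fun i => t - ε * ((i : ℝ) / (m + 1)), fun i j hij => ?_, fun i => hb ?_⟩
  · have : (i : ℝ) < j := by exact_mod_cast hij
    simp only
    gcongr
  · rw [Metric.mem_ball, Real.dist_eq]
    have h1 : (i : ℝ) / (m + 1) < 1 := by
      rw [div_lt_one (by positivity)]
      have : (i : ℝ) < m := by exact_mod_cast i.isLt
      linarith
    have h0 : 0 ≤ (i : ℝ) / (m + 1) := by positivity
    rw [sub_sub_cancel_left, abs_neg, abs_of_nonneg (by positivity)]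
    nlinarith

theorem isOpen_strictAnti (m : ℕ) : IsOpen {y : Fin m → ℝ | StrictAnti y} := by
  have : {y : Fin m → ℝ | StrictAnti y} = ⋂ i, ⋂ j, {y | i < j → y j < y i} := by
    ext y; simp [StrictAnti]
  rw [this]
  refine isOpen_iInter_of_finite fun i => isOpen_iInter_of_finite fun j => ?_
  by_cases hij : i < j
  · simpa [hij] using isOpen_lt (continuous_apply j) (continuous_apply i)
  · simp [hij]

theorem isOpen_chamber {U : Set ℝ} (hU : IsOpen U) (m : ℕ) :
    IsOpen {y : Fin m → ℝ | StrictAnti y ∧ ∀ i, y i ∈ U} := by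
  have : {y : Fin m → ℝ | StrictAnti y ∧ ∀ i, y i ∈ U} =
      {y | StrictAnti y} ∩ Set.univ.pi fun _ => U := by ext y; simp
  rw [this]
  exact (isOpen_strictAnti m).inter (isOpen_set_pi Set.finite_univ fun _ _ => hU)

theorem exists_mem_of_ae {X : Type*} [TopologicalSpace X] [MeasurableSpace X] {μ : Measure X}
    [μ.IsOpenPosMeasure] {P : X → Prop} (h : ∀ᵐ x ∂μ, P x) {S : Set X} (hS : IsOpen S)
    (hne : S.Nonempty) : ∃ x ∈ S, P x := by
  by_contra hcon
  push Not at hcon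
  exact hS.measure_ne_zero μ hne (measure_mono_null (fun x hx => hcon x hx) (ae_iff.1 h))

/-- Two weights generating the same support of a density on the chamber live on the same
interval. -/
theorem support_eq {m : ℕ} (hm : 0 < m) {I J : Set ℝ} (hI : IsOpen I) (hIc : I.OrdConnected)
    (hJ : IsOpen J) (hJc : J.OrdConnected) {F G : (Fin m → ℝ) → ℝ}
    (h : ∀ᵐ y, StrictAnti y → F y = G y)
    (hF : ∀ y, StrictAnti y → (F y ≠ 0 ↔ ∀ i, y i ∈ I))
    (hG : ∀ y, StrictAnti y → (G y ≠ 0 ↔ ∀ i, y i ∈ J)) : I = J := by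
  have key : ∀ {I J : Set ℝ} {F G : (Fin m → ℝ) → ℝ}, IsOpen I → J.OrdConnected →
      (∀ᵐ y, StrictAnti y → F y = G y) →
      (∀ y, StrictAnti y → (F y ≠ 0 ↔ ∀ i, y i ∈ I)) →
      (∀ y, StrictAnti y → (G y ≠ 0 ↔ ∀ i, y i ∈ J)) → I ⊆ J := by
    intro I J F G hI hJ h hF hG
    by_contra hIJ
    obtain ⟨U, hU, hne, hUI, hUJ⟩ := exists_isOpen_subset_diff hI hJ hIJ
    obtain ⟨y, ⟨hy, hyU⟩, hFG⟩ := exists_mem_of_ae h (isOpen_chamber hU m)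
      (exists_strictAnti_mem hU hne m)
    have h1 := (hF y hy).2 fun i => hUI (hyU i)
    rw [hFG hy] at h1
    exact hUJ _ (hyU ⟨0, hm⟩) ((hG y hy).1 h1 _)
  exact (key hI hJc h hF hG).antisymm (key hJ hIc
    (h.mono fun y hy hs => (hy hs).symm) hG hF)

/-- Equal finite measures on the decreasing configurations have almost everywhere equal densities. -/
theorem ae_eq_of_withDensity_chamber {m : ℕ} {F G : (Fin m → ℝ) → ℝ} (hF : Measurable F)
    (hG : Measurable G) (hF0 : ∀ y, 0 ≤ F y) (hG0 : ∀ y, 0 ≤ G y) {c₁ c₂ : ENNReal}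
    (h : c₁ • (volume.withDensity ({y : Fin m → ℝ | StrictAnti y}.indicator
        fun y => ENNReal.ofReal (F y))) =
      c₂ • (volume.withDensity ({y : Fin m → ℝ | StrictAnti y}.indicator
        fun y => ENNReal.ofReal (G y))))
    (hfin : (c₁ • (volume.withDensity ({y : Fin m → ℝ | StrictAnti y}.indicator
        fun y => ENNReal.ofReal (F y)))) Set.univ ≠ ⊤) :
    ∀ᵐ y, StrictAnti y → c₁.toReal * F y = c₂.toReal * G y := by
  have hFm : Measurable ({y : Fin m → ℝ | StrictAnti y}.indicator
      fun y => ENNReal.ofReal (F y)) := hF.ennreal_ofReal.indicator (measurableSet_strictAnti m)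
  have hGm : Measurable ({y : Fin m → ℝ | StrictAnti y}.indicator
      fun y => ENNReal.ofReal (G y)) := hG.ennreal_ofReal.indicator (measurableSet_strictAnti m)
  rw [← withDensity_smul _ hFm] at h hfin
  rw [← withDensity_smul _ hGm] at h
  rw [withDensity_apply _ MeasurableSet.univ, Measure.restrict_univ] at hfin
  have := (withDensity_eq_iff (hFm.const_smul c₁).aemeasurable (hGm.const_smul c₂).aemeasurable
    hfin).1 h
  filter_upwards [this] with y hy hs
  simp only [Pi.smul_apply, Set.indicator_of_mem (show y ∈ {y : Fin m → ℝ | StrictAnti y} from hs),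
    smul_eq_mul] at hy
  have h2 := congrArg ENNReal.toReal hy
  rwa [ENNReal.toReal_mul, ENNReal.toReal_mul, ENNReal.toReal_ofReal (hF0 y),
    ENNReal.toReal_ofReal (hG0 y)] at h2

/-! ### An ensemble determines its weight -/

theorem measurable_density {m : ℕ} {w : ℝ → ℝ} (hw : Measurable w) (β : ℕ) :
    Measurable fun y : Fin m → ℝ => (∏ i, w (y i)) * |vdm y| ^ β := by
  have := measurable_vdm (N := m)
  fun_prop

theorem continuousOn_prod_comp {m : ℕ} {I : Set ℝ} {w : ℝ → ℝ} (hw : ContinuousOn w I) :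
    ContinuousOn (fun y : Fin m → ℝ => ∏ i, w (y i)) {y | StrictAnti y ∧ ∀ i, y i ∈ I} :=
  continuousOn_finsetProd _ fun i _ =>
    hw.comp (continuous_apply i).continuousOn fun _ hy => hy.2 i

theorem map_kthLargest_ensemble {m β : ℕ} {w : ℝ → ℝ} (hw : Measurable w) :
    (ensemble β m w).map (fun x k => kthLargest x k) =
      ((unnormalized β m w Set.univ)⁻¹ * m.factorial) •
        (volume.withDensity ({y : Fin m → ℝ | StrictAnti y}.indicator
        fun y => ENNReal.ofReal ((∏ i, w (y i)) * |vdm y| ^ β))) := by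
  rw [ensemble, Measure.map_smul, map_kthLargest_unnormalized hw, mul_smul,
    ← withDensity_smul _ ((measurable_density hw β).ennreal_ofReal.indicator
      (measurableSet_strictAnti m))]
  congr 2
  ext y
  by_cases hy : y ∈ {y : Fin m → ℝ | StrictAnti y}
  · rw [Pi.smul_apply, Set.indicator_of_mem hy, Set.indicator_of_mem hy, smul_eq_mul]
  · rw [Pi.smul_apply, Set.indicator_of_notMem hy, Set.indicator_of_notMem hy, smul_zero]

theorem density_ne_zero_iff {m β : ℕ} {I : Set ℝ} {w : ℝ → ℝ} (hw : IsWeightOn I w) {c : ℝ}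
    (hc : 0 < c) {y : Fin m → ℝ} (hy : StrictAnti y) :
    c * ((∏ i, w (y i)) * |vdm y| ^ β) ≠ 0 ↔ ∀ i, y i ∈ I := by
  have hv : |vdm y| ^ β ≠ 0 := pow_ne_zero _ (abs_ne_zero.2 (vdm_ne_zero hy.injective))
  rw [← hw.prod_pos_iff]
  have h0 : 0 ≤ ∏ i, w (y i) := prod_nonneg fun i _ => hw.nonneg _
  constructor
  · intro h
    exact lt_of_le_of_ne h0 fun h' => h (by rw [← h']; ring)
  · exact fun h => mul_ne_zero hc.ne' (mul_ne_zero h.ne' hv)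

/-- The constant factors of the densities are positive and finite. -/
theorem inv_mul_natCast_pos {a : ENNReal} (h0 : a ≠ 0) (h1 : a ≠ ⊤) {k : ℕ} (hk : 0 < k) :
    a⁻¹ * k ≠ ⊤ ∧ 0 < (a⁻¹ * k).toReal := by
  have ht : a⁻¹ * k ≠ ⊤ := ENNReal.mul_ne_top (ENNReal.inv_ne_top.2 h0) (ENNReal.natCast_ne_top k)
  exact ⟨ht, ENNReal.toReal_pos (mul_ne_zero (ENNReal.inv_ne_zero.2 h1)
    (Nat.cast_ne_zero.2 hk.ne')) ht⟩

/-- The law of an ensemble determines its weight up to a constant factor. -/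
theorem weight_eq_of_map_kthLargest_eq {m β : ℕ} (hm : 0 < m) {I J : Set ℝ} {v w : ℝ → ℝ}
    (hv : IsWeightOn I v) (hw : IsWeightOn J w) (hPv : IsProbabilityMeasure (ensemble β m v))
    (hPw : IsProbabilityMeasure (ensemble β m w))
    (h : (ensemble β m v).map (fun x k => kthLargest x k) =
      (ensemble β m w).map fun x k => kthLargest x k) : ∃ C > 0, ∀ t, v t = C * w t := by
  have hfin : (ensemble β m v).map (fun x k => kthLargest x k) Set.univ ≠ ⊤ := by
    rw [Measure.map_apply measurable_kthLargest MeasurableSet.univ, Set.preimage_univ]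
    exact measure_ne_top _ _
  rw [map_kthLargest_ensemble hv.measurable] at h hfin
  rw [map_kthLargest_ensemble hw.measurable] at h
  obtain ⟨hv0, hv1⟩ := mass_of_isProbabilityMeasure_ensemble hPv
  obtain ⟨hw0, hw1⟩ := mass_of_isProbabilityMeasure_ensemble hPw
  obtain ⟨-, hp1⟩ := inv_mul_natCast_pos hv0 hv1 m.factorial_pos
  obtain ⟨-, hp2⟩ := inv_mul_natCast_pos hw0 hw1 m.factorial_pos
  have hae := ae_eq_of_withDensity_chamber (measurable_density hv.measurable β)
    (measurable_density hw.measurable β)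
    (fun y => mul_nonneg (prod_nonneg fun i _ => hv.nonneg _) (by positivity))
    (fun y => mul_nonneg (prod_nonneg fun i _ => hw.nonneg _) (by positivity)) h hfin
  set c₁ := ((unnormalized β m v Set.univ)⁻¹ * m.factorial).toReal
  set c₂ := ((unnormalized β m w Set.univ)⁻¹ * m.factorial).toReal
  obtain rfl := support_eq hm hv.isOpen hv.ordConnected hw.isOpen hw.ordConnected hae
    (fun y hy => density_ne_zero_iff hv hp1 hy) fun y hy => density_ne_zero_iff hw hp2 hy
  -- Both densities are continuous on the chamber, so they agree there everywhere.
  have hEq : Set.EqOn (fun y : Fin m → ℝ => c₁ * ((∏ i, v (y i)) * |vdm y| ^ β))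
      (fun y => c₂ * ((∏ i, w (y i)) * |vdm y| ^ β)) {y | StrictAnti y ∧ ∀ i, y i ∈ I} := by
    refine Measure.eqOn_open_of_ae_eq (μ := volume) ?_ (isOpen_chamber hv.isOpen m) ?_ ?_
    · rw [Filter.EventuallyEq, ae_restrict_iff' (isOpen_chamber hv.isOpen m).measurableSet]
      exact hae.mono fun y hy hs => hy hs.1
    · exact continuousOn_const.mul ((continuousOn_prod_comp hv.continuousOn).mul
        (continuous_vdm.abs.pow β).continuousOn)
    · exact continuousOn_const.mul ((continuousOn_prod_comp hw.continuousOn).mul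
        (continuous_vdm.abs.pow β).continuousOn)
  obtain ⟨k, rfl⟩ : ∃ k, m = k + 1 := ⟨m - 1, by omega⟩
  -- Vary the largest point, with the others fixed below it.
  have hlocal : ∀ s ∈ I, ∀ t ∈ I, s ≤ t → v t * w s = w t * v s := by
    intro s hs t ht hst
    obtain ⟨u, hu, hus⟩ := exists_lt_mem hv.isOpen hs
    obtain ⟨y, hy, hyU⟩ := exists_strictAnti_mem (hv.isOpen.inter isOpen_Iio)
      ⟨u, hu, (hus : u ∈ Set.Iio s)⟩ k
    have hanti : ∀ a, s ≤ a → StrictAnti (Fin.cons a y : Fin (k + 1) → ℝ) := by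
      intro a ha i j hij
      induction j using Fin.cases with
      | zero => exact absurd hij (Fin.not_lt_zero i)
      | succ j =>
        induction i using Fin.cases with
        | zero =>
          simp only [Fin.cons_zero, Fin.cons_succ]
          exact lt_of_lt_of_le (hyU j).2 ha
        | succ i =>
          simp only [Fin.cons_succ]
          exact hy (by simpa using hij)
    have hval : ∀ a ∈ I, s ≤ a → c₁ * v a * ∏ i, v (y i) = c₂ * w a * ∏ i, w (y i) := by
      intro a haI ha
      have := hEq ⟨hanti a ha, fun i => by
        induction i using Fin.cases with
        | zero => simpa using haI
        | succ i => simpa using (hyU i).1⟩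
      simp only [Fin.prod_univ_succ, Fin.cons_zero, Fin.cons_succ] at this
      have hvd : |vdm (Fin.cons a y : Fin (k + 1) → ℝ)| ^ β ≠ 0 :=
        pow_ne_zero _ (abs_ne_zero.2 (vdm_ne_zero (hanti a ha).injective))
      refine mul_right_cancel₀ hvd ?_
      linear_combination this
    have h1 := hval s hs le_rfl
    have h2 := hval t ht hst
    have hA : 0 < c₁ * ∏ i, v (y i) := mul_pos hp1 (prod_pos fun i _ => hv.pos _ (hyU i).1)
    refine mul_left_cancel₀ (mul_pos hA (hw.pos s hs)).ne' ?_
    linear_combination (w s) ^ 2 * h2 - w t * w s * h1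
  obtain ⟨t₀, ht₀⟩ := hv.nonempty
  refine ⟨v t₀ / w t₀, div_pos (hv.pos _ ht₀) (hw.pos _ ht₀), fun t => ?_⟩
  by_cases ht : t ∈ I
  · have := (hw.pos _ ht₀).ne'
    rw [div_mul_eq_mul_div, eq_div_iff this]
    rcases le_total t₀ t with h' | h'
    · rw [hlocal t₀ ht₀ t ht h']; ring
    · have := hlocal t ht t₀ ht₀ h'
      linarith
  · rw [hv.eq_zero t ht, hw.eq_zero t ht, mul_zero]

/-! ### Normalisable orthogonal ensembles have moments -/

/-- By Fubini, for almost every choice of all points but one the integral over the last one is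
finite. -/
theorem exists_integrable_mul_prod_abs_sub {k : ℕ} {I U : Set ℝ} {f : ℝ → ℝ}
    (hf : IsWeightOn I f) (h : unnormalized 1 (k + 1) f Set.univ ≠ ⊤) (hU : IsOpen U) (hne : U.Nonempty) (hUI : U ⊆ I) :
    ∃ y : Fin k → ℝ, (∀ i, y i ∈ U) ∧ Integrable fun t => f t * ∏ i, |y i - t| := by
  have hfm := hf.measurable
  let e : Fin k ⊕ Fin 1 ≃ Fin (k + 1) := finSumFinEquiv
  have hF : Measurable fun z : Fin (k + 1) → ℝ =>
      ENNReal.ofReal ((∏ i, f (z i)) * |vdm z| ^ 1) :=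
    measurable_unnormalized_density hf.measurable 1
  rw [unnormalized_eq, withDensity_apply _ MeasurableSet.univ, Measure.restrict_univ,
    lintegral_merge e hF] at h
  have hmeas : Measurable fun y : Fin k → ℝ => ∫⁻ x : Fin 1 → ℝ,
      ENNReal.ofReal ((∏ i, f (merge e y x i)) * |vdm (merge e y x)| ^ 1) :=
    Measurable.lintegral_prod_right' (f := fun q : (Fin k → ℝ) × (Fin 1 → ℝ) =>
      ENNReal.ofReal ((∏ i, f (merge e q.1 q.2 i)) * |vdm (merge e q.1 q.2)| ^ 1))
      (hF.comp (measurable_merge e))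
  obtain ⟨y, ⟨hy, hyU⟩, hfin⟩ := exists_mem_of_ae (ae_lt_top hmeas h) (isOpen_chamber hU k)
    (exists_strictAnti_mem hU hne k)
  refine ⟨y, hyU, ?_⟩
  set A := (∏ i, f (y i)) * |vdm y| with hA
  have hA0 : 0 < A := mul_pos (prod_pos fun i _ => hf.pos _ (hUI (hyU i)))
    (abs_pos.2 (vdm_ne_zero hy.injective))
  have h1 : ∀ x : Fin 1 → ℝ, (∏ i, f (merge e y x i)) * |vdm (merge e y x)| ^ 1 =
      A * (f (x 0) * ∏ i, |y i - x 0|) := by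
    intro x
    have hx : |vdm x| = 1 := by rw [abs_vdm]; simp
    rw [prod_merge, pow_one, abs_vdm_split e]
    simp only [merge_inl, merge_inr, Fin.prod_univ_one, Fin.isValue, hx, hA]
    ring
  simp only [h1] at hfin
  have hmp := volume_preserving_funUnique (Fin 1) ℝ
  have hnn : ∀ t, 0 ≤ A * (f t * ∏ i, |y i - t|) := fun t =>
    mul_nonneg hA0.le (mul_nonneg (hf.nonneg t) (prod_nonneg fun i _ => abs_nonneg _))
  have hg : Measurable fun t => ENNReal.ofReal (A * (f t * ∏ i, |y i - t|)) := by fun_prop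
  have h2 : ∫⁻ t, ENNReal.ofReal (A * (f t * ∏ i, |y i - t|)) < ⊤ := by
    rw [← hmp.lintegral_comp hg]
    exact hfin
  have h3 : Integrable fun t => A * (f t * ∏ i, |y i - t|) :=
    (lintegral_ofReal_ne_top_iff_integrable (by fun_prop)
      (Filter.Eventually.of_forall hnn)).1 h2.ne
  refine (h3.const_mul A⁻¹).congr (Filter.Eventually.of_forall fun t => ?_)
  simp only
  rw [inv_mul_cancel_left₀ hA0.ne']

/-- Fixing all points but one in two separated regions shows that a normalisable orthogonal
ensemble on `k + 1` points has a weight with `k` moments. -/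
theorem integrable_of_unnormalized_ne_top {k : ℕ} {I : Set ℝ} {f : ℝ → ℝ} (hf : IsWeightOn I f)
    (h : unnormalized 1 (k + 1) f Set.univ ≠ ⊤) : Integrable fun t => f t * (1 + |t|) ^ k := by
  have hfm := hf.measurable
  obtain ⟨t₀, ht₀⟩ := hf.nonempty
  obtain ⟨r, hr, hb⟩ := Metric.isOpen_iff.1 hf.isOpen t₀ ht₀
  rw [Real.ball_eq_Ioo] at hb
  -- The fixed points below `t₀` control the weight above `t₀`, and conversely.
  obtain ⟨y, hy, hyi⟩ := exists_integrable_mul_prod_abs_sub hf h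
    (U := Set.Ioo (t₀ - r) (t₀ - r / 2))
    isOpen_Ioo (Set.nonempty_Ioo.2 (by linarith)) fun t ht => hb ⟨ht.1, by linarith [ht.2]⟩
  obtain ⟨z, hz, hzi⟩ := exists_integrable_mul_prod_abs_sub hf h
    (U := Set.Ioo (t₀ + r / 2) (t₀ + r))
    isOpen_Ioo (Set.nonempty_Ioo.2 (by linarith)) fun t ht => hb ⟨by linarith [ht.1], ht.2⟩
  set B : ℝ := 1 + 2 * (1 + |t₀|) / r with hB
  have hBr : B * (r / 2) = r / 2 + (1 + |t₀|) := by rw [hB]; field_simp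
  have hB1 : 1 ≤ B := by
    have : 0 ≤ 2 * (1 + |t₀|) / r := by positivity
    linarith
  have key : ∀ t a : ℝ, |t - t₀| + r / 2 ≤ |a - t| → 1 + |t| ≤ B * |a - t| := by
    intro t a hta
    have h1 : |t| ≤ |t - t₀| + |t₀| := by
      have := abs_add_le (t - t₀) t₀
      rwa [sub_add_cancel] at this
    have h2 : B * (|t - t₀| + r / 2) ≤ B * |a - t| := mul_le_mul_of_nonneg_left hta (by linarith)
    nlinarith [abs_nonneg (t - t₀)]
  have key2 : ∀ (t : ℝ) (a : Fin k → ℝ), (∀ i, |t - t₀| + r / 2 ≤ |a i - t|) →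
      (1 + |t|) ^ k ≤ B ^ k * ∏ i, |a i - t| := by
    intro t a ha
    have e1 : (1 + |t|) ^ k = ∏ _i : Fin k, (1 + |t|) := by simp
    have e2 : B ^ k = ∏ _i : Fin k, B := by simp
    rw [e1, e2, ← prod_mul_distrib]
    exact prod_le_prod (fun i _ => by positivity) fun i _ => key t _ (ha i)
  refine ((hyi.add hzi).const_mul (B ^ k)).mono' (by fun_prop)
    (Filter.Eventually.of_forall fun t => ?_)
  have hf0 := hf.nonneg t
  rw [Real.norm_eq_abs, abs_of_nonneg (mul_nonneg hf0 (by positivity))]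
  have hp1 : 0 ≤ B ^ k * ∏ i, |y i - t| := mul_nonneg (by positivity)
    (prod_nonneg fun i _ => abs_nonneg _)
  have hp2 : 0 ≤ B ^ k * ∏ i, |z i - t| := mul_nonneg (by positivity)
    (prod_nonneg fun i _ => abs_nonneg _)
  have : (1 + |t|) ^ k ≤ B ^ k * (∏ i, |y i - t|) + B ^ k * ∏ i, |z i - t| := by
    rcases le_total t₀ t with ht | ht
    · refine (key2 t y fun i => ?_).trans (le_add_of_nonneg_right hp2)
      rw [abs_of_nonneg (sub_nonneg.2 ht), abs_sub_comm]
      refine le_trans ?_ (le_abs_self _)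
      linarith [(hy i).2]
    · refine (key2 t z fun i => ?_).trans (le_add_of_nonneg_left hp1)
      rw [abs_of_nonpos (sub_nonpos.2 ht)]
      refine le_trans ?_ (le_abs_self _)
      linarith [(hz i).1]
  calc f t * (1 + |t|) ^ k ≤ f t * (B ^ k * (∏ i, |y i - t|) + B ^ k * ∏ i, |z i - t|) := by gcongr
    _ = _ := by simp only [Pi.add_apply]; ring

/-! ### The gap identity -/

/-- The identity between densities expressing that the kept points of orthogonal ensembles with
weight `f` form a unitary (`κ = 0`) or symplectic (`κ = 1`) ensemble whose weight is `f W`. -/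
structure GapIdentity (κ h m p : ℕ) (C : ℝ) (I : Set ℝ) (f W : ℝ → ℝ) : Prop where
  isWeightOn : IsWeightOn I f
  integrable : Integrable fun t => f t * (1 + |t|) ^ (p - 1 + κ * m)
  const_pos : 0 < C
  weight_pos : ∀ t ∈ I, 0 < W t
  eq : ∀ y : Fin m → ℝ, StrictAnti y → (∀ i, y i ∈ I) →
    gapIntegral κ h p f y = C * (∏ i, W (y i)) * |vdm y| ^ (1 + 2 * κ)

theorem isOpen_gap {m : ℕ} (h : ℕ) (y : Fin m → ℝ) (i : ℕ) : IsOpen (gap h y i) := by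
  have : gap h y i = ⋂ j : Fin m, {t | ((j : ℕ) + h ≤ i → t < y j) ∧ (i < (j : ℕ) + h → y j < t)} := by
    ext t; simp [gap]
  rw [this]
  refine isOpen_iInter_of_finite fun j => ?_
  rcases le_or_gt ((j : ℕ) + h) i with hj | hj
  · convert! (isOpen_Iio : IsOpen (Set.Iio (y j))) using 1
    ext t; simp [hj, hj.not_gt]
  · convert! (isOpen_Ioi : IsOpen (Set.Ioi (y j))) using 1
    ext t; simp [hj, hj.not_ge]

theorem gap_inter_nonempty {m h : ℕ} (hm : 0 < m) {I : Set ℝ} (hI : IsOpen I)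
    (hc : I.OrdConnected) {y : Fin m → ℝ} (hy : StrictAnti y) (hyI : ∀ i, y i ∈ I) {i : ℕ}
    (hi : i < m + h) : (gap h y i ∩ I).Nonempty := by
  have hle : ∀ a b : Fin m, (a : ℕ) ≤ b → y b ≤ y a := fun a b hab => hy.antitone hab
  rcases lt_or_ge i h with h0 | h0
  · obtain ⟨t, ht, hlt⟩ := exists_gt_mem hI (hyI ⟨0, hm⟩)
    exact ⟨t, fun j => ⟨fun hj => by omega, fun _ => (hle ⟨0, hm⟩ j (Nat.zero_le _)).trans_lt hlt⟩,
      ht⟩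
  · rcases lt_or_ge (i - h + 1) m with h1 | h1
    · have hlt : y ⟨i - h + 1, h1⟩ < y ⟨i - h, by omega⟩ := hy (by simp [Fin.lt_def])
      refine ⟨(y ⟨i - h + 1, h1⟩ + y ⟨i - h, by omega⟩) / 2, fun j => ⟨fun hj => ?_, fun hj => ?_⟩,
        hc.out (hyI ⟨i - h + 1, h1⟩) (hyI ⟨i - h, by omega⟩) ⟨by linarith, by linarith⟩⟩
      · have : y ⟨i - h, by omega⟩ ≤ y j := hle j ⟨i - h, by omega⟩ (by simp only; omega)
        linarith
      · have : y j ≤ y ⟨i - h + 1, h1⟩ := hle ⟨i - h + 1, h1⟩ j (by simp only; omega)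
        linarith
    · obtain ⟨t, ht, hlt⟩ := exists_lt_mem hI (hyI ⟨m - 1, by omega⟩)
      exact ⟨t, fun j => ⟨fun hj => hlt.trans_le (hle j ⟨m - 1, by omega⟩
        (by have := j.isLt; simp only; omega)), fun hj => by have := j.isLt; omega⟩, ht⟩

theorem gapIntegral_pos_of_mem {κ m p h : ℕ} (hm : 0 < m) (hp : p ≤ m + h)
    {I : Set ℝ} {f : ℝ → ℝ} (hf : IsWeightOn I f)
    (hint : Integrable fun t => f t * (1 + |t|) ^ (p - 1 + κ * m)) {y : Fin m → ℝ}
    (hy : StrictAnti y) (hyI : ∀ i, y i ∈ I) : 0 < gapIntegral κ h p f y :=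
  gapIntegral_pos hf.measurable hf.nonneg hint (U := fun j : Fin p => gap h y j ∩ I)
    (fun j => (isOpen_gap h y j).inter hf.isOpen)
    (fun j => gap_inter_nonempty hm hf.isOpen hf.ordConnected hy hyI
      (by have := j.isLt; omega)) (fun j => Set.inter_subset_left) fun j t ht => hf.pos t ht.2

/-- The equality of laws gives the gap identity, and in particular the equality of the supports of
the weights. -/
theorem gapIdentity_of_density_eq {κ m p h : ℕ} (hm : 0 < m) (hp : p ≤ m + h)
    {I J : Set ℝ} {f w : ℝ → ℝ} (hf : IsWeightOn I f) (hw : IsWeightOn J w)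
    (hint : Integrable fun t => f t * (1 + |t|) ^ (p - 1 + κ * m)) {c₁ c₂ : ENNReal}
    (hc₁ : 0 < c₁.toReal) (hc₂ : 0 < c₂.toReal)
    (hlaw : c₁ • (volume.withDensity ({y : Fin m → ℝ | StrictAnti y}.indicator
        fun y => ENNReal.ofReal ((∏ i, f (y i)) * |vdm y| * gapIntegral κ h p f y))) =
      c₂ • (volume.withDensity ({y : Fin m → ℝ | StrictAnti y}.indicator
        fun y => ENNReal.ofReal ((∏ i, w (y i)) * |vdm y| ^ (2 + 2 * κ)))))
    (hfin : (c₁ • (volume.withDensity ({y : Fin m → ℝ | StrictAnti y}.indicator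
        fun y => ENNReal.ofReal ((∏ i, f (y i)) * |vdm y| * gapIntegral κ h p f y))))
        Set.univ ≠ ⊤) :
    I = J ∧ ∃ C, GapIdentity κ h m p C I f fun t => w t / f t := by
  have hcont := continuous_gapIntegral (m := m) (h := h) hf.measurable hf.nonneg hint
  have hΦm : Measurable fun y : Fin m → ℝ => gapIntegral κ h p f y := hcont.measurable
  have hFm : Measurable fun y : Fin m → ℝ => (∏ i, f (y i)) * |vdm y| * gapIntegral κ h p f y := by
    have h1 := measurable_density (m := m) hf.measurable 1
    simp only [pow_one] at h1
    exact h1.mul hΦm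
  have hae := ae_eq_of_withDensity_chamber hFm (measurable_density hw.measurable _)
    (fun y => mul_nonneg (mul_nonneg (prod_nonneg fun i _ => hf.nonneg _) (abs_nonneg _))
      (gapIntegral_nonneg hf.nonneg y))
    (fun y => mul_nonneg (prod_nonneg fun i _ => hw.nonneg _) (by positivity)) hlaw hfin
  obtain rfl := support_eq hm hf.isOpen hf.ordConnected hw.isOpen hw.ordConnected hae
    (fun y hy => by
      rw [← hf.prod_pos_iff]
      have h0 : 0 ≤ ∏ i, f (y i) := prod_nonneg fun i _ => hf.nonneg _
      refine ⟨fun hne => lt_of_le_of_ne h0 fun h' => hne (by rw [← h']; ring), fun hpos => ?_⟩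
      exact mul_ne_zero hc₁.ne' (mul_ne_zero (mul_ne_zero hpos.ne'
        (abs_ne_zero.2 (vdm_ne_zero hy.injective)))
        (gapIntegral_pos_of_mem hm hp hf hint hy ((hf.prod_pos_iff y).1 hpos)).ne'))
    fun y hy => density_ne_zero_iff hw hc₂ hy
  refine ⟨rfl, c₂.toReal / c₁.toReal, hf, hint, div_pos hc₂ hc₁,
    fun t ht => div_pos (hw.pos t ht) (hf.pos t ht), fun y hy hyI => ?_⟩
  -- Both densities are continuous on the chamber, so they agree there everywhere.
  have hEq : Set.EqOn
      (fun y : Fin m → ℝ => c₁.toReal * ((∏ i, f (y i)) * |vdm y| * gapIntegral κ h p f y))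
      (fun y => c₂.toReal * ((∏ i, w (y i)) * |vdm y| ^ (2 + 2 * κ)))
      {y | StrictAnti y ∧ ∀ i, y i ∈ I} := by
    refine Measure.eqOn_open_of_ae_eq (μ := volume) ?_ (isOpen_chamber hf.isOpen m) ?_ ?_
    · rw [Filter.EventuallyEq, ae_restrict_iff' (isOpen_chamber hf.isOpen m).measurableSet]
      exact hae.mono fun y hy hs => hy hs.1
    · exact continuousOn_const.mul (((continuousOn_prod_comp hf.continuousOn).mul
        continuous_vdm.abs.continuousOn).mul hcont.continuousOn)
    · exact continuousOn_const.mul ((continuousOn_prod_comp hw.continuousOn).mul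
        (continuous_vdm.abs.pow _).continuousOn)
  have h1 := hEq ⟨hy, hyI⟩
  simp only at h1
  have hv : 0 < |vdm y| := abs_pos.2 (vdm_ne_zero hy.injective)
  have hpf : 0 < ∏ i, f (y i) := (hf.prod_pos_iff y).2 hyI
  rw [prod_div_distrib]
  refine mul_left_cancel₀ (mul_pos hc₁ (mul_pos hpf hv)).ne' ?_
  have hc := hc₁.ne'
  have hpf' := hpf.ne'
  have h2 : c₁.toReal * ((∏ i, f (y i)) * |vdm y|) * (c₂.toReal / c₁.toReal *
      ((∏ i, w (y i)) / ∏ i, f (y i)) * |vdm y| ^ (1 + 2 * κ)) =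
      c₂.toReal * ((∏ i, w (y i)) * (|vdm y| * |vdm y| ^ (1 + 2 * κ))) := by
    generalize |vdm y| ^ (1 + 2 * κ) = q
    field_simp
  rw [h2]
  linear_combination h1

theorem integral_gapKernel_eq_lintegral {κ m p h : ℕ} {f : ℝ → ℝ} (hf : Measurable f)
    (hf0 : ∀ t, 0 ≤ f t) (hint : Integrable fun t => f t * (1 + |t|) ^ (p - 1 + κ * m))
    (y : Fin m → ℝ) : ENNReal.ofReal (gapIntegral κ h p f y) =
      ∫⁻ x in Set.univ.pi fun i : Fin p => gap h y i, ENNReal.ofReal (gapKernel κ f y x) :=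
  ofReal_integral_eq_lintegral_ofReal (integrable_gapKernel hf hf0 hint y).integrableOn
    (Filter.Eventually.of_forall fun x => gapKernel_nonneg hf0 y x)

theorem mul_smul_withDensity_chamber {m : ℕ} {a : ENNReal} {k : ℕ} {F : (Fin m → ℝ) → ℝ}
    (hF : Measurable F) :
    a • (volume.withDensity ({y : Fin m → ℝ | StrictAnti y}.indicator
        fun y => (k : ENNReal) * ENNReal.ofReal (F y))) =
      (a * k) • (volume.withDensity ({y : Fin m → ℝ | StrictAnti y}.indicator
        fun y => ENNReal.ofReal (F y))) := by
  rw [mul_smul, ← withDensity_smul _ (hF.ennreal_ofReal.indicator (measurableSet_strictAnti m))]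
  congr 2
  ext y
  by_cases hy : y ∈ {y : Fin m → ℝ | StrictAnti y}
  · rw [Pi.smul_apply, Set.indicator_of_mem hy, Set.indicator_of_mem hy, smul_eq_mul]
  · rw [Pi.smul_apply, Set.indicator_of_notMem hy, Set.indicator_of_notMem hy, smul_zero]

theorem measurable_kept_density {κ m p h : ℕ} {I : Set ℝ} {f : ℝ → ℝ} (hf : IsWeightOn I f)
    (hint : Integrable fun t => f t * (1 + |t|) ^ (p - 1 + κ * m)) :
    Measurable fun y : Fin m → ℝ => (∏ i, f (y i)) * |vdm y| * gapIntegral κ h p f y := by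
  have h1 := measurable_density (m := m) hf.measurable 1
  simp only [pow_one] at h1
  exact h1.mul (continuous_gapIntegral hf.measurable hf.nonneg hint).measurable

/-- The equality of the law of the kept points of one orthogonal ensemble with a symplectic ensemble
forces the supports to agree and gives the gap identity with `κ = 1`. -/
theorem gapIdentity_single {K m p h : ℕ} {e : Fin m ⊕ Fin p ≃ Fin K} (he : IsAlternating h e)
    (hm : 0 < m) (hh : h ≤ 1) (hp : p ≤ m + h) (hp0 : 0 < p) {I J : Set ℝ} {f w : ℝ → ℝ}
    (hf : IsWeightOn I f) (hw : IsWeightOn J w) (hP : IsProbabilityMeasure (OE K f))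
    (hQ : IsProbabilityMeasure (SE m w))
    (hlaw : (OE K f).map (fun x (i : Fin m) => kthLargest x (e (.inl i))) =
      (SE m w).map fun x k => kthLargest x k) :
    I = J ∧ ∃ C, GapIdentity 1 h m p C I f fun t => w t / f t := by
  have hK : K = m + p := by simpa using (Fintype.card_congr e).symm
  obtain ⟨hf0, hf1⟩ := mass_of_isProbabilityMeasure_ensemble hP
  obtain ⟨hw0, hw1⟩ := mass_of_isProbabilityMeasure_ensemble hQ
  have hint : Integrable fun t => f t * (1 + |t|) ^ (p - 1 + 1 * m) := by
    have : K = (p - 1 + 1 * m) + 1 := by omega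
    rw [this] at hf1
    exact integrable_of_unnormalized_ne_top hf hf1
  have hdens : (OE K f).map (fun x (i : Fin m) => kthLargest x (e (.inl i))) =
      ((unnormalized 1 K f Set.univ)⁻¹ * K.factorial) •
      (volume.withDensity ({y : Fin m → ℝ | StrictAnti y}.indicator
        fun y => ENNReal.ofReal ((∏ i, f (y i)) * |vdm y| * gapIntegral 1 h p f y))) := by
    rw [OE, ensemble, Measure.map_smul, map_kept_single he hh hp hf.measurable hf.nonneg,
      ← mul_smul_withDensity_chamber (measurable_kept_density hf hint)]
    congr 3
    ext y
    have hpf : 0 ≤ ∏ i, f (y i) := prod_nonneg fun i _ => hf.nonneg _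
    rw [mul_assoc (∏ i, f (y i)), ENNReal.ofReal_mul hpf, ENNReal.ofReal_mul (abs_nonneg _),
      integral_gapKernel_eq_lintegral hf.measurable hf.nonneg hint,
      ← lintegral_const_mul _ (measurable_gapKernel hf.measurable y).ennreal_ofReal]
    congr 2
    refine lintegral_congr fun x => ?_
    rw [← ENNReal.ofReal_mul (abs_nonneg _), abs_vdm_split e]
    simp only [merge_inl, merge_inr, gapKernel, pow_one]
    rw [prod_comm]
    congr 1
    ring
  have hfin : (OE K f).map (fun x (i : Fin m) => kthLargest x (e (.inl i))) Set.univ ≠ ⊤ := by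
    rw [Measure.map_apply (measurable_keptMap _) MeasurableSet.univ, Set.preimage_univ]
    exact measure_ne_top _ _
  rw [SE, map_kthLargest_ensemble hw.measurable] at hlaw
  rw [hdens] at hlaw hfin
  exact gapIdentity_of_density_eq hm hp hf hw hint
    (inv_mul_natCast_pos hf0 hf1 K.factorial_pos).2 (inv_mul_natCast_pos hw0 hw1 m.factorial_pos).2
    hlaw hfin

/-- Since the mass of an `ensemble` that is not a probability measure is `0` or `∞`, a superposition
of total mass `1` has two normalisable constituents. -/
theorem isProbabilityMeasure_of_superpose {M N : ℕ} {f : ℝ → ℝ}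
    (h : IsProbabilityMeasure (superpose (OE M f) (OE N f))) :
    IsProbabilityMeasure (OE M f) ∧ IsProbabilityMeasure (OE N f) := by
  have h1 := h.measure_univ
  have : SFinite (OE N f) := sFinite_ensemble
  rw [superpose, Measure.map_apply measurable_append MeasurableSet.univ, Set.preimage_univ,
    ← Set.univ_prod_univ, Measure.prod_prod] at h1
  have key : ∀ K, OE K f Set.univ ≠ 0 → IsProbabilityMeasure (OE K f) ∨ OE K f Set.univ = ⊤ := by
    intro K hK
    by_cases h0 : unnormalized 1 K f Set.univ = 0
    · rw [OE, ensemble, Measure.smul_apply, h0, smul_eq_mul, mul_zero] at hK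
      exact absurd rfl hK
    · by_cases ht : unnormalized 1 K f Set.univ = ⊤
      · rw [OE, ensemble, Measure.smul_apply, ht, ENNReal.inv_top, zero_smul] at hK
        exact absurd rfl hK
      · exact Or.inl (isProbabilityMeasure_ensemble h0 ht)
  have hM0 : OE M f Set.univ ≠ 0 := fun h0 => by simp [h0] at h1
  have hN0 : OE N f Set.univ ≠ 0 := fun h0 => by simp [h0] at h1
  refine ⟨(key M hM0).resolve_right fun ht => ?_, (key N hN0).resolve_right fun ht => ?_⟩
  · rw [ht, ENNReal.top_mul hN0] at h1; exact ENNReal.top_ne_one h1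
  · rw [ht, ENNReal.mul_top hM0] at h1; exact ENNReal.top_ne_one h1

/-- The equality of the law of the kept points of two superposed orthogonal ensembles with a unitary
ensemble forces the supports to agree and gives the gap identity with `κ = 0`. -/
theorem gapIdentity_superposed {M N m p h : ℕ} (hMN : M ≤ N) {e : Fin m ⊕ Fin p ≃ Fin (M + N)}
    (he : IsAlternating h e) (hm : 0 < m) (hh : h ≤ 1) (hp : p ≤ m + h) (hp0 : 0 < p)
    (hmp : (m = M ∧ p = N) ∨ (m = N ∧ p = M)) {I J : Set ℝ} {f w : ℝ → ℝ}
    (hf : IsWeightOn I f) (hw : IsWeightOn J w)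
    (hP : IsProbabilityMeasure (superpose (OE M f) (OE N f)))
    (hQ : IsProbabilityMeasure (UE m w))
    (hlaw : (superpose (OE M f) (OE N f)).map (fun x (i : Fin m) => kthLargest x (e (.inl i))) =
      (UE m w).map fun x k => kthLargest x k) :
    I = J ∧ ∃ C, GapIdentity 0 h m p C I f fun t => w t / f t := by
  obtain ⟨hPM, hPN⟩ := isProbabilityMeasure_of_superpose hP
  obtain ⟨hM0, hM1⟩ := mass_of_isProbabilityMeasure_ensemble hPM
  obtain ⟨hN0, hN1⟩ := mass_of_isProbabilityMeasure_ensemble hPN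
  obtain ⟨hw0, hw1⟩ := mass_of_isProbabilityMeasure_ensemble hQ
  have hp1 : unnormalized 1 p f Set.univ ≠ ⊤ := by rcases hmp with h | h <;> rw [h.2] <;> assumption
  have hint : Integrable fun t => f t * (1 + |t|) ^ (p - 1 + 0 * m) := by
    have : p = (p - 1 + 0 * m) + 1 := by omega
    rw [this] at hp1
    exact integrable_of_unnormalized_ne_top hf hp1
  have hc1 : 0 < ((unnormalized 1 M f Set.univ)⁻¹ * (unnormalized 1 N f Set.univ)⁻¹ *
      (M.factorial * N.factorial * 2 ^ M : ℕ)).toReal := by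
    rw [mul_assoc, ENNReal.toReal_mul]
    exact mul_pos (ENNReal.toReal_pos (ENNReal.inv_ne_zero.2 hM1) (ENNReal.inv_ne_top.2 hM0))
      (inv_mul_natCast_pos hN0 hN1 (by positivity)).2
  have hdens : (superpose (OE M f) (OE N f)).map
      (fun x (i : Fin m) => kthLargest x (e (.inl i))) =
      ((unnormalized 1 M f Set.univ)⁻¹ * (unnormalized 1 N f Set.univ)⁻¹ *
        (M.factorial * N.factorial * 2 ^ M : ℕ)) •
      (volume.withDensity ({y : Fin m → ℝ | StrictAnti y}.indicator
        fun y => ENNReal.ofReal ((∏ i, f (y i)) * |vdm y| * gapIntegral 0 h p f y))) := by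
    rw [OE, OE, superpose_ensemble, Measure.map_smul,
      map_kept_superposed hMN he hh hp hmp hf.measurable hf.nonneg,
      ← mul_smul_withDensity_chamber (measurable_kept_density hf hint)]
    congr 3
    ext y
    have hpf : 0 ≤ ∏ i, f (y i) := prod_nonneg fun i _ => hf.nonneg _
    rw [ENNReal.ofReal_mul (mul_nonneg hpf (abs_nonneg _)),
      integral_gapKernel_eq_lintegral hf.measurable hf.nonneg hint]
    congr 2
    refine lintegral_congr fun x => ?_
    simp [gapKernel]
  have hfin : (superpose (OE M f) (OE N f)).map
      (fun x (i : Fin m) => kthLargest x (e (.inl i))) Set.univ ≠ ⊤ := by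
    rw [Measure.map_apply (measurable_keptMap _) MeasurableSet.univ, Set.preimage_univ]
    exact measure_ne_top _ _
  rw [UE, map_kthLargest_ensemble hw.measurable] at hlaw
  rw [hdens] at hlaw hfin
  exact gapIdentity_of_density_eq hm hp hf hw hint hc1
    (inv_mul_natCast_pos hw0 hw1 m.factorial_pos).2 hlaw hfin

theorem IsWeightOn.neg {I : Set ℝ} {w : ℝ → ℝ} (hw : IsWeightOn I w) :
    IsWeightOn (-I) fun t => w (-t) where
  isOpen := hw.isOpen.neg
  ordConnected := by
    refine ⟨fun a ha b hb t ht => hw.ordConnected.out (Set.mem_neg.1 hb) (Set.mem_neg.1 ha)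
      ⟨neg_le_neg ht.2, neg_le_neg ht.1⟩⟩
  nonempty := hw.nonempty.neg
  measurable := hw.measurable.comp measurable_neg
  continuousOn := hw.continuousOn.comp continuous_neg.continuousOn fun _ ht => ht
  pos t ht := hw.pos _ ht
  eq_zero t ht := hw.eq_zero _ ht

theorem GapIdentity.neg {κ h m p : ℕ} {C : ℝ} {I : Set ℝ} {f W : ℝ → ℝ}
    (H : GapIdentity κ h m p C I f W) (hh : h ≤ p + 1 - m) (hp : m ≤ p + 1) :
    GapIdentity κ (p + 1 - m - h) m p C (-I) (fun t => f (-t)) fun t => W (-t) where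
  isWeightOn := H.isWeightOn.neg
  integrable := by
    have := H.integrable.comp_neg
    simpa only [abs_neg] using this
  const_pos := H.const_pos
  weight_pos t ht := H.weight_pos _ ht
  eq y hy hyI := by
    have h1 := gapIntegral_neg (κ := κ) (f := f) hh hp fun i => -y i.rev
    simp only [Fin.rev_rev, neg_neg] at h1
    have hv : |vdm fun i : Fin m => -y i.rev| = |vdm y| := by
      rw [← abs_vdm_comp_perm y Fin.revPerm, abs_vdm, abs_vdm]
      refine prod_congr rfl fun i _ => prod_congr rfl fun j _ => ?_
      simp only [Function.comp, Fin.revPerm_apply]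
      rw [neg_sub_neg, abs_sub_comm]
    rw [h1, H.eq _ (fun i j hij => neg_lt_neg (hy (Fin.rev_lt_rev.2 hij)))
      fun i => Set.mem_neg.1 (hyI _), hv]
    congr 2
    exact Equiv.prod_comp Fin.revPerm fun i => W (-y i)

/-! ### Configurations with equally spaced points -/

theorem strictAnti_cons {k : ℕ} {s : ℝ} {y : Fin k → ℝ} (hs : ∀ i, y i < s) (hy : StrictAnti y) :
    StrictAnti (Fin.cons s y : Fin (k + 1) → ℝ) := by
  intro i j hij
  induction j using Fin.cases with
  | zero => exact absurd hij (Fin.not_lt_zero i)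
  | succ j =>
    induction i using Fin.cases with
    | zero => simpa using hs j
    | succ i => simpa using hy (by simpa using hij)

theorem strictAnti_snoc {k : ℕ} {s : ℝ} {y : Fin k → ℝ} (hs : ∀ i, s < y i) (hy : StrictAnti y) :
    StrictAnti (Fin.snoc (α := fun _ => ℝ) y s : Fin (k + 1) → ℝ) := by
  intro i j hij
  induction i using Fin.lastCases with
  | last => exact absurd hij (Fin.le_last j).not_gt
  | cast i =>
    induction j using Fin.lastCases with
    | last => simpa using hs i
    | cast j => simpa using hy (by simpa using hij)

theorem prod_cons {k : ℕ} (W : ℝ → ℝ) (s : ℝ) (y : Fin k → ℝ) :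
    ∏ i, W ((Fin.cons s y : Fin (k + 1) → ℝ) i) = W s * ∏ i, W (y i) := by
  rw [Fin.prod_univ_succ]; simp

theorem prod_snoc {k : ℕ} (W : ℝ → ℝ) (s : ℝ) (y : Fin k → ℝ) :
    ∏ i, W ((Fin.snoc (α := fun _ => ℝ) y s : Fin (k + 1) → ℝ) i) = (∏ i, W (y i)) * W s := by
  rw [Fin.prod_univ_castSucc]; simp

theorem forall_cons {k : ℕ} {P : ℝ → Prop} {s : ℝ} {y : Fin k → ℝ} (hs : P s)
    (hy : ∀ i, P (y i)) (i : Fin (k + 1)) : P ((Fin.cons s y : Fin (k + 1) → ℝ) i) := by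
  induction i using Fin.cases with
  | zero => simpa using hs
  | succ i => simpa using hy i

theorem forall_snoc {k : ℕ} {P : ℝ → Prop} {s : ℝ} {y : Fin k → ℝ} (hs : P s)
    (hy : ∀ i, P (y i)) (i : Fin (k + 1)) :
    P ((Fin.snoc (α := fun _ => ℝ) y s : Fin (k + 1) → ℝ) i) := by
  induction i using Fin.lastCases with
  | last => simpa using hs
  | cast i => simpa using hy i

theorem integrable_of_integrable_mul_pow {f : ℝ → ℝ} {N : ℕ} (hf : Measurable f)
    (hf0 : ∀ t, 0 ≤ f t) (hint : Integrable fun t => f t * (1 + |t|) ^ N) : Integrable f := by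
  refine hint.mono' hf.aestronglyMeasurable (Filter.Eventually.of_forall fun t => ?_)
  rw [Real.norm_eq_abs, abs_of_nonneg (hf0 t)]
  exact le_mul_of_one_le_right (hf0 t) (one_le_pow₀ (by linarith [abs_nonneg t]))

theorem setIntegral_pos_of_isOpen {f : ℝ → ℝ} (hf : Integrable f) (hf0 : ∀ t, 0 ≤ f t) {U : Set ℝ}
    (hU : IsOpen U) (hne : U.Nonempty) (hpos : ∀ t ∈ U, 0 < f t) : 0 < ∫ t in U, f t := by
  rw [setIntegral_pos_iff_support_of_nonneg_ae (Filter.Eventually.of_forall hf0) hf.integrableOn]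
  exact (hU.measure_pos volume hne).trans_le (measure_mono fun t ht => ⟨(hpos t ht).ne', ht⟩)

/-- The points `b - 4 i η`. -/
def grid (b η : ℝ) (i : ℕ) : ℝ := b - 4 * i * η

/-- An interval well inside the gap between `grid b η j` and `grid b η (j + 1)`. -/
def gridGap (b η : ℝ) (j : ℕ) : Set ℝ := Set.Ioo (grid b η j - 3 * η) (grid b η j - η)

theorem grid_add_le {b η : ℝ} (hη : 0 < η) {i j : ℕ} (h : i < j) :
    grid b η j + 4 * η ≤ grid b η i := by
  have : (i : ℝ) + 1 ≤ j := by exact_mod_cast h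
  unfold grid; nlinarith

theorem grid_le {b η : ℝ} (hη : 0 < η) {i j : ℕ} (h : i ≤ j) : grid b η j ≤ grid b η i := by
  have : (i : ℝ) ≤ j := by exact_mod_cast h
  unfold grid; nlinarith

theorem grid_zero (b η : ℝ) : grid b η 0 = b := by simp [grid]

theorem strictAnti_grid {b η : ℝ} (hη : 0 < η) (k a : ℕ) :
    StrictAnti fun i : Fin k => grid b η (i + a) := fun i j hij => by
  have := grid_add_le (b := b) hη (i := i + a) (j := j + a) (by have : (i : ℕ) < j := hij; omega)
  simp only; linarith

theorem isOpen_gridGap (b η : ℝ) (j : ℕ) : IsOpen (gridGap b η j) := isOpen_Ioo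

theorem gridGap_nonempty {b η : ℝ} (hη : 0 < η) (j : ℕ) : (gridGap b η j).Nonempty :=
  Set.nonempty_Ioo.2 (by linarith)

theorem le_abs_sub_of_mem_gridGap {b η : ℝ} (hη : 0 < η) {j k : ℕ} (hjk : j < k) {t u : ℝ}
    (ht : t ∈ gridGap b η j) (hu : u ∈ gridGap b η k) : η ≤ |t - u| := by
  have := grid_add_le (b := b) hη hjk
  refine le_trans ?_ (le_abs_self _)
  linarith [ht.1, hu.2]

theorem le_abs_grid_sub {b η : ℝ} (hη : 0 < η) {i j : ℕ} {t : ℝ} (ht : t ∈ gridGap b η j) :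
    η ≤ |grid b η i - t| := by
  rcases le_or_gt i j with h | h
  · have := grid_le (b := b) hη h
    exact le_trans (by linarith [ht.2]) (le_abs_self _)
  · have := grid_add_le (b := b) hη h
    rw [abs_sub_comm]
    exact le_trans (by linarith [ht.1]) (le_abs_self _)

section Bounds

variable {κ k q : ℕ} {f : ℝ → ℝ}

/-- The lower bound for a largest point `s` above a grid of other points. -/
theorem exists_grid_le_gapIntegral (hf : Measurable f) (hf0 : ∀ t, 0 ≤ f t)
    (hint : Integrable fun t => f t * (1 + |t|) ^ (q + κ * (k + 1))) {b η : ℝ} (hη : 0 < η)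
    (hη1 : η ≤ 1) (hpos : ∀ j ≤ q, ∀ t ∈ gridGap b η j, 0 < f t) :
    ∃ c > 0, ∀ s ≥ b, c * (s - b + η) ^ (κ * (q + 1)) ≤
      gapIntegral κ 0 (q + 1) f (Fin.cons s fun i : Fin k => grid b η (i + 1)) := by
  have hfi := integrable_of_integrable_mul_pow hf hf0 hint
  refine ⟨(∏ j : Fin (q + 1), ∫ t in gridGap b η j, f t) *
    (η ^ ((q + 1) * (q + 1)) * (η ^ (κ * k)) ^ (q + 1)), mul_pos (prod_pos fun j _ =>
      setIntegral_pos_of_isOpen hfi hf0 (isOpen_gridGap b η j) (gridGap_nonempty hη j)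
        (hpos j (by omega))) (by positivity), fun s hs => ?_⟩
  have hs' : 0 ≤ s - b + η := by linarith
  have h := le_gapIntegral (κ := κ) (h := 0) (p := q + 1) hf hf0 hint
    (y := (Fin.cons s fun i : Fin k => grid b η (i + 1) : Fin (k + 1) → ℝ))
    (U := fun j => gridGap b η j) (fun j => (isOpen_gridGap b η j).measurableSet)
    (fun j t ht i => ?_) (fun j => hfi.integrableOn) hη.le hη1
    (fun j l hjl t ht u hu => le_abs_sub_of_mem_gridGap hη hjl ht hu)
    (d := fun _ => Fin.cons (s - b + η) fun _ => η)
    (fun j i => forall_cons (P := fun x => 0 ≤ x) hs' (fun _ => hη.le) i) (fun j i t ht => ?_)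
  · refine le_trans (le_of_eq ?_) h
    simp only [prod_cons (fun x => x ^ κ)]
    simp only [prod_const, card_univ, Fintype.card_fin]
    rw [mul_pow, ← pow_mul, ← pow_mul η κ k]
    ring
  · induction i using Fin.cases with
    | zero =>
      have := grid_le (b := b) hη (Nat.zero_le (j : ℕ))
      rw [grid_zero] at this
      exact ⟨fun _ => by rw [Fin.cons_zero]; linarith [ht.2], fun hij => by simp at hij⟩
    | succ i =>
      simp only [Fin.val_succ, add_zero, Fin.cons_succ]
      refine ⟨fun hij => ?_, fun hij => ?_⟩
      · have := grid_le (b := b) hη hij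
        linarith [ht.2]
      · have := grid_add_le (b := b) hη hij
        linarith [ht.1]
  · induction i using Fin.cases with
    | zero =>
      have := grid_le (b := b) hη (Nat.zero_le (j : ℕ))
      rw [grid_zero] at this
      simp only [Fin.cons_zero]
      exact le_trans (by linarith [ht.2]) (le_abs_self _)
    | succ i =>
      simp only [Fin.cons_succ]
      exact le_abs_grid_sub hη ht

theorem gapIntegral_le_of_setIntegral_le {m h : ℕ} (hf : Measurable f) (hf0 : ∀ t, 0 ≤ f t)
    (hint : Integrable fun t => f t * (1 + |t|) ^ (q + κ * m)) (y : Fin m → ℝ) {A : ℝ}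
    (hA : ∏ i, (1 + |y i|) ^ κ ≤ A) {S : Set ℝ} (hsub : gap h y 0 ⊆ S) :
    gapIntegral κ h (q + 1) f y ≤ A ^ (q + 1) * (∫ t, f t * (1 + |t|) ^ (q + κ * m)) ^ q *
      ∫ t in S, f t * (1 + |t|) ^ (q + κ * m) := by
  have hnn : ∀ t, 0 ≤ f t * (1 + |t|) ^ (q + κ * m) := fun t => mul_nonneg (hf0 t) (by positivity)
  have hM : 0 ≤ ∫ t, f t * (1 + |t|) ^ (q + κ * m) := integral_nonneg hnn
  have hA0 : 0 ≤ ∏ i, (1 + |y i|) ^ κ := prod_nonneg fun i _ => by positivity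
  have hint' : Integrable fun t => f t * (1 + |t|) ^ (q + 1 - 1 + κ * m) := hint
  have h1 : ∫ t in gap h y 0, gapFactor κ (q + 1) f y t ≤
      A * ∫ t in S, f t * (1 + |t|) ^ (q + κ * m) := by
    refine (setIntegral_gapFactor_le hf hf0 hint' y _).trans (mul_le_mul hA ?_
      (integral_nonneg hnn) (hA0.trans hA))
    exact setIntegral_mono_set hint.integrableOn (Filter.Eventually.of_forall hnn)
      (Filter.Eventually.of_forall hsub)
  refine (gapIntegral_le_first hf hf0 hint y).trans ?_
  have h2 : ((∏ i, (1 + |y i|) ^ κ) * ∫ t, f t * (1 + |t|) ^ (q + κ * m)) ^ q ≤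
      (A * ∫ t, f t * (1 + |t|) ^ (q + κ * m)) ^ q :=
    pow_le_pow_left₀ (mul_nonneg hA0 hM) (mul_le_mul_of_nonneg_right hA hM) q
  have h3 : 0 ≤ A * ∫ t in S, f t * (1 + |t|) ^ (q + κ * m) :=
    mul_nonneg (hA0.trans hA) (integral_nonneg hnn)
  calc _ ≤ (A * ∫ t in S, f t * (1 + |t|) ^ (q + κ * m)) *
        (A * ∫ t, f t * (1 + |t|) ^ (q + κ * m)) ^ q :=
        mul_le_mul h1 h2 (pow_nonneg (mul_nonneg hA0 hM) q) h3
    _ = _ := by rw [mul_pow]; ring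

theorem prod_one_add_abs_le {m : ℕ} {y : Fin m → ℝ} {R : ℝ} (hy : ∀ i, |y i| ≤ R) (κ : ℕ) :
    ∏ i, (1 + |y i|) ^ κ ≤ (1 + R) ^ (κ * m) := by
  have : (1 + R) ^ (κ * m) = ∏ _i : Fin m, (1 + R) ^ κ := by simp [pow_mul]
  rw [this]
  exact prod_le_prod (fun i _ => by positivity) fun i _ =>
    pow_le_pow_left₀ (by positivity) (by linarith [hy i]) κ

end Bounds

/-! ### Even weights on the line -/

theorem tendsto_setIntegral_Ioi {g : ℝ → ℝ} (hg : Integrable g) :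
    Filter.Tendsto (fun n : ℕ => ∫ t in Set.Ioi (n : ℝ), g t) Filter.atTop (nhds 0) := by
  have h := tendsto_setIntegral_of_antitone (s := fun n : ℕ => Set.Ioi (n : ℝ)) (f := g)
    (μ := volume) (fun n => measurableSet_Ioi)
    (fun a b hab => Set.Ioi_subset_Ioi (by exact_mod_cast hab)) ⟨0, hg.integrableOn⟩
  have h2 : ⋂ n : ℕ, Set.Ioi (n : ℝ) = ∅ := by
    ext t
    simp only [Set.mem_iInter, Set.mem_Ioi, Set.mem_empty_iff_false, iff_false, not_forall, not_lt]
    exact exists_nat_ge t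
  simpa [h2] using h

/-- If only one of the two extreme points is integrated out, the law of the kept points is not
symmetric: sending one kept point to infinity costs much more on one side than on the other. -/
theorem GapIdentity.false_of_even {κ k : ℕ} {C : ℝ} {f W : ℝ → ℝ}
    (H : GapIdentity κ 0 (k + 1) (k + 1) C Set.univ f W) (hf : ∀ t, f (-t) = f t)
    (hW : ∀ t, W (-t) = W t) : False := by
  have H' := H.neg (by omega) (by omega)
  simp only [hf, hW] at H'
  rw [show k + 1 + 1 - (k + 1) - 0 = 1 by omega] at H'
  have hfm := H.isWeightOn.measurable
  have hf0 := H.isWeightOn.nonneg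
  have hint : Integrable fun t => f t * (1 + |t|) ^ (k + κ * (k + 1)) := H.integrable
  set M := ∫ t, f t * (1 + |t|) ^ (k + κ * (k + 1)) with hM
  obtain ⟨c, hc, hlow⟩ := exists_grid_le_gapIntegral (k := k) (q := k) hfm hf0 hint (b := 0)
    one_pos le_rfl fun j _ t _ => H.isWeightOn.pos t trivial
  set A : ℝ := ∏ i : Fin k, (1 + |grid 0 1 (i + 1)|) ^ κ with hA
  have hA0 : 0 ≤ A := prod_nonneg fun i _ => by positivity
  -- By symmetry, the same values of `W` describe the integral in which the upper extreme point is
  -- integrated out instead; that one is at most a tail of a convergent integral.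
  have hbound : ∀ n : ℕ, c ≤ A ^ (k + 1) * M ^ k *
      ∫ t in Set.Ioi (n : ℝ), f t * (1 + |t|) ^ (k + κ * (k + 1)) := by
    intro n
    have hn : (0 : ℝ) ≤ n := n.cast_nonneg
    have hanti : StrictAnti (Fin.cons (n : ℝ) fun i : Fin k => grid 0 1 (i + 1) :
        Fin (k + 1) → ℝ) := by
      refine strictAnti_cons (fun i => ?_) (strictAnti_grid one_pos k 1)
      have := grid_add_le (b := 0) one_pos (Nat.succ_pos (i : ℕ))
      rw [grid_zero] at this
      simp only [Nat.succ_eq_add_one] at this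
      linarith
    have h1 := hlow n hn
    rw [H.eq _ hanti fun _ => trivial, ← H'.eq _ hanti fun _ => by simp] at h1
    have h2 := h1.trans (gapIntegral_le_of_setIntegral_le hfm hf0 hint _
      (A := (1 + n) ^ κ * A) (by
        rw [prod_cons fun x => (1 + |x|) ^ κ, abs_of_nonneg hn])
      (S := Set.Ioi (n : ℝ)) fun t ht => by simpa using (ht 0).2 (by simp))
    rw [mul_pow, ← pow_mul, ← hM, sub_zero, add_comm (n : ℝ) 1] at h2
    have hp : 0 < (1 + (n : ℝ)) ^ (κ * (k + 1)) := by positivity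
    refine le_of_mul_le_mul_right ?_ hp
    linarith
  have hlim := (tendsto_setIntegral_Ioi hint).const_mul (A ^ (k + 1) * M ^ k)
  rw [mul_zero] at hlim
  exact hc.not_ge (ge_of_tendsto' hlim hbound)

/-- If neither of the extreme points is integrated out, then the decay of `W` needed when one kept
point goes to infinity is too fast when two kept points go to infinity in opposite directions. -/
theorem GapIdentity.false_of_even_two_sided {κ k : ℕ} {C : ℝ} {f W : ℝ → ℝ}
    (H : GapIdentity κ 0 (k + 2) (k + 1) C Set.univ f W) (hW : ∀ t, W (-t) = W t) : False := by
  have hfm := H.isWeightOn.measurable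
  have hf0 := H.isWeightOn.nonneg
  have hint : Integrable fun t => f t * (1 + |t|) ^ (k + κ * (k + 2)) := H.integrable
  have hfi := integrable_of_integrable_mul_pow hfm hf0 hint
  have hWp : ∀ t, 0 < W t := fun t => H.weight_pos t trivial
  set M := ∫ t, f t * (1 + |t|) ^ (k + κ * (k + 2)) with hM
  have hM0 : 0 ≤ M := integral_nonneg fun t => mul_nonneg (hf0 t) (by positivity)
  let g : Fin k → ℝ := fun i => grid 0 1 (i + 1)
  have hg : StrictAnti g := strictAnti_grid one_pos k 1
  have hg0 : ∀ i, g i < 0 := fun i => by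
    have := grid_add_le (b := 0) one_pos (Nat.succ_pos (i : ℕ))
    rw [grid_zero] at this
    simp only [Nat.succ_eq_add_one] at this
    simp only [g]; linarith
  set T : ℝ := 4 * k + 4 with hT
  have hgT : ∀ i, -T < g i := fun i => by
    have : ((i : ℕ) : ℝ) + 1 ≤ k := by exact_mod_cast i.isLt
    simp only [g, grid, hT]; push_cast; linarith
  let z : ℝ → Fin (k + 1) → ℝ := fun t => Fin.snoc (α := fun _ => ℝ) g (-t)
  have hz0 : ∀ t > 0, ∀ i, z t i < 0 := fun t ht =>
    forall_snoc (P := fun x => x < 0) (by linarith) hg0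
  have hanti : ∀ s > 0, ∀ t ≥ T, StrictAnti (Fin.cons s (z t) : Fin (k + 2) → ℝ) :=
    fun s hs t ht => strictAnti_cons (fun i => (hz0 t (by
      have : 0 < T := by positivity
      linarith) i).trans hs) (strictAnti_snoc (fun i => by linarith [hgT i]) hg)
  have hT0 : 0 < T := by positivity
  have hval : ∀ s > 0, ∀ t ≥ T, gapIntegral κ 0 (k + 1) f (Fin.cons s (z t) : Fin (k + 2) → ℝ) =
      C * (W s * ∏ i, W (z t i)) * ((∏ i, |s - z t i|) * |vdm (z t)|) ^ (1 + 2 * κ) := by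
    intro s hs t ht
    rw [H.eq _ (hanti s hs t ht) fun _ => trivial, prod_cons, abs_vdm_cons]
  -- One kept point `s` goes to infinity: an upper bound for `W s`.
  have hone : ∃ c, ∀ s ≥ 1, W s * s ^ ((k + 1) * (1 + 2 * κ)) ≤ c * s ^ (κ * (k + 1)) := by
    set A : ℝ := ∏ i, (1 + |z T i|) ^ κ
    have hA0 : 0 ≤ A := prod_nonneg fun i _ => by positivity
    set D := C * (∏ i, W (z T i)) * |vdm (z T)| ^ (1 + 2 * κ) with hD
    have hD0 : 0 < D := mul_pos (mul_pos H.const_pos (prod_pos fun i _ => hWp _))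
      (pow_pos (abs_pos.2 (vdm_ne_zero
        (strictAnti_snoc (fun i => hgT i) hg).injective)) _)
    refine ⟨2 ^ (κ * (k + 1)) * (A ^ (k + 1) * M ^ k * M) / D, fun s hs => ?_⟩
    have hs0 : 0 < s := by linarith
    have h1 := gapIntegral_le_of_setIntegral_le (h := 0) hfm hf0 hint
      (Fin.cons s (z T) : Fin (k + 2) → ℝ) (A := (1 + s) ^ κ * A) (by
        rw [prod_cons fun x => (1 + |x|) ^ κ, abs_of_pos hs0])
      (Set.subset_univ _)
    rw [Measure.restrict_univ, ← hM, hval s hs0 T le_rfl] at h1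
    have h2 : s ^ (k + 1) ≤ ∏ i, |s - z T i| := by
      have : s ^ (k + 1) = ∏ _i : Fin (k + 1), s := by simp
      rw [this]
      exact prod_le_prod (fun i _ => hs0.le) fun i _ =>
        le_trans (by linarith [hz0 T hT0 i]) (le_abs_self _)
    have h3 : W s * s ^ ((k + 1) * (1 + 2 * κ)) * D ≤
        C * (W s * ∏ i, W (z T i)) * ((∏ i, |s - z T i|) * |vdm (z T)|) ^ (1 + 2 * κ) := by
      have h4 : (s ^ (k + 1)) ^ (1 + 2 * κ) ≤ (∏ i, |s - z T i|) ^ (1 + 2 * κ) := by gcongr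
      rw [← pow_mul] at h4
      have h5 : 0 ≤ W s * D := (mul_pos (hWp s) hD0).le
      calc _ = W s * D * s ^ ((k + 1) * (1 + 2 * κ)) := by ring
        _ ≤ W s * D * (∏ i, |s - z T i|) ^ (1 + 2 * κ) := by gcongr
        _ = _ := by rw [hD, mul_pow]; ring
    have h6 : (1 + s) ^ (κ * (k + 1)) ≤ 2 ^ (κ * (k + 1)) * s ^ (κ * (k + 1)) := by
      rw [← mul_pow]
      exact pow_le_pow_left₀ (by linarith) (by linarith) _
    rw [div_mul_eq_mul_div, le_div_iff₀ hD0]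
    refine (h3.trans h1).trans ?_
    rw [mul_pow, ← pow_mul]
    have h7 : 0 ≤ A ^ (k + 1) * M ^ k * M := by positivity
    calc _ = (A ^ (k + 1) * M ^ k * M) * (1 + s) ^ (κ * (k + 1)) := by ring
      _ ≤ (A ^ (k + 1) * M ^ k * M) * (2 ^ (κ * (k + 1)) * s ^ (κ * (k + 1))) := by gcongr
      _ = _ := by ring
  -- Two kept points `s` and `-s` go to infinity: a lower bound for the integral over the gaps.
  have htwo : ∃ c > 0, ∀ s ≥ 2 * T, c * s ^ (2 * κ * (k + 1)) ≤
      gapIntegral κ 0 (k + 1) f (Fin.cons s (z s) : Fin (k + 2) → ℝ) := by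
    refine ⟨(∏ j : Fin (k + 1), ∫ t in gridGap 0 1 j, f t) * ((1 / 2) ^ κ) ^ (k + 1),
      mul_pos (prod_pos fun j _ => setIntegral_pos_of_isOpen hfi hf0 (isOpen_gridGap 0 1 j)
        (gridGap_nonempty one_pos j) fun t _ => H.isWeightOn.pos t trivial) (by positivity),
      fun s hs => ?_⟩
    have hs0 : 0 < s := by linarith
    have hjT : ∀ j : Fin (k + 1), ∀ t ∈ gridGap 0 1 (j : ℕ), -T < t ∧ t < 0 := by
      intro j t ht
      have hj : ((j : ℕ) : ℝ) ≤ k := by exact_mod_cast Nat.lt_succ_iff.1 j.isLt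
      have hj0 : (0 : ℝ) ≤ (j : ℕ) := Nat.cast_nonneg _
      have h1 := ht.1
      have h2 := ht.2
      simp only [grid] at h1 h2
      exact ⟨by rw [hT]; linarith, by linarith⟩
    have h := le_gapIntegral (κ := κ) (h := 0) (p := k + 1) hfm hf0 hint
      (y := (Fin.cons s (z s) : Fin (k + 2) → ℝ))
      (U := fun j => gridGap 0 1 j) (fun j => (isOpen_gridGap 0 1 j).measurableSet)
      (fun j t ht i => ?_) (fun j => hfi.integrableOn) zero_le_one le_rfl
      (fun j l hjl t ht u hu => le_abs_sub_of_mem_gridGap one_pos hjl ht hu)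
      (d := fun _ => Fin.cons s (Fin.snoc (α := fun _ => ℝ) (fun _ => 1) (s / 2)))
      (fun j i => forall_cons (P := fun x => 0 ≤ x) hs0.le
        (forall_snoc (P := fun x => 0 ≤ x) (by positivity) fun _ => zero_le_one) i)
      (fun j i t ht => ?_)
    · refine le_trans (le_of_eq ?_) h
      simp only [prod_cons (fun x => x ^ κ), prod_snoc (fun x => x ^ κ)]
      simp only [prod_const, card_univ, Fintype.card_fin, one_pow, one_mul]
      rw [show 2 * κ * (k + 1) = κ * (k + 1) + κ * (k + 1) by ring, pow_add, div_pow, div_pow,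
        mul_pow, div_pow, one_pow, div_pow, one_pow, ← pow_mul, ← pow_mul]
      ring
    · induction i using Fin.cases with
      | zero => exact ⟨fun _ => by rw [Fin.cons_zero]; linarith [(hjT j t ht).2],
          fun hij => by simp at hij⟩
      | succ i =>
        simp only [Fin.val_succ, add_zero, Fin.cons_succ]
        induction i using Fin.lastCases with
        | last =>
          simp only [z, Fin.snoc_last, Fin.val_last]
          exact ⟨fun hij => by have := j.isLt; omega, fun _ => by linarith [(hjT j t ht).1]⟩
        | cast i =>
          simp only [z, Fin.snoc_castSucc, Fin.val_castSucc, g]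
          refine ⟨fun hij => ?_, fun hij => ?_⟩
          · have := grid_le (b := 0) one_pos hij
            linarith [ht.2]
          · have := grid_add_le (b := 0) one_pos hij
            linarith [ht.1]
    · induction i using Fin.cases with
      | zero =>
        simp only [Fin.cons_zero]
        exact le_trans (by linarith [(hjT j t ht).2]) (le_abs_self _)
      | succ i =>
        simp only [Fin.cons_succ]
        induction i using Fin.lastCases with
        | last =>
          simp only [z, Fin.snoc_last]
          rw [abs_sub_comm]
          exact le_trans (by linarith [(hjT j t ht).1]) (le_abs_self _)
        | cast i =>
          simp only [z, Fin.snoc_castSucc, g]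
          exact le_abs_grid_sub one_pos ht
  obtain ⟨c₁, hc₁⟩ := hone
  obtain ⟨c₂, hc₂, hlow⟩ := htwo
  set E := C * (∏ i, W (g i)) * (2 ^ (2 * k + 1) * |vdm g|) ^ (1 + 2 * κ) with hE
  have hE0 : 0 ≤ E := mul_nonneg (mul_nonneg H.const_pos.le
    (prod_nonneg fun i _ => (hWp _).le)) (by positivity)
  have hfinal : ∀ s ≥ 2 * T, c₂ * s ≤ E * c₁ ^ 2 := by
    intro s hs
    have hT4 : 4 ≤ T := by
      have : (0 : ℝ) ≤ k := k.cast_nonneg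
      rw [hT]
      linarith
    have hs1 : 1 ≤ s := by linarith
    have hs0 : 0 < s := by linarith
    have h1 := hlow s hs
    rw [hval s hs0 s (by linarith)] at h1
    simp only [z] at h1
    rw [prod_snoc, abs_vdm_snoc, hW, prod_snoc fun x => |s - x|] at h1
    have hp1 : ∏ i, |s - g i| ≤ (2 * s) ^ k := by
      have : (2 * s) ^ k = ∏ _i : Fin k, (2 * s) := by simp
      rw [this]
      refine prod_le_prod (fun i _ => abs_nonneg _) fun i _ => ?_
      rw [abs_of_pos (by linarith [hg0 i])]
      linarith [hgT i]
    have hp2 : ∏ i, |-s - g i| ≤ (2 * s) ^ k := by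
      have : (2 * s) ^ k = ∏ _i : Fin k, (2 * s) := by simp
      rw [this]
      refine prod_le_prod (fun i _ => abs_nonneg _) fun i _ => ?_
      rw [abs_of_neg (by linarith [hgT i])]
      linarith [hg0 i]
    have hp3 : |s - -s| = 2 * s := by rw [abs_of_pos (by linarith)]; ring
    have hv : (∏ i, |s - g i|) * |s - -s| * ((∏ i, |-s - g i|) * |vdm g|) ≤
        s ^ (2 * k + 1) * (2 ^ (2 * k + 1) * |vdm g|) := by
      calc _ ≤ (2 * s) ^ k * (2 * s) * ((2 * s) ^ k * |vdm g|) := by rw [hp3]; gcongr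
        _ = _ := by rw [mul_pow]; ring
    have h2 : c₂ * s ^ (2 * κ * (k + 1)) ≤
        E * (W s) ^ 2 * s ^ ((2 * k + 1) * (1 + 2 * κ)) := by
      refine h1.trans ?_
      have h4 : 0 ≤ C * (W s * ((∏ i, W (g i)) * W s)) := mul_nonneg H.const_pos.le
        (mul_nonneg (hWp _).le (mul_nonneg (prod_nonneg fun i _ => (hWp _).le) (hWp _).le))
      calc _ ≤ C * (W s * ((∏ i, W (g i)) * W s)) *
            (s ^ (2 * k + 1) * (2 ^ (2 * k + 1) * |vdm g|)) ^ (1 + 2 * κ) := by gcongr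
        _ = _ := by rw [hE, mul_pow, ← pow_mul]; ring
    have h3 := hc₁ s hs1
    have h5 : (W s * s ^ ((k + 1) * (1 + 2 * κ))) ^ 2 ≤ (c₁ * s ^ (κ * (k + 1))) ^ 2 :=
      pow_le_pow_left₀ (mul_nonneg (hWp s).le (by positivity)) h3 2
    -- Inserting the bound for `W s` twice leaves the power `s ^ (1 + 2 κ)` unbalanced.
    have h6 : c₂ * s ^ (1 + 2 * κ) ≤ E * c₁ ^ 2 := by
      have hpos : 0 < s ^ (2 * κ * (k + 1) + (2 * k + 1) * (1 + 2 * κ)) := by positivity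
      refine le_of_mul_le_mul_right ?_ hpos
      calc c₂ * s ^ (1 + 2 * κ) * s ^ (2 * κ * (k + 1) + (2 * k + 1) * (1 + 2 * κ))
          = c₂ * s ^ (2 * κ * (k + 1)) * (s ^ ((k + 1) * (1 + 2 * κ))) ^ 2 := by
            rw [← pow_mul, mul_assoc c₂, ← pow_add, mul_assoc c₂, ← pow_add]
            congr 2; ring
        _ ≤ E * (W s) ^ 2 * s ^ ((2 * k + 1) * (1 + 2 * κ)) * (s ^ ((k + 1) * (1 + 2 * κ))) ^ 2 := by
            gcongr
        _ = E * s ^ ((2 * k + 1) * (1 + 2 * κ)) * (W s * s ^ ((k + 1) * (1 + 2 * κ))) ^ 2 := by ring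
        _ ≤ E * s ^ ((2 * k + 1) * (1 + 2 * κ)) * (c₁ * s ^ (κ * (k + 1))) ^ 2 := by gcongr
        _ = _ := by
            rw [mul_pow c₁, ← pow_mul, pow_add, show κ * (k + 1) * 2 = 2 * κ * (k + 1) by ring]
            ring
    have h7 : s ≤ s ^ (1 + 2 * κ) := le_self_pow₀ hs1 (by omega)
    exact (mul_le_mul_of_nonneg_left h7 hc₂.le).trans h6
  have h1 := hfinal (max (2 * T) (E * c₁ ^ 2 / c₂ + 1)) (le_max_left _ _)
  have h2 : c₂ * (E * c₁ ^ 2 / c₂ + 1) ≤ E * c₁ ^ 2 :=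
    (mul_le_mul_of_nonneg_left (le_max_right _ _) hc₂.le).trans h1
  rw [mul_add, mul_div_cancel₀ _ hc₂.ne'] at h2
  linarith

/-! ### The weight at an unfilled upper end -/

theorem gridGap_subset_Ioo {b b₀ δ η : ℝ} {j K : ℕ} (hη : 0 < η) (hb₀ : b₀ ≤ b)
    (hδ : b - δ ≤ b₀ - 4 * (K + 1) * η) (hj : j ≤ K) : gridGap b₀ η j ⊆ Set.Ioo (b - δ) b := by
  intro t ht
  have h1 := ht.1
  have h2 := ht.2
  have h3 : (j : ℝ) ≤ K := by exact_mod_cast hj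
  have h4 : (0 : ℝ) ≤ j := j.cast_nonneg
  simp only [grid] at h1 h2
  constructor <;> nlinarith

theorem grid_mem_Ioo {b b₀ δ η : ℝ} {j K : ℕ} (hη : 0 < η) (hb₀ : b₀ < b)
    (hδ : b - δ ≤ b₀ - 4 * (K + 1) * η) (hj : j ≤ K) : grid b₀ η j ∈ Set.Ioo (b - δ) b := by
  have h3 : (j : ℝ) ≤ K := by exact_mod_cast hj
  have h4 : (0 : ℝ) ≤ j := j.cast_nonneg
  simp only [grid]
  constructor <;> nlinarith

/-- As no point above the largest kept point `s` is integrated out, `W s` is a continuous positive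
function of `s` up to the end of the support and beyond. -/
theorem GapIdentity.exists_bounds_weight {κ k q : ℕ} {C b₀ B η : ℝ} {I : Set ℝ} {f W : ℝ → ℝ}
    (H : GapIdentity κ 0 (k + 1) (q + 1) C I f W) (hη : 0 < η) (hη1 : η ≤ 1) (hB : b₀ ≤ B)
    (hgap : ∀ j ≤ q, gridGap b₀ η j ⊆ I) (hgrid : ∀ i < k, grid b₀ η (i + 1) ∈ I) :
    ∃ w₁ > 0, ∃ w₂ > 0, ∀ s ∈ Set.Icc b₀ B ∩ I, w₁ ≤ W s ∧ W s ≤ w₂ := by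
  have hfm := H.isWeightOn.measurable
  have hf0 := H.isWeightOn.nonneg
  have hint : Integrable fun t => f t * (1 + |t|) ^ (q + κ * (k + 1)) := H.integrable
  obtain ⟨c, hc, hlow⟩ := exists_grid_le_gapIntegral hfm hf0 hint hη hη1
    fun j hj t ht => H.isWeightOn.pos t (hgap j hj ht)
  set g : Fin k → ℝ := fun i => grid b₀ η (i + 1) with hg
  have hganti : StrictAnti g := strictAnti_grid hη k 1
  have hglt : ∀ i, g i < b₀ := fun i => by
    have := grid_add_le (b := b₀) hη (Nat.succ_pos (i : ℕ))
    rw [grid_zero] at this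
    simp only [Nat.succ_eq_add_one] at this
    simp only [g]; linarith
  have hV : 0 < |vdm g| := abs_pos.2 (vdm_ne_zero hganti.injective)
  have hP : 0 < ∏ i, W (g i) := prod_pos fun i _ => H.weight_pos _ (hgrid i i.isLt)
  have hC := H.const_pos
  have hden : ∀ s ∈ Set.Icc b₀ B, 0 < C * (∏ i, W (g i)) * ((∏ i, |s - g i|) * |vdm g|) ^ (1 + 2 * κ) := by
    intro s hs
    have : 0 < ∏ i, |s - g i| := prod_pos fun i _ => abs_pos.2 (by linarith [hglt i, hs.1])
    positivity
  -- The gap identity, solved for `W s`.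
  set G : ℝ → ℝ := fun s => gapIntegral κ 0 (q + 1) f (Fin.cons s g : Fin (k + 1) → ℝ) /
    (C * (∏ i, W (g i)) * ((∏ i, |s - g i|) * |vdm g|) ^ (1 + 2 * κ)) with hG
  have hcont : ContinuousOn G (Set.Icc b₀ B) := by
    refine ContinuousOn.div ?_ (by fun_prop) fun s hs => (hden s hs).ne'
    refine ((continuous_gapIntegral (h := 0) (p := q + 1) hfm hf0 hint).comp ?_).continuousOn
    exact Continuous.finCons continuous_id continuous_const
  have hpos : ∀ s ∈ Set.Icc b₀ B, 0 < G s := fun s hs =>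
    div_pos (lt_of_lt_of_le (mul_pos hc (pow_pos (by linarith [hs.1]) _)) (hlow s hs.1)) (hden s hs)
  have hGW : ∀ s ∈ Set.Icc b₀ B ∩ I, G s = W s := by
    intro s hs
    have h1 := H.eq (Fin.cons s g) (strictAnti_cons (fun i => (hglt i).trans_le hs.1.1) hganti)
      (forall_cons (P := (· ∈ I)) hs.2 fun i => hgrid i i.isLt)
    rw [hG]
    simp only
    rw [h1, prod_cons, abs_vdm_cons, div_eq_iff (hden s hs.1).ne']
    ring
  obtain ⟨u, hu, hmin⟩ := isCompact_Icc.exists_isMinOn (Set.nonempty_Icc.2 hB) hcont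
  obtain ⟨v, hv, hmax⟩ := isCompact_Icc.exists_isMaxOn (Set.nonempty_Icc.2 hB) hcont
  exact ⟨G u, hpos u hu, G v, hpos v hv, fun s hs => ⟨hGW s hs ▸ hmin hs.1, hGW s hs ▸ hmax hs.1⟩⟩

theorem mul_rpow_bounds {a x u : ℝ} (hx : 0 < x) (h1 : x ≤ u) (h2 : u ≤ 2 * x) :
    x ^ a * 2 ^ (-|a|) ≤ u ^ a ∧ u ^ a ≤ x ^ a * 2 ^ |a| := by
  have hv1 : 1 ≤ u / x := (one_le_div hx).2 h1
  have hv2 : u / x ≤ 2 := (div_le_iff₀ hx).2 h2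
  have hu : u ^ a = x ^ a * (u / x) ^ a := by
    rw [← Real.mul_rpow hx.le (by linarith), mul_div_cancel₀ _ hx.ne']
  have hxa : 0 < x ^ a := Real.rpow_pos_of_pos hx a
  rw [hu]
  refine ⟨mul_le_mul_of_nonneg_left ?_ hxa.le, mul_le_mul_of_nonneg_left ?_ hxa.le⟩
  · calc (2 : ℝ) ^ (-|a|) ≤ (u / x) ^ (-|a|) :=
          Real.rpow_le_rpow_of_nonpos (by linarith) hv2 (by simp)
      _ ≤ (u / x) ^ a := Real.rpow_le_rpow_of_exponent_le hv1 (neg_abs_le a)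
  · calc (u / x) ^ a ≤ (u / x) ^ |a| := Real.rpow_le_rpow_of_exponent_le hv1 (le_abs_self a)
      _ ≤ 2 ^ |a| := Real.rpow_le_rpow (by linarith) hv2 (abs_nonneg a)

/-- If no point above the largest kept point is integrated out and `f` behaves like a power at the
upper end of its support, then this power is trivial: the integral over the gap of two kept points
approaching the end together has to have the size of their Vandermonde factor. -/
theorem GapIdentity.exponent_eq_zero {κ k q : ℕ} {C b δ a c₁ c₂ : ℝ} {I : Set ℝ} {f W : ℝ → ℝ}
    (H : GapIdentity κ 0 (k + 2) (q + 1) C I f W) (hq : q ≤ k + 1) (hδ : 0 < δ)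
    (hI : Set.Ioo (b - δ) b ⊆ I) (hc₁ : 0 < c₁)
    (hf₁ : ∀ t ∈ Set.Ioo (b - δ) b, c₁ * (b - t) ^ a ≤ f t)
    (hf₂ : ∀ t ∈ Set.Ioo (b - δ) b, f t ≤ c₂ * (b - t) ^ a) : a = 0 := by
  have hfm := H.isWeightOn.measurable
  have hf0 := H.isWeightOn.nonneg
  have hint : Integrable fun t => f t * (1 + |t|) ^ (q + κ * (k + 2)) := H.integrable
  have hfi := integrable_of_integrable_mul_pow hfm hf0 hint
  have hC := H.const_pos
  have hc₂ : 0 < c₂ := by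
    have ht : b - δ / 2 ∈ Set.Ioo (b - δ) b := ⟨by linarith, by linarith⟩
    have h1 : 0 < (b - (b - δ / 2)) ^ a := Real.rpow_pos_of_pos (by linarith) a
    have h2 := (hf₁ _ ht).trans (hf₂ _ ht)
    exact hc₁.trans_le (le_of_mul_le_mul_right h2 h1)
  obtain ⟨η, hη, hη1, hηδ⟩ : ∃ η : ℝ, 0 < η ∧ η ≤ 1 ∧ (4 * (k + 1 + 1) + 1) * η ≤ δ := by
    refine ⟨min 1 (δ / (4 * (k + 1 + 1) + 1)), lt_min one_pos (by positivity), min_le_left _ _, ?_⟩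
    have := min_le_right 1 (δ / (4 * ((k : ℝ) + 1 + 1) + 1))
    rwa [le_div_iff₀ (by positivity), mul_comm] at this
  set b₀ := b - η with hb₀
  have hlt : b₀ < b := by linarith
  have hδ' : b - δ ≤ b₀ - 4 * ((k + 1 : ℕ) + 1) * η := by push_cast; linarith
  have hgapI : ∀ j ≤ k + 1, gridGap b₀ η j ⊆ I := fun j hj =>
    (gridGap_subset_Ioo hη hlt.le hδ' hj).trans hI
  have hgrid : ∀ j ≤ k + 1, grid b₀ η j ∈ Set.Ioo (b - δ) b := fun j hj =>
    grid_mem_Ioo hη hlt hδ' hj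
  obtain ⟨w₁, hw₁, w₂, hw₂, hW⟩ := H.exists_bounds_weight (B := b) hη hη1 hlt.le
    (fun j hj => hgapI j (hj.trans hq)) fun i hi => hI (hgrid _ (by omega))
  set g : Fin k → ℝ := fun i => grid b₀ η (i + 1) with hg
  have hganti : StrictAnti g := strictAnti_grid hη k 1
  have hgmem : ∀ i, g i ∈ Set.Ioo (b - δ) b := fun i => hgrid _ (by omega)
  have hglt : ∀ i, g i ≤ b₀ - 4 * η := fun i => by
    have := grid_add_le (b := b₀) hη (Nat.succ_pos (i : ℕ))
    rw [grid_zero] at this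
    simp only [Nat.succ_eq_add_one] at this
    simp only [g]; linarith
  have hV : 0 < |vdm g| := abs_pos.2 (vdm_ne_zero hganti.injective)
  have hP : 0 < ∏ i, W (g i) := prod_pos fun i _ => H.weight_pos _ (hI (hgmem i))
  -- The two largest kept points are `b - ε` and `b - 2 ε`.
  set z : ℝ → Fin (k + 2) → ℝ := fun ε => Fin.cons (b - ε) (Fin.cons (b - 2 * ε) g) with hz
  set Q : ℝ → ℝ := fun ε => C * (∏ i, W (g i)) *
    ((∏ i, |b - ε - g i|) * ((∏ i, |b - 2 * ε - g i|) * |vdm g|)) ^ (1 + 2 * κ) with hQ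
  have hzmem : ∀ ε, 0 < ε → ε ≤ η / 2 → ∀ i, z ε i ∈ Set.Ioo (b - δ) b := by
    intro ε h0 h1
    have hηδ' : η < δ := by nlinarith
    exact forall_cons (P := (· ∈ Set.Ioo (b - δ) b)) ⟨by linarith, by linarith⟩
      (forall_cons (P := (· ∈ Set.Ioo (b - δ) b)) ⟨by linarith, by linarith⟩ hgmem)
  have hval : ∀ ε, 0 < ε → ε ≤ η / 2 → gapIntegral κ 0 (q + 1) f (z ε) =
      W (b - ε) * W (b - 2 * ε) * Q ε * ε ^ (1 + 2 * κ) := by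
    intro ε h0 h1
    have hanti : StrictAnti (z ε) := by
      refine strictAnti_cons (forall_cons (P := (· < b - ε)) (by linarith) fun i => ?_)
        (strictAnti_cons (fun i => ?_) hganti) <;> linarith [hglt i]
    rw [H.eq _ hanti fun i => hI (hzmem ε h0 h1 i), hz]
    simp only
    rw [prod_cons, prod_cons, abs_vdm_cons, abs_vdm_cons, prod_cons fun x => |b - ε - x|, hQ,
      show b - ε - (b - 2 * ε) = ε by ring, abs_of_pos h0]
    simp only [mul_pow]
    ring
  obtain ⟨e₁, he₁, e₂, he₂, hQb⟩ : ∃ e₁ > 0, ∃ e₂ > 0, ∀ ε ∈ Set.Icc 0 (η / 2),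
      e₁ ≤ Q ε ∧ Q ε ≤ e₂ := by
    have hcont : ContinuousOn Q (Set.Icc 0 (η / 2)) := by
      refine Continuous.continuousOn ?_; fun_prop
    have hpos : ∀ ε ∈ Set.Icc 0 (η / 2), 0 < Q ε := by
      intro ε hε
      have h1 : 0 < ∏ i, |b - ε - g i| := prod_pos fun i _ =>
        abs_pos.2 (by linarith [hglt i, hε.2])
      have h2 : 0 < ∏ i, |b - 2 * ε - g i| := prod_pos fun i _ =>
        abs_pos.2 (by linarith [hglt i, hε.2])
      simp only [hQ]; positivity
    have hne : (Set.Icc 0 (η / 2)).Nonempty := Set.nonempty_Icc.2 (by linarith)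
    obtain ⟨u, hu, hmin⟩ := isCompact_Icc.exists_isMinOn hne hcont
    obtain ⟨v, hv, hmax⟩ := isCompact_Icc.exists_isMaxOn hne hcont
    exact ⟨Q u, hpos u hu, Q v, hpos v hv, fun s hs => ⟨hmin hs, hmax hs⟩⟩
  have hWb : ∀ ε, 0 < ε → ε ≤ η / 2 → w₁ * w₁ * e₁ ≤ W (b - ε) * W (b - 2 * ε) * Q ε ∧
      W (b - ε) * W (b - 2 * ε) * Q ε ≤ w₂ * w₂ * e₂ := by
    intro ε h0 h1
    have hηδ' : η < δ := by nlinarith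
    obtain ⟨h2, h3⟩ := hW (b - ε) ⟨⟨by linarith, by linarith⟩, hI ⟨by linarith, by linarith⟩⟩
    obtain ⟨h4, h5⟩ := hW (b - 2 * ε) ⟨⟨by linarith, by linarith⟩, hI ⟨by linarith, by linarith⟩⟩
    obtain ⟨h6, h7⟩ := hQb ε ⟨h0.le, h1⟩
    have h8 : 0 ≤ W (b - ε) := hw₁.le.trans h2
    have h9 : 0 ≤ W (b - 2 * ε) := hw₁.le.trans h4
    have h10 : 0 ≤ Q ε := he₁.le.trans h6
    constructor <;> gcongr
  have hpow : ∀ ε, 0 < ε → ∀ t ∈ Set.Icc (b - 2 * ε) (b - ε),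
      ε ^ a * 2 ^ (-|a|) ≤ (b - t) ^ a ∧ (b - t) ^ a ≤ ε ^ a * 2 ^ |a| := fun ε h0 t ht =>
    mul_rpow_bounds h0 (by linarith [ht.2]) (by linarith [ht.1])
  -- The integral over the gaps is at least of the order `ε ^ a ε ^ (1 + 2 κ)` …
  have hlow : ∃ d > 0, ∀ ε, 0 < ε → ε ≤ η / 2 →
      d * ε ^ a * ε ^ (1 + 2 * κ) ≤ gapIntegral κ 0 (q + 1) f (z ε) := by
    refine ⟨c₁ * 2 ^ (-|a|) / 2 * (∏ j : Fin q, ∫ t in gridGap b₀ η j, f t) *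
      (η ^ ((q + 1) * (q + 1)) * ((1 / 4) ^ κ * (1 / 4) ^ κ * η ^ (κ * k) *
        (η ^ (κ * (k + 2))) ^ q)), ?_, fun ε h0 h1 => ?_⟩
    · have h1 : 0 < ∏ j : Fin q, ∫ t in gridGap b₀ η j, f t := prod_pos fun j _ =>
        setIntegral_pos_of_isOpen hfi hf0 (isOpen_gridGap b₀ η j) (gridGap_nonempty hη j)
          fun t ht => H.isWeightOn.pos t (hgapI j (by omega) ht)
      positivity
    have h := le_gapIntegral (κ := κ) (h := 0) (p := q + 1) hfm hf0 hint (y := z ε)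
      (U := Fin.cons (Set.Ioo (b - 7 / 4 * ε) (b - 5 / 4 * ε)) fun j : Fin q => gridGap b₀ η j)
      (fun j => ?_) (fun j => ?_) (fun j => hfi.integrableOn) hη.le hη1 (fun j l hjl => ?_)
      (d := Fin.cons (Fin.cons (ε / 4) (Fin.cons (ε / 4) fun _ => η)) fun _ _ => η)
      (fun j => ?_) (fun j => ?_)
    · refine le_trans ?_ h
      have h2 : c₁ * (ε ^ a * 2 ^ (-|a|)) * (ε / 2) ≤
          ∫ t in Set.Ioo (b - 7 / 4 * ε) (b - 5 / 4 * ε), f t := by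
        have h3 := setIntegral_ge_of_const_le_real (μ := volume)
          (s := Set.Ioo (b - 7 / 4 * ε) (b - 5 / 4 * ε)) (f := f)
          (c := c₁ * (ε ^ a * 2 ^ (-|a|))) measurableSet_Ioo (by simp) (fun t ht => ?_)
          hfi.integrableOn
        · rw [Real.volume_real_Ioo_of_le (by linarith)] at h3
          convert h3 using 1; ring
        · have hηδ' : η < δ := by nlinarith
          refine le_trans (mul_le_mul_of_nonneg_left (hpow ε h0 t
            ⟨by linarith [ht.1], by linarith [ht.2]⟩).1 hc₁.le)
            (hf₁ t ⟨by linarith [ht.1], by linarith [ht.2]⟩)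
      rw [Fin.prod_univ_succ, Fin.prod_univ_succ (n := q)]
      simp only [Fin.cons_zero, Fin.cons_succ]
      rw [prod_cons fun x => x ^ κ, prod_cons fun x => x ^ κ]
      simp only [prod_const, card_univ, Fintype.card_fin]
      have h3 : 0 ≤ ∏ j : Fin q, ∫ t in gridGap b₀ η j, f t :=
        prod_nonneg fun j _ => integral_nonneg hf0
      calc _ = c₁ * (ε ^ a * 2 ^ (-|a|)) * (ε / 2) * (∏ j : Fin q, ∫ t in gridGap b₀ η j, f t) *
            (η ^ ((q + 1) * (q + 1)) * (((ε / 4) ^ κ * ((ε / 4) ^ κ * (η ^ κ) ^ k)) *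
              ((η ^ κ) ^ (k + 2)) ^ q)) := by
            rw [← pow_mul, ← pow_mul, div_eq_mul_one_div ε 4, mul_pow, pow_add, pow_mul ε 2 κ]
            ring
        _ ≤ _ := by gcongr
    · induction j using Fin.cases with
      | zero => exact measurableSet_Ioo
      | succ j => exact (isOpen_gridGap b₀ η j).measurableSet
    · induction j using Fin.cases with
      | zero =>
        intro t ht i
        have ht1 := ht.1
        have ht2 := ht.2
        induction i using Fin.cases with
        | zero => exact ⟨fun _ => by simp only [hz, Fin.cons_zero]; linarith, fun hi => by simp at hi⟩
        | succ i =>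
          refine ⟨fun hi => by simp at hi, fun _ => ?_⟩
          simp only [hz, Fin.cons_succ]
          refine forall_cons (P := (· < t)) (by linarith) (fun i => ?_) i
          linarith [hglt i]
      | succ j =>
        intro t ht i
        have ht1 := ht.1
        have ht2 := ht.2
        have hj := grid_le (b := b₀) hη (Nat.zero_le (j : ℕ))
        rw [grid_zero] at hj
        induction i using Fin.cases with
        | zero => exact ⟨fun _ => by simp only [hz, Fin.cons_zero]; linarith, fun hi => by simp at hi⟩
        | succ i =>
          induction i using Fin.cases with
          | zero => exact ⟨fun _ => by simp only [hz, Fin.cons_succ, Fin.cons_zero]; linarith,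
              fun hi => by simp at hi⟩
          | succ i =>
            simp only [hz, Fin.cons_succ, Fin.val_succ, add_zero, hg]
            refine ⟨fun hi => ?_, fun hi => ?_⟩
            · have := grid_le (b := b₀) hη (i := i + 1) (j := j) (by omega)
              linarith
            · have := grid_add_le (b := b₀) hη (i := j) (j := i + 1) (by omega)
              linarith
    · induction l using Fin.cases with
      | zero => exact absurd hjl (Fin.not_lt_zero j)
      | succ l =>
        induction j using Fin.cases with
        | zero =>
          intro t ht u hu
          have hj := grid_le (b := b₀) hη (Nat.zero_le (l : ℕ))
          rw [grid_zero] at hj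
          have ht1 := ht.1
          have hu2 := hu.2
          exact le_trans (by linarith) (le_abs_self _)
        | succ j =>
          exact fun t ht u hu => le_abs_sub_of_mem_gridGap hη (by simpa using hjl) ht hu
    · induction j using Fin.cases with
      | zero =>
        exact forall_cons (P := (0 ≤ ·)) (by positivity)
          (forall_cons (P := (0 ≤ ·)) (by positivity) fun _ => hη.le)
      | succ j => exact fun _ => hη.le
    · induction j using Fin.cases with
      | zero =>
        intro i t ht
        have ht1 := ht.1
        have ht2 := ht.2
        induction i using Fin.cases with
        | zero => simp only [hz, Fin.cons_zero]; exact le_trans (by linarith) (le_abs_self _)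
        | succ i =>
          induction i using Fin.cases with
          | zero =>
            simp only [hz, Fin.cons_zero, Fin.cons_succ]
            rw [abs_sub_comm]
            exact le_trans (by linarith) (le_abs_self _)
          | succ i =>
            simp only [hz, Fin.cons_zero, Fin.cons_succ]
            rw [abs_sub_comm]
            exact le_trans (by linarith [hglt i]) (le_abs_self _)
      | succ j =>
        intro i t ht
        have ht2 := ht.2
        have hj := grid_le (b := b₀) hη (Nat.zero_le (j : ℕ))
        rw [grid_zero] at hj
        simp only [hz, Fin.cons_succ]
        refine forall_cons (P := fun x => η ≤ |x - t|)
          (le_trans (by linarith) (le_abs_self _)) (forall_cons (P := fun x => η ≤ |x - t|)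
          (le_trans (by linarith) (le_abs_self _)) fun i => le_abs_grid_sub hη ht) i
  -- … and at most of this order.
  have hup : ∃ d > 0, ∀ ε, 0 < ε → ε ≤ η / 2 →
      gapIntegral κ 0 (q + 1) f (z ε) ≤ d * ε ^ a * ε ^ (1 + 2 * κ) := by
    set R : ℝ := |b| + δ with hR
    have hRmem : ∀ t ∈ Set.Ioo (b - δ) b, |t| ≤ R := fun t ht => by
      rw [hR, abs_le]
      constructor <;> linarith [ht.1, ht.2, neg_abs_le b, le_abs_self b]
    have hR0 : 0 ≤ R := by positivity
    set M := ∫ t, f t * (1 + |t|) ^ (q + κ * (k + 2)) with hM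
    have hM0 : 0 ≤ M := integral_nonneg fun t => mul_nonneg (hf0 t) (by positivity)
    refine ⟨c₂ * 2 ^ |a| * (1 + R) ^ q * δ ^ (κ * k) * ((1 + R) ^ (κ * (k + 2)) * (M + 1)) ^ q,
      by positivity, fun ε h0 h1 => ?_⟩
    have hηδ' : η < δ := by nlinarith
    have hint' : Integrable fun t => f t * (1 + |t|) ^ (q + 1 - 1 + κ * (k + 2)) := hint
    have h2 : ∫ t in gap 0 (z ε) 0, gapFactor κ (q + 1) f (z ε) t ≤
        c₂ * (ε ^ a * 2 ^ |a|) * (1 + R) ^ q * (ε ^ κ * (ε ^ κ * δ ^ (κ * k))) * ε := by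
      have h3 : gap 0 (z ε) 0 ⊆ Set.Ioo (b - 2 * ε) (b - ε) := fun t ht =>
        ⟨by simpa [hz] using (ht 1).2 (by simp), by simpa [hz] using (ht 0).1 (by simp)⟩
      refine (setIntegral_mono_set (integrable_gapFactor hfm hf0 hint' (z ε)).integrableOn
        (Filter.Eventually.of_forall fun t => gapFactor_nonneg hf0 (z ε) t)
        (Filter.Eventually.of_forall h3)).trans ?_
      have h4 := norm_setIntegral_le_of_norm_le_const (μ := volume)
        (s := Set.Ioo (b - 2 * ε) (b - ε)) (f := gapFactor κ (q + 1) f (z ε))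
        (C := c₂ * (ε ^ a * 2 ^ |a|) * (1 + R) ^ q * (ε ^ κ * (ε ^ κ * δ ^ (κ * k)))) (by simp)
        fun t ht => ?_
      · rw [Real.volume_real_Ioo_of_le (by linarith), show b - ε - (b - 2 * ε) = ε by ring] at h4
        exact (le_abs_self _).trans h4
      · have ht1 := ht.1
        have ht2 := ht.2
        have htm : t ∈ Set.Ioo (b - δ) b := ⟨by linarith, by linarith⟩
        rw [Real.norm_eq_abs, abs_of_nonneg (gapFactor_nonneg hf0 _ _), gapFactor,
          Nat.add_sub_cancel]
        have h5 : f t ≤ c₂ * (ε ^ a * 2 ^ |a|) := (hf₂ t htm).trans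
          (mul_le_mul_of_nonneg_left (hpow ε h0 t ⟨ht1.le, ht2.le⟩).2 hc₂.le)
        have h6 : ∏ i, |z ε i - t| ^ κ ≤ ε ^ κ * (ε ^ κ * δ ^ (κ * k)) := by
          have h7 : ∏ i, |g i - t| ^ κ ≤ δ ^ (κ * k) := by
            have : δ ^ (κ * k) = ∏ _i : Fin k, δ ^ κ := by simp [pow_mul]
            rw [this]
            refine prod_le_prod (fun i _ => by positivity) fun i _ =>
              pow_le_pow_left₀ (abs_nonneg _) ?_ κ
            rw [abs_le]
            constructor <;> linarith [(hgmem i).1, (hgmem i).2, htm.1, htm.2]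
          have h8 : |b - ε - t| ≤ ε := by rw [abs_le]; constructor <;> linarith
          have h9 : |b - 2 * ε - t| ≤ ε := by rw [abs_le]; constructor <;> linarith
          simp only [hz]
          rw [prod_cons fun x => |x - t| ^ κ, prod_cons fun x => |x - t| ^ κ]
          gcongr
        have h7 : 0 ≤ ∏ i, |z ε i - t| ^ κ := prod_nonneg fun i _ => by positivity
        have h8 := hRmem t htm
        have h9 := hf0 t
        gcongr
    have h3 : ∏ i, (1 + |z ε i|) ^ κ ≤ (1 + R) ^ (κ * (k + 2)) :=
      prod_one_add_abs_le (fun i => hRmem _ (hzmem ε h0 h1 i)) κ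
    have h4 : 0 ≤ ∏ i, (1 + |z ε i|) ^ κ := prod_nonneg fun i _ => by positivity
    refine (gapIntegral_le_first hfm hf0 hint (z ε)).trans ?_
    calc _ ≤ c₂ * (ε ^ a * 2 ^ |a|) * (1 + R) ^ q * (ε ^ κ * (ε ^ κ * δ ^ (κ * k))) * ε *
          ((1 + R) ^ (κ * (k + 2)) * (M + 1)) ^ q := by
          refine mul_le_mul h2 (pow_le_pow_left₀ (mul_nonneg h4 hM0)
            (mul_le_mul h3 (by linarith) hM0 (by positivity)) q)
            (pow_nonneg (mul_nonneg h4 hM0) q) (by positivity)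
      _ = _ := by rw [pow_add, pow_mul ε 2 κ]; ring
  -- The right-hand side of the gap identity is of the order `ε ^ (1 + 2 κ)`, so `ε ^ a` is bounded
  -- and bounded away from `0`.
  obtain ⟨d₁, hd₁, hlow⟩ := hlow
  obtain ⟨d₂, hd₂, hup⟩ := hup
  have hE1 : ∀ ε, 0 < ε → ε ≤ η / 2 → d₁ * ε ^ a ≤ w₂ * w₂ * e₂ := by
    intro ε h0 h1
    have h2 := hlow ε h0 h1
    rw [hval ε h0 h1] at h2
    exact (le_of_mul_le_mul_right h2 (by positivity)).trans (hWb ε h0 h1).2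
  have hE2 : ∀ ε, 0 < ε → ε ≤ η / 2 → w₁ * w₁ * e₁ ≤ d₂ * ε ^ a := by
    intro ε h0 h1
    have h2 := hup ε h0 h1
    rw [hval ε h0 h1] at h2
    exact (hWb ε h0 h1).1.trans (le_of_mul_le_mul_right h2 (by positivity))
  have hmem : ∀ᶠ ε in nhdsWithin (0 : ℝ) (Set.Ioi 0), 0 < ε ∧ ε ≤ η / 2 := by
    filter_upwards [Ioo_mem_nhdsGT (show (0 : ℝ) < η / 2 by linarith)] with ε hε
    exact ⟨hε.1, hε.2.le⟩
  rcases lt_trichotomy a 0 with ha | ha | ha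
  · have h1 := (tendsto_rpow_neg_nhdsGT_zero ha).const_mul_atTop hd₁
    obtain ⟨ε, h2, h3, h4⟩ := ((h1.eventually_gt_atTop (w₂ * w₂ * e₂)).and hmem).exists
    exact absurd (hE1 ε h3 h4) h2.not_ge
  · exact ha
  · have h1 : Filter.Tendsto (fun ε : ℝ => d₂ * ε ^ a) (nhdsWithin 0 (Set.Ioi 0)) (nhds 0) := by
      have h2 := ((Real.continuousAt_rpow_const 0 a (Or.inr ha.le)).tendsto.mono_left
        (nhdsWithin_le_nhds (s := Set.Ioi 0))).const_mul d₂
      rwa [Real.zero_rpow ha.ne', mul_zero] at h2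
    obtain ⟨ε, h2, h3, h4⟩ := ((h1.eventually (gt_mem_nhds (show 0 < w₁ * w₁ * e₁ by
      positivity))).and hmem).exists
    exact absurd (hE2 ε h3 h4) h2.not_ge

/-- If no point above the largest kept point is integrated out, then `f` cannot decay rapidly at an
unbounded upper end: one kept point far out shows that `W` decays at most polynomially, whereas with
two of them the integral over the gap between them decays rapidly. -/
theorem GapIdentity.false_of_rapid_decay {κ k q : ℕ} {C : ℝ} {I : Set ℝ} {f W : ℝ → ℝ}
    (H : GapIdentity κ 0 (k + 2) (q + 1) C I f W) (hq : q ≤ k + 1) (hI : Set.Ioi 0 ⊆ I)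
    (hdecay : ∀ N : ℕ, Integrable fun t => f t * (1 + |t|) ^ N) : False := by
  have hfm := H.isWeightOn.measurable
  have hf0 := H.isWeightOn.nonneg
  have hint : Integrable fun t => f t * (1 + |t|) ^ (q + κ * (k + 2)) := H.integrable
  have hC := H.const_pos
  set T : ℕ := 4 * k + 8 with hT
  have hδ' : (T : ℝ) + 1 - (T + 1) ≤ T - 4 * ((k + 1 : ℕ) + 1) * 1 := by rw [hT]; push_cast; linarith
  have hIoo : Set.Ioo ((T : ℝ) + 1 - (T + 1)) (T + 1) ⊆ Set.Ioi 0 := fun t ht => by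
    have := ht.1
    simp only [Set.mem_Ioi]; linarith
  have hgapI : ∀ j ≤ k + 1, gridGap (T : ℝ) 1 j ⊆ I := fun j hj =>
    ((gridGap_subset_Ioo one_pos (by linarith) hδ' hj).trans hIoo).trans hI
  have hgrid : ∀ j ≤ k + 1, 0 < grid (T : ℝ) 1 j := fun j hj =>
    hIoo (grid_mem_Ioo one_pos (by linarith) hδ' hj)
  have hglt : ∀ i : ℕ, grid (T : ℝ) 1 (i + 1) ≤ T - 4 := fun i => by
    have := grid_add_le (b := (T : ℝ)) one_pos (Nat.succ_pos i)
    rw [grid_zero] at this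
    simp only [Nat.succ_eq_add_one] at this
    linarith
  have hWp : ∀ t > 0, 0 < W t := fun t ht => H.weight_pos t (hI ht)
  set N := (k + 1) * (1 + 2 * κ) with hN
  -- One kept point `s` far out: a lower bound for `W s`.
  obtain ⟨c, hc, hone⟩ : ∃ c > 0, ∀ s ≥ (T : ℝ), c ≤ W s * s ^ N := by
    obtain ⟨c, hc, hlow⟩ := exists_grid_le_gapIntegral (k := k + 1) hfm hf0 hint one_pos le_rfl
      fun j hj t ht => H.isWeightOn.pos t (hgapI j (hj.trans hq) ht)
    set g : Fin (k + 1) → ℝ := fun i => grid T 1 (i + 1) with hg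
    have hganti : StrictAnti g := strictAnti_grid one_pos (k + 1) 1
    have hg0 : ∀ i, 0 < g i := fun i => hgrid _ (by omega)
    have hgT : ∀ i, g i ≤ T - 4 := fun i => hglt i
    have hV : 0 < |vdm g| := abs_pos.2 (vdm_ne_zero hganti.injective)
    have hP : 0 < ∏ i, W (g i) := prod_pos fun i _ => hWp _ (hg0 i)
    refine ⟨c / (C * (∏ i, W (g i)) * |vdm g| ^ (1 + 2 * κ)), by positivity, fun s hs => ?_⟩
    have hs0 : 0 < s := lt_of_lt_of_le (by rw [hT]; positivity) hs
    have h1 := hlow s hs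
    rw [H.eq _ (strictAnti_cons (fun i => by linarith [hgT i]) hganti)
      (forall_cons (P := (· ∈ I)) (hI hs0) fun i => hI (hg0 i)), prod_cons, abs_vdm_cons] at h1
    rw [div_le_iff₀ (by positivity)]
    have h2 : c ≤ c * (s - T + 1) ^ (κ * (q + 1)) :=
      le_mul_of_one_le_right hc.le (one_le_pow₀ (by linarith))
    have h3 : ∏ i, |s - g i| ≤ s ^ (k + 1) := by
      have : s ^ (k + 1) = ∏ _i : Fin (k + 1), s := by simp
      rw [this]
      refine prod_le_prod (fun i _ => abs_nonneg _) fun i _ => ?_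
      rw [abs_le]
      constructor <;> linarith [hg0 i, hgT i]
    have h4 := hWp s hs0
    have h5 : 0 ≤ ∏ i, |s - g i| := prod_nonneg fun i _ => abs_nonneg _
    calc c ≤ C * (W s * ∏ i, W (g i)) * ((∏ i, |s - g i|) * |vdm g|) ^ (1 + 2 * κ) := h2.trans h1
      _ ≤ C * (W s * ∏ i, W (g i)) * (s ^ (k + 1) * |vdm g|) ^ (1 + 2 * κ) := by gcongr
      _ = _ := by rw [mul_pow, ← pow_mul]; ring
  -- Two kept points `s` and `s + 1` far out.
  set g : Fin k → ℝ := fun i => grid T 1 (i + 1) with hg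
  have hganti : StrictAnti g := strictAnti_grid one_pos k 1
  have hg0 : ∀ i, 0 < g i := fun i => hgrid _ (by omega)
  have hgT : ∀ i, g i ≤ T - 4 := fun i => hglt i
  have hV : 0 < |vdm g| := abs_pos.2 (vdm_ne_zero hganti.injective)
  have hP : 0 < ∏ i, W (g i) := prod_pos fun i _ => hWp _ (hg0 i)
  set M := ∫ t, f t * (1 + |t|) ^ (q + κ * (k + 2)) with hM
  set e := κ * (k + 2) * (q + 1) + 2 * N with he
  set D := C * (∏ i, W (g i)) * |vdm g| ^ (1 + 2 * κ) with hD
  have hD0 : 0 < D := by positivity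
  have hbound : ∀ n ≥ T, D * c ^ 2 ≤ M ^ q * 2 ^ e *
      ∫ t in Set.Ioi (n : ℝ), f t * (1 + |t|) ^ (q + κ * (k + 2) + e) := by
    intro n hn
    have hs : (T : ℝ) ≤ n := by exact_mod_cast hn
    set s : ℝ := (n : ℝ) with hs'
    have hs0 : 0 < s := lt_of_lt_of_le (by rw [hT]; positivity) hs
    set z : Fin (k + 2) → ℝ := Fin.cons (s + 1) (Fin.cons s g) with hz
    have h1 : gapIntegral κ 0 (q + 1) f z = C * (W (s + 1) * (W s * ∏ i, W (g i))) *
        ((∏ i, |s + 1 - g i|) * ((∏ i, |s - g i|) * |vdm g|)) ^ (1 + 2 * κ) := by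
      rw [H.eq z (strictAnti_cons (forall_cons (P := (· < s + 1)) (by linarith) fun i => by
        linarith [hgT i]) (strictAnti_cons (fun i => by linarith [hgT i]) hganti))
        (forall_cons (P := (· ∈ I)) (hI (by simp only [Set.mem_Ioi]; linarith))
          (forall_cons (P := (· ∈ I)) (hI hs0) fun i => hI (hg0 i))), hz, prod_cons, prod_cons,
        abs_vdm_cons, abs_vdm_cons, prod_cons fun x => |s + 1 - x|]
      simp
    have hone_le : ∀ u ≥ s, 1 ≤ ∏ i, |u - g i| := fun u hu => by
      simpa using prod_le_prod (s := univ) (f := fun _ : Fin k => (1 : ℝ)) (fun i _ => zero_le_one)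
        fun i _ => le_trans (by linarith [hgT i]) (le_abs_self (u - g i))
    have h2 : W (s + 1) * W s * D ≤ gapIntegral κ 0 (q + 1) f z := by
      have h3 : |vdm g| ≤ (∏ i, |s + 1 - g i|) * ((∏ i, |s - g i|) * |vdm g|) := by
        refine le_trans ?_ (le_mul_of_one_le_left (mul_nonneg (prod_nonneg fun i _ => abs_nonneg _)
          hV.le) (hone_le (s + 1) (by linarith)))
        exact le_mul_of_one_le_left hV.le (hone_le s le_rfl)
      have h4 := hWp s hs0
      have h5 := hWp (s + 1) (by linarith)
      rw [h1]
      calc _ = C * (W (s + 1) * (W s * ∏ i, W (g i))) * |vdm g| ^ (1 + 2 * κ) := by rw [hD]; ring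
        _ ≤ _ := by gcongr
    have h3 := gapIntegral_le_of_setIntegral_le (h := 0) hfm hf0 hint z
      (prod_one_add_abs_le (R := s + 1) (forall_cons (P := fun x => |x| ≤ s + 1)
        (abs_of_pos (by linarith)).le (forall_cons (P := fun x => |x| ≤ s + 1)
        (by rw [abs_of_pos hs0]; linarith) fun i => by
          rw [abs_of_pos (hg0 i)]; linarith [hgT i])) κ)
      (S := Set.Ioi s) fun t ht => by simpa [hz] using (ht 1).2 (by simp)
    rw [← hM, ← pow_mul] at h3
    have h4 : c ≤ W s * (1 + (s + 1)) ^ N := (hone s hs).trans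
      (mul_le_mul_of_nonneg_left (pow_le_pow_left₀ hs0.le (by linarith) N) (hWp s hs0).le)
    have h5 : c ≤ W (s + 1) * (1 + (s + 1)) ^ N := (hone (s + 1) (by linarith)).trans
      (mul_le_mul_of_nonneg_left (pow_le_pow_left₀ (by linarith) (by linarith) N)
        (hWp (s + 1) (by linarith)).le)
    have hM0 : 0 ≤ M := integral_nonneg fun t => mul_nonneg (hf0 t) (by positivity)
    have h6 : (1 + (s + 1)) ^ e * ∫ t in Set.Ioi s, f t * (1 + |t|) ^ (q + κ * (k + 2)) ≤
        2 ^ e * ∫ t in Set.Ioi s, f t * (1 + |t|) ^ (q + κ * (k + 2) + e) := by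
      rw [← integral_const_mul, ← integral_const_mul]
      refine setIntegral_mono_on (hint.const_mul _).integrableOn
        ((hdecay _).const_mul _).integrableOn measurableSet_Ioi fun t ht => ?_
      have ht' : s < t := ht
      have h7 : (1 + (s + 1)) ^ e ≤ (2 * (1 + |t|)) ^ e :=
        pow_le_pow_left₀ (by linarith) (by linarith [le_abs_self t]) e
      have h8 : 0 ≤ f t * (1 + |t|) ^ (q + κ * (k + 2)) := mul_nonneg (hf0 t) (by positivity)
      calc _ ≤ (2 * (1 + |t|)) ^ e * (f t * (1 + |t|) ^ (q + κ * (k + 2))) :=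
            mul_le_mul_of_nonneg_right h7 h8
        _ = _ := by rw [mul_pow, pow_add]; ring
    have hW1 := (hWp s hs0).le
    have hW2 := (hWp (s + 1) (by linarith)).le
    have hr : 0 ≤ 1 + (s + 1) := by linarith
    calc D * c ^ 2 = D * (c * c) := by ring
      _ ≤ D * ((W (s + 1) * (1 + (s + 1)) ^ N) * (W s * (1 + (s + 1)) ^ N)) := by gcongr
      _ = W (s + 1) * W s * D * (1 + (s + 1)) ^ (2 * N) := by ring
      _ ≤ (1 + (s + 1)) ^ (κ * (k + 2) * (q + 1)) * M ^ q *
          (∫ t in Set.Ioi s, f t * (1 + |t|) ^ (q + κ * (k + 2))) * (1 + (s + 1)) ^ (2 * N) :=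
          mul_le_mul_of_nonneg_right (h2.trans h3) (by positivity)
      _ = M ^ q * ((1 + (s + 1)) ^ e *
          ∫ t in Set.Ioi s, f t * (1 + |t|) ^ (q + κ * (k + 2))) := by rw [he, pow_add]; ring
      _ ≤ M ^ q * (2 ^ e * ∫ t in Set.Ioi s, f t * (1 + |t|) ^ (q + κ * (k + 2) + e)) := by gcongr
      _ = _ := by ring
  have hlim := (tendsto_setIntegral_Ioi (hdecay (q + κ * (k + 2) + e))).const_mul (M ^ q * 2 ^ e)
  rw [mul_zero] at hlim
  have h1 := ge_of_tendsto hlim (Filter.eventually_atTop.2 ⟨T, hbound⟩)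
  have h2 : 0 < D * c ^ 2 := by positivity
  linarith

/-! ### From the decimation statements to the gap identity -/

theorem kept_of_evenEq {K m p : ℕ} {e : Fin m ⊕ Fin p ≃ Fin K} (he : IsAlternating 1 e)
    {hK : K / 2 = m} {μ : Measure (Fin K → ℝ)} {ν : Measure (Fin m → ℝ)} (h : EvenEq hK μ ν) :
    μ.map (fun x (i : Fin m) => kthLargest x (e (.inl i))) = ν.map fun x k => kthLargest x k := by
  rw [← h.2.2]
  congr 1
  ext x i
  rw [evenPart]
  congr 1
  exact Fin.ext (he.1 i)

theorem kept_of_oddEq {K m p : ℕ} {e : Fin m ⊕ Fin p ≃ Fin K} (he : IsAlternating 0 e)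
    {hK : (K + 1) / 2 = m} {μ : Measure (Fin K → ℝ)} {ν : Measure (Fin m → ℝ)}
    (h : OddEq hK μ ν) :
    μ.map (fun x (i : Fin m) => kthLargest x (e (.inl i))) = ν.map fun x k => kthLargest x k := by
  rw [← h.2.2]
  congr 1
  ext x i
  rw [oddPart]
  congr 1
  exact Fin.ext (he.1 i)

theorem IsWeightOn.ratioSq {I J : Set ℝ} {f g : ℝ → ℝ} (hf : IsWeightOn I f) (hg : IsWeightOn J g)
    (h : RatioDefined f g) : IsWeightOn J (ratioSq f g) := by
  have hJI : J ⊆ I := fun t ht => by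
    by_contra h0
    exact (hg.pos t ht).ne' (h t (hf.eq_zero t h0))
  refine ⟨hg.isOpen, hg.ordConnected, hg.nonempty, ?_, ?_, fun t ht => ?_, fun t ht => ?_⟩
  · have := hf.measurable
    have := hg.measurable
    unfold EigenvalueEnsemble.ratioSq
    fun_prop
  · exact (hg.continuousOn.div (hf.continuousOn.mono hJI) fun t ht =>
      (hf.pos t (hJI ht)).ne').pow 2
  · exact pow_pos (div_pos (hg.pos t ht) (hf.pos t (hJI ht))) 2
  · simp [EigenvalueEnsemble.ratioSq, hg.eq_zero t ht]

section Extract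

variable {n : ℕ} {I J : Set ℝ} {f g : ℝ → ℝ} (hn : 2 ≤ n) (hf : IsWeightOn I f)
  (hg : IsWeightOn J g)

include hn hf hg

/-- The upper extreme point is integrated out and the lower one is kept (`h = 1`, `p = m`). -/
theorem gapIdentity_of_even_same (h : EvenUnionSame n f g ∨ EvenSingle n f g) :
    I = J ∧ ∃ κ k C W, GapIdentity κ 1 (k + 2) (k + 2) C I f W ∧
      ((∀ t, f (-t) = f t) → (∀ t, g (-t) = g t) → ∀ t, W (-t) = W t) := by
  rcases h with h | ⟨hr, h⟩
  · obtain ⟨k, hk⟩ := Nat.exists_eq_add_of_le' (show 2 ≤ 2 * n by omega)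
    obtain ⟨e, he⟩ := exists_isAlternating (m := 2 * n) (p := 2 * n) (K := 2 * n + 2 * n) (h := 1)
      le_rfl (by omega) (by omega) (by omega)
    obtain ⟨hIJ, C, H⟩ := gapIdentity_superposed le_rfl he (by omega) le_rfl (by omega) (by omega)
      (Or.inl ⟨rfl, rfl⟩) hf hg h.1 h.2.1 (kept_of_evenEq he h)
    rw [hk] at H
    exact ⟨hIJ, 0, k, C, _, H, fun h1 h2 t => by simp only [h1, h2]⟩
  · obtain ⟨k, hk⟩ := Nat.exists_eq_add_of_le' hn
    obtain ⟨e, he⟩ := exists_isAlternating (m := n) (p := n) (K := 2 * n) (h := 1)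
      le_rfl (by omega) (by omega) (by omega)
    obtain ⟨hIJ, C, H⟩ := gapIdentity_single he (by omega) le_rfl (by omega) (by omega)
      hf (hf.ratioSq hg hr) h.1 h.2.1 (kept_of_evenEq he h)
    rw [hk] at H
    exact ⟨hIJ, 1, k, C, _, H, fun h1 h2 t => by simp only [ratioSq, h1, h2]⟩

/-- The lower extreme point is integrated out and the upper one is kept (`h = 0`, `p = m`). -/
theorem gapIdentity_of_odd_same (h : OddUnionSame n f g ∨ OddSingle n f g) :
    I = J ∧ ∃ κ k C W, GapIdentity κ 0 (k + 2) (k + 2) C I f W ∧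
      ((∀ t, f (-t) = f t) → (∀ t, g (-t) = g t) → ∀ t, W (-t) = W t) := by
  rcases h with h | ⟨hr, h⟩
  · obtain ⟨k, hk⟩ := Nat.exists_eq_add_of_le' (show 2 ≤ 2 * n by omega)
    obtain ⟨e, he⟩ := exists_isAlternating (m := 2 * n) (p := 2 * n) (K := 2 * n + 2 * n) (h := 0)
      zero_le_one (by omega) (by omega) (by omega)
    obtain ⟨hIJ, C, H⟩ := gapIdentity_superposed le_rfl he (by omega) zero_le_one (by omega)
      (by omega) (Or.inl ⟨rfl, rfl⟩) hf hg h.1 h.2.1 (kept_of_oddEq he h)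
    rw [hk] at H
    exact ⟨hIJ, 0, k, C, _, H, fun h1 h2 t => by simp only [h1, h2]⟩
  · obtain ⟨k, hk⟩ := Nat.exists_eq_add_of_le' hn
    obtain ⟨e, he⟩ := exists_isAlternating (m := n) (p := n) (K := 2 * n) (h := 0)
      zero_le_one (by omega) (by omega) (by omega)
    obtain ⟨hIJ, C, H⟩ := gapIdentity_single he (by omega) zero_le_one (by omega) (by omega)
      hf (hf.ratioSq hg hr) h.1 h.2.1 (kept_of_oddEq he h)
    rw [hk] at H
    exact ⟨hIJ, 1, k, C, _, H, fun h1 h2 t => by simp only [ratioSq, h1, h2]⟩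

/-- Both extreme points are kept (`h = 0`, `p = m - 1`). -/
theorem gapIdentity_of_odd_pred {hn1 : 1 ≤ n}
    (h : OddUnionPred n hn1 f g ∨ OddSinglePred n hn1 f g) :
    I = J ∧ ∃ κ k C W, GapIdentity κ 0 (k + 2) (k + 1) C I f W ∧
      ((∀ t, f (-t) = f t) → (∀ t, g (-t) = g t) → ∀ t, W (-t) = W t) := by
  rcases h with h | ⟨hr, h⟩
  · obtain ⟨k, hk⟩ := Nat.exists_eq_add_of_le' (show 2 ≤ 2 * n by omega)
    obtain ⟨e, he⟩ := exists_isAlternating (m := 2 * n) (p := 2 * n - 1)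
      (K := 2 * n - 1 + 2 * n) (h := 0) zero_le_one (by omega) (by omega) (by omega)
    obtain ⟨hIJ, C, H⟩ := gapIdentity_superposed (by omega) he (by omega) zero_le_one (by omega)
      (by omega) (Or.inr ⟨rfl, rfl⟩) hf hg h.1 h.2.1 (kept_of_oddEq he h)
    rw [show 2 * n - 1 = k + 1 by omega, hk] at H
    exact ⟨hIJ, 0, k, C, _, H, fun h1 h2 t => by simp only [h1, h2]⟩
  · obtain ⟨k, hk⟩ := Nat.exists_eq_add_of_le' hn
    obtain ⟨e, he⟩ := exists_isAlternating (m := n) (p := n - 1) (K := 2 * n - 1) (h := 0)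
      zero_le_one (by omega) (by omega) (by omega)
    obtain ⟨hIJ, C, H⟩ := gapIdentity_single he (by omega) zero_le_one (by omega) (by omega)
      hf (hf.ratioSq hg hr) h.1 h.2.1 (kept_of_oddEq he h)
    rw [show n - 1 = k + 1 by omega, hk] at H
    exact ⟨hIJ, 1, k, C, _, H, fun h1 h2 t => by simp only [ratioSq, h1, h2]⟩

end Extract

/-! ### The kept law determines the weight -/

theorem eq_mul_of_ratioSq_eq {J J' : Set ℝ} {f g g₀ : ℝ → ℝ} (hg : IsWeightOn J g)
    (hg₀ : IsWeightOn J' g₀) (h : RatioDefined f g) (h₀ : RatioDefined f g₀)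
    (heq : ∃ D > 0, ∀ t, ratioSq f g t = D * ratioSq f g₀ t) : ∃ D > 0, ∀ t, g t = D * g₀ t := by
  obtain ⟨D, hD, heq⟩ := heq
  refine ⟨√D, Real.sqrt_pos.2 hD, fun t => ?_⟩
  by_cases h0 : f t = 0
  · rw [h t h0, h₀ t h0, mul_zero]
  · have h1 := heq t
    simp only [ratioSq, div_pow] at h1
    rw [mul_div_assoc', div_left_inj' (pow_ne_zero 2 h0)] at h1
    rw [← Real.sqrt_sq (hg.nonneg t), h1, Real.sqrt_mul hD.le, Real.sqrt_sq (hg₀.nonneg t)]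

theorem weight_eq_of_evenEq {N m β : ℕ} {hN : N / 2 = m} (hm : 0 < m) {J J' : Set ℝ}
    {v w : ℝ → ℝ} (hv : IsWeightOn J v) (hw : IsWeightOn J' w) {μ : Measure (Fin N → ℝ)}
    (h : EvenEq hN μ (ensemble β m v)) (h' : EvenEq hN μ (ensemble β m w)) :
    ∃ D > 0, ∀ t, v t = D * w t :=
  weight_eq_of_map_kthLargest_eq hm hv hw h.2.1 h'.2.1 (h.2.2.symm.trans h'.2.2)

theorem weight_eq_of_oddEq {N m β : ℕ} {hN : (N + 1) / 2 = m} (hm : 0 < m) {J J' : Set ℝ}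
    {v w : ℝ → ℝ} (hv : IsWeightOn J v) (hw : IsWeightOn J' w) {μ : Measure (Fin N → ℝ)}
    (h : OddEq hN μ (ensemble β m v)) (h' : OddEq hN μ (ensemble β m w)) :
    ∃ D > 0, ∀ t, v t = D * w t :=
  weight_eq_of_map_kthLargest_eq hm hv hw h.2.1 h'.2.1 (h.2.2.symm.trans h'.2.2)

section Uniqueness

variable {n : ℕ} {I J J' : Set ℝ} {f g g₀ : ℝ → ℝ} (hn : 2 ≤ n) (hf : IsWeightOn I f)
  (hg : IsWeightOn J g) (hg₀ : IsWeightOn J' g₀)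

include hn hf hg hg₀

theorem eq_mul_of_even_succ (h : EvenUnionSucc n f g ∨ EvenSingleSucc n f g)
    (h₀ : EvenUnionSucc n f g₀ ∧ EvenSingleSucc n f g₀) : ∃ D > 0, ∀ t, g t = D * g₀ t := by
  rcases h with h | h
  · exact weight_eq_of_evenEq (by omega) hg hg₀ h h₀.1
  · exact eq_mul_of_ratioSq_eq hg hg₀ h.1 h₀.2.1 (weight_eq_of_evenEq (by omega)
      (hf.ratioSq hg h.1) (hf.ratioSq hg₀ h₀.2.1) h.2 h₀.2.2)

theorem eq_mul_of_even_same (h : EvenUnionSame n f g ∨ EvenSingle n f g)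
    (h₀ : EvenUnionSame n f g₀ ∧ EvenSingle n f g₀) : ∃ D > 0, ∀ t, g t = D * g₀ t := by
  rcases h with h | h
  · exact weight_eq_of_evenEq (by omega) hg hg₀ h h₀.1
  · exact eq_mul_of_ratioSq_eq hg hg₀ h.1 h₀.2.1 (weight_eq_of_evenEq (by omega)
      (hf.ratioSq hg h.1) (hf.ratioSq hg₀ h₀.2.1) h.2 h₀.2.2)

theorem eq_mul_of_odd_same (h : OddUnionSame n f g ∨ OddSingle n f g)
    (h₀ : OddUnionSame n f g₀ ∧ OddSingle n f g₀) : ∃ D > 0, ∀ t, g t = D * g₀ t := by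
  rcases h with h | h
  · exact weight_eq_of_oddEq (by omega) hg hg₀ h h₀.1
  · exact eq_mul_of_ratioSq_eq hg hg₀ h.1 h₀.2.1 (weight_eq_of_oddEq (by omega)
      (hf.ratioSq hg h.1) (hf.ratioSq hg₀ h₀.2.1) h.2 h₀.2.2)

theorem eq_mul_of_odd_pred {hn1 : 1 ≤ n} (h : OddUnionPred n hn1 f g ∨ OddSinglePred n hn1 f g)
    (h₀ : OddUnionPred n hn1 f g₀ ∧ OddSinglePred n hn1 f g₀) : ∃ D > 0, ∀ t, g t = D * g₀ t := by
  rcases h with h | h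
  · exact weight_eq_of_oddEq (by omega) hg hg₀ h h₀.1
  · exact eq_mul_of_ratioSq_eq hg hg₀ h.1 h₀.2.1 (weight_eq_of_oddEq (by omega)
      (hf.ratioSq hg h.1) (hf.ratioSq hg₀ h₀.2.1) h.2 h₀.2.2)

end Uniqueness

theorem IsPairRescaling.const_mul {f g g₀ F G : ℝ → ℝ} (h : IsPairRescaling f g₀ F G) {D : ℝ}
    (hD : 0 < D) (hg : ∀ t, g t = D * g₀ t) : IsPairRescaling f g F G := by
  obtain ⟨c, hc, C, hC, E, hE, h1, h2⟩ := h
  exact ⟨c, hc, C, hC, D * E, by positivity, h1, fun x => by rw [hg, h2, mul_assoc]⟩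

theorem EvenSuccPair.const_mul {n : ℕ} {f g g₀ : ℝ → ℝ} (h : EvenSuccPair n f g₀) {D : ℝ}
    (hD : 0 < D) (hg : ∀ t, g t = D * g₀ t) : EvenSuccPair n f g :=
  h.imp (·.const_mul hD hg) (Or.imp (fun ⟨a, ha, h⟩ => ⟨a, ha, h.const_mul hD hg⟩)
    (Or.imp (fun ⟨a, ha, b, hb, h⟩ => ⟨a, ha, b, hb, h.const_mul hD hg⟩)
      fun ⟨a, ha, h⟩ => ⟨a, ha, h.const_mul hD hg⟩))

theorem EvenSamePair.const_mul {f g g₀ : ℝ → ℝ} (h : EvenSamePair f g₀) {D : ℝ}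
    (hD : 0 < D) (hg : ∀ t, g t = D * g₀ t) : EvenSamePair f g :=
  h.imp (·.const_mul hD hg) fun ⟨a, ha, h⟩ => ⟨a, ha, h.const_mul hD hg⟩

theorem OddSamePair.const_mul {f g g₀ : ℝ → ℝ} (h : OddSamePair f g₀) {D : ℝ}
    (hD : 0 < D) (hg : ∀ t, g t = D * g₀ t) : OddSamePair f g :=
  h.imp fun _ h => ⟨h.1, h.2.const_mul hD hg⟩

theorem OddPredPair.const_mul {f g g₀ : ℝ → ℝ} (h : OddPredPair f g₀) {D : ℝ}
    (hD : 0 < D) (hg : ∀ t, g t = D * g₀ t) : OddPredPair f g :=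
  IsPairRescaling.const_mul h hD hg

/-! ### Exponents of the classical weights -/

theorem IsWeightOn.rescale {I : Set ℝ} {w : ℝ → ℝ} (hw : IsWeightOn I w) {c C : ℝ} (hc : 0 < c)
    (hC : 0 < C) : IsWeightOn ((fun t => c * t) ⁻¹' I) fun t => C * w (c * t) where
  isOpen := hw.isOpen.preimage (by fun_prop)
  ordConnected := hw.ordConnected.preimage_mono (monotone_mul_left_of_nonneg hc.le)
  nonempty := by
    obtain ⟨t, ht⟩ := hw.nonempty
    exact ⟨t / c, by rwa [Set.mem_preimage, mul_div_cancel₀ _ hc.ne']⟩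
  measurable := by have := hw.measurable; fun_prop
  continuousOn := continuousOn_const.mul (hw.continuousOn.comp (by fun_prop) fun _ ht => ht)
  pos t ht := mul_pos hC (hw.pos _ ht)
  eq_zero t ht := by rw [hw.eq_zero _ ht, mul_zero]

theorem isWeightOn_indicator {I : Set ℝ} {w : ℝ → ℝ} (ho : IsOpen I) (hc : I.OrdConnected)
    (hne : I.Nonempty) (hm : Measurable w) (hcont : ContinuousOn w I) (hpos : ∀ t ∈ I, 0 < w t) :
    IsWeightOn I (I.indicator w) where
  isOpen := ho
  ordConnected := hc
  nonempty := hne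
  measurable := hm.indicator ho.measurableSet
  continuousOn := hcont.congr fun t ht => Set.indicator_of_mem ht w
  pos t ht := by rw [Set.indicator_of_mem ht]; exact hpos t ht
  eq_zero t ht := Set.indicator_of_notMem ht w

theorem isWeightOn_univ {w : ℝ → ℝ} (hc : Continuous w) (hpos : ∀ t, 0 < w t) :
    IsWeightOn Set.univ w :=
  ⟨isOpen_univ, Set.ordConnected_univ, Set.univ_nonempty, hc.measurable, hc.continuousOn,
    fun t _ => hpos t, fun _ ht => absurd trivial ht⟩

theorem isWeightOn_gaussian : IsWeightOn Set.univ fun x => Real.exp (-x ^ 2) :=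
  isWeightOn_univ (by fun_prop) fun _ => Real.exp_pos _

theorem isWeightOn_laguerre (a : ℝ) :
    IsWeightOn (Set.Ioi 0) ((Set.Ioi 0).indicator fun x => x ^ a * Real.exp (-x)) :=
  isWeightOn_indicator isOpen_Ioi Set.ordConnected_Ioi Set.nonempty_Ioi (by fun_prop)
    ((continuousOn_id.rpow_const fun t ht => Or.inl (ne_of_gt ht)).mul (by fun_prop))
    fun t ht => mul_pos (Real.rpow_pos_of_pos ht a) (Real.exp_pos _)

theorem isWeightOn_jacobi (a b : ℝ) :
    IsWeightOn (Set.Ioo 0 1) ((Set.Ioo 0 1).indicator fun x => x ^ a * (1 - x) ^ b) :=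
  isWeightOn_indicator isOpen_Ioo Set.ordConnected_Ioo (Set.nonempty_Ioo.2 one_pos) (by fun_prop)
    ((continuousOn_id.rpow_const fun t ht => Or.inl (ne_of_gt ht.1)).mul
      (ContinuousOn.rpow_const (by fun_prop) fun t ht => Or.inl (sub_pos.2 ht.2).ne'))
    fun t ht => mul_pos (Real.rpow_pos_of_pos ht.1 a) (Real.rpow_pos_of_pos (sub_pos.2 ht.2) b)

theorem isWeightOn_cauchy (α : ℝ) : IsWeightOn Set.univ fun x => (1 + x ^ 2) ^ (-α) :=
  isWeightOn_univ (Continuous.rpow_const (by fun_prop) fun t => Or.inl (one_add_sq_pos t).ne')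
    fun t => Real.rpow_pos_of_pos (one_add_sq_pos t) _

theorem IsClassicalWeight.exists_isWeightOn {w : ℝ → ℝ} (h : IsClassicalWeight w) :
    ∃ I, IsWeightOn I w := by
  rcases h with ⟨c, hc, C, hC, h⟩ | ⟨a, -, c, hc, C, hC, h⟩ | ⟨a, -, b, -, c, hc, C, hC, h⟩ |
    ⟨α, -, c, hc, C, hC, h⟩ <;> rw [funext h]
  · exact ⟨_, isWeightOn_gaussian.rescale hc hC⟩
  · exact ⟨_, (isWeightOn_laguerre a).rescale hc hC⟩
  · exact ⟨_, (isWeightOn_jacobi a b).rescale hc hC⟩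
  · exact ⟨_, (isWeightOn_cauchy α).rescale hc hC⟩

theorem IsClassicalWeight.neg_eq {w : ℝ → ℝ} (h : IsClassicalWeight w)
    (hw : IsWeightOn Set.univ w) (t : ℝ) : w (-t) = w t := by
  have hpos := hw.pos (-1) trivial
  rcases h with ⟨c, hc, C, hC, h⟩ | ⟨a, -, c, hc, C, hC, h⟩ | ⟨a, -, b, -, c, hc, C, hC, h⟩ |
    ⟨α, -, c, hc, C, hC, h⟩
  · rw [h, h, mul_neg]; simp only [neg_sq]
  · rw [h, Set.indicator_of_notMem (by simp only [Set.mem_Ioi]; linarith)] at hpos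
    simp at hpos
  · rw [h, Set.indicator_of_notMem (fun h0 => by have := h0.1; linarith)] at hpos
    simp at hpos
  · rw [h, h, mul_neg]; simp only [neg_sq]

/-- The vanishing of the exponent, for `f` given as a power times a continuous function. -/
theorem GapIdentity.exponent_eq_zero_of_continuousAt {κ k q : ℕ} {C b a δ : ℝ} {I : Set ℝ}
    {f W φ : ℝ → ℝ} (H : GapIdentity κ 0 (k + 2) (q + 1) C I f W) (hq : q ≤ k + 1) (hδ : 0 < δ)
    (hI : Set.Ioo (b - δ) b ⊆ I) (hφ : ContinuousAt φ b) (hφ0 : 0 < φ b)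
    (hf : ∀ t ∈ Set.Ioo (b - δ) b, f t = φ t * (b - t) ^ a) : a = 0 := by
  obtain ⟨ε, hε, hεφ⟩ := Metric.eventually_nhds_iff.1
    ((hφ.eventually (lt_mem_nhds (half_lt_self hφ0))).and
      (hφ.eventually (gt_mem_nhds (show φ b < 2 * φ b by linarith))))
  have hsub : Set.Ioo (b - min δ ε) b ⊆ Set.Ioo (b - δ) b := fun t ht =>
    ⟨by linarith [ht.1, min_le_left δ ε], ht.2⟩
  have hnear : ∀ t ∈ Set.Ioo (b - min δ ε) b, φ b / 2 < φ t ∧ φ t < 2 * φ b := fun t ht => by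
    refine hεφ ?_
    rw [Real.dist_eq, abs_sub_comm, abs_of_pos (sub_pos.2 ht.2)]
    linarith [ht.1, min_le_right δ ε]
  refine H.exponent_eq_zero hq (b := b) (δ := min δ ε) (c₁ := φ b / 2) (c₂ := 2 * φ b)
    (lt_min hδ hε) (hsub.trans hI) (half_pos hφ0) (fun t ht => ?_) fun t ht => ?_
  all_goals
    rw [hf t (hsub ht)]
    have h0 : 0 < (b - t) ^ a := Real.rpow_pos_of_pos (sub_pos.2 ht.2) a
  · exact mul_le_mul_of_nonneg_right (hnear t ht).1.le h0.le
  · exact mul_le_mul_of_nonneg_right (hnear t ht).2.le h0.le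

section Exponents

variable {κ k q : ℕ} {a b c C D : ℝ} {I : Set ℝ} {W : ℝ → ℝ}

theorem GapIdentity.false_of_laguerre (ha : -1 < a) (hc : 0 < c) (hC : 0 < C)
    (H : GapIdentity κ 0 (k + 2) (q + 1) D ((fun t => c * t) ⁻¹' Set.Ioi 0)
      (fun t => C * (Set.Ioi 0).indicator (fun x => x ^ a * Real.exp (-x)) (c * t)) W)
    (hq : q ≤ k + 1) : False := by
  refine H.false_of_rapid_decay hq (fun t ht => mul_pos hc ht) fun N => ?_
  set f : ℝ → ℝ := fun t => C * (Set.Ioi 0).indicator (fun x => x ^ a * Real.exp (-x)) (c * t)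
  have hf0 := H.isWeightOn.nonneg
  have hfm := H.isWeightOn.measurable
  have hint : ∀ j ≤ N, Integrable fun t => f t * t ^ j := by
    -- `f` is the first weight of the Laguerre pair with exponent `2 a + 1`, on the scale `2 c`.
    have hP := (isPearsonWeight_laguerre N (a := 2 * a + 1) (by linarith)).scale
      (c := 2 * c) (C := C / 2 ^ a) (by positivity) (by positivity)
    intro j hj
    refine (hP.integrable j hj).congr (Filter.Eventually.of_forall fun t => ?_)
    simp only [f]
    congr 1
    rcases lt_or_ge 0 t with ht | ht
    · have h1 : 0 < c * t := mul_pos hc ht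
      rw [Set.indicator_of_mem (by simpa [mul_assoc] using h1),
        Set.indicator_of_mem (by simpa using h1), show (2 * a + 1 - 1) / 2 = a by ring,
        mul_assoc 2 c t, Real.mul_rpow zero_le_two h1.le,
        show -(2 * (c * t)) / 2 = -(c * t) by ring]
      field_simp
    · have h1 : c * t ≤ 0 := mul_nonpos_of_nonneg_of_nonpos hc.le ht
      rw [Set.indicator_of_notMem (by simp only [Set.mem_Ioi]; linarith),
        Set.indicator_of_notMem (by simp only [Set.mem_Ioi]; linarith)]
      simp
  have h0 := hint 0 (Nat.zero_le N)
  simp only [pow_zero, mul_one] at h0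
  refine ((h0.add (hint N le_rfl).norm).const_mul (2 ^ N)).mono'
    (hfm.mul (by fun_prop)).aestronglyMeasurable
    (Filter.Eventually.of_forall fun t => ?_)
  have h1 : (1 + |t|) ^ N ≤ 2 ^ N * (1 + |t| ^ N) := by
    calc (1 + |t|) ^ N ≤ (2 * max 1 |t|) ^ N :=
          pow_le_pow_left₀ (by positivity) (by linarith [le_max_left 1 |t|, le_max_right 1 |t|]) N
      _ = 2 ^ N * max 1 |t| ^ N := mul_pow _ _ _
      _ ≤ 2 ^ N * (1 + |t| ^ N) := by
          gcongr
          rcases max_choice 1 |t| with h | h <;> rw [h]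
          · simp
          · simp
  rw [Real.norm_eq_abs, abs_of_nonneg (mul_nonneg (hf0 t) (by positivity))]
  simp only [Pi.add_apply, norm_mul, norm_pow, Real.norm_eq_abs, abs_of_nonneg (hf0 t)]
  calc f t * (1 + |t|) ^ N ≤ f t * (2 ^ N * (1 + |t| ^ N)) := mul_le_mul_of_nonneg_left h1 (hf0 t)
    _ = _ := by ring

/-- Reflection turns the lower end of the Laguerre support into an upper end. -/
theorem GapIdentity.exponent_eq_zero_of_laguerre_neg (hc : 0 < c) (hC : 0 < C)
    (H : GapIdentity κ 0 (k + 2) (q + 1) D (-((fun t => c * t) ⁻¹' Set.Ioi 0))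
      (fun t => C * (Set.Ioi 0).indicator (fun x => x ^ a * Real.exp (-x)) (c * -t)) W)
    (hq : q ≤ k + 1) : a = 0 := by
  refine H.exponent_eq_zero_of_continuousAt hq (b := 0) (δ := 1)
    (φ := fun t => C * c ^ a * Real.exp (c * t)) one_pos (fun t ht => ?_) (by fun_prop)
    (by positivity) fun t ht => ?_
  · exact mul_pos hc (neg_pos.2 ht.2)
  · have h1 : 0 < -t := neg_pos.2 ht.2
    rw [Set.indicator_of_mem (by exact mul_pos hc h1), Real.mul_rpow hc.le h1.le, zero_sub,
      mul_neg c, neg_neg]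
    ring

theorem GapIdentity.exponent_eq_zero_of_jacobi (hc : 0 < c) (hC : 0 < C)
    (H : GapIdentity κ 0 (k + 2) (q + 1) D ((fun t => c * t) ⁻¹' Set.Ioo 0 1)
      (fun t => C * (Set.Ioo 0 1).indicator (fun x => x ^ a * (1 - x) ^ b) (c * t)) W)
    (hq : q ≤ k + 1) : b = 0 := by
  have hmem : ∀ t ∈ Set.Ioo (1 / c - 1 / c) (1 / c), c * t ∈ Set.Ioo (0 : ℝ) 1 := fun t ht => by
    rw [sub_self] at ht
    exact ⟨mul_pos hc ht.1, by rw [mul_comm]; exact (lt_div_iff₀ hc).1 ht.2⟩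
  refine H.exponent_eq_zero_of_continuousAt hq (b := 1 / c) (δ := 1 / c)
    (φ := fun t => C * c ^ b * (c * t) ^ a) (by positivity) hmem ?_ (by positivity) fun t ht => ?_
  · refine continuousAt_const.mul (ContinuousAt.rpow_const (by fun_prop) (Or.inl ?_))
    rw [mul_one_div_cancel hc.ne']
    exact one_ne_zero
  · have h1 : 1 - c * t = c * (1 / c - t) := by field_simp
    rw [Set.indicator_of_mem (hmem t ht), h1, Real.mul_rpow hc.le (sub_pos.2 ht.2).le]
    ring

/-- Reflection turns the lower end of the Jacobi support into an upper end. -/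
theorem GapIdentity.exponent_eq_zero_of_jacobi_neg (hc : 0 < c) (hC : 0 < C)
    (H : GapIdentity κ 0 (k + 2) (q + 1) D (-((fun t => c * t) ⁻¹' Set.Ioo 0 1))
      (fun t => C * (Set.Ioo 0 1).indicator (fun x => x ^ a * (1 - x) ^ b) (c * -t)) W)
    (hq : q ≤ k + 1) : a = 0 := by
  have hmem : ∀ t ∈ Set.Ioo (0 - 1 / c) 0, c * -t ∈ Set.Ioo (0 : ℝ) 1 := fun t ht => by
    refine ⟨mul_pos hc (neg_pos.2 ht.2), ?_⟩
    rw [mul_comm]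
    exact (lt_div_iff₀ hc).1 (by linarith [ht.1])
  refine H.exponent_eq_zero_of_continuousAt hq (b := 0) (δ := 1 / c)
    (φ := fun t => C * c ^ a * (1 - c * -t) ^ b) (by positivity) hmem ?_ ?_ fun t ht => ?_
  · exact continuousAt_const.mul (ContinuousAt.rpow_const (by fun_prop) (Or.inl (by simp)))
  · simp only [neg_zero, mul_zero, sub_zero, Real.one_rpow, mul_one]; positivity
  · rw [Set.indicator_of_mem (hmem t ht), zero_sub, Real.mul_rpow hc.le (neg_pos.2 ht.2).le]
    ring

end Exponents

/-! ### Classification -/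

/-- Normalisability bounds the decay of a Cauchy weight. -/
theorem lt_of_integrable_cauchy {c C β : ℝ} {N : ℕ} (hc : 0 < c) (hC : 0 < C) (hβ : 0 < β)
    (h : Integrable fun t => C * (1 + (c * t) ^ 2) ^ (-β) * (1 + |t|) ^ N) :
    (N : ℝ) + 1 < 2 * β := by
  have hK : 0 < C * (1 + c ^ 2) ^ (-β) := by positivity
  have h1 : IntegrableOn (fun t : ℝ => t ^ ((N : ℝ) - 2 * β)) (Set.Ioi 1) := by
    refine (h.const_mul (C * (1 + c ^ 2) ^ (-β))⁻¹).integrableOn.mono' (by fun_prop) ?_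
    filter_upwards [ae_restrict_mem measurableSet_Ioi] with t ht
    have ht1 : 1 < t := ht
    have ht0 : 0 < t := by linarith
    rw [Real.norm_eq_abs, abs_of_pos (Real.rpow_pos_of_pos ht0 _), ← div_eq_inv_mul,
      le_div_iff₀ hK, sub_eq_add_neg, Real.rpow_add ht0, Real.rpow_natCast]
    have h2 : t ^ (-(2 * β)) * (1 + c ^ 2) ^ (-β) ≤ (1 + (c * t) ^ 2) ^ (-β) := by
      rw [show -(2 * β) = (2 : ℕ) * -β by push_cast; ring, Real.rpow_mul ht0.le,
        Real.rpow_natCast, ← Real.mul_rpow (by positivity) (by positivity)]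
      refine Real.rpow_le_rpow_of_nonpos (by positivity) ?_ (by linarith)
      nlinarith
    have h3 : t ^ N ≤ (1 + |t|) ^ N := by
      rw [abs_of_pos ht0]
      exact pow_le_pow_left₀ ht0.le (by linarith) N
    calc _ = C * (t ^ (-(2 * β)) * (1 + c ^ 2) ^ (-β)) * t ^ N := by ring
      _ ≤ _ := by gcongr
  have := (integrableOn_Ioi_rpow_iff one_pos).1 h1
  linarith

/-- Every classical weight with `2 n` moments is the first weight of a listed pair; for Cauchy weights
the moments give the restriction on the exponent. -/
theorem exists_evenSuccPair {n : ℕ} {f : ℝ → ℝ} (hf : IsClassicalWeight f)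
    (hint : Integrable fun t => f t * (1 + |t|) ^ (2 * n)) :
    ∃ J g₀, IsWeightOn J g₀ ∧ EvenSuccPair n f g₀ := by
  rcases hf with ⟨c, hc, C, hC, h⟩ | ⟨a, ha, c, hc, C, hC, h⟩ | ⟨a, ha, b, hb, c, hc, C, hC, h⟩ |
    ⟨β, hβ, c, hc, C, hC, h⟩
  · refine ⟨_, _, isWeightOn_gaussian.rescale (c := √2 * c) (by positivity) one_pos, Or.inl
      ⟨√2 * c, by positivity, C, hC, 1, one_pos, fun x => ?_, fun x => rfl⟩⟩
    rw [h]
    simp only [mul_pow, Real.sq_sqrt zero_le_two]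
    congr 2; ring
  · refine ⟨_, _, (isWeightOn_laguerre (2 * a + 1)).rescale (c := 2 * c) (by positivity) one_pos,
      Or.inr (Or.inl ⟨2 * a + 1, by linarith, 2 * c, by positivity, C / 2 ^ a, by positivity, 1,
        one_pos, fun x => ?_, fun x => rfl⟩)⟩
    rw [h]
    rcases lt_or_ge 0 x with hx | hx
    · have h1 : 0 < c * x := mul_pos hc hx
      rw [Set.indicator_of_mem (by simpa using h1),
        Set.indicator_of_mem (by simpa [mul_assoc] using h1), show (2 * a + 1 - 1) / 2 = a by ring,
        mul_assoc 2 c x, Real.mul_rpow zero_le_two h1.le,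
        show -(2 * (c * x)) / 2 = -(c * x) by ring]
      field_simp
    · have h1 : c * x ≤ 0 := mul_nonpos_of_nonneg_of_nonpos hc.le hx
      rw [Set.indicator_of_notMem (by simp only [Set.mem_Ioi]; linarith),
        Set.indicator_of_notMem (by simp only [Set.mem_Ioi]; linarith)]
      simp
  · refine ⟨_, _, (isWeightOn_jacobi (2 * a + 1) (2 * b + 1)).rescale hc one_pos,
      Or.inr (Or.inr (Or.inl ⟨2 * a + 1, by linarith, 2 * b + 1, by linarith, c, hc, C, hC, 1,
        one_pos, fun x => ?_, fun x => rfl⟩))⟩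
    rw [h, show (2 * a + 1 - 1) / 2 = a by ring, show (2 * b + 1 - 1) / 2 = b by ring]
  · have h1 := lt_of_integrable_cauchy (β := β) (N := 2 * n) hc hC (by linarith) (by simpa only [h] using hint)
    refine ⟨_, _, (isWeightOn_cauchy (2 * β - 1)).rescale hc one_pos,
      Or.inr (Or.inr (Or.inr ⟨2 * β - 1, by push_cast at h1; linarith, c, hc, C, hC, 1, one_pos,
        fun x => ?_, fun x => rfl⟩))⟩
    rw [h, show -(2 * β - 1 + 1) / 2 = -β by ring]

theorem jacobi_eq_upper (b : ℝ) : ((Set.Ioo 0 1).indicator fun x : ℝ => x ^ (0 : ℝ) * (1 - x) ^ b) =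
    (Set.Ioo 0 1).indicator fun x => (1 - x) ^ b := by simp

theorem jacobi_eq_lower (a : ℝ) : ((Set.Ioo 0 1).indicator fun x : ℝ => x ^ a * (1 - x) ^ (0 : ℝ)) =
    (Set.Ioo 0 1).indicator fun x => x ^ a := by simp

/-- Two intervals on which the same weight lives coincide, so the case distinction on a classical
weight can be made together with its support. -/
theorem IsClassicalWeight.cases_isWeightOn {I : Set ℝ} {f : ℝ → ℝ} (hf : IsClassicalWeight f)
    (hfI : IsWeightOn I f) : I = Set.univ ∨
    (∃ a > (-1 : ℝ), ∃ c > (0 : ℝ), ∃ C > (0 : ℝ), I = (fun t => c * t) ⁻¹' Set.Ioi 0 ∧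
      f = fun t => C * (Set.Ioi 0).indicator (fun x => x ^ a * Real.exp (-x)) (c * t)) ∨
    ∃ a > (-1 : ℝ), ∃ b > (-1 : ℝ), ∃ c > (0 : ℝ), ∃ C > (0 : ℝ), I = (fun t => c * t) ⁻¹' Set.Ioo 0 1 ∧
      f = fun t => C * (Set.Ioo 0 1).indicator (fun x => x ^ a * (1 - x) ^ b) (c * t) := by
  have hsupp : ∀ {J : Set ℝ}, IsWeightOn J f → I = J := fun hJ => by
    ext t
    rw [hfI.mem_iff, hJ.mem_iff]
  rcases hf with ⟨c, hc, C, hC, h⟩ | ⟨a, ha, c, hc, C, hC, h⟩ | ⟨a, ha, b, hb, c, hc, C, hC, h⟩ |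
    ⟨β, hβ, c, hc, C, hC, h⟩ <;> obtain rfl := funext h
  · exact Or.inl (hsupp (isWeightOn_gaussian.rescale hc hC))
  · exact Or.inr (Or.inl ⟨a, ha, c, hc, C, hC,
      hsupp ((isWeightOn_laguerre a).rescale hc hC), rfl⟩)
  · exact Or.inr (Or.inr ⟨a, ha, b, hb, c, hc, C, hC,
      hsupp ((isWeightOn_jacobi a b).rescale hc hC), rfl⟩)
  · exact Or.inl (hsupp ((isWeightOn_cauchy β).rescale hc hC))

section Classify

variable {κ k : ℕ} {D : ℝ} {I : Set ℝ} {f g W : ℝ → ℝ} (hf : IsClassicalWeight f)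
  (hg : IsClassicalWeight g) (hgI : IsWeightOn I g)
  (hW : (∀ t, f (-t) = f t) → (∀ t, g (-t) = g t) → ∀ t, W (-t) = W t)

include hf hg hgI hW

/-- As no point below the smallest kept one is integrated out, the reflected identity constrains the
lower end of the support. -/
theorem exists_evenSamePair (H : GapIdentity κ 1 (k + 2) (k + 2) D I f W) :
    ∃ J g₀, IsWeightOn J g₀ ∧ EvenSamePair f g₀ := by
  have H' := H.neg (by omega) (by omega)
  rw [show k + 2 + 1 - (k + 2) - 1 = 0 by omega] at H'
  rcases hf.cases_isWeightOn H.isWeightOn with rfl | ⟨a, ha, c, hc, C, hC, rfl, rfl⟩ |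
    ⟨a, ha, b, hb, c, hc, C, hC, rfl, rfl⟩
  · have hfe := hf.neg_eq H.isWeightOn
    have hWe := hW hfe (hg.neg_eq hgI)
    rw [Set.neg_univ] at H'
    exact (H'.false_of_even (k := k + 1) (by simpa using fun t => (hfe t).symm)
      (by simpa using fun t => (hWe t).symm)).elim
  · obtain rfl := H'.exponent_eq_zero_of_laguerre_neg (q := k + 1) hc hC le_rfl
    refine ⟨_, _, (isWeightOn_laguerre 0).rescale (c := 2 * c) (by positivity) one_pos,
      Or.inl ⟨2 * c, by positivity, C, hC, 1, one_pos, fun x => ?_, fun x => by simp⟩⟩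
    beta_reduce
    have h1 : 2 * c * x ∈ Set.Ioi (0 : ℝ) ↔ c * x ∈ Set.Ioi (0 : ℝ) := by
      simp [mul_assoc]
    by_cases hx : c * x ∈ Set.Ioi (0 : ℝ)
    · rw [Set.indicator_of_mem hx, Set.indicator_of_mem (h1.2 hx), Real.rpow_zero, one_mul,
        show -(2 * c * x) / 2 = -(c * x) by ring]
    · rw [Set.indicator_of_notMem hx, Set.indicator_of_notMem fun h => hx (h1.1 h)]
  · obtain rfl := H'.exponent_eq_zero_of_jacobi_neg (q := k + 1) hc hC le_rfl
    refine ⟨_, _, (isWeightOn_jacobi 0 (2 * b + 1)).rescale hc one_pos,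
      Or.inr ⟨2 * b + 1, by linarith, c, hc, C, hC, 1, one_pos, fun x => ?_, fun x => ?_⟩⟩
    · rw [jacobi_eq_upper, show (2 * b + 1 - 1) / 2 = b by ring]
    · rw [jacobi_eq_upper]

/-- As no point above the largest kept one is integrated out, the upper end of the support is
constrained. -/
theorem exists_oddSamePair (H : GapIdentity κ 0 (k + 2) (k + 2) D I f W) :
    ∃ J g₀, IsWeightOn J g₀ ∧ OddSamePair f g₀ := by
  rcases hf.cases_isWeightOn H.isWeightOn with rfl | ⟨a, ha, c, hc, C, hC, rfl, rfl⟩ |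
    ⟨a, ha, b, hb, c, hc, C, hC, rfl, rfl⟩
  · have hfe := hf.neg_eq H.isWeightOn
    exact (H.false_of_even (k := k + 1) hfe (hW hfe (hg.neg_eq hgI))).elim
  · exact (H.false_of_laguerre (q := k + 1) ha hc hC le_rfl).elim
  · obtain rfl := H.exponent_eq_zero_of_jacobi (q := k + 1) hc hC le_rfl
    refine ⟨_, _, (isWeightOn_jacobi (2 * a + 1) 0).rescale hc one_pos,
      2 * a + 1, by linarith, c, hc, C, hC, 1, one_pos, fun x => ?_, fun x => ?_⟩
    · rw [jacobi_eq_lower, show (2 * a + 1 - 1) / 2 = a by ring]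
    · rw [jacobi_eq_lower]

/-- Both ends of the support are constrained. -/
theorem exists_oddPredPair (H : GapIdentity κ 0 (k + 2) (k + 1) D I f W) :
    ∃ J g₀, IsWeightOn J g₀ ∧ OddPredPair f g₀ := by
  have H' := H.neg (by omega) (by omega)
  rw [show k + 1 + 1 - (k + 2) - 0 = 0 by omega] at H'
  rcases hf.cases_isWeightOn H.isWeightOn with rfl | ⟨a, ha, c, hc, C, hC, rfl, rfl⟩ |
    ⟨a, ha, b, hb, c, hc, C, hC, rfl, rfl⟩
  · exact (H.false_of_even_two_sided (hW (hf.neg_eq H.isWeightOn) (hg.neg_eq hgI))).elim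
  · exact (H.false_of_laguerre (q := k) ha hc hC (by omega)).elim
  · obtain rfl := H.exponent_eq_zero_of_jacobi (q := k) hc hC (by omega)
    obtain rfl := H'.exponent_eq_zero_of_jacobi_neg (q := k) hc hC (by omega)
    refine ⟨_, _, (isWeightOn_jacobi 0 0).rescale hc one_pos,
      c, hc, C, hC, 1, one_pos, fun x => ?_, fun x => ?_⟩ <;> simp

end Classify

variable {n : ℕ} {f g : ℝ → ℝ}

theorem evenSuccPair_of_isClassicalWeight (hn : 2 ≤ n) (hf : IsClassicalWeight f)
    (hg : IsClassicalWeight g) (h : EvenUnionSucc n f g ∨ EvenSingleSucc n f g) :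
    EvenSuccPair n f g := by
  obtain ⟨I, hfI⟩ := hf.exists_isWeightOn
  obtain ⟨J, hgJ⟩ := hg.exists_isWeightOn
  have hP : IsProbabilityMeasure (OE (2 * n + 1) f) := by
    rcases h with h | h
    · exact (isProbabilityMeasure_of_superpose h.1).2
    · exact h.2.1
  obtain ⟨J', g₀, hg₀, h₀⟩ := exists_evenSuccPair hf
    (integrable_of_unnormalized_ne_top hfI (mass_of_isProbabilityMeasure_ensemble hP).2)
  obtain ⟨E, hE, hgE⟩ := eq_mul_of_even_succ hn hfI hgJ hg₀ h (even_succ_of_evenSuccPair h₀)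
  exact h₀.const_mul hE hgE

theorem evenSamePair_of_isClassicalWeight (hn : 2 ≤ n) (hf : IsClassicalWeight f)
    (hg : IsClassicalWeight g) (h : EvenUnionSame n f g ∨ EvenSingle n f g) :
    EvenSamePair f g := by
  obtain ⟨I, hfI⟩ := hf.exists_isWeightOn
  obtain ⟨J, hgJ⟩ := hg.exists_isWeightOn
  obtain ⟨rfl, κ, k, D, W, H, hW⟩ := gapIdentity_of_even_same hn hfI hgJ h
  obtain ⟨J', g₀, hg₀, h₀⟩ := exists_evenSamePair hf hg hgJ hW H
  obtain ⟨E, hE, hgE⟩ := eq_mul_of_even_same hn hfI hgJ hg₀ h (even_same_of_evenSamePair h₀)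
  exact h₀.const_mul hE hgE

theorem oddSamePair_of_isClassicalWeight (hn : 2 ≤ n) (hf : IsClassicalWeight f)
    (hg : IsClassicalWeight g) (h : OddUnionSame n f g ∨ OddSingle n f g) :
    OddSamePair f g := by
  obtain ⟨I, hfI⟩ := hf.exists_isWeightOn
  obtain ⟨J, hgJ⟩ := hg.exists_isWeightOn
  obtain ⟨rfl, κ, k, D, W, H, hW⟩ := gapIdentity_of_odd_same hn hfI hgJ h
  obtain ⟨J', g₀, hg₀, h₀⟩ := exists_oddSamePair hf hg hgJ hW H
  obtain ⟨E, hE, hgE⟩ := eq_mul_of_odd_same hn hfI hgJ hg₀ h (odd_same_of_oddSamePair h₀)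
  exact h₀.const_mul hE hgE

theorem oddPredPair_of_isClassicalWeight (hn : 2 ≤ n) {hn1 : 1 ≤ n} (hf : IsClassicalWeight f)
    (hg : IsClassicalWeight g) (h : OddUnionPred n hn1 f g ∨ OddSinglePred n hn1 f g) :
    OddPredPair f g := by
  obtain ⟨I, hfI⟩ := hf.exists_isWeightOn
  obtain ⟨J, hgJ⟩ := hg.exists_isWeightOn
  obtain ⟨rfl, κ, k, D, W, H, hW⟩ := gapIdentity_of_odd_pred hn hfI hgJ h
  obtain ⟨J', g₀, hg₀, h₀⟩ := exists_oddPredPair hf hg hgJ hW H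
  obtain ⟨E, hE, hgE⟩ := eq_mul_of_odd_pred hn hfI hgJ hg₀ h (odd_pred_of_oddPredPair hn1 h₀)
  exact h₀.const_mul hE hgE

end EigenvalueEnsemble

end

theorem mainTheorem7 (n : ℕ) (hn : 2 ≤ n) :
    -- The listed pairs satisfy both statements of the respective pair of statements.
    ((∀ f g : ℝ → ℝ, EigenvalueEnsemble.EvenSuccPair n f g →
        EigenvalueEnsemble.EvenUnionSucc n f g ∧ EigenvalueEnsemble.EvenSingleSucc n f g) ∧
     (∀ f g : ℝ → ℝ, EigenvalueEnsemble.EvenSamePair f g →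
        EigenvalueEnsemble.EvenUnionSame n f g ∧ EigenvalueEnsemble.EvenSingle n f g) ∧
     (∀ f g : ℝ → ℝ, EigenvalueEnsemble.OddSamePair f g →
        EigenvalueEnsemble.OddUnionSame n f g ∧ EigenvalueEnsemble.OddSingle n f g) ∧
     (∀ f g : ℝ → ℝ, EigenvalueEnsemble.OddPredPair f g →
        EigenvalueEnsemble.OddUnionPred n (by omega) f g ∧
          EigenvalueEnsemble.OddSinglePred n (by omega) f g)) ∧
    -- Among the classical weights, no other pair satisfies either of the two statements.
    (∀ f g : ℝ → ℝ, EigenvalueEnsemble.IsClassicalWeight f →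
      EigenvalueEnsemble.IsClassicalWeight g →
      (EigenvalueEnsemble.EvenUnionSucc n f g ∨ EigenvalueEnsemble.EvenSingleSucc n f g →
        EigenvalueEnsemble.EvenSuccPair n f g) ∧
      (EigenvalueEnsemble.EvenUnionSame n f g ∨ EigenvalueEnsemble.EvenSingle n f g →
        EigenvalueEnsemble.EvenSamePair f g) ∧
      (EigenvalueEnsemble.OddUnionSame n f g ∨ EigenvalueEnsemble.OddSingle n f g →
        EigenvalueEnsemble.OddSamePair f g) ∧
      (EigenvalueEnsemble.OddUnionPred n (by omega) f g ∨
          EigenvalueEnsemble.OddSinglePred n (by omega) f g →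
        EigenvalueEnsemble.OddPredPair f g)) := by
  open EigenvalueEnsemble in
  exact ⟨⟨fun _ _ => even_succ_of_evenSuccPair, fun _ _ => even_same_of_evenSamePair,
    fun _ _ => odd_same_of_oddSamePair, fun _ _ => odd_pred_of_oddPredPair _⟩,
    fun _ _ hf hg => ⟨evenSuccPair_of_isClassicalWeight hn hf hg,
      evenSamePair_of_isClassicalWeight hn hf hg, oddSamePair_of_isClassicalWeight hn hf hg,
      oddPredPair_of_isClassicalWeight hn hf hg⟩⟩
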